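/- **Setting.** Let $\mathscr A$ be a unital $C^*$-algebra with a strongly continuous action $\alpha$ of $\mathbb R^n$ by $*$-automorphisms, let $B$ be a skew-symmetric real $n\times n$ matrix, and let $\mathscr A^\infty$ be the algebra of all $a\in\mathscr A$ for which $t\mapsto\alpha_t(a)$ is smooth, with the Fréchet topology given by the semi-norms $\|\delta^\gamma a\|$, $\delta^\gamma a=i^{-|\gamma|}\partial_t^\gamma|_{t=0}\alpha_t(a)$. Put $\langle\xi\rangle=(1+|\xi|^2)^{1/2}$ and let $S^m(\mathbb R^n,\mathscr A^\infty)$ be the space of smooth $f:\mathbb R^n\to\mathscr A^\infty$ with $\|\delta^\gamma\partial_\xi^\beta f(\xi)\|\le C_{\gamma\beta}\langle\xi\rangle^{m-|\beta|}$ for all $\gamma,\beta$. Let $\mathscr S(\mathbb R^n,\mathscr A^\infty)$ be the Schwartz space, and for $f\in S^m(\mathbb R^n,\mathscr A^\infty)$ and $u\in\mathscr S(\mathbb R^n,\mathscr A^\infty)$ put $$(P_fu)(x)=(2\pi)^{-n}\int e^{i\langle x,\xi\rangle}\alpha_{-x}\big(f(\xi+Bx)\big)\hat u(\xi)\,d\xi,\qquad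 \hat u(\xi)=\int e^{-i\langle x,\xi\rangle}u(x)\,dx .$$ Let $\Gamma=\{re^{it}: r>0,\ a<t<b\}$ be an open sector, $a<b\le a+2\pi$; powers $z^d$ refer to a fixed branch on $\{z:1/z\in\Gamma\}$. For $m,d\in\mathbb R$ let $S^{m,d}=S^{m,d}(\mathbb R^n\times\Gamma,\mathscr A^\infty)$ be the space of smooth maps $f:\mathbb R^n\times\Gamma\to\mathscr A^\infty$, holomorphic in $\mu\in\Gamma$, such that for all $j\ge0$ we have $\partial_z^j\big(z^df(\cdot,\tfrac1z)\big)\in S^{m+j}(\mathbb R^n,\mathscr A^\infty)$ for $\tfrac1z\in\Gamma$, with estimates that are uniform for $\tfrac1z$ in compact subsets of $\Gamma$, and uniform for $|z|\le1$ and $\tfrac1z$ in closed subsectors of $\Gamma$. Let $S^{\infty,d}=\bigcup_mS^{m,d}$. For $f\in S^{m,d}$ and $f_j\in S^{m-j,d}$ write $f\sim\sum_{j\ge0}f_j$ in $S^{\infty,d}$ if $f-\sum_{j<N}f_j\in S^{m-N,d}$ for all $N\ge0$. A symbol $f\in S^{\infty,d}$ is weakly polyhomogeneous, $f\sim\sum_jf_{m-j}$,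 if there are $m\in\mathbb R$ and $f_{m-j}\in S^{m-j-d,d}$ with $f_{m-j}(t\xi,t\mu)=t^{m-j}f_{m-j}(\xi,\mu)$ for $t\ge1$, $|\xi|\ge1$, $\mu\in\Gamma$, such that $f\sim\sum_jf_{m-j}$ in $S^{\infty,d}$ in this sense (with $m-d$ as leading order). The twisted product is, for each $\mu\in\Gamma$, the $\mathscr A^\infty$-valued oscillatory integral $$f\sharp g(\xi,\mu)=(2\pi)^{-n}\int\Big(\int e^{-i\langle y,\eta\rangle}f(\eta+\xi,\mu)\,\alpha_{-y}\big(g(\xi+By,\mu)\big)\,dy\Big)d\eta .$$ **Theorem.** (1) Let $f\in S^{m,d}$ and $g\in S^{m',d'}$. Then the oscillatory integral defining $f\sharp g$ exists, $f\sharp g\in S^{m+m',d+d'}$, and for every $\mu\in\Gamma$ we have $P_fP_g=P_{f\sharp g}$ as operators on $\mathscr S(\mathbb R^n,\mathscr A^\infty)$. Moreover, in $S^{\infty,d+d'}$, $$f\sharp g(\xi,\mu)\sim\sum_{\kappa}\frac{(-i)^{|\kappa|}}{\kappa!}\,\partial_\xi^\kappa f(\xi,\mu)\ \partial_x^\kappa\big|_{x=0}\,\alpha_{-x}\big(g(\xi+Bx,\mu)\big),$$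 where the terms with $|\kappa|=j$ together form the $j$-th term, of order $m+m'-j$. (2) Let $f\sim\sum_{j}f_{m-j}$ in $S^{\infty,d}$ and $g\sim\sum_jg_{m'-j}$ in $S^{\infty,d'}$ be weakly polyhomogeneous. Then $f\sharp g\in S^{\infty,d+d'}$ is weakly polyhomogeneous, $P_fP_g=P_{f\sharp g}$ for every $\mu\in\Gamma$, and $f\sharp g\sim\sum_{j\ge0}(f\sharp g)_{m+m'-j}$ as a weakly polyhomogeneous symbol in $S^{\infty,d+d'}$, with $$(f\sharp g)_{m+m'-j}(\xi,\mu)=\sum_{k+l+|\kappa|=j}\frac{(-i)^{|\kappa|}}{\kappa!}\,\partial_\xi^\kappa f_{m-k}(\xi,\mu)\,g^{B,\kappa}_{m'-l}(\xi,\mu),$$ $$g^{B,\kappa}_{m'-l}(\xi,\mu)=\sum_{k=0}^{\min(l,|\kappa|)}\ \sum_{\beta+\gamma=\kappa,\ |\gamma|=k}\binom{\kappa}{\beta}(-i\delta)^\beta\,\partial_{B,\xi}^\gamma\, g_{m'-l+k}(\xi,\mu),\qquad \partial_{B,\xi_j}=\sum_kB_{kj}\partial_{\xi_k}.$$ In particular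 $(f\sharp g)_{m+m'}(\xi,\mu)=f_m(\xi,\mu)\,g_{m'}(\xi,\mu)$. -/

import Mathlib

open scoped ContDiff SchwartzMap Topology

namespace TwistedPsiDO

noncomputable section

/-- Euclidean space `ℝⁿ`. -/
abbrev Eucl (n : ℕ) : Type := EuclideanSpace ℝ (Fin n)

/-- Length `|γ|` of a multi-index. -/
def len {n : ℕ} (γ : Fin n → ℕ) : ℕ := ∑ i, γ i

/-- `γ! = ∏ γ_i!`. -/
def multiFactorial {n : ℕ} (γ : Fin n → ℕ) : ℕ := ∏ i, (γ i).factorial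

/-- `binom(γ, β) = ∏ binom(γ_i, β_i)`. -/
def multiChoose {n : ℕ} (γ β : Fin n → ℕ) : ℕ := ∏ i, (γ i).choose (β i)

/-- The Japanese bracket `⟨ξ⟩ = (1 + |ξ|²)^{1/2}`. -/
def bracket {n : ℕ} (ξ : Eucl n) : ℝ := Real.sqrt (1 + ‖ξ‖ ^ 2)

/-- The vector `Bx`. -/
def matVec {n : ℕ} (B : Matrix (Fin n) (Fin n) ℝ) (x : Eucl n) : Eucl n :=
  WithLp.toLp 2 (B.mulVec (WithLp.ofLp x))

section Derivatives

variable {n : ℕ} {V : Type*} [NormedAddCommGroup V] [NormedSpace ℝ V]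

/-- The partial derivative `∂_j F`. -/
def pd (j : Fin n) (F : Eucl n → V) : Eucl n → V :=
  fun x => fderiv ℝ F x (EuclideanSpace.single j 1)

/-- The twisted partial derivative `∂_{B,j} F = ∑_k B_{kj} ∂_k F`. -/
def pdB (B : Matrix (Fin n) (Fin n) ℝ) (j : Fin n) (F : Eucl n → V) : Eucl n → V :=
  fun x => ∑ k, B k j • pd k F x

/-- `D_1^{γ_1} ⋯ D_n^{γ_n} F` for a family of operators `D_1, …, D_n`. -/
def multiIter (D : Fin n → (Eucl n → V) → (Eucl n → V)) (γ : Fin n → ℕ)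
    (F : Eucl n → V) : Eucl n → V :=
  (List.finRange n).foldr (fun j G => (D j)^[γ j] G) F

/-- `∂^γ F`. -/
def mpd (γ : Fin n → ℕ) (F : Eucl n → V) : Eucl n → V := multiIter pd γ F

/-- `∂_B^γ F`. -/
def mpdB (B : Matrix (Fin n) (Fin n) ℝ) (γ : Fin n → ℕ) (F : Eucl n → V) : Eucl n → V :=
  multiIter (pdB B) γ F

end Derivatives

/-- A strongly continuous action of `ℝⁿ` on a unital C*-algebra by *-automorphisms. -/
structure CStarAction (n : ℕ) (A : Type*) [CStarAlgebra A] where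
  act : Eucl n → A ≃⋆ₐ[ℂ] A
  act_zero : ∀ a, act 0 a = a
  act_add : ∀ s t a, act (s + t) a = act s (act t a)
  continuous_act : ∀ a, Continuous fun t => act t a

section Calculus

variable {n : ℕ} {A : Type*} [CStarAlgebra A]

/-- The smooth subalgebra `A^∞`. -/
def smoothSet (α : CStarAction n A) : Set A := {a | ContDiff ℝ ∞ fun t => α.act t a}

/-- `δ^γ a = i^{-|γ|} ∂_t^γ|_{t=0} α_t(a)`. The seminorms `a ↦ ‖δ^γ a‖` define the Fréchet
topology of `A^∞`. -/
def delta (α : CStarAction n A) (γ : Fin n → ℕ) (a : A) : A :=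
  (Complex.I ^ len γ)⁻¹ • mpd γ (fun t => α.act t a) 0

/-- Smooth maps `ℝⁿ → A^∞`: as `A^∞` is (through `a ↦ (δ^γ a)_γ`) a closed subspace of a product
of copies of `A`, a map with values in `A^∞` is smooth for the Fréchet topology iff every
`δ^γ ∘ f` is smooth as a map into `A`. -/
structure SmoothMap (α : CStarAction n A) (f : Eucl n → A) : Prop where
  mem : ∀ ξ, f ξ ∈ smoothSet α
  smooth : ∀ γ, ContDiff ℝ ∞ fun ξ => delta α γ (f ξ)

/-- The Schwartz space `𝒮(ℝⁿ, A^∞)`. -/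
structure IsSchwartz (α : CStarAction n A) (u : Eucl n → A) : Prop where
  smooth : SmoothMap α u
  decay : ∀ (N : ℕ) (γ β : Fin n → ℕ), ∃ C : ℝ, ∀ x,
    bracket x ^ N * ‖delta α γ (mpd β u x)‖ ≤ C

/-- The estimates of `S^m`, uniformly for a family `F z`, `z ∈ Z`. -/
def UniformEstimates (α : CStarAction n A) (m : ℝ) (Z : Set ℂ) (F : ℂ → Eucl n → A) : Prop :=
  ∀ γ β : Fin n → ℕ, ∃ C : ℝ, ∀ z ∈ Z, ∀ ξ,
    ‖delta α γ (mpd β (F z) ξ)‖ ≤ C * bracket ξ ^ (m - len β)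

/-- The symbol space `S^m(ℝⁿ, A^∞)`. -/
structure IsSymbol (α : CStarAction n A) (m : ℝ) (f : Eucl n → A) : Prop where
  smooth : SmoothMap α f
  bound : ∀ γ β : Fin n → ℕ, ∃ C : ℝ, ∀ ξ,
    ‖delta α γ (mpd β f ξ)‖ ≤ C * bracket ξ ^ (m - len β)

/-- The Fourier transform `û(ξ) = ∫ e^{-i⟨x,ξ⟩} u(x) dx`. -/
def fourierT (u : Eucl n → A) (ξ : Eucl n) : A :=
  ∫ x, Complex.exp (-(Complex.I * (inner ℝ x ξ : ℝ))) • u x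

/-- The pseudodifferential multiplier
`(P_f u)(x) = (2π)^{-n} ∫ e^{i⟨x,ξ⟩} α_{-x}(f(ξ + Bx)) û(ξ) dξ`. -/
def psiDO (α : CStarAction n A) (B : Matrix (Fin n) (Fin n) ℝ) (f : Eucl n → A)
    (u : Eucl n → A) (x : Eucl n) : A :=
  ((2 * Real.pi) ^ n : ℝ)⁻¹ • ∫ ξ, Complex.exp (Complex.I * (inner ℝ x ξ : ℝ)) •
    (α.act (-x) (f (ξ + matVec B x)) * fourierT u ξ)

/-- `(2π)^{-n} ∫ (∫ e^{-i⟨y,η⟩} χ(εy, εη) a(y, η) dy) dη`, with a cutoff `χ`. -/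
def regIntegral (χ : 𝓢(Eucl n × Eucl n, ℂ)) (a : Eucl n → Eucl n → A) (ε : ℝ) : A :=
  ((2 * Real.pi) ^ n : ℝ)⁻¹ • ∫ η, ∫ y,
    (Complex.exp (-(Complex.I * (inner ℝ y η : ℝ))) * χ (ε • y, ε • η)) • a y η

/-- `v` is the `A^∞`-valued oscillatory integral `(2π)^{-n} ∬ e^{-i⟨y,η⟩} a(y, η) dy dη`: for every
Schwartz cutoff `χ` with `χ(0) = 1` the regularized integrals lie in `A^∞` and converge to `v` in
the topology of `A^∞` as `ε → 0⁺`. -/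
def IsOscIntegral (α : CStarAction n A) (a : Eucl n → Eucl n → A) (v : A) : Prop :=
  v ∈ smoothSet α ∧ ∀ χ : 𝓢(Eucl n × Eucl n, ℂ), χ 0 = 1 →
    (∀ ε : ℝ, 0 < ε → regIntegral χ a ε ∈ smoothSet α) ∧
    ∀ γ, Filter.Tendsto (fun ε : ℝ => delta α γ (regIntegral χ a ε)) (𝓝[>] 0)
      (𝓝 (delta α γ v))

open Classical in
/-- The oscillatory integral (`0` if it does not exist). -/
def oscIntegral (α : CStarAction n A) (a : Eucl n → Eucl n → A) : A :=
  if h : ∃ v, IsOscIntegral α a v then h.choose else 0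

/-- The amplitude `(y, η) ↦ f(η + ξ) α_{-y}(g(ξ + By))`. -/
def sharpAmplitude (α : CStarAction n A) (B : Matrix (Fin n) (Fin n) ℝ) (f g : Eucl n → A)
    (ξ y η : Eucl n) : A :=
  f (η + ξ) * α.act (-y) (g (ξ + matVec B y))

/-- The twisted product
`(f ♯ g)(ξ) = (2π)^{-n} ∫ (∫ e^{-i⟨y,η⟩} f(η + ξ) α_{-y}(g(ξ + By)) dy) dη`. -/
def sharp (α : CStarAction n A) (B : Matrix (Fin n) (Fin n) ℝ) (f g : Eucl n → A)
    (ξ : Eucl n) : A :=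
  oscIntegral α (sharpAmplitude α B f g ξ)

/-- `f^{B,κ}(ξ) = ∂_x^κ|_{x=0} α_{-x}(f(ξ + Bx))`. -/
def twistDeriv (α : CStarAction n A) (B : Matrix (Fin n) (Fin n) ℝ) (κ : Fin n → ℕ)
    (f : Eucl n → A) (ξ : Eucl n) : A :=
  mpd κ (fun x => α.act (-x) (f (ξ + matVec B x))) 0

/-! ### Weakly parametric symbols -/

/-- The open sector `{r e^{it} : r > 0, a < t < b}`. -/
def openSector (a b : ℝ) : Set ℂ :=
  {μ | ∃ r t : ℝ, 0 < r ∧ a < t ∧ t < b ∧ μ = r * Complex.exp (t * Complex.I)}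

/-- The closed sector `{r e^{it} : r > 0, a ≤ t ≤ b}`. -/
def closedSector (a b : ℝ) : Set ℂ :=
  {μ | ∃ r t : ℝ, 0 < r ∧ a ≤ t ∧ t ≤ b ∧ μ = r * Complex.exp (t * Complex.I)}

/-- The branch of `z ↦ z^d` on `{z : 1/z ∈ openSector a b}`, `b ≤ a + 2π`, given by
`(r⁻¹ e^{-it})^d = r^{-d} e^{-idt}` for `r > 0` and `a < t < b`. -/
def branchPow (a b d : ℝ) (z : ℂ) : ℂ :=
  Complex.exp (-(((a + b) / 2 * d : ℝ) * Complex.I)) *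
    (z * Complex.exp (((a + b) / 2 : ℝ) * Complex.I)) ^ (d : ℂ)

/-- `∂_z^j (z^d f(ξ, 1/z))`. -/
def zDeriv (a b d : ℝ) (f : Eucl n → ℂ → A) (j : ℕ) (z : ℂ) (ξ : Eucl n) : A :=
  iteratedDeriv j (fun w => branchPow a b d w • f ξ w⁻¹) z

/-- The weakly parametric symbols `S^{m,d}(ℝⁿ × Γ, A^∞)`, `Γ = openSector a b`. -/
structure IsWeaklyParametric (α : CStarAction n A) (a b m d : ℝ) (f : Eucl n → ℂ → A) : Prop where
  mem : ∀ ξ, ∀ μ ∈ openSector a b, f ξ μ ∈ smoothSet α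
  smooth : ∀ γ, ContDiffOn ℝ ∞ (fun p : Eucl n × ℂ => delta α γ (f p.1 p.2))
    (Set.univ ×ˢ openSector a b)
  holo : ∀ γ ξ, DifferentiableOn ℂ (fun μ => delta α γ (f ξ μ)) (openSector a b)
  symbol : ∀ (j : ℕ) (z : ℂ), z⁻¹ ∈ openSector a b → IsSymbol α (m + j) (zDeriv a b d f j z)
  /-- locally uniform estimates on `Γ` -/
  locally_uniform : ∀ (j : ℕ) (K : Set ℂ), IsCompact K → K ⊆ openSector a b →
    UniformEstimates α (m + j) {z | z⁻¹ ∈ K} (zDeriv a b d f j)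
  /-- uniform estimates for `|z| ≤ 1` and `1/z` in closed subsectors of `Γ` -/
  uniform : ∀ (j : ℕ) (a' b' : ℝ), a < a' → a' ≤ b' → b' < b →
    UniformEstimates α (m + j) {z | z⁻¹ ∈ closedSector a' b' ∧ ‖z‖ ≤ 1} (zDeriv a b d f j)

/-- `f ∼ ∑_j F_j` in `S^{∞,d}`, with leading order `m`. -/
structure AsympExpansion (α : CStarAction n A) (a b m d : ℝ) (f : Eucl n → ℂ → A)
    (F : ℕ → Eucl n → ℂ → A) : Prop where
  mem : IsWeaklyParametric α a b m d f
  term : ∀ j : ℕ, IsWeaklyParametric α a b (m - j) d (F j)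
  remainder : ∀ N : ℕ, IsWeaklyParametric α a b (m - N) d
    (fun ξ μ => f ξ μ - ∑ j ∈ Finset.range N, F j ξ μ)

/-- Homogeneity in `(ξ, μ)` of degree `k` for `|ξ| ≥ 1`. -/
def IsHomogeneous (a b k : ℝ) (f : Eucl n → ℂ → A) : Prop :=
  ∀ (t : ℝ) (ξ : Eucl n), ∀ μ ∈ openSector a b, 1 ≤ t → 1 ≤ ‖ξ‖ →
    f (t • ξ) (t * μ) = t ^ k • f ξ μ

/-- `f ∼ ∑_j F_j` in `S^{∞,d}` with `F_j = f_{m-j} ∈ S^{m-j-d,d}` homogeneous of degree `m - j`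
for `|ξ| ≥ 1`. -/
structure PolyhomExpansion (α : CStarAction n A) (a b m d : ℝ) (f : Eucl n → ℂ → A)
    (F : ℕ → Eucl n → ℂ → A) : Prop where
  homogeneous : ∀ j : ℕ, IsHomogeneous a b (m - j) (F j)
  expansion : AsympExpansion α a b (m - d) d f F

/-- Weakly polyhomogeneous (1-step) symbols in `S^{∞,d}`. -/
def IsWeaklyPolyhomogeneous (α : CStarAction n A) (a b d : ℝ) (f : Eucl n → ℂ → A) : Prop :=
  ∃ (m : ℝ) (F : ℕ → Eucl n → ℂ → A), PolyhomExpansion α a b m d f F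

/-- The twisted product of symbols depending on `μ`. -/
def sharpParam (α : CStarAction n A) (B : Matrix (Fin n) (Fin n) ℝ) (f g : Eucl n → ℂ → A)
    (ξ : Eucl n) (μ : ℂ) : A :=
  sharp α B (fun ζ => f ζ μ) (fun ζ => g ζ μ) ξ

/-- `∑_{|κ| = j} (-i)^{|κ|}/κ! ∂_ξ^κ f(ξ,μ) ∂_x^κ|_{x=0} α_{-x}(g(ξ + Bx, μ))`. -/
def sharpTerm (α : CStarAction n A) (B : Matrix (Fin n) (Fin n) ℝ) (f g : Eucl n → ℂ → A)
    (j : ℕ) (ξ : Eucl n) (μ : ℂ) : A :=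
  ∑ κ ∈ Finset.piAntidiag (Finset.univ : Finset (Fin n)) j,
    ((-Complex.I) ^ len κ / (multiFactorial κ : ℂ)) •
      (mpd κ (fun ζ => f ζ μ) ξ * twistDeriv α B κ (fun ζ => g ζ μ) ξ)

/-- `g^{B,κ}_{m'-l} = ∑_{k ≤ min(l, |κ|)} ∑_{β+γ=κ, |γ|=k} binom(κ,β) (-iδ)^β ∂_B^γ g_{m'-l+k}`,
the homogeneous part of degree `m' - l` of `g^{B,κ}`, where `G l = g_{m'-l}`. -/
def twistPart (α : CStarAction n A) (B : Matrix (Fin n) (Fin n) ℝ) (κ : Fin n → ℕ)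
    (G : ℕ → Eucl n → ℂ → A) (l : ℕ) (ξ : Eucl n) (μ : ℂ) : A :=
  ∑ k ∈ Finset.range (min l (len κ) + 1), ∑ β ∈ Finset.Iic κ with len (κ - β) = k,
    ((multiChoose κ β : ℂ) * (-Complex.I) ^ len β) •
      delta α β (mpdB B (κ - β) (fun ζ => G (l - k) ζ μ) ξ)

/-- `(f ♯ g)_{m+m'-j} = ∑_{k+l+|κ|=j} (-i)^{|κ|}/κ! ∂_ξ^κ f_{m-k} g^{B,κ}_{m'-l}`. -/
def sharpPart (α : CStarAction n A) (B : Matrix (Fin n) (Fin n) ℝ) (F G : ℕ → Eucl n → ℂ → A)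
    (j : ℕ) (ξ : Eucl n) (μ : ℂ) : A :=
  ∑ q ∈ Finset.HasAntidiagonal.antidiagonal j, ∑ p ∈ Finset.HasAntidiagonal.antidiagonal q.1,
    ∑ κ ∈ Finset.piAntidiag (Finset.univ : Finset (Fin n)) q.2,
      ((-Complex.I) ^ len κ / (multiFactorial κ : ℂ)) •
        (mpd κ (fun ζ => F p.1 ζ μ) ξ * twistPart α B κ G p.2 ξ μ)

/-- The identity `P_f P_g = P_h` of operators on `𝒮(ℝⁿ, A^∞)` for every `μ ∈ Γ`; the first
conjunct records that `P_g` maps `𝒮(ℝⁿ, A^∞)` to itself. -/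
def ComposesTo (α : CStarAction n A) (B : Matrix (Fin n) (Fin n) ℝ) (a b : ℝ)
    (f g h : Eucl n → ℂ → A) : Prop :=
  ∀ μ ∈ openSector a b, ∀ u, IsSchwartz α u →
    IsSchwartz α (psiDO α B (fun ζ => g ζ μ) u) ∧
    psiDO α B (fun ζ => f ζ μ) (psiDO α B (fun ζ => g ζ μ) u) = psiDO α B (fun ζ => h ζ μ) u

end Calculus

end

end TwistedPsiDO

open TwistedPsiDO

open scoped ContDiff SchwartzMap Topology

open TwistedPsiDO

namespace TwistedPsiDO

noncomputable section

open MeasureTheory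

/-! ### The Japanese bracket -/

section Bracket

variable {n : ℕ}

/-! Calculus with values in the Fréchet algebra `A^∞` is reduced to calculus with values in `A`. A
family `F(ξ, z)` is replaced by its equivariant extension `tw α F`, the map `(s, ξ, z) ↦ α_s(F(ξ,
z))`. Smoothness into `A^∞` becomes ordinary smoothness of this map (`sm_of_delta`), `δ^γ` is up to
a constant a derivative in `s`, and by equivariance a derivative of an extension is again an
extension (`fderiv_tw_eq`). Passing from `f(ξ, μ)` to `z^d f(ξ, 1/z)` turns `S^{m,d}` into the class
`Sym`: derivatives in `s` keep the order, derivatives in `ξ` lower it by one, derivatives in `z`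
raise it by one (`IsWeaklyParametric.sym`, `isWeaklyParametric_of_sym`). In a graded class stable
under differentiation only the functions themselves have to be estimated (`Sym.of_class`). Hence a
bilinear operation with a Leibniz rule produces symbols as soon as it is bounded (`LeibnizOp.sym`).

Existence. The identity `1 = ρ + ∑ x_b κ_b` on phase space, with `ρ = (1 + |x|²)⁻¹`, allows a
partial integration that improves the decay of the weight by one order. Only derivatives in `s` and
`ξ` fall on the symbols, so their orders do not rise. After `M` steps (`osc`) the integral converges
absolutely. It is bounded by `⟨ξ⟩^{m+m'}` uniformly over bounded families of weights (`osc_bound`)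
and continuous in the weight (`osc_tendsto`). So the cutoff limit exists, is independent of the
cutoff, and obeys the Leibniz rule (`leibnizOp_oscI`, `isOscIntegral_oscI`).

Expansion. Let `T_t` be the integral with `F(ξ + tη)` in place of `F(ξ + η)`. Fourier inversion
gives `T_0(F, G) = F G` (`JI_zero_tendsto`). The factor `η_j` produced by `d/dt` is converted by
partial integration into a derivative in `y_j`, so that `d/dt T_t(F, G) = -i ∑_j T_t(∂_j F, D_j G)`
with `D_j` the twisted derivative (`J_hasDerivAt`, up to a cutoff error). The Taylor polynomial
satisfies the same equation. Each induction step replaces `(F, G)` by `(∂_j F, D_j G)`, of total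
order one less, and the mean value inequality gives a remainder of order `m + m' - N`
(`JI_sub_taylor_bound`, `leibnizOp_remainder`). The multi-index form is the multinomial formula for
commuting operators (`expOp_eq`).

Composition. Cutoffs in `(y, η)` make the triple integral for `P_f P_g` absolutely convergent.
Fubini and a translation of the covariable exhibit the cutoff form of `f ♯ g`, and the two cutoffs
are then removed one after the other, dominated by the uniform bound for `osc` (`quant_oscI`).

Polyhomogeneous symbols. Expansions may be multiplied, differentiated and substituted into one
another (`Expn.of_sum`). Since `D_j = -∂_{s_j} + ∂_{B,j}` is a sum of commuting operators, a
binomial formula holds (`mnab_twistVec`). Only the second summand lowers order and degree, and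
regrouping by its exponent gives the formula for `g^{B,κ}` (`Expn.twistDeriv`,
`isHomogeneous_sharpPart`). -/

lemma one_le_bracket (ξ : Eucl n) : 1 ≤ bracket ξ := by
  unfold bracket
  rw [Real.one_le_sqrt]
  nlinarith [sq_nonneg ‖ξ‖]

lemma bracket_pos (ξ : Eucl n) : 0 < bracket ξ := lt_of_lt_of_le one_pos (one_le_bracket ξ)

lemma bracket_le_one_add_norm (ξ : Eucl n) : bracket ξ ≤ 1 + ‖ξ‖ := by
  unfold bracket
  rw [Real.sqrt_le_left (by positivity)]
  nlinarith [norm_nonneg ξ]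

lemma norm_le_bracket (ξ : Eucl n) : ‖ξ‖ ≤ bracket ξ :=
  Real.le_sqrt_of_sq_le (by linarith)

lemma one_add_norm_le_bracket (ξ : Eucl n) : 1 + ‖ξ‖ ≤ 2 * bracket ξ := by
  linarith [one_le_bracket ξ, norm_le_bracket ξ]

lemma bracket_add_le (ξ η : Eucl n) : bracket (ξ + η) ≤ bracket ξ * (1 + ‖η‖) := by
  have h1 : bracket (ξ + η) ≤ bracket ξ + ‖η‖ := by
    have h2 := norm_add_le ξ η
    have h3 : bracket ξ ^ 2 = 1 + ‖ξ‖ ^ 2 := Real.sq_sqrt (by positivity)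
    have h4 := norm_le_bracket ξ
    have h5 := norm_nonneg η
    have h6 := norm_nonneg (ξ + η)
    refine (Real.sqrt_le_left (by linarith [bracket_pos ξ])).2 ?_
    nlinarith [mul_le_mul_of_nonneg_left h4 h5, mul_self_le_mul_self h6 h2]
  nlinarith [one_le_bracket ξ, norm_nonneg η]

lemma bracket_rpow_pos (ξ : Eucl n) (m : ℝ) : 0 < bracket ξ ^ m :=
  Real.rpow_pos_of_pos (bracket_pos ξ) m

lemma bracket_rpow_mono (ξ : Eucl n) {m m' : ℝ} (h : m ≤ m') : bracket ξ ^ m ≤ bracket ξ ^ m' :=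
  Real.rpow_le_rpow_of_exponent_le (one_le_bracket ξ) h

/-- Peetre's inequality. -/
lemma bracket_add_rpow_le (ξ η : Eucl n) (m : ℝ) :
    bracket (ξ + η) ^ m ≤ bracket ξ ^ m * (1 + ‖η‖) ^ |m| := by
  have hη : (0 : ℝ) < 1 + ‖η‖ := by positivity
  rcases le_total 0 m with hm | hm
  · rw [abs_of_nonneg hm, ← Real.mul_rpow (bracket_pos ξ).le hη.le]
    exact Real.rpow_le_rpow (bracket_pos _).le (bracket_add_le ξ η) hm
  -- For negative exponents the inequality is used in reverse: `ξ` is regarded as the translate of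
  -- `ξ + η` by `-η`.
  · have h := bracket_add_le (ξ + η) (-η)
    rw [add_neg_cancel_right, norm_neg] at h
    rw [abs_of_nonpos hm, Real.rpow_neg hη.le]
    rw [← div_eq_mul_inv, le_div_iff₀ (Real.rpow_pos_of_pos hη m),
      ← Real.mul_rpow (bracket_pos _).le hη.le]
    exact Real.rpow_le_rpow_of_nonpos (bracket_pos ξ) h hm

end Bracket

/-! ### Equivariant extension and directional derivatives -/

/-- The space of triples `(s, ξ, z)`: group parameter, covariable, spectral parameter. -/
abbrev PV (n : ℕ) : Type := Eucl n × Eucl n × ℂ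

/-- A directional index: along the action, along the covariable, along the parameter. -/
inductive Dir (n : ℕ) : Type
  | act (j : Fin n) : Dir n
  | sp (j : Fin n) : Dir n
  | par : Dir n

/-- The vector belonging to a directional index. -/
def Dir.vec {n : ℕ} : Dir n → PV n
  | .act j => (EuclideanSpace.single j 1, 0, 0)
  | .sp j => (0, EuclideanSpace.single j 1, 0)
  | .par => (0, 0, 1)

/-- The change of order caused by a derivative. -/
def Dir.wt {n : ℕ} : Dir n → ℝ
  | .act _ => 0
  | .sp _ => -1
  | .par => 1

/-- An open parameter set with the family of subsets on which estimates are required. -/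
structure ParamDomain where
  U : Set ℂ
  isOpen : IsOpen U
  fam : Set (Set ℂ)
  sub : ∀ K ∈ fam, K ⊆ U
  compact_mem : ∀ K, IsCompact K → K ⊆ U → K ∈ fam

section Equivariant

variable {n : ℕ} {A : Type*} [CStarAlgebra A]

lemma norm_act (α : CStarAction n A) (s : Eucl n) (a : A) : ‖α.act s a‖ = ‖a‖ :=
  NonUnitalStarAlgHom.norm_map (α.act s) (α.act s).injective a

/-- `α_s` as a continuous linear map. -/
def actL (α : CStarAction n A) (s : Eucl n) : A →L[ℝ] A :=
  LinearMap.mkContinuous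
    { toFun := α.act s
      map_add' := map_add (α.act s)
      map_smul' := fun c a => by
        have := map_smul (α.act s) (c : ℂ) a
        simpa using this } 1 (fun a => by simp [norm_act])

@[simp] lemma actL_apply (α : CStarAction n A) (s : Eucl n) (a : A) : actL α s a = α.act s a := rfl

lemma act_neg_act (α : CStarAction n A) (s : Eucl n) (a : A) : α.act (-s) (α.act s a) = a := by
  rw [← α.act_add, neg_add_cancel, α.act_zero]

/-- Strong continuity gives joint continuity because every `α_s` is isometric: the error `α_s(a' -
a)` has norm `‖a' - a‖`, whatever `s` is. -/
lemma continuous_act_uncurry (α : CStarAction n A) :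
    Continuous fun p : Eucl n × A => α.act p.1 p.2 := by
  rw [continuous_iff_continuousAt]
  rintro ⟨s, a⟩
  have h1 : Filter.Tendsto (fun p : Eucl n × A => α.act p.1 a) (𝓝 (s, a)) (𝓝 (α.act s a)) :=
    ((α.continuous_act a).tendsto s).comp continuous_fst.continuousAt
  have h2 : Filter.Tendsto (fun p : Eucl n × A => α.act p.1 (p.2 - a)) (𝓝 (s, a)) (𝓝 0) := by
    rw [tendsto_zero_iff_norm_tendsto_zero]
    simp only [norm_act]
    have : Continuous fun p : Eucl n × A => ‖p.2 - a‖ := by fun_prop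
    simpa using this.tendsto (s, a)
  have := h1.add h2
  simp only [map_sub, add_zero, add_sub_cancel] at this
  exact this

/-- The equivariant extension `(s, ξ, z) ↦ α_s(F ξ z)`. -/
def tw (α : CStarAction n A) (F : Eucl n → ℂ → A) (p : PV n) : A := α.act p.1 (F p.2.1 p.2.2)

/-- The points whose parameter lies in `U`. -/
def dom (n : ℕ) (U : Set ℂ) : Set (PV n) := {p | p.2.2 ∈ U}

lemma isOpen_dom {U : Set ℂ} (hU : IsOpen U) : IsOpen (dom n U) :=
  hU.preimage (by fun_prop)

open Classical in
/-- Directional derivative of the equivariant extension at group parameter `0`. -/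
def nab (α : CStarAction n A) (U : Set ℂ) (v : PV n) (F : Eucl n → ℂ → A) : Eucl n → ℂ → A :=
  -- The value `0` off `U` makes the rules for `nab` equalities of functions, so that they can be
  -- rewritten under further derivatives.
  fun ξ z => if z ∈ U then fderiv ℝ (tw α F) (0, ξ, z) v else 0

/-- Smoothness as a map into the smooth subalgebra, for parameters in `U`. -/
def Sm (α : CStarAction n A) (U : Set ℂ) (F : Eucl n → ℂ → A) : Prop :=
  ContDiffOn ℝ ∞ (tw α F) (dom n U)

variable {α : CStarAction n A} {U : Set ℂ} {F G : Eucl n → ℂ → A}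

lemma norm_tw (p : PV n) : ‖tw α F p‖ = ‖F p.2.1 p.2.2‖ := norm_act α _ _

@[simp] lemma tw_zero_left (ξ : Eucl n) (z : ℂ) : tw α F (0, ξ, z) = F ξ z := α.act_zero _

lemma tw_add_left (s s' ξ : Eucl n) (z : ℂ) :
    tw α F (s + s', ξ, z) = α.act s (tw α F (s', ξ, z)) := α.act_add _ _ _

lemma tw_mul (p : PV n) : tw α (fun ξ z => F ξ z * G ξ z) p = tw α F p * tw α G p := map_mul _ _ _

lemma tw_add (p : PV n) : tw α (fun ξ z => F ξ z + G ξ z) p = tw α F p + tw α G p := map_add _ _ _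

lemma tw_smul (c : ℂ) (p : PV n) : tw α (fun ξ z => c • F ξ z) p = c • tw α F p := map_smul _ _ _

lemma tw_sum {ι : Type*} (s : Finset ι) (F : ι → Eucl n → ℂ → A) (p : PV n) :
    tw α (fun ξ z => ∑ i ∈ s, F i ξ z) p = ∑ i ∈ s, tw α (F i) p := map_sum _ _ _

/-- Translation of the group parameter by `s` is composition with the continuous linear map `α_s`,
so the derivative at `s` is determined by the one at `0`. No differentiability is assumed. -/
lemma fderiv_tw (s ξ : Eucl n) (z : ℂ) (v : PV n) :
    fderiv ℝ (tw α F) (s, ξ, z) v = α.act s (fderiv ℝ (tw α F) (0, ξ, z) v) := by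
  by_cases h : DifferentiableAt ℝ (tw α F) (0, ξ, z)
  · have e : tw α F = fun p => actL α s (tw α F (p - (s, 0, 0))) := by
      funext p
      rcases p with ⟨s', ξ', z'⟩
      simp [← tw_add_left]
    have h' : HasFDerivAt (tw α F) (fderiv ℝ (tw α F) (0, ξ, z)) ((s, ξ, z) - (s, 0, 0)) := by
      simpa using h.hasFDerivAt
    have h2 := (actL α s).hasFDerivAt.comp _ (h'.comp (s, ξ, z)
      ((hasFDerivAt_id (𝕜 := ℝ) (s, ξ, z)).sub_const (s, (0 : Eucl n), (0 : ℂ))))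
    have h3 : HasFDerivAt (tw α F) ((actL α s).comp
        ((fderiv ℝ (tw α F) (0, ξ, z)).comp (ContinuousLinearMap.id ℝ (PV n)))) (s, ξ, z) :=
      h2.congr_of_eventuallyEq (Filter.Eventually.of_forall fun p => congrFun e p)
    rw [h3.fderiv]
    rfl
  -- Differentiability at `s` could be transported back to `0` by `α_{-s}`. So both derivatives take
  -- the default value `0`.
  · have h' : ¬ DifferentiableAt ℝ (tw α F) (s, ξ, z) := by
      intro h1
      apply h
      have e : tw α F = fun p => actL α (-s) (tw α F (p + (s, 0, 0))) := by
        funext p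
        rcases p with ⟨s', ξ', z'⟩
        simp [← tw_add_left]
      have h1' : DifferentiableAt ℝ (tw α F) ((0, ξ, z) + (s, 0, 0)) := by simpa using h1
      rw [e]
      exact (actL α (-s)).differentiableAt.comp _
        (h1'.comp (0, ξ, z) (differentiableAt_id.add_const _))
    rw [fderiv_zero_of_not_differentiableAt h, fderiv_zero_of_not_differentiableAt h']
    simp

/-- This closes the calculus: since the derivative of an extension is an extension, iterated
derivatives are iterates of `nab` acting on families `F(ξ, z)`. -/
lemma fderiv_tw_eq {p : PV n} (hp : p ∈ dom n U) (v : PV n) :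
    fderiv ℝ (tw α F) p v = tw α (nab α U v F) p := by
  rcases p with ⟨s, ξ, z⟩
  rw [fderiv_tw]
  simp only [dom, Set.mem_ofPred_eq] at hp
  simp [tw, nab, hp]

lemma Sm.contDiffAt (hU : IsOpen U) (h : Sm α U F) {p : PV n} (hp : p ∈ dom n U) :
    ContDiffAt ℝ ∞ (tw α F) p := ContDiffOn.contDiffAt h ((isOpen_dom hU).mem_nhds hp)

lemma Sm.differentiableAt (hU : IsOpen U) (h : Sm α U F) {p : PV n} (hp : p ∈ dom n U) :
    DifferentiableAt ℝ (tw α F) p := (h.contDiffAt hU hp).differentiableAt (by simp)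

lemma nab_of_notMem {z : ℂ} (hz : z ∉ U) (v : PV n) (ξ : Eucl n) : nab α U v F ξ z = 0 := by
  simp [nab, hz]

lemma nab_of_mem {z : ℂ} (hz : z ∈ U) (v : PV n) (ξ : Eucl n) :
    nab α U v F ξ z = fderiv ℝ (tw α F) (0, ξ, z) v := by
  simp [nab, hz]

lemma Sm.nab (hU : IsOpen U) (h : Sm α U F) (v : PV n) : Sm α U (nab α U v F) := by
  have h1 : ContDiffOn ℝ ∞ (fun p => fderiv ℝ (tw α F) p v) (dom n U) :=
    (h.fderiv_of_isOpen (isOpen_dom hU) (m := ∞) (by simp)).clm_apply contDiffOn_const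
  exact h1.congr fun p hp => (fderiv_tw_eq hp v).symm

lemma Sm.congr (h : Sm α U F) (hFG : ∀ ξ, ∀ z ∈ U, G ξ z = F ξ z) : Sm α U G :=
  ContDiffOn.congr h fun p hp => by simp only [tw]; rw [hFG _ _ hp]

lemma Sm.add (h : Sm α U F) (h' : Sm α U G) : Sm α U fun ξ z => F ξ z + G ξ z :=
  (ContDiffOn.add h h').congr fun p _ => tw_add p

lemma Sm.mul (h : Sm α U F) (h' : Sm α U G) : Sm α U fun ξ z => F ξ z * G ξ z :=
  (ContDiffOn.mul h h').congr fun p _ => tw_mul p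

lemma Sm.smul (c : ℂ) (h : Sm α U F) : Sm α U fun ξ z => c • F ξ z :=
  (ContDiffOn.const_smul c h).congr fun p _ => tw_smul c p

/-- By `fderiv_tw_eq` both sides are values of the second derivative of the single function `tw α
F`, which is symmetric. -/
lemma nab_comm (hU : IsOpen U) (h : Sm α U F) (v w : PV n) :
    nab α U v (nab α U w F) = nab α U w (nab α U v F) := by
  funext ξ z
  by_cases hz : z ∈ U
  · have hp : ((0, ξ, z) : PV n) ∈ dom n U := hz
    have key : ∀ v w : PV n, nab α U v (nab α U w F) ξ z
        = fderiv ℝ (fderiv ℝ (tw α F)) (0, ξ, z) v w := by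
      intro v w
      rw [nab_of_mem hz]
      have e : tw α (nab α U w F) =ᶠ[𝓝 (0, ξ, z)] fun p => fderiv ℝ (tw α F) p w := by
        filter_upwards [(isOpen_dom hU).mem_nhds hp] with p hp
        exact (fderiv_tw_eq hp w).symm
      rw [e.fderiv_eq]
      have hd : DifferentiableAt ℝ (fderiv ℝ (tw α F)) (0, ξ, z) :=
        ((h.contDiffAt hU hp).fderiv_right (m := ∞) (by simp)).differentiableAt (by simp)
      rw [fderiv_clm_apply hd (differentiableAt_const w)]
      simp
    rw [key, key]
    exact ((h.contDiffAt hU hp).isSymmSndFDerivAt (by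
      simpa using WithTop.coe_le_coe.2 (le_top : (2 : ℕ∞) ≤ ⊤))) v w
  · simp [nab_of_notMem hz]

lemma nab_add_vec (v w : PV n) :
    nab α U (v + w) F = fun ξ z => nab α U v F ξ z + nab α U w F ξ z := by
  funext ξ z
  by_cases hz : z ∈ U
  · simp [nab_of_mem hz]
  · simp [nab_of_notMem hz]

lemma nab_smul_vec (c : ℝ) (v : PV n) :
    nab α U (c • v) F = fun ξ z => (c : ℂ) • nab α U v F ξ z := by
  funext ξ z
  by_cases hz : z ∈ U
  · simp [nab_of_mem hz]
  · simp [nab_of_notMem hz]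

lemma nab_zero_vec : nab α U 0 F = fun _ _ => 0 := by
  funext ξ z
  simp [nab]

lemma nab_sum_vec {ι : Type*} (s : Finset ι) (v : ι → PV n) :
    nab α U (∑ i ∈ s, v i) F = fun ξ z => ∑ i ∈ s, nab α U (v i) F ξ z := by
  funext ξ z
  by_cases hz : z ∈ U
  · simp [nab_of_mem hz]
  · simp [nab_of_notMem hz]

lemma nab_add (hU : IsOpen U) (h : Sm α U F) (h' : Sm α U G) (v : PV n) :
    nab α U v (fun ξ z => F ξ z + G ξ z) = fun ξ z => nab α U v F ξ z + nab α U v G ξ z := by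
  funext ξ z
  by_cases hz : z ∈ U
  · have hp : ((0, ξ, z) : PV n) ∈ dom n U := hz
    have e : tw α (fun ξ z => F ξ z + G ξ z) = fun p => tw α F p + tw α G p := funext tw_add
    simp only [nab_of_mem hz, e]
    rw [fderiv_fun_add (h.differentiableAt hU hp) (h'.differentiableAt hU hp)]
    rfl
  · simp [nab_of_notMem hz]

lemma nab_smul (hU : IsOpen U) (h : Sm α U F) (c : ℂ) (v : PV n) :
    nab α U v (fun ξ z => c • F ξ z) = fun ξ z => c • nab α U v F ξ z := by
  funext ξ z
  by_cases hz : z ∈ U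
  · have hp : ((0, ξ, z) : PV n) ∈ dom n U := hz
    have e : tw α (fun ξ z => c • F ξ z) = fun p => c • tw α F p := funext (tw_smul c)
    simp only [nab_of_mem hz, e]
    rw [fderiv_fun_const_smul (h.differentiableAt hU hp)]
    rfl
  · simp [nab_of_notMem hz]

lemma nab_mul (hU : IsOpen U) (h : Sm α U F) (h' : Sm α U G) (v : PV n) :
    nab α U v (fun ξ z => F ξ z * G ξ z)
      = fun ξ z => nab α U v F ξ z * G ξ z + F ξ z * nab α U v G ξ z := by
  funext ξ z
  by_cases hz : z ∈ U
  · have hp : ((0, ξ, z) : PV n) ∈ dom n U := hz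
    have e : tw α (fun ξ z => F ξ z * G ξ z) = fun p => tw α F p * tw α G p := funext tw_mul
    simp only [nab_of_mem hz, e]
    rw [fderiv_fun_mul' (h.differentiableAt hU hp) (h'.differentiableAt hU hp)]
    simp [add_comm]
  · simp [nab_of_notMem hz]

lemma Sm.zero : Sm α U (fun _ _ => 0) := by
  have : tw α (fun _ _ => 0) = fun _ => 0 := funext fun p => map_zero _
  simp only [Sm, this]
  exact contDiffOn_const

lemma Sm.sum {ι : Type*} (s : Finset ι) {F : ι → Eucl n → ℂ → A} (h : ∀ i ∈ s, Sm α U (F i)) :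
    Sm α U fun ξ z => ∑ i ∈ s, F i ξ z :=
  (ContDiffOn.sum h).congr fun p _ => tw_sum s F p

lemma nab_congr (hU : IsOpen U) (hFG : ∀ ξ, ∀ z ∈ U, F ξ z = G ξ z) (v : PV n) :
    nab α U v F = nab α U v G := by
  funext ξ z
  by_cases hz : z ∈ U
  · rw [nab_of_mem hz, nab_of_mem hz]
    have hp : ((0, ξ, z) : PV n) ∈ dom n U := hz
    have e : tw α F =ᶠ[𝓝 (0, ξ, z)] tw α G := by
      filter_upwards [(isOpen_dom hU).mem_nhds hp] with p hp
      simp only [tw]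
      rw [hFG _ _ hp]
    rw [e.fderiv_eq]
  · simp [nab_of_notMem hz]

end Equivariant

/-! ### Symbols depending on a parameter -/

section Sym

variable {n : ℕ} {A : Type*} [CStarAlgebra A]

/-- Iterated derivatives along a word of directions, the first letter acting first. -/
def nabs (α : CStarAction n A) (U : Set ℂ) : List (Dir n) → (Eucl n → ℂ → A) → Eucl n → ℂ → A
  | [], F => F
  | d :: w, F => nabs α U w (nab α U d.vec F)

/-- Total change of order of a word. -/
def wtSum : List (Dir n) → ℝ
  | [] => 0
  | d :: w => d.wt + wtSum w

/-- Symbols of order `m`, holomorphic in the parameter, with order increasing by one under each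
parameter derivative, and estimates uniform on the sets of the family. -/
structure Sym (α : CStarAction n A) (D : ParamDomain) (m : ℝ) (F : Eucl n → ℂ → A) : Prop where
  sm : Sm α D.U F
  holo : nab α D.U (0, 0, Complex.I) F = fun ξ z => Complex.I • nab α D.U (0, 0, 1) F ξ z
  bound : ∀ w : List (Dir n), ∀ K ∈ D.fam, ∃ C : ℝ, ∀ z ∈ K, ∀ ξ,
    ‖nabs α D.U w F ξ z‖ ≤ C * bracket ξ ^ (m + wtSum w)

variable {α : CStarAction n A} {D : ParamDomain} {F G : Eucl n → ℂ → A} {m m' : ℝ}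

lemma nabs_add {U : Set ℂ} (hU : IsOpen U) (w : List (Dir n)) {F G : Eucl n → ℂ → A}
    (h : Sm α U F) (h' : Sm α U G) : nabs α U w (fun ξ z => F ξ z + G ξ z)
      = fun ξ z => nabs α U w F ξ z + nabs α U w G ξ z := by
  induction w generalizing F G with
  | nil => rfl
  | cons d w ih =>
    simp only [TwistedPsiDO.nabs]; rw [nab_add hU h h', ih (h.nab hU _) (h'.nab hU _)]

lemma nabs_smul {U : Set ℂ} (hU : IsOpen U) (w : List (Dir n)) {F : Eucl n → ℂ → A}
    (h : Sm α U F) (c : ℂ) : nabs α U w (fun ξ z => c • F ξ z)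
      = fun ξ z => c • nabs α U w F ξ z := by
  induction w generalizing F with
  | nil => rfl
  | cons d w ih => simp only [TwistedPsiDO.nabs]; rw [nab_smul hU h, ih (h.nab hU _)]

lemma nabs_congr {U : Set ℂ} (hU : IsOpen U) (w : List (Dir n)) {F G : Eucl n → ℂ → A}
    (hFG : ∀ ξ, ∀ z ∈ U, F ξ z = G ξ z) (ξ : Eucl n) {z : ℂ} (hz : z ∈ U) :
    nabs α U w F ξ z = nabs α U w G ξ z := by
  cases w with
  | nil => exact hFG ξ z hz
  | cons d w => simp only [TwistedPsiDO.nabs]; rw [nab_congr hU hFG]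

lemma Sym.exists_bound (h : Sym α D m F) (w : List (Dir n)) {K : Set ℂ} (hK : K ∈ D.fam) :
    ∃ C : ℝ, 0 ≤ C ∧ ∀ z ∈ K, ∀ ξ, ‖nabs α D.U w F ξ z‖ ≤ C * bracket ξ ^ (m + wtSum w) := by
  obtain ⟨C, hC⟩ := h.bound w K hK
  refine ⟨max C 0, le_max_right _ _, fun z hz ξ => (hC z hz ξ).trans ?_⟩
  exact mul_le_mul_of_nonneg_right (le_max_left _ _) (bracket_rpow_pos _ _).le

lemma Sym.exists_bound_zero (h : Sym α D m F) {K : Set ℂ} (hK : K ∈ D.fam) :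
    ∃ C : ℝ, 0 ≤ C ∧ ∀ z ∈ K, ∀ ξ, ‖F ξ z‖ ≤ C * bracket ξ ^ m := by
  simpa [nabs, wtSum] using h.exists_bound [] hK

lemma Sym.mono (h : Sym α D m F) (hm : m ≤ m') : Sym α D m' F where
  sm := h.sm
  holo := h.holo
  bound w K hK := by
    obtain ⟨C, hC0, hC⟩ := h.exists_bound w hK
    refine ⟨C, fun z hz ξ => (hC z hz ξ).trans ?_⟩
    exact mul_le_mul_of_nonneg_left (bracket_rpow_mono ξ (by linarith)) hC0

lemma Sym.congr (h : Sym α D m F) (hFG : ∀ ξ, ∀ z ∈ D.U, G ξ z = F ξ z) : Sym α D m G where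
  sm := h.sm.congr hFG
  holo := by rw [nab_congr D.isOpen hFG, nab_congr D.isOpen hFG]; exact h.holo
  bound w K hK := by
    obtain ⟨C, hC⟩ := h.bound w K hK
    refine ⟨C, fun z hz ξ => ?_⟩
    rw [nabs_congr D.isOpen w hFG ξ (D.sub K hK hz)]
    exact hC z hz ξ

lemma Sym.nabDir (h : Sym α D m F) (d : Dir n) : Sym α D (m + d.wt) (nab α D.U d.vec F) where
  sm := h.sm.nab D.isOpen _
  holo := by
    rw [nab_comm D.isOpen h.sm, h.holo, nab_smul D.isOpen (h.sm.nab D.isOpen _),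
      nab_comm D.isOpen h.sm]
  bound w K hK := by
    obtain ⟨C, hC⟩ := h.bound (d :: w) K hK
    refine ⟨C, fun z hz ξ => ?_⟩
    have := hC z hz ξ
    rwa [wtSum, ← add_assoc] at this

lemma Sym.add (h : Sym α D m F) (h' : Sym α D m G) : Sym α D m fun ξ z => F ξ z + G ξ z where
  sm := h.sm.add h'.sm
  holo := by
    rw [nab_add D.isOpen h.sm h'.sm, nab_add D.isOpen h.sm h'.sm, h.holo, h'.holo]
    simp only [smul_add]
  bound w K hK := by
    obtain ⟨C, hC⟩ := h.bound w K hK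
    obtain ⟨C', hC'⟩ := h'.bound w K hK
    refine ⟨C + C', fun z hz ξ => ?_⟩
    rw [nabs_add D.isOpen w h.sm h'.sm, add_mul]
    exact norm_add_le_of_le (hC z hz ξ) (hC' z hz ξ)

lemma Sym.smul (c : ℂ) (h : Sym α D m F) : Sym α D m fun ξ z => c • F ξ z where
  sm := h.sm.smul c
  holo := by
    rw [nab_smul D.isOpen h.sm, nab_smul D.isOpen h.sm, h.holo]
    simp only [smul_comm c]
  bound w K hK := by
    obtain ⟨C, hC⟩ := h.bound w K hK
    refine ⟨‖c‖ * C, fun z hz ξ => ?_⟩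
    rw [nabs_smul D.isOpen w h.sm, norm_smul, mul_assoc]
    exact mul_le_mul_of_nonneg_left (hC z hz ξ) (norm_nonneg _)

lemma Sym.sub (h : Sym α D m F) (h' : Sym α D m G) : Sym α D m fun ξ z => F ξ z - G ξ z := by
  simpa [sub_eq_add_neg] using h.add (h'.smul (-1))

lemma nab_zero_fun {U : Set ℂ} (v : PV n) : nab α U v (fun _ _ => (0 : A)) = fun _ _ => 0 := by
  have : tw α (fun _ _ => (0 : A)) = fun _ => 0 := funext fun p => map_zero _
  funext ξ z
  simp [nab, this]

lemma nabs_zero_fun {U : Set ℂ} (w : List (Dir n)) :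
    nabs α U w (fun _ _ => (0 : A)) = fun _ _ => 0 := by
  induction w with
  | nil => rfl
  | cons d w ih => rw [nabs, nab_zero_fun, ih]

lemma Sym.zero : Sym α D m (fun _ _ => 0) where
  sm := Sm.zero
  holo := by simp [nab_zero_fun]
  bound w K _ := ⟨0, fun z _ ξ => by simp [nabs_zero_fun]⟩

lemma Sym.sum {ι : Type*} (s : Finset ι) {F : ι → Eucl n → ℂ → A}
    (h : ∀ i ∈ s, Sym α D m (F i)) : Sym α D m fun ξ z => ∑ i ∈ s, F i ξ z := by
  classical
  induction s using Finset.induction_on with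
  | empty => simpa using Sym.zero
  | insert a s ha ih =>
    simp only [Finset.sum_insert ha]
    exact (h a (by simp)).add (ih fun i hi => h i (by simp [hi]))

/-- Decomposition of a vector into the coordinate directions. -/
lemma PV_eq_sum (v : PV n) : v = (∑ j, v.1 j • (Dir.act j).vec) + (∑ j, v.2.1 j • (Dir.sp j).vec)
    + v.2.2.re • (Dir.par : Dir n).vec + v.2.2.im • ((0, 0, Complex.I) : PV n) := by
  rcases v with ⟨s, ξ, z⟩
  have key : ∀ s : Eucl n, s = ∑ j, s j • (EuclideanSpace.single j (1 : ℝ) : Eucl n) := by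
    intro s
    ext i
    simp [Finset.sum_apply, Pi.single_apply]
  refine Prod.ext ?_ (Prod.ext ?_ ?_)
  · simp only [Dir.vec, Prod.fst_add, Prod.fst_sum, Prod.smul_fst]
    simpa using key s
  · simp only [Dir.vec, Prod.fst_add, Prod.snd_add, Prod.fst_sum, Prod.snd_sum, Prod.smul_fst,
      Prod.smul_snd]
    simpa using key ξ
  · simp only [Dir.vec, Prod.snd_add, Prod.snd_sum, Prod.smul_snd]
    simp [Complex.re_add_im]

/-- The Cauchy–Riemann equation `holo` reduces every complex direction to the direction `1`. This is
why the words in `Sym` need no letter for the imaginary direction. -/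
lemma Sym.nab_par (h : Sym α D m F) (c : ℂ) :
    nab α D.U (0, 0, c) F = fun ξ z => c • nab α D.U (0, 0, 1) F ξ z := by
  have e : ((0, 0, c) : PV n) = c.re • ((0, 0, 1) : PV n) + c.im • ((0, 0, Complex.I) : PV n) := by
    simp [Complex.re_add_im]
  rw [e, nab_add_vec, nab_smul_vec, nab_smul_vec, h.holo]
  funext ξ z
  beta_reduce
  rw [smul_smul, ← add_smul, Complex.re_add_im]

/-- Derivatives along the action and the covariable do not raise the order. -/
lemma Sym.nab_space (h : Sym α D m F) (s ξ : Eucl n) : Sym α D m (nab α D.U (s, ξ, 0) F) := by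
  rw [PV_eq_sum (s, ξ, (0 : ℂ))]
  simp only [nab_add_vec, nab_sum_vec, nab_smul_vec]
  refine ((Sym.add (Sym.sum _ fun j _ => Sym.smul _ ((h.nabDir (.act j)).mono (by simp [Dir.wt])))
    (Sym.sum _ fun j _ => Sym.smul _ ((h.nabDir (.sp j)).mono (by simp [Dir.wt])))).add
      ?_).add ?_
  · simpa using Sym.zero
  · simpa using Sym.zero

lemma Sym.nab_cov (h : Sym α D m F) (ξ : Eucl n) : Sym α D (m - 1) (nab α D.U (0, ξ, 0) F) := by
  rw [PV_eq_sum ((0 : Eucl n), ξ, (0 : ℂ))]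
  simp only [nab_add_vec, nab_sum_vec, nab_smul_vec]
  refine ((Sym.add ?_
    (Sym.sum _ fun j _ => Sym.smul _ ((h.nabDir (.sp j)).mono (by simp [Dir.wt, sub_eq_add_neg])))).add
      ?_).add ?_
  all_goals simpa using Sym.zero

lemma Sym.nab_any (h : Sym α D m F) (v : PV n) : Sym α D (m + 1) (nab α D.U v F) := by
  have e : v = (v.1, v.2.1, 0) + (0, 0, v.2.2) := by simp
  rw [e, nab_add_vec, h.nab_par]
  exact ((h.nab_space _ _).mono (by linarith)).add (Sym.smul _ (h.nabDir .par))

/-- A graded class of functions stable under differentiation, with the estimate for the functions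
themselves, consists of symbols. -/
theorem Sym.of_class (𝒞 : ℝ → Set (Eucl n → ℂ → A))
    (hd : ∀ m, ∀ h ∈ 𝒞 m, DifferentiableOn ℝ (tw α h) (dom n D.U))
    (hholo : ∀ m, ∀ h ∈ 𝒞 m,
      nab α D.U (0, 0, Complex.I) h = fun ξ z => Complex.I • nab α D.U (0, 0, 1) h ξ z)
    (hdir : ∀ m, ∀ h ∈ 𝒞 m, ∀ d : Dir n, ∃ h₁ ∈ 𝒞 (m + d.wt), ∃ h₂ ∈ 𝒞 (m + d.wt),
      nab α D.U d.vec h = fun ξ z => h₁ ξ z + h₂ ξ z)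
    (hb : ∀ m, ∀ h ∈ 𝒞 m, ∀ K ∈ D.fam, ∃ C : ℝ, ∀ z ∈ K, ∀ ξ, ‖h ξ z‖ ≤ C * bracket ξ ^ m) :
    ∀ m, ∀ h ∈ 𝒞 m, Sym α D m h := by
  -- Induction on the order of differentiability. The derivative in any direction is a combination
  -- of the coordinate derivatives, each a sum of two members of the class, the two summands of a
  -- Leibniz rule. The imaginary direction is eliminated by `hholo`.
  have hsm : ∀ k : ℕ, ∀ m, ∀ h ∈ 𝒞 m, ContDiffOn ℝ k (tw α h) (dom n D.U) := by
    intro k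
    induction k with
    | zero =>
      intro m h hh
      exact contDiffOn_zero.2 (hd m h hh).continuousOn
    | succ k ih =>
      intro m h hh
      have ihdir : ∀ d : Dir n, ContDiffOn ℝ k (tw α (nab α D.U d.vec h)) (dom n D.U) := by
        intro d
        obtain ⟨h₁, hh₁, h₂, hh₂, e⟩ := hdir m h hh d
        rw [e]
        exact ((ih _ _ hh₁).add (ih _ _ hh₂)).congr fun p _ => tw_add p
      rw [Nat.cast_succ, contDiffOn_succ_iff_fderiv_of_isOpen (isOpen_dom D.isOpen)]
      refine ⟨hd m h hh, by simp, contDiffOn_clm_apply.2 fun v => ?_⟩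
      have e : ∀ p ∈ dom n D.U, fderiv ℝ (tw α h) p v =
          (∑ j, v.1 j • tw α (nab α D.U (Dir.act j).vec h) p)
          + (∑ j, v.2.1 j • tw α (nab α D.U (Dir.sp j).vec h) p)
          + v.2.2.re • tw α (nab α D.U (Dir.par : Dir n).vec h) p
          + v.2.2.im • (Complex.I • tw α (nab α D.U (Dir.par : Dir n).vec h) p) := by
        intro p hp
        conv_lhs => rw [PV_eq_sum v]
        simp only [map_add, map_sum, map_smul]
        simp only [fderiv_tw_eq hp]
        rw [hholo m h hh, tw_smul]
        rfl
      refine ContDiffOn.congr ?_ e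
      refine ((ContDiffOn.add ?_ ?_).add ?_).add ?_
      · exact ContDiffOn.sum fun j _ => (ihdir _).const_smul _
      · exact ContDiffOn.sum fun j _ => (ihdir _).const_smul _
      · exact (ihdir _).const_smul _
      · exact ((ihdir _).const_smul _).const_smul _
  have hsm' : ∀ m, ∀ h ∈ 𝒞 m, Sm α D.U h := fun m h hh =>
    contDiffOn_infty.2 fun k => hsm k m h hh
  have hbw : ∀ w : List (Dir n), ∀ m, ∀ h ∈ 𝒞 m, ∀ K ∈ D.fam, ∃ C : ℝ, ∀ z ∈ K, ∀ ξ,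
      ‖nabs α D.U w h ξ z‖ ≤ C * bracket ξ ^ (m + wtSum w) := by
    intro w
    induction w with
    | nil => intro m h hh K hK; simpa [nabs, wtSum] using hb m h hh K hK
    | cons d w ih =>
      intro m h hh K hK
      obtain ⟨h₁, hh₁, h₂, hh₂, e⟩ := hdir m h hh d
      obtain ⟨C₁, hC₁⟩ := ih _ h₁ hh₁ K hK
      obtain ⟨C₂, hC₂⟩ := ih _ h₂ hh₂ K hK
      refine ⟨C₁ + C₂, fun z hz ξ => ?_⟩
      rw [nabs, e, nabs_add D.isOpen w (hsm' _ _ hh₁) (hsm' _ _ hh₂), add_mul, wtSum, ← add_assoc]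
      exact norm_add_le_of_le (hC₁ z hz ξ) (hC₂ z hz ξ)
  exact fun m h hh => ⟨hsm' m h hh, hholo m h hh, fun w K hK => hbw w m h hh K hK⟩

/-- Products of symbols, graded by the sum of the orders, form a class stable under differentiation,
so only the product of the two sup estimates is needed. -/
lemma Sym.mul (hF : Sym α D m F) (hG : Sym α D m' G) :
    Sym α D (m + m') fun ξ z => F ξ z * G ξ z := by
  refine Sym.of_class (fun μ => {h | ∃ m m' F G, m + m' = μ ∧ Sym α D m F ∧ Sym α D m' G ∧
    h = fun ξ z => F ξ z * G ξ z}) ?_ ?_ ?_ ?_ _ _ ⟨m, m', F, G, rfl, hF, hG, rfl⟩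
  · rintro μ _ ⟨m, m', F, G, rfl, hF, hG, rfl⟩
    exact (hF.sm.mul hG.sm).differentiableOn (by simp)
  · rintro μ _ ⟨m, m', F, G, rfl, hF, hG, rfl⟩
    rw [nab_mul D.isOpen hF.sm hG.sm, nab_mul D.isOpen hF.sm hG.sm, hF.holo, hG.holo]
    simp
  · rintro μ _ ⟨m, m', F, G, rfl, hF, hG, rfl⟩ d
    exact ⟨_, ⟨_, _, _, _, by ring, hF.nabDir d, hG, rfl⟩, _,
      ⟨_, _, _, _, by ring, hF, hG.nabDir d, rfl⟩, nab_mul D.isOpen hF.sm hG.sm _⟩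
  · rintro μ _ ⟨m, m', F, G, rfl, hF, hG, rfl⟩ K hK
    obtain ⟨C, hC0, hC⟩ := hF.exists_bound_zero hK
    obtain ⟨C', hC0', hC'⟩ := hG.exists_bound_zero hK
    refine ⟨C * C', fun z hz ξ => (norm_mul_le _ _).trans ?_⟩
    rw [Real.rpow_add (bracket_pos ξ)]
    calc _ ≤ (C * bracket ξ ^ m) * (C' * bracket ξ ^ m') :=
          mul_le_mul (hC z hz ξ) (hC' z hz ξ) (norm_nonneg _)
            (mul_nonneg hC0 (bracket_rpow_pos _ _).le)
      _ = _ := by ring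

end Sym

/-! ### Scalar weights on phase space -/

section Weights

variable {n : ℕ} {I : Type*}

/-- Directional derivative of a scalar function on phase space. -/
def dv (v : Eucl n × Eucl n) (ψ : Eucl n × Eucl n → ℂ) : Eucl n × Eucl n → ℂ :=
  fun x => fderiv ℝ ψ x v

/-- Iterated directional derivatives. -/
def dvs : List (Eucl n × Eucl n) → (Eucl n × Eucl n → ℂ) → Eucl n × Eucl n → ℂ
  | [], ψ => ψ
  | v :: l, ψ => dvs l (dv v ψ)

/-- Uniform bound of growth `q` for a family of functions and its derivatives up to order `N`. -/
def WB : ℕ → ℝ → (I → Eucl n × Eucl n → ℂ) → Prop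
  | 0, q, ψ => ∃ C : ℝ, 0 ≤ C ∧ ∀ i x, ‖ψ i x‖ ≤ C * (1 + ‖x‖) ^ q
  | N + 1, q, ψ => (∃ C : ℝ, 0 ≤ C ∧ ∀ i x, ‖ψ i x‖ ≤ C * (1 + ‖x‖) ^ q) ∧
      ∀ v, WB N q fun i => dv v (ψ i)

/-- Families of smooth functions all of whose derivatives have growth `q`, uniformly. -/
structure W (q : ℝ) (ψ : I → Eucl n × Eucl n → ℂ) : Prop where
  smooth : ∀ i, ContDiff ℝ ∞ (ψ i)
  wb : ∀ N, WB N q ψ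

variable {q q' : ℝ} {ψ ψ' : I → Eucl n × Eucl n → ℂ} {κ κ' : Eucl n × Eucl n → ℂ}

lemma contDiff_dv (h : ContDiff ℝ ∞ κ) (v : Eucl n × Eucl n) : ContDiff ℝ ∞ (dv v κ) :=
  (h.fderiv_right (m := ∞) (by simp)).clm_apply contDiff_const

lemma dv_add (h : ContDiff ℝ ∞ κ) (h' : ContDiff ℝ ∞ κ') (v : Eucl n × Eucl n) :
    dv v (fun x => κ x + κ' x) = fun x => dv v κ x + dv v κ' x := by
  funext x
  simp only [dv]
  rw [fderiv_fun_add (h.differentiable (by simp) x) (h'.differentiable (by simp) x)]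
  rfl

lemma dv_mul (h : ContDiff ℝ ∞ κ) (h' : ContDiff ℝ ∞ κ') (v : Eucl n × Eucl n) :
    dv v (fun x => κ x * κ' x) = fun x => dv v κ x * κ' x + κ x * dv v κ' x := by
  funext x
  simp only [dv]
  rw [fderiv_fun_mul (h.differentiable (by simp) x) (h'.differentiable (by simp) x)]
  simp [add_comm, mul_comm]

lemma dvs_add (l : List (Eucl n × Eucl n)) (h : ContDiff ℝ ∞ κ) (h' : ContDiff ℝ ∞ κ') :
    dvs l (fun x => κ x + κ' x) = fun x => dvs l κ x + dvs l κ' x := by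
  induction l generalizing κ κ' with
  | nil => rfl
  | cons v l ih => simp only [dvs]; rw [dv_add h h', ih (contDiff_dv h v) (contDiff_dv h' v)]

lemma WB.zero_bound {N : ℕ} (h : WB N q ψ) :
    ∃ C : ℝ, 0 ≤ C ∧ ∀ i x, ‖ψ i x‖ ≤ C * (1 + ‖x‖) ^ q := by
  cases N with
  | zero => exact h
  | succ N => exact h.1

lemma WB.pred {N : ℕ} (h : WB (N + 1) q ψ) : WB N q ψ := by
  induction N generalizing ψ with
  | zero => exact h.1
  | succ N ih => exact ⟨h.1, fun v => ih (h.2 v)⟩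

lemma one_le_one_add_norm {E : Type*} [NormedAddCommGroup E] (x : E) : 1 ≤ 1 + ‖x‖ := by
  linarith [norm_nonneg x]

lemma WB.mono {N : ℕ} (h : WB N q ψ) (hq : q ≤ q') : WB N q' ψ := by
  have key : ∀ ψ : I → Eucl n × Eucl n → ℂ,
      (∃ C : ℝ, 0 ≤ C ∧ ∀ i x, ‖ψ i x‖ ≤ C * (1 + ‖x‖) ^ q) →
      ∃ C : ℝ, 0 ≤ C ∧ ∀ i x, ‖ψ i x‖ ≤ C * (1 + ‖x‖) ^ q' := by
    rintro ψ ⟨C, hC, hb⟩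
    exact ⟨C, hC, fun i x => (hb i x).trans (mul_le_mul_of_nonneg_left
      (Real.rpow_le_rpow_of_exponent_le (one_le_one_add_norm x) hq) hC)⟩
  induction N generalizing ψ with
  | zero => exact key _ h
  | succ N ih => exact ⟨key _ h.1, fun v => ih (h.2 v)⟩

lemma WB.add {N : ℕ} (hs : ∀ i, ContDiff ℝ ∞ (ψ i)) (hs' : ∀ i, ContDiff ℝ ∞ (ψ' i))
    (h : WB N q ψ) (h' : WB N q ψ') : WB N q fun i x => ψ i x + ψ' i x := by
  have key : ∀ ψ ψ' : I → Eucl n × Eucl n → ℂ,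
      (∃ C : ℝ, 0 ≤ C ∧ ∀ i x, ‖ψ i x‖ ≤ C * (1 + ‖x‖) ^ q) →
      (∃ C : ℝ, 0 ≤ C ∧ ∀ i x, ‖ψ' i x‖ ≤ C * (1 + ‖x‖) ^ q) →
      ∃ C : ℝ, 0 ≤ C ∧ ∀ i x, ‖ψ i x + ψ' i x‖ ≤ C * (1 + ‖x‖) ^ q := by
    rintro ψ ψ' ⟨C, hC, hb⟩ ⟨C', hC', hb'⟩
    refine ⟨C + C', by positivity, fun i x => ?_⟩
    rw [add_mul]
    exact norm_add_le_of_le (hb i x) (hb' i x)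
  induction N generalizing ψ ψ' with
  | zero => exact key _ _ h h'
  | succ N ih =>
    refine ⟨key _ _ h.1 h'.1, fun v => ?_⟩
    simp only [dv_add (hs _) (hs' _)]
    exact ih (fun i => contDiff_dv (hs i) v) (fun i => contDiff_dv (hs' i) v) (h.2 v) (h'.2 v)

lemma WB.mul {N : ℕ} (hs : ∀ i, ContDiff ℝ ∞ (ψ i)) (hs' : ∀ i, ContDiff ℝ ∞ (ψ' i))
    (h : WB N q ψ) (h' : WB N q' ψ') : WB N (q + q') fun i x => ψ i x * ψ' i x := by
  have key : ∀ ψ ψ' : I → Eucl n × Eucl n → ℂ,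
      (∃ C : ℝ, 0 ≤ C ∧ ∀ i x, ‖ψ i x‖ ≤ C * (1 + ‖x‖) ^ q) →
      (∃ C : ℝ, 0 ≤ C ∧ ∀ i x, ‖ψ' i x‖ ≤ C * (1 + ‖x‖) ^ q') →
      ∃ C : ℝ, 0 ≤ C ∧ ∀ i x, ‖ψ i x * ψ' i x‖ ≤ C * (1 + ‖x‖) ^ (q + q') := by
    rintro ψ ψ' ⟨C, hC, hb⟩ ⟨C', hC', hb'⟩
    refine ⟨C * C', by positivity, fun i x => ?_⟩
    rw [norm_mul, Real.rpow_add (by positivity), mul_mul_mul_comm]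
    exact mul_le_mul (hb i x) (hb' i x) (norm_nonneg _) (by positivity)
  induction N generalizing ψ ψ' with
  | zero => exact key _ _ h h'
  | succ N ih =>
    refine ⟨key _ _ h.1 h'.1, fun v => ?_⟩
    simp only [dv_mul (hs _) (hs' _)]
    refine WB.add (fun i => (contDiff_dv (hs i) v).mul (hs' i))
      (fun i => (hs i).mul (contDiff_dv (hs' i) v)) ?_ ?_
    · exact ih (fun i => contDiff_dv (hs i) v) hs' (h.2 v) h'.pred
    · exact ih hs (fun i => contDiff_dv (hs' i) v) h.pred (h'.2 v)

lemma WB.const_mul {N : ℕ} (hs : ∀ i, ContDiff ℝ ∞ (ψ i)) (h : WB N q ψ) {c : I → ℂ} {R : ℝ}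
    (hc : ∀ i, ‖c i‖ ≤ R) : WB N q fun i x => c i * ψ i x := by
  have key : ∀ ψ : I → Eucl n × Eucl n → ℂ,
      (∃ C : ℝ, 0 ≤ C ∧ ∀ i x, ‖ψ i x‖ ≤ C * (1 + ‖x‖) ^ q) →
      ∃ C : ℝ, 0 ≤ C ∧ ∀ i x, ‖c i * ψ i x‖ ≤ C * (1 + ‖x‖) ^ q := by
    rintro ψ ⟨C, hC, hb⟩
    refine ⟨max R 0 * C, by positivity, fun i x => ?_⟩
    rw [norm_mul, mul_assoc]
    exact mul_le_mul ((hc i).trans (le_max_left _ _)) (hb i x) (norm_nonneg _) (by positivity)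
  induction N generalizing ψ with
  | zero => exact key _ h
  | succ N ih =>
    refine ⟨key _ h.1, fun v => ?_⟩
    have e : (fun i => dv v fun x => c i * ψ i x) = fun i x => c i * dv v (ψ i) x := by
      funext i x
      simp only [dv]
      rw [fderiv_const_mul ((hs i).differentiable (by simp) x)]
      rfl
    rw [e]
    exact ih (fun i => contDiff_dv (hs i) v) (h.2 v)

lemma W.bound (h : W q ψ) : ∃ C : ℝ, 0 ≤ C ∧ ∀ i x, ‖ψ i x‖ ≤ C * (1 + ‖x‖) ^ q := h.wb 0

lemma W.mono (h : W q ψ) (hq : q ≤ q') : W q' ψ := ⟨h.smooth, fun N => (h.wb N).mono hq⟩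

lemma W.dv (h : W q ψ) (v : Eucl n × Eucl n) : W q fun i => dv v (ψ i) :=
  ⟨fun i => contDiff_dv (h.smooth i) v, fun N => (h.wb (N + 1)).2 v⟩

lemma W.mul (h : W q ψ) (h' : W q' ψ') : W (q + q') fun i x => ψ i x * ψ' i x :=
  ⟨fun i => (h.smooth i).mul (h'.smooth i), fun N => (h.wb N).mul h.smooth h'.smooth (h'.wb N)⟩

lemma dv_const (v : Eucl n × Eucl n) (c : ℂ) : dv v (fun _ => c) = fun _ => 0 := by
  funext x; simp [dv]

lemma WB_const (N : ℕ) (c : ℂ) : WB N 0 (fun (_ : I) (_ : Eucl n × Eucl n) => c) := by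
  induction N generalizing c with
  | zero => exact ⟨‖c‖, norm_nonneg _, fun i x => by simp⟩
  | succ N ih =>
    refine ⟨⟨‖c‖, norm_nonneg _, fun i x => by simp⟩, fun v => ?_⟩
    simp only [dv_const]
    exact ih 0

lemma W_const (c : ℂ) : W 0 (fun (_ : I) (_ : Eucl n × Eucl n) => c) :=
  ⟨fun _ => contDiff_const, fun N => WB_const N c⟩

lemma W_linear (L : Eucl n × Eucl n →L[ℝ] ℂ) : W 1 (fun (_ : I) x => L x) := by
  refine ⟨fun _ => L.contDiff, fun N => ?_⟩
  have hb : ∃ C : ℝ, 0 ≤ C ∧ ∀ (_ : I) x, ‖L x‖ ≤ C * (1 + ‖x‖) ^ (1 : ℝ) := by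
    refine ⟨‖L‖, norm_nonneg _, fun _ x => (L.le_opNorm x).trans ?_⟩
    rw [Real.rpow_one]
    gcongr
    linarith
  cases N with
  | zero => exact hb
  | succ N =>
    refine ⟨hb, fun v => ?_⟩
    have : dv v (fun x => L x) = fun _ => L v := by funext x; simp [dv]
    beta_reduce
    rw [this]
    exact (WB_const N _).mono (by norm_num)

/-- `1 + |y|² + |η|²`. -/
def quad (x : Eucl n × Eucl n) : ℝ := 1 + ‖x.1‖ ^ 2 + ‖x.2‖ ^ 2

lemma quad_pos (x : Eucl n × Eucl n) : 0 < quad x := by unfold quad; positivity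

/-- `(1 + |y|² + |η|²)⁻¹`. -/
def rho (x : Eucl n × Eucl n) : ℂ := ((quad x)⁻¹ : ℝ)

/-- `(1 + |x|)² ≤ 4 (1 + |y|² + |η|²)`. -/
lemma one_add_norm_sq_le_quad (x : Eucl n × Eucl n) : (1 + ‖x‖) ^ 2 ≤ 4 * quad x := by
  have h1 := norm_nonneg x.1
  have h2 := norm_nonneg x.2
  have h : ‖x‖ ^ 2 ≤ ‖x.1‖ ^ 2 + ‖x.2‖ ^ 2 := by
    rw [Prod.norm_def]
    rcases max_cases ‖x.1‖ ‖x.2‖ with ⟨h, _⟩ | ⟨h, _⟩ <;> rw [h] <;> nlinarith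
  unfold quad
  nlinarith [sq_nonneg (1 - ‖x‖)]

lemma contDiff_quad : ContDiff ℝ ∞ (quad (n := n)) :=
  (contDiff_const.add (contDiff_fst.norm_sq ℝ)).add (contDiff_snd.norm_sq ℝ)

lemma contDiff_rho : ContDiff ℝ ∞ (rho (n := n)) :=
  Complex.ofRealCLM.contDiff.comp (contDiff_quad.inv fun x => (quad_pos x).ne')

/-- The linear functional `x ↦ 2 (⟨y, v₁⟩ + ⟨η, v₂⟩)`. -/
def quadDeriv (v : Eucl n × Eucl n) : Eucl n × Eucl n →L[ℝ] ℂ :=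
  Complex.ofRealCLM.comp ((2 : ℝ) • ((innerSL ℝ v.1).comp (ContinuousLinearMap.fst ℝ _ _)
    + (innerSL ℝ v.2).comp (ContinuousLinearMap.snd ℝ _ _)))

lemma dv_rho (v : Eucl n × Eucl n) :
    dv v rho = fun x => -1 * (rho x * (rho x * quadDeriv v x)) := by
  funext x
  have h1 : HasFDerivAt (fun x : Eucl n × Eucl n => ‖x.1‖ ^ 2)
      (2 • (innerSL ℝ x.1).comp (ContinuousLinearMap.fst ℝ (Eucl n) (Eucl n))) x :=
    (hasFDerivAt_fst (𝕜 := ℝ) (p := x)).norm_sq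
  have h2 : HasFDerivAt (fun x : Eucl n × Eucl n => ‖x.2‖ ^ 2)
      (2 • (innerSL ℝ x.2).comp (ContinuousLinearMap.snd ℝ (Eucl n) (Eucl n))) x :=
    (hasFDerivAt_snd (𝕜 := ℝ) (p := x)).norm_sq
  have h3 := Complex.ofRealCLM.hasFDerivAt.comp x
    ((hasDerivAt_inv (quad_pos x).ne').comp_hasFDerivAt x ((h1.const_add 1).add h2))
  have h4 : HasFDerivAt (rho (n := n)) _ x := h3
  simp only [dv]
  rw [h4.fderiv]
  simp [rho, quadDeriv, real_inner_comm]
  ring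

/-- By `dv_rho` a derivative of `rho` is a product of two copies of `rho` and a linear form, of
growth `-2 - 2 + 1 ≤ -2`. The product estimate then closes the induction on the number of
derivatives. -/
lemma W_rho : W (-2) (fun (_ : I) => rho (n := n)) := by
  refine ⟨fun _ => contDiff_rho, fun N => ?_⟩
  have hb : ∃ C : ℝ, 0 ≤ C ∧ ∀ (_ : I) x, ‖rho (n := n) x‖ ≤ C * (1 + ‖x‖) ^ (-2 : ℝ) := by
    refine ⟨4, by norm_num, fun _ x => ?_⟩
    have h := one_add_norm_sq_le_quad x
    have h0 : (0 : ℝ) < 1 + ‖x‖ := by positivity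
    have hq := quad_pos x
    rw [Real.rpow_neg h0.le, Real.rpow_two, rho, Complex.norm_real, Real.norm_of_nonneg
      (by positivity), ← div_eq_mul_inv, le_div_iff₀ (by positivity), inv_mul_le_iff₀ hq]
    linarith
  induction N with
  | zero => exact hb
  | succ N ih =>
    refine ⟨hb, fun v => ?_⟩
    beta_reduce
    rw [dv_rho]
    have hl := (W_linear (I := I) (quadDeriv v))
    have h1 := WB.mul (fun _ => contDiff_rho) hl.smooth ih (hl.wb N)
    have hs1 := fun _ : I => contDiff_rho.mul (quadDeriv v).contDiff
    have h2 := WB.mul (fun _ => contDiff_rho) hs1 ih h1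
    have hs2 := fun i : I => contDiff_rho.mul (hs1 i)
    exact (h2.const_mul hs2 (c := fun _ => -1) (R := 1) (by simp)).mono (by norm_num)

/-- Bounded convergence of families of weights. -/
structure WConv (l : Filter I) (q : ℝ) (ψ : I → Eucl n × Eucl n → ℂ)
    (κ : Eucl n × Eucl n → ℂ) : Prop where
  w : W q ψ
  smooth : ContDiff ℝ ∞ κ
  lim : ∀ (w : List (Eucl n × Eucl n)) x, Filter.Tendsto (fun i => dvs w (ψ i) x) l (𝓝 (dvs w κ x))

variable {l : Filter I}

lemma WConv.dv (h : WConv l q ψ κ) (v : Eucl n × Eucl n) :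
    WConv l q (fun i => dv v (ψ i)) (dv v κ) :=
  ⟨h.w.dv v, contDiff_dv h.smooth v, fun w x => h.lim (v :: w) x⟩

lemma WConv.mono (h : WConv l q ψ κ) (hq : q ≤ q') : WConv l q' ψ κ :=
  ⟨h.w.mono hq, h.smooth, h.lim⟩

lemma WConv.mul_left (h : WConv l q ψ κ) {σ : Eucl n × Eucl n → ℂ} (hσ : W q' fun _ : I => σ)
    (hσs : ContDiff ℝ ∞ σ) : WConv l (q' + q) (fun i x => σ x * ψ i x) fun x => σ x * κ x := by
  refine ⟨hσ.mul h.w, hσs.mul h.smooth, fun w => ?_⟩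
  have key : ∀ (w : List (Eucl n × Eucl n)) (σ : Eucl n × Eucl n → ℂ) (ψ : I → Eucl n × Eucl n → ℂ)
      (κ : Eucl n × Eucl n → ℂ), ContDiff ℝ ∞ σ → (∀ i, ContDiff ℝ ∞ (ψ i)) → ContDiff ℝ ∞ κ →
      (∀ w x, Filter.Tendsto (fun i => dvs w (ψ i) x) l (𝓝 (dvs w κ x))) →
      ∀ x, Filter.Tendsto (fun i => dvs w (fun x => σ x * ψ i x) x) l
        (𝓝 (dvs w (fun x => σ x * κ x) x)) := by
    intro w
    induction w with
    | nil => intro σ ψ κ _ _ _ hl x; exact (hl [] x).const_mul _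
    | cons v w ih =>
      intro σ ψ κ hσ hψ hκ hl x
      have hdσ := contDiff_dv hσ v
      have hdψ := fun i => contDiff_dv (hψ i) v
      have hdκ := contDiff_dv hκ v
      simp only [dvs]
      simp only [dv_mul hσ hκ, dv_mul hσ (hψ _)]
      rw [dvs_add w (hdσ.mul hκ) (hσ.mul hdκ)]
      simp only [dvs_add w (hdσ.mul (hψ _)) (hσ.mul (hdψ _))]
      exact (ih _ _ _ hdσ hψ hκ hl x).add (ih _ _ _ hσ hdψ hdκ (fun w x => hl (v :: w) x) x)
  exact key w σ ψ κ hσs h.w.smooth h.smooth h.lim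

/-! ### Cutoff families -/

/-- The function `(y, η) ↦ χ(ε₁ y, ε₂ η + c)`, for `θ = (ε₁, ε₂, c)`. -/
def cut (χ : 𝓢(Eucl n × Eucl n, ℂ)) (θ : ℝ × ℝ × Eucl n) (x : Eucl n × Eucl n) : ℂ :=
  χ (θ.1 • x.1, θ.2.1 • x.2 + θ.2.2)

/-- The linear part of the change of variables in `cut`. -/
def cutLin (a b : ℝ) : Eucl n × Eucl n →L[ℝ] Eucl n × Eucl n :=
  (a • ContinuousLinearMap.fst ℝ _ _).prod (b • ContinuousLinearMap.snd ℝ _ _)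

lemma cut_eq (χ : 𝓢(Eucl n × Eucl n, ℂ)) (θ : ℝ × ℝ × Eucl n) :
    cut χ θ = fun x => χ (cutLin θ.1 θ.2.1 x + (0, θ.2.2)) := by
  funext x; simp [cut, cutLin]

lemma contDiff_cut (χ : 𝓢(Eucl n × Eucl n, ℂ)) (θ : ℝ × ℝ × Eucl n) : ContDiff ℝ ∞ (cut χ θ) := by
  rw [cut_eq]
  exact (χ.smooth ⊤).comp ((cutLin _ _).contDiff.add contDiff_const)

open LineDeriv in
-- Derivatives of cutoffs are scaling factors times cutoffs built from other Schwartz functions.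
-- Statements about all derivatives therefore follow by induction over all `χ` at once, and the
-- scaling factors make derivatives small when the cutoff is wide.
lemma dv_cut (χ : 𝓢(Eucl n × Eucl n, ℂ)) (θ : ℝ × ℝ × Eucl n) (v : Eucl n × Eucl n) :
    dv v (cut χ θ) = fun x => (θ.1 : ℂ) * cut (∂_{((v.1, 0) : Eucl n × Eucl n)} χ) θ x
      + (θ.2.1 : ℂ) * cut (∂_{((0, v.2) : Eucl n × Eucl n)} χ) θ x := by
  funext x
  have h : HasFDerivAt (cut χ θ) ((fderiv ℝ χ (cutLin θ.1 θ.2.1 x + (0, θ.2.2))).comp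
      (cutLin θ.1 θ.2.1)) x := by
    rw [cut_eq]
    exact (χ.hasFDerivAt _).comp x ((cutLin θ.1 θ.2.1).hasFDerivAt.add_const _)
  simp only [dv]
  rw [h.fderiv]
  have e : cutLin θ.1 θ.2.1 v
      = θ.1 • ((v.1, 0) : Eucl n × Eucl n) + θ.2.1 • ((0, v.2) : Eucl n × Eucl n) := by
    simp [cutLin]
  rw [ContinuousLinearMap.comp_apply, e, map_add, map_smul, map_smul]
  simp only [cut_eq, SchwartzMap.lineDerivOp_apply_eq_fderiv, Complex.real_smul]

lemma schwartz_bound (χ : 𝓢(Eucl n × Eucl n, ℂ)) (k : ℕ) :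
    ∃ C : ℝ, 0 ≤ C ∧ ∀ x, ‖χ x‖ ≤ C * (1 + ‖x‖) ^ (-(k : ℝ)) := by
  refine ⟨2 ^ k * ((Finset.Iic (k, 0)).sup fun m => SchwartzMap.seminorm ℝ m.1 m.2) χ,
    by positivity, fun x => ?_⟩
  have h := SchwartzMap.one_add_le_sup_seminorm_apply (𝕜 := ℝ) (m := (k, 0)) (k := k) (n := 0)
    le_rfl le_rfl χ x
  rw [norm_iteratedFDeriv_zero] at h
  rw [Real.rpow_neg (by positivity), Real.rpow_natCast, ← div_eq_mul_inv,
    le_div_iff₀ (by positivity), mul_comm]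
  exact h

/-- Uniform bounds for the cutoffs with scaling parameters in `[0, 1]`. -/
lemma W_cut (χ : 𝓢(Eucl n × Eucl n, ℂ)) {θ : I → ℝ × ℝ × Eucl n}
    (hθ : ∀ i, |(θ i).1| ≤ 1 ∧ |(θ i).2.1| ≤ 1) : W 0 fun i => cut χ (θ i) := by
  refine ⟨fun i => contDiff_cut χ _, fun N => ?_⟩
  induction N generalizing χ with
  | zero =>
    obtain ⟨C, hC, hb⟩ := schwartz_bound χ 0
    exact ⟨C, hC, fun i x => by simpa [cut] using hb _⟩
  | succ N ih =>
    refine ⟨(ih χ).zero_bound, fun v => ?_⟩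
    simp only [dv_cut]
    refine WB.add (fun i => contDiff_const.mul (contDiff_cut _ _))
      (fun i => contDiff_const.mul (contDiff_cut _ _)) ?_ ?_
    · exact (ih _).const_mul (fun i => contDiff_cut _ _) (R := 1) fun i => by simpa using (hθ i).1
    · exact (ih _).const_mul (fun i => contDiff_cut _ _) (R := 1) fun i => by simpa using (hθ i).2

/-- Rapid decay of a single cutoff. -/
lemma W_cut_decay (χ : 𝓢(Eucl n × Eucl n, ℂ)) {θ : ℝ × ℝ × Eucl n} (h1 : 0 < θ.1)
    (h2 : 0 < θ.2.1) (k : ℕ) : W (-(k : ℝ)) fun _ : I => cut χ θ := by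
  refine ⟨fun i => contDiff_cut χ _, fun N => ?_⟩
  induction N generalizing χ with
  | zero =>
    obtain ⟨C, hC, hb⟩ := schwartz_bound χ k
    -- `R` is chosen so that `1 + ‖x‖ ≤ R (1 + ‖X‖)` for the rescaled and shifted argument `X`: the
    -- inverse scalings undo the dilation, the last term undoes the shift.
    set R : ℝ := 1 + θ.1⁻¹ + θ.2.1⁻¹ + θ.2.1⁻¹ * ‖θ.2.2‖ with hR
    have hR0 : 0 < R := by positivity
    refine ⟨C * R ^ k, by positivity, fun _ x => (hb _).trans ?_⟩
    rw [mul_assoc]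
    refine mul_le_mul_of_nonneg_left ?_ hC
    set X : Eucl n × Eucl n := (θ.1 • x.1, θ.2.1 • x.2 + θ.2.2) with hX
    have hx : 1 + ‖x‖ ≤ R * (1 + ‖X‖) := by
      have e1 : ‖x.1‖ ≤ θ.1⁻¹ * ‖X‖ := by
        have : ‖X.1‖ ≤ ‖X‖ := norm_fst_le X
        rw [hX, norm_smul, Real.norm_of_nonneg h1.le] at this
        rw [← div_eq_inv_mul, le_div_iff₀ h1, mul_comm]
        exact this
      have e2 : ‖x.2‖ ≤ θ.2.1⁻¹ * (‖X‖ + ‖θ.2.2‖) := by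
        have h3 : ‖X.2‖ ≤ ‖X‖ := norm_snd_le X
        have h4 : ‖θ.2.1 • x.2‖ ≤ ‖X.2‖ + ‖θ.2.2‖ := by
          have : θ.2.1 • x.2 = X.2 - θ.2.2 := by simp [hX]
          rw [this]; exact norm_sub_le _ _
        rw [norm_smul, Real.norm_of_nonneg h2.le] at h4
        rw [← div_eq_inv_mul, le_div_iff₀ h2, mul_comm]
        linarith
      have hX0 := norm_nonneg X
      have hc0 : 0 ≤ θ.2.1⁻¹ * ‖θ.2.2‖ := by positivity
      have i1 : 0 < θ.1⁻¹ := by positivity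
      have i2 : 0 < θ.2.1⁻¹ := by positivity
      rw [Prod.norm_def x]
      rcases max_cases ‖x.1‖ ‖x.2‖ with ⟨h, _⟩ | ⟨h, _⟩ <;> rw [h, hR] <;>
        nlinarith [mul_nonneg hc0 hX0, mul_nonneg i1.le hX0, mul_nonneg i2.le hX0]
    rw [Real.rpow_neg (by positivity), Real.rpow_neg (by positivity), Real.rpow_natCast,
      Real.rpow_natCast, ← div_eq_mul_inv, le_div_iff₀ (by positivity), ← div_eq_inv_mul,
      div_le_iff₀ (by positivity), ← mul_pow]
    exact pow_le_pow_left₀ (by positivity) hx k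
  | succ N ih =>
    refine ⟨(ih χ).zero_bound, fun v => ?_⟩
    simp only [dv_cut]
    refine WB.add (fun i => contDiff_const.mul (contDiff_cut _ _))
      (fun i => contDiff_const.mul (contDiff_cut _ _)) ?_ ?_
    · exact (ih _).const_mul (fun i => contDiff_cut _ _) (R := |θ.1|) fun i => by simp
    · exact (ih _).const_mul (fun i => contDiff_cut _ _) (R := |θ.2.1|) fun i => by simp

lemma dvs_const_mul (w : List (Eucl n × Eucl n)) (h : ContDiff ℝ ∞ κ) (c : ℂ) :
    dvs w (fun x => c * κ x) = fun x => c * dvs w κ x := by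
  induction w generalizing κ with
  | nil => rfl
  | cons v w ih =>
    have e : dv v (fun x => c * κ x) = fun x => c * dv v κ x := by
      funext x
      simp only [dv]
      rw [fderiv_const_mul (h.differentiable (by simp) x)]
      rfl
    simp only [dvs]
    rw [e, ih (contDiff_dv h v)]

/-- The limit `θ₀` may have vanishing scalings. The limiting weight is then constant in the
corresponding variable, and this is how cutoffs are removed. -/
lemma WConv_cut (χ : 𝓢(Eucl n × Eucl n, ℂ)) {θ : I → ℝ × ℝ × Eucl n} {θ₀ : ℝ × ℝ × Eucl n}
    (hθ : ∀ i, |(θ i).1| ≤ 1 ∧ |(θ i).2.1| ≤ 1) (hl : Filter.Tendsto θ l (𝓝 θ₀)) :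
    WConv l 0 (fun i => cut χ (θ i)) (cut χ θ₀) := by
  refine ⟨W_cut χ hθ, contDiff_cut _ _, fun w => ?_⟩
  induction w generalizing χ with
  | nil =>
    intro x
    have : Continuous fun θ : ℝ × ℝ × Eucl n => cut χ θ x := by
      unfold cut
      exact χ.continuous.comp (by fun_prop)
    exact (this.tendsto θ₀).comp hl
  | cons v w ih =>
    intro x
    simp only [dvs]
    simp only [dv_cut]
    have hs := fun (c : ℂ) χ θ => contDiff_const.mul (contDiff_cut (n := n) χ θ) (f := fun _ => c)
    have e := fun (c c' : ℂ) (χ χ' : 𝓢(Eucl n × Eucl n, ℂ)) (θ : ℝ × ℝ × Eucl n) =>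
      dvs_add w (hs c χ θ) (hs c' χ' θ)
    simp only [e]
    simp only [dvs_const_mul w (contDiff_cut _ _)]
    have t1 : Filter.Tendsto (fun i => ((θ i).1 : ℂ)) l (𝓝 (θ₀.1 : ℂ)) :=
      ((Complex.continuous_ofReal.comp continuous_fst).tendsto θ₀).comp hl
    have t2 : Filter.Tendsto (fun i => ((θ i).2.1 : ℂ)) l (𝓝 (θ₀.2.1 : ℂ)) :=
      ((Complex.continuous_ofReal.comp (continuous_fst.comp continuous_snd)).tendsto θ₀).comp hl
    exact (t1.mul (ih _ x)).add (t2.mul (ih _ x))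

end Weights

/-! ### Differentiation of parameter integrals -/

section ParamIntegral

variable {n : ℕ} {A : Type*} [CStarAlgebra A] {α : CStarAction n A} {U : Set ℂ}
  {F G : Eucl n → ℂ → A}

lemma Sm.continuous_comp (h : Sm α U F) {E : Type*} [TopologicalSpace E] {l : E → PV n}
    (hl : Continuous l) (hd : ∀ x, l x ∈ dom n U) : Continuous fun x => tw α F (l x) :=
  ContinuousOn.comp_continuous h.continuousOn hl hd

lemma Sm.hasFDerivAt (hU : IsOpen U) (h : Sm α U F) {p : PV n} (hp : p ∈ dom n U) :
    HasFDerivAt (tw α F) (fderiv ℝ (tw α F) p) p := (h.differentiableAt hU hp).hasFDerivAt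

lemma hasFDerivAt_smul_mul {V : Type*} [NormedAddCommGroup V] [NormedSpace ℝ V] {p : V}
    {c : V → ℂ} {f g : V → A} {c' : V →L[ℝ] ℂ} {f' g' : V →L[ℝ] A} (hc : HasFDerivAt c c' p)
    (hf : HasFDerivAt f f' p) (hg : HasFDerivAt g g' p) :
    HasFDerivAt (fun p => c p • (f p * g p)) (c'.smulRight (f p * g p)
      + c p • (((ContinuousLinearMap.mul ℝ A).flip (g p)).comp f'
        + (ContinuousLinearMap.mul ℝ A (f p)).comp g')) p := by
  refine (hc.smul (hf.mul' hg)).congr_fderiv ?_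
  ext v
  simp only [add_apply, ContinuousLinearMap.smulRight_apply,
    smul_apply, ContinuousLinearMap.comp_apply, ContinuousLinearMap.flip_apply,
    ContinuousLinearMap.mul_apply', smul_eq_mul, op_smul_eq_mul]
  rw [add_comm (c' v • _), add_comm (f p * g' v)]
  rfl

set_option maxHeartbeats 800000 in
-- Dominated differentiation under the integral sign for a scalar times a product of two extensions
-- along affine arguments. It serves both the phase-space integral, whose scalar factor does not
-- depend on `p`, and the quantization, whose scalar factor is a wave. The three terms come from the
-- scalar and from the two extensions.
theorem hasFDerivAt_integral_tw {E : Type*} [NormedAddCommGroup E] [MeasurableSpace E]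
    [BorelSpace E] [SecondCountableTopology E] {μ : Measure E} (hU : IsOpen U)
    (hF : Sm α U F) (hG : Sm α U G) {c : PV n → E → ℂ} {c' : PV n → E → PV n →L[ℝ] ℂ}
    {Λ₁ Λ₂ : PV n →L[ℝ] PV n} {l₁ l₂ : E → PV n} (hl₁ : Continuous l₁) (hl₂ : Continuous l₂)
    {p₀ : PV n} {S : Set (PV n)} (hS : S ∈ 𝓝 p₀) (hd₁ : ∀ p ∈ S, ∀ x, Λ₁ p + l₁ x ∈ dom n U)
    (hd₂ : ∀ p ∈ S, ∀ x, Λ₂ p + l₂ x ∈ dom n U)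
    (hc : ∀ p ∈ S, ∀ x, HasFDerivAt (fun p => c p x) (c' p x) p)
    (hcc : ∀ p ∈ S, Continuous (c p)) (hcc' : ∀ v, Continuous fun x => c' p₀ x v)
    {b bF bG : E → ℝ} (hbc : ∀ p ∈ S, ∀ x, ‖c p x‖ ≤ b x) (hbc' : ∀ p ∈ S, ∀ x, ‖c' p x‖ ≤ b x)
    (hbF : ∀ p ∈ S, ∀ x, ‖tw α F (Λ₁ p + l₁ x)‖ ≤ bF x)
    (hbF' : ∀ p ∈ S, ∀ x, ‖fderiv ℝ (tw α F) (Λ₁ p + l₁ x)‖ ≤ bF x)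
    (hbG : ∀ p ∈ S, ∀ x, ‖tw α G (Λ₂ p + l₂ x)‖ ≤ bG x)
    (hbG' : ∀ p ∈ S, ∀ x, ‖fderiv ℝ (tw α G) (Λ₂ p + l₂ x)‖ ≤ bG x)
    (hInt : Integrable (fun x => b x * (bF x * bG x)) μ) :
    ∃ L : PV n →L[ℝ] A,
      HasFDerivAt (fun p => ∫ x, c p x • (tw α F (Λ₁ p + l₁ x) * tw α G (Λ₂ p + l₂ x)) ∂μ) L p₀ ∧
      ∀ v, L v = ∫ x, (c' p₀ x v • (tw α F (Λ₁ p₀ + l₁ x) * tw α G (Λ₂ p₀ + l₂ x))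
        + (c p₀ x • (tw α (nab α U (Λ₁ v) F) (Λ₁ p₀ + l₁ x) * tw α G (Λ₂ p₀ + l₂ x))
        + c p₀ x • (tw α F (Λ₁ p₀ + l₁ x) * tw α (nab α U (Λ₂ v) G) (Λ₂ p₀ + l₂ x)))) ∂μ := by
  have hp₀ : p₀ ∈ S := mem_of_mem_nhds hS
  set H : PV n → E → PV n →L[ℝ] A := fun p x =>
    (c' p x).smulRight (tw α F (Λ₁ p + l₁ x) * tw α G (Λ₂ p + l₂ x))
    + c p x • (((ContinuousLinearMap.mul ℝ A).flip (tw α G (Λ₂ p + l₂ x))).comp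
        ((fderiv ℝ (tw α F) (Λ₁ p + l₁ x)).comp Λ₁)
      + ((ContinuousLinearMap.mul ℝ A) (tw α F (Λ₁ p + l₁ x))).comp
        ((fderiv ℝ (tw α G) (Λ₂ p + l₂ x)).comp Λ₂)) with hH
  have hHv : ∀ p ∈ S, ∀ x v, H p x v = c' p x v • (tw α F (Λ₁ p + l₁ x) * tw α G (Λ₂ p + l₂ x))
        + (c p x • (tw α (nab α U (Λ₁ v) F) (Λ₁ p + l₁ x) * tw α G (Λ₂ p + l₂ x))
        + c p x • (tw α F (Λ₁ p + l₁ x) * tw α (nab α U (Λ₂ v) G) (Λ₂ p + l₂ x))) := by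
    intro p hp x v
    simp [hH, fderiv_tw_eq (hd₁ p hp x), fderiv_tw_eq (hd₂ p hp x)]
  have hderiv : ∀ p ∈ S, ∀ x, HasFDerivAt
      (fun p => c p x • (tw α F (Λ₁ p + l₁ x) * tw α G (Λ₂ p + l₂ x))) (H p x) p := by
    intro p hp x
    have h1 := (hF.hasFDerivAt hU (hd₁ p hp x)).comp p (Λ₁.hasFDerivAt.add_const (l₁ x))
    have h2 := (hG.hasFDerivAt hU (hd₂ p hp x)).comp p (Λ₂.hasFDerivAt.add_const (l₂ x))
    exact hasFDerivAt_smul_mul (hc p hp x) h1 h2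
  have hcF : ∀ p ∈ S, Continuous fun x => tw α F (Λ₁ p + l₁ x) := fun p hp =>
    hF.continuous_comp (continuous_const.add hl₁) (hd₁ p hp)
  have hcG : ∀ p ∈ S, Continuous fun x => tw α G (Λ₂ p + l₂ x) := fun p hp =>
    hG.continuous_comp (continuous_const.add hl₂) (hd₂ p hp)
  have hcont : ∀ p ∈ S, Continuous fun x =>
      c p x • (tw α F (Λ₁ p + l₁ x) * tw α G (Λ₂ p + l₂ x)) := fun p hp =>
    (hcc p hp).smul ((hcF p hp).mul (hcG p hp))
  have hHc : Continuous (H p₀) := by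
    refine continuous_clm_apply.2 fun v => ?_
    simp only [hHv p₀ hp₀]
    have h1 : Continuous fun x => tw α (nab α U (Λ₁ v) F) (Λ₁ p₀ + l₁ x) :=
      (hF.nab hU _).continuous_comp (continuous_const.add hl₁) (hd₁ p₀ hp₀)
    have h2 : Continuous fun x => tw α (nab α U (Λ₂ v) G) (Λ₂ p₀ + l₂ x) :=
      (hG.nab hU _).continuous_comp (continuous_const.add hl₂) (hd₂ p₀ hp₀)
    exact ((hcc' v).smul ((hcF p₀ hp₀).mul (hcG p₀ hp₀))).add
      (((hcc p₀ hp₀).smul (h1.mul (hcG p₀ hp₀))).add ((hcc p₀ hp₀).smul ((hcF p₀ hp₀).mul h2)))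
  have hHb : ∀ p ∈ S, ∀ x, ‖H p x‖ ≤ (1 + ‖Λ₁‖ + ‖Λ₂‖) * (b x * (bF x * bG x)) := by
    intro p hp x
    have b0 : 0 ≤ b x := (norm_nonneg _).trans (hbc p hp x)
    have bF0 : 0 ≤ bF x := (norm_nonneg _).trans (hbF p hp x)
    have bG0 : 0 ≤ bG x := (norm_nonneg _).trans (hbG p hp x)
    refine ContinuousLinearMap.opNorm_le_bound _ (by positivity) fun v => ?_
    have e1 : ‖tw α F (Λ₁ p + l₁ x) * tw α G (Λ₂ p + l₂ x)‖ ≤ bF x * bG x :=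
      (norm_mul_le _ _).trans (mul_le_mul (hbF p hp x) (hbG p hp x) (norm_nonneg _) bF0)
    have e2 : ‖fderiv ℝ (tw α F) (Λ₁ p + l₁ x) (Λ₁ v)‖ ≤ bF x * (‖Λ₁‖ * ‖v‖) :=
      (ContinuousLinearMap.le_opNorm _ _).trans
        (mul_le_mul (hbF' p hp x) (Λ₁.le_opNorm v) (norm_nonneg _) bF0)
    have e3 : ‖fderiv ℝ (tw α G) (Λ₂ p + l₂ x) (Λ₂ v)‖ ≤ bG x * (‖Λ₂‖ * ‖v‖) :=
      (ContinuousLinearMap.le_opNorm _ _).trans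
        (mul_le_mul (hbG' p hp x) (Λ₂.le_opNorm v) (norm_nonneg _) bG0)
    have e4 : ‖c' p x v‖ ≤ b x * ‖v‖ := (ContinuousLinearMap.le_opNorm _ _).trans
      (mul_le_mul_of_nonneg_right (hbc' p hp x) (norm_nonneg _))
    have f1 : ‖c' p x v • (tw α F (Λ₁ p + l₁ x) * tw α G (Λ₂ p + l₂ x))‖
        ≤ (b x * ‖v‖) * (bF x * bG x) := by
      rw [norm_smul]
      exact mul_le_mul e4 e1 (norm_nonneg _) (by positivity)
    have f2 : ‖c p x • (fderiv ℝ (tw α F) (Λ₁ p + l₁ x) (Λ₁ v) * tw α G (Λ₂ p + l₂ x))‖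
        ≤ b x * ((bF x * (‖Λ₁‖ * ‖v‖)) * bG x) := by
      rw [norm_smul]
      exact mul_le_mul (hbc p hp x) ((norm_mul_le _ _).trans
        (mul_le_mul e2 (hbG p hp x) (norm_nonneg _) (by positivity))) (norm_nonneg _) b0
    have f3 : ‖c p x • (tw α F (Λ₁ p + l₁ x) * fderiv ℝ (tw α G) (Λ₂ p + l₂ x) (Λ₂ v))‖
        ≤ b x * (bF x * (bG x * (‖Λ₂‖ * ‖v‖))) := by
      rw [norm_smul]
      exact mul_le_mul (hbc p hp x) ((norm_mul_le _ _).trans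
        (mul_le_mul (hbF p hp x) e3 (norm_nonneg _) bF0)) (norm_nonneg _) b0
    rw [hHv p hp x v, ← fderiv_tw_eq (hd₁ p hp x), ← fderiv_tw_eq (hd₂ p hp x)]
    refine (norm_add_le_of_le f1 (norm_add_le_of_le f2 f3)).trans (le_of_eq ?_)
    ring
  have : SecondCountableTopologyEither E (PV n →L[ℝ] A) := ⟨Or.inl inferInstance⟩
  have hHi : Integrable (H p₀) μ :=
    (hInt.const_mul (1 + ‖Λ₁‖ + ‖Λ₂‖)).mono' hHc.aestronglyMeasurable
      (Filter.Eventually.of_forall (hHb p₀ hp₀))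
  refine ⟨∫ x, H p₀ x ∂μ, ?_, fun v => ?_⟩
  · refine hasFDerivAt_integral_of_dominated_of_fderiv_le (F := fun p x =>
      c p x • (tw α F (Λ₁ p + l₁ x) * tw α G (Λ₂ p + l₂ x))) hS ?_ ?_ hHc.aestronglyMeasurable
      (Filter.Eventually.of_forall fun x p hp => hHb p hp x) (hInt.const_mul _)
      (Filter.Eventually.of_forall fun x p hp => hderiv p hp x)
    · filter_upwards [hS] with p hp
      exact (hcont p hp).aestronglyMeasurable
    · refine hInt.mono' (hcont p₀ hp₀).aestronglyMeasurable (Filter.Eventually.of_forall fun x => ?_)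
      have b0 : 0 ≤ b x := (norm_nonneg _).trans (hbc p₀ hp₀ x)
      have bF0 : 0 ≤ bF x := (norm_nonneg _).trans (hbF p₀ hp₀ x)
      rw [norm_smul]
      exact mul_le_mul (hbc p₀ hp₀ x) ((norm_mul_le _ _).trans (mul_le_mul (hbF p₀ hp₀ x)
        (hbG p₀ hp₀ x) (norm_nonneg _) bF0)) (norm_nonneg _) b0
  · rw [ContinuousLinearMap.integral_apply hHi]
    exact integral_congr_ae (Filter.Eventually.of_forall fun x => hHv p₀ hp₀ x v)

end ParamIntegral

/-! ### Pointwise bounds for the extension of a symbol and its derivative -/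

section SymBounds

variable {n : ℕ} {A : Type*} [CStarAlgebra A] {α : CStarAction n A} {D : ParamDomain}
  {F G : Eucl n → ℂ → A} {m m' : ℝ}

lemma Sym.tw_bound (h : Sym α D m F) {K : Set ℂ} (hK : K ∈ D.fam) :
    ∃ C : ℝ, 0 ≤ C ∧ ∀ p : PV n, p.2.2 ∈ K → ‖tw α F p‖ ≤ C * bracket p.2.1 ^ m := by
  obtain ⟨C, hC, hb⟩ := h.exists_bound_zero hK
  exact ⟨C, hC, fun p hp => by rw [norm_tw]; exact hb _ hp _⟩

/-- In finite dimension the operator norm is controlled by the values on a basis. The exponent `m +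
1` accounts for the parameter direction, the only one that raises the order. -/
lemma Sym.fderiv_bound (h : Sym α D m F) {K : Set ℂ} (hK : K ∈ D.fam) :
    ∃ C : ℝ, 0 ≤ C ∧ ∀ p : PV n, p.2.2 ∈ K →
      ‖fderiv ℝ (tw α F) p‖ ≤ C * bracket p.2.1 ^ (m + 1) := by
  let v := Module.finBasis ℝ (PV n)
  obtain ⟨C₀, hC₀, hop⟩ := v.exists_opNorm_le (F := A)
  choose C hC hb using fun i => (h.nab_any (v i)).tw_bound hK
  refine ⟨C₀ * ∑ i, C i, by have := Finset.sum_nonneg fun i (_ : i ∈ Finset.univ) => hC i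
                            positivity, fun p hp => ?_⟩
  rw [mul_assoc]
  have hB := bracket_rpow_pos p.2.1 (m + 1)
  refine hop (mul_nonneg (Finset.sum_nonneg fun i _ => hC i) hB.le) fun i => ?_
  rw [fderiv_tw_eq (D.sub K hK hp)]
  refine (hb i p hp).trans (mul_le_mul_of_nonneg_right ?_ hB.le)
  exact Finset.single_le_sum (fun i _ => hC i) (Finset.mem_univ i)

lemma ParamDomain.exists_closedBall (D : ParamDomain) {z : ℂ} (hz : z ∈ D.U) :
    ∃ r > 0, Metric.closedBall z r ∈ D.fam := by
  obtain ⟨r, hr, h⟩ := Metric.nhds_basis_closedBall.mem_iff.1 (D.isOpen.mem_nhds hz)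
  exact ⟨r, hr, D.compact_mem _ (isCompact_closedBall z r) h⟩

lemma ParamDomain.singleton_mem (D : ParamDomain) {z : ℂ} (hz : z ∈ D.U) : {z} ∈ D.fam :=
  D.compact_mem _ isCompact_singleton (by simpa using hz)

lemma one_add_norm_rpow_mul {E E' : Type*} [NormedAddCommGroup E] [NormedAddCommGroup E'] {x : E}
    {y : E'} {R r : ℝ} (hR : 0 ≤ R) (hr : 0 ≤ r) (h : ‖y‖ ≤ R * ‖x‖) :
    (1 + ‖y‖) ^ r ≤ (1 + R) ^ r * (1 + ‖x‖) ^ r := by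
  rw [← Real.mul_rpow (by positivity) (by positivity)]
  refine Real.rpow_le_rpow (by positivity) ?_ hr
  nlinarith [norm_nonneg x]

/-- Local bound for a symbol along a shifted line of arguments. -/
lemma bracket_shift_le (ξ₀ δ v : Eucl n) (hδ : ‖δ‖ ≤ 1) (m : ℝ) :
    bracket (ξ₀ + δ + v) ^ m ≤ bracket ξ₀ ^ m * 2 ^ |m| * (1 + ‖v‖) ^ |m| := by
  rw [add_assoc, mul_assoc, ← Real.mul_rpow (by norm_num) (by positivity)]
  refine (bracket_add_rpow_le _ _ _).trans
    (mul_le_mul_of_nonneg_left ?_ (bracket_rpow_pos _ _).le)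
  refine Real.rpow_le_rpow (by positivity) ?_ (abs_nonneg m)
  linarith [norm_add_le δ v, norm_nonneg v]

/-- Values and derivatives of a symbol near a point grow at most polynomially in the shift. -/
lemma Sym.local_bound (h : Sym α D m F) (ξ₀ : Eucl n) {K : Set ℂ} (hK : K ∈ D.fam) :
    ∃ C : ℝ, 0 ≤ C ∧ ∀ p : PV n, p.2.2 ∈ K → ∀ v : Eucl n, ‖p.2.1 - (ξ₀ + v)‖ ≤ 1 →
      ‖tw α F p‖ ≤ C * (1 + ‖v‖) ^ (|m| + 1) ∧
      ‖fderiv ℝ (tw α F) p‖ ≤ C * (1 + ‖v‖) ^ (|m| + 1) := by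
  obtain ⟨C₁, hC₁, hb₁⟩ := h.tw_bound hK
  obtain ⟨C₂, hC₂, hb₂⟩ := h.fderiv_bound hK
  have e1 : |m + 1| ≤ |m| + 1 := by simpa using abs_add_le m 1
  have key : ∀ m' : ℝ, |m'| ≤ |m| + 1 → ∀ p : PV n, ∀ v : Eucl n, ‖p.2.1 - (ξ₀ + v)‖ ≤ 1 →
      bracket p.2.1 ^ m' ≤ (bracket ξ₀ ^ m' * 2 ^ |m'|) * (1 + ‖v‖) ^ (|m| + 1) := by
    intro m' hm' p v hv
    have e : p.2.1 = ξ₀ + (p.2.1 - (ξ₀ + v)) + v := by abel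
    rw [e]
    refine (bracket_shift_le ξ₀ _ v hv m').trans (mul_le_mul_of_nonneg_left ?_ ?_)
    · exact Real.rpow_le_rpow_of_exponent_le (one_le_one_add_norm v) hm'
    · have := bracket_rpow_pos ξ₀ m'; positivity
  have p1 := bracket_rpow_pos ξ₀ m
  have p2 := bracket_rpow_pos ξ₀ (m + 1)
  refine ⟨C₁ * (bracket ξ₀ ^ m * 2 ^ |m|) + C₂ * (bracket ξ₀ ^ (m + 1) * 2 ^ |m + 1|),
    by positivity, fun p hp v hv => ⟨?_, ?_⟩⟩
  · refine (hb₁ p hp).trans ?_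
    have := mul_le_mul_of_nonneg_left (key m (by linarith) p v hv) hC₁
    have h2 : 0 ≤ C₂ * (bracket ξ₀ ^ (m + 1) * 2 ^ |m + 1|) * (1 + ‖v‖) ^ (|m| + 1) := by positivity
    linarith
  · refine (hb₂ p hp).trans ?_
    have := mul_le_mul_of_nonneg_left (key (m + 1) e1 p v hv) hC₂
    have h2 : 0 ≤ C₁ * (bracket ξ₀ ^ m * 2 ^ |m|) * (1 + ‖v‖) ^ (|m| + 1) := by positivity
    linarith

end SymBounds

/-! ### The phase-space integrals -/

section PhaseIntegral

variable {n : ℕ} {A : Type*} [CStarAlgebra A]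

/-- `x ↦ B x` as a continuous linear map. -/
def matVecL (B : Matrix (Fin n) (Fin n) ℝ) : Eucl n →L[ℝ] Eucl n :=
  LinearMap.toContinuousLinearMap
    { toFun := matVec B
      map_add' := fun x y => by ext i; simp [matVec, Matrix.mulVec_add]
      map_smul' := fun c x => by ext i; simp [matVec, Matrix.mulVec_smul] }

@[simp] lemma matVecL_apply (B : Matrix (Fin n) (Fin n) ℝ) (x : Eucl n) :
    matVecL B x = matVec B x := rfl

/-- `α_s` as a linear isometric equivalence. -/
def actE (α : CStarAction n A) (s : Eucl n) : A ≃ₗᵢ[ℝ] A where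
  toLinearEquiv :=
    { (actL α s).toLinearMap with
      invFun := α.act (-s)
      left_inv := fun a => act_neg_act α s a
      right_inv := fun a => by simpa using act_neg_act α (-s) a }
  norm_map' := fun a => norm_act α s a

@[simp] lemma actE_apply (α : CStarAction n A) (s : Eucl n) (a : A) : actE α s a = α.act s a := rfl

/-- Because `α_s` is a linear isometry, no integrability is required. -/
lemma act_integral {E : Type*} [MeasurableSpace E] {μ : Measure E} (α : CStarAction n A)
    (s : Eucl n) (f : E → A) : α.act s (∫ x, f x ∂μ) = ∫ x, α.act s (f x) ∂μ :=
  (LinearIsometry.integral_comp_comm (actE α s).toLinearIsometry f).symm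

/-- `e^{-i⟨y, η⟩}`. -/
def phase (x : Eucl n × Eucl n) : ℂ := Complex.exp (-(Complex.I * (inner ℝ x.1 x.2 : ℝ)))

/-- The shift `(0, tη, 0)`. -/
def covShift (t : ℝ) : Eucl n × Eucl n →L[ℝ] PV n :=
  (0 : Eucl n × Eucl n →L[ℝ] Eucl n).prod ((t • ContinuousLinearMap.snd ℝ _ _).prod 0)

/-- The shift `(-y, By, 0)`. -/
def actShift (B : Matrix (Fin n) (Fin n) ℝ) : Eucl n × Eucl n →L[ℝ] PV n :=
  (-ContinuousLinearMap.fst ℝ _ _).prod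
    (((matVecL B).comp (ContinuousLinearMap.fst ℝ _ _)).prod 0)

lemma covShift_apply (t : ℝ) (x : Eucl n × Eucl n) : covShift t x = (0, t • x.2, 0) := rfl

lemma actShift_apply (B : Matrix (Fin n) (Fin n) ℝ) (x : Eucl n × Eucl n) :
    actShift B x = (-x.1, matVec B x.1, 0) := rfl

/-- The amplitude `F(s, ξ + tη, z) G(s - y, ξ + By, z)` in terms of equivariant extensions. -/
def amp (α : CStarAction n A) (B : Matrix (Fin n) (Fin n) ℝ) (F G : Eucl n → ℂ → A) (p : PV n)
    (t : ℝ) (x : Eucl n × Eucl n) : A :=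
  tw α F (p + covShift t x) * tw α G (p + actShift B x)

/-- The weighted phase-space integral of the amplitude. -/
def J (α : CStarAction n A) (B : Matrix (Fin n) (Fin n) ℝ) (t : ℝ) (ψ : Eucl n × Eucl n → ℂ)
    (F G : Eucl n → ℂ → A) (p : PV n) : A :=
  ∫ x, (ψ x * phase x) • amp α B F G p t x

variable {α : CStarAction n A} {B : Matrix (Fin n) (Fin n) ℝ} {D : ParamDomain}
  {F G : Eucl n → ℂ → A} {m m' q : ℝ} {ψ : Eucl n × Eucl n → ℂ} {p : PV n} {t : ℝ} {I : Type*}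

@[simp] lemma norm_phase (x : Eucl n × Eucl n) : ‖phase x‖ = 1 := by
  rw [phase, Complex.norm_exp]; simp

lemma contDiff_phase : ContDiff ℝ ∞ (phase (n := n)) := by
  unfold phase
  have h : ContDiff ℝ ∞ fun x : Eucl n × Eucl n => ((inner ℝ x.1 x.2 : ℝ) : ℂ) :=
    Complex.ofRealCLM.contDiff.comp (contDiff_fst.inner ℝ contDiff_snd)
  exact (contDiff_const.mul h).neg.cexp

/-- The linear functional `(y, η) ↦ ⟨v₁, η⟩ + ⟨y, v₂⟩`. -/
def phaseLin (v : Eucl n × Eucl n) : Eucl n × Eucl n →L[ℝ] ℂ :=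
  Complex.ofRealCLM.comp ((innerSL ℝ v.1).comp (ContinuousLinearMap.snd ℝ _ _)
    + (innerSL ℝ v.2).comp (ContinuousLinearMap.fst ℝ _ _))

lemma phaseLin_apply (v x : Eucl n × Eucl n) :
    phaseLin v x = ((inner ℝ v.1 x.2 + inner ℝ v.2 x.1 : ℝ) : ℂ) := rfl

lemma fderiv_phase (v x : Eucl n × Eucl n) :
    fderiv ℝ phase x v = -Complex.I * (phaseLin v x * phase x) := by
  have h0 : HasFDerivAt (fun x : Eucl n × Eucl n => (inner ℝ x.1 x.2 : ℝ)) _ x :=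
    (hasFDerivAt_fst (𝕜 := ℝ) (p := x)).inner ℝ hasFDerivAt_snd
  have h1 := (((Complex.ofRealCLM.hasFDerivAt.comp x h0).const_mul Complex.I).neg).cexp
  have h2 : HasFDerivAt (phase (n := n)) _ x := h1
  rw [h2.fderiv]
  simp [phaseLin_apply, phase, fderivInnerCLM_apply, real_inner_comm]
  ring

instance isAddHaarMeasure_phase : (volume : Measure (Eucl n × Eucl n)).IsAddHaarMeasure := by
  rw [Measure.volume_eq_prod]
  infer_instance

lemma integrable_rpow_phase {r : ℝ} (hr : r < -(2 * n : ℝ)) :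
    Integrable fun x : Eucl n × Eucl n => (1 + ‖x‖) ^ r := by
  have h := integrable_one_add_norm (E := Eucl n × Eucl n) (μ := volume) (r := -r) (by
    simp
    linarith)
  simpa using h

/-- Peetre's inequality in each factor separates the powers of `⟨ξ⟩`, which keep the orders `m` and
`m'`, from the growth in the integration variable, which costs their absolute values. -/
lemma amp_bound (hF : Sym α D m F) (hG : Sym α D m' G) {K : Set ℂ} (hK : K ∈ D.fam) {R : ℝ}
    (hR : 0 ≤ R) : ∃ C : ℝ, 0 ≤ C ∧ ∀ p : PV n, p.2.2 ∈ K → ∀ t : ℝ, |t| ≤ R → ∀ x,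
      ‖amp α B F G p t x‖ ≤ C * bracket p.2.1 ^ (m + m') * (1 + ‖x‖) ^ (|m| + |m'|) := by
  obtain ⟨C, hC, hb⟩ := hF.tw_bound hK
  obtain ⟨C', hC', hb'⟩ := hG.tw_bound hK
  refine ⟨C * (1 + R) ^ |m| * (C' * (1 + ‖matVecL B‖) ^ |m'|), by positivity,
    fun p hp t ht x => ?_⟩
  have e1 : ‖tw α F (p + covShift t x)‖
      ≤ C * (bracket p.2.1 ^ m * ((1 + R) ^ |m| * (1 + ‖x‖) ^ |m|)) := by
    refine (hb _ (by simpa [covShift_apply] using hp)).trans (mul_le_mul_of_nonneg_left ?_ hC)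
    refine (bracket_add_rpow_le p.2.1 _ m).trans
      (mul_le_mul_of_nonneg_left ?_ (bracket_rpow_pos _ _).le)
    refine one_add_norm_rpow_mul hR (abs_nonneg _) ?_
    rw [covShift_apply]
    simp only [norm_smul, Real.norm_eq_abs]
    exact mul_le_mul ht (norm_snd_le x) (norm_nonneg _) hR
  have e2 : ‖tw α G (p + actShift B x)‖
      ≤ C' * (bracket p.2.1 ^ m' * ((1 + ‖matVecL B‖) ^ |m'| * (1 + ‖x‖) ^ |m'|)) := by
    refine (hb' _ (by simpa [actShift_apply] using hp)).trans (mul_le_mul_of_nonneg_left ?_ hC')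
    refine (bracket_add_rpow_le p.2.1 _ m').trans
      (mul_le_mul_of_nonneg_left ?_ (bracket_rpow_pos _ _).le)
    refine one_add_norm_rpow_mul (norm_nonneg _) (abs_nonneg _) ?_
    rw [actShift_apply]
    exact ((matVecL B).le_opNorm x.1).trans
      (mul_le_mul_of_nonneg_left (norm_fst_le x) (norm_nonneg _))
  refine (norm_mul_le _ _).trans ((mul_le_mul e1 e2 (norm_nonneg _) ?_).trans (le_of_eq ?_))
  · have := bracket_rpow_pos p.2.1 m; positivity
  · rw [Real.rpow_add (bracket_pos _), Real.rpow_add (by positivity)]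
    ring

lemma Sm.continuous_amp (hF : Sm α D.U F) (hG : Sm α D.U G) (hp : p ∈ dom n D.U) (t : ℝ) :
    Continuous (amp α B F G p t) := by
  refine (hF.continuous_comp (by fun_prop) fun x => ?_).mul
    (hG.continuous_comp (by fun_prop) fun x => ?_)
  · simpa [dom, covShift_apply] using hp
  · simpa [dom, actShift_apply] using hp

lemma Sm.continuous_integrand (hF : Sm α D.U F) (hG : Sm α D.U G) (hψ : ContDiff ℝ ∞ ψ)
    (hp : p ∈ dom n D.U) (t : ℝ) :
    Continuous fun x => (ψ x * phase x) • amp α B F G p t x :=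
  (hψ.continuous.mul contDiff_phase.continuous).smul (hF.continuous_amp hG hp t)

lemma integrand_bound {ψ : I → Eucl n × Eucl n → ℂ} (hψ : W q ψ) (hF : Sym α D m F)
    (hG : Sym α D m' G) {K : Set ℂ} (hK : K ∈ D.fam) {R : ℝ} (hR : 0 ≤ R) :
    ∃ C : ℝ, 0 ≤ C ∧ ∀ i, ∀ p : PV n, p.2.2 ∈ K → ∀ t : ℝ, |t| ≤ R → ∀ x,
      ‖(ψ i x * phase x) • amp α B F G p t x‖
        ≤ C * bracket p.2.1 ^ (m + m') * (1 + ‖x‖) ^ (q + (|m| + |m'|)) := by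
  obtain ⟨C, hC, hb⟩ := hψ.bound
  obtain ⟨C', hC', hb'⟩ := amp_bound (B := B) hF hG hK hR
  refine ⟨C * C', by positivity, fun i p hp t ht x => ?_⟩
  have hx : (0 : ℝ) < 1 + ‖x‖ := by positivity
  rw [norm_smul, norm_mul, norm_phase, mul_one, Real.rpow_add hx q]
  refine (mul_le_mul (hb i x) (hb' p hp t ht x) (norm_nonneg _) (by positivity)).trans
    (le_of_eq (by ring))

lemma J_bound {ψ : I → Eucl n × Eucl n → ℂ} (hψ : W q ψ) (hF : Sym α D m F)
    (hG : Sym α D m' G) (hq : q + (|m| + |m'|) < -(2 * n : ℝ)) {K : Set ℂ} (hK : K ∈ D.fam)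
    {R : ℝ} (hR : 0 ≤ R) :
    ∃ C : ℝ, 0 ≤ C ∧ ∀ i, ∀ p : PV n, p.2.2 ∈ K → ∀ t : ℝ, |t| ≤ R →
      ‖J α B t (ψ i) F G p‖ ≤ C * bracket p.2.1 ^ (m + m') := by
  obtain ⟨C, hC, hb⟩ := integrand_bound (B := B) hψ hF hG hK hR
  have hInt := integrable_rpow_phase hq
  refine ⟨C * ∫ x : Eucl n × Eucl n, (1 + ‖x‖) ^ (q + (|m| + |m'|)),
    mul_nonneg hC (integral_nonneg fun x => by positivity), fun i p hp t ht => ?_⟩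
  refine (norm_integral_le_of_norm_le (hInt.const_mul (C * bracket p.2.1 ^ (m + m')))
    (Filter.Eventually.of_forall (hb i p hp t ht))).trans (le_of_eq ?_)
  rw [integral_const_mul]
  ring

lemma J_integrable (hψ : W q fun _ : Unit => ψ) (hF : Sym α D m F)
    (hG : Sym α D m' G) (hq : q + (|m| + |m'|) < -(2 * n : ℝ)) (hp : p ∈ dom n D.U) (t : ℝ) :
    Integrable fun x => (ψ x * phase x) • amp α B F G p t x := by
  obtain ⟨C, hC, hb⟩ := integrand_bound (B := B) hψ hF hG (D.singleton_mem hp) (abs_nonneg t)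
  exact ((integrable_rpow_phase hq).const_mul (C * bracket p.2.1 ^ (m + m'))).mono'
    (hF.sm.continuous_integrand hG.sm (hψ.smooth ()) hp t).aestronglyMeasurable
    (Filter.Eventually.of_forall (hb () p rfl t le_rfl))

/-- Leibniz rule for the phase-space integral. -/
theorem J_hasFDerivAt (hψ : W q fun _ : Unit => ψ) (hF : Sym α D m F) (hG : Sym α D m' G)
    (hq : q + (|m| + |m'|) + 2 < -(2 * n : ℝ)) (hp : p ∈ dom n D.U) (t : ℝ) :
    ∃ L : PV n →L[ℝ] A, HasFDerivAt (J α B t ψ F G) L p ∧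
      ∀ v, L v = J α B t ψ (nab α D.U v F) G p + J α B t ψ F (nab α D.U v G) p := by
  obtain ⟨r, hr, hK⟩ := D.exists_closedBall hp
  obtain ⟨CF, hCF, hbF⟩ := hF.local_bound p.2.1 hK
  obtain ⟨CG, hCG, hbG⟩ := hG.local_bound p.2.1 hK
  obtain ⟨C, hC, hb⟩ := hψ.bound
  -- A derivative in an arbitrary direction may raise either order by one. The summand `2` in `hq`
  -- pays for both factors.
  have e1 : |m + 1| ≤ |m| + 1 := by simpa using abs_add_le m 1
  have e2 : |m' + 1| ≤ |m'| + 1 := by simpa using abs_add_le m' 1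
  have hpn : ∀ r : ℝ, ∀ x : Eucl n × Eucl n, 0 ≤ (1 + ‖x‖) ^ r := fun r x => by positivity
  have hB : ∀ x : Eucl n × Eucl n, ‖matVec B x.1‖ ≤ ‖matVecL B‖ * ‖x‖ := fun x =>
    ((matVecL B).le_opNorm x.1).trans (mul_le_mul_of_nonneg_left (norm_fst_le x) (norm_nonneg _))
  have ht : ∀ x : Eucl n × Eucl n, ‖t • x.2‖ ≤ |t| * ‖x‖ := fun x => by
    rw [norm_smul, Real.norm_eq_abs]
    exact mul_le_mul_of_nonneg_left (norm_snd_le x) (abs_nonneg _)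
  set S : Set (PV n) := {p' | p'.2.1 ∈ Metric.closedBall p.2.1 1 ∧
    p'.2.2 ∈ Metric.closedBall p.2.2 r} with hS
  have hSn : S ∈ 𝓝 p := by
    refine Filter.inter_mem ?_ ?_
    · exact (continuous_fst.comp continuous_snd).continuousAt.preimage_mem_nhds
        (Metric.closedBall_mem_nhds _ one_pos)
    · exact (continuous_snd.comp continuous_snd).continuousAt.preimage_mem_nhds
        (Metric.closedBall_mem_nhds _ hr)
  have hSF : ∀ p' ∈ S, ∀ x, (p' + covShift t x).2.2 ∈ Metric.closedBall p.2.2 r ∧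
      ‖(p' + covShift t x).2.1 - (p.2.1 + t • x.2)‖ ≤ 1 := by
    intro p' hp' x
    rw [covShift_apply]
    refine ⟨by simpa using hp'.2, ?_⟩
    simpa [dist_eq_norm] using hp'.1
  have hSG : ∀ p' ∈ S, ∀ x, (p' + actShift B x).2.2 ∈ Metric.closedBall p.2.2 r ∧
      ‖(p' + actShift B x).2.1 - (p.2.1 + matVec B x.1)‖ ≤ 1 := by
    intro p' hp' x
    rw [actShift_apply]
    refine ⟨by simpa using hp'.2, ?_⟩
    simpa [dist_eq_norm] using hp'.1
  have hF' : ∀ p' ∈ S, ∀ x, ‖tw α F (p' + covShift t x)‖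
        ≤ CF * ((1 + |t|) ^ (|m| + 1) * (1 + ‖x‖) ^ (|m| + 1)) ∧
      ‖fderiv ℝ (tw α F) (p' + covShift t x)‖
        ≤ CF * ((1 + |t|) ^ (|m| + 1) * (1 + ‖x‖) ^ (|m| + 1)) := by
    intro p' hp' x
    obtain ⟨h1, h2⟩ := hbF _ (hSF p' hp' x).1 _ (hSF p' hp' x).2
    have h3 := mul_le_mul_of_nonneg_left
      (one_add_norm_rpow_mul (abs_nonneg t) (by positivity : 0 ≤ |m| + 1) (ht x)) hCF
    exact ⟨h1.trans h3, h2.trans h3⟩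
  have hG' : ∀ p' ∈ S, ∀ x, ‖tw α G (p' + actShift B x)‖
        ≤ CG * ((1 + ‖matVecL B‖) ^ (|m'| + 1) * (1 + ‖x‖) ^ (|m'| + 1)) ∧
      ‖fderiv ℝ (tw α G) (p' + actShift B x)‖
        ≤ CG * ((1 + ‖matVecL B‖) ^ (|m'| + 1) * (1 + ‖x‖) ^ (|m'| + 1)) := by
    intro p' hp' x
    obtain ⟨h1, h2⟩ := hbG _ (hSG p' hp' x).1 _ (hSG p' hp' x).2
    have h3 := mul_le_mul_of_nonneg_left
      (one_add_norm_rpow_mul (norm_nonneg _) (by positivity : 0 ≤ |m'| + 1) (hB x)) hCG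
    exact ⟨h1.trans h3, h2.trans h3⟩
  have hcc : Continuous fun x => ψ x * phase x :=
    (hψ.smooth ()).continuous.mul contDiff_phase.continuous
  have hbc : ∀ x, ‖ψ x * phase x‖ ≤ C * (1 + ‖x‖) ^ q := fun x => by
    rw [norm_mul, norm_phase, mul_one]
    exact hb () x
  obtain ⟨L, hL, hLv⟩ := hasFDerivAt_integral_tw (μ := volume) D.isOpen hF.sm hG.sm
    (c := fun _ x => ψ x * phase x) (c' := fun _ _ => 0)
    (Λ₁ := ContinuousLinearMap.id ℝ (PV n)) (Λ₂ := ContinuousLinearMap.id ℝ (PV n))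
    (l₁ := covShift t) (l₂ := actShift B) (by fun_prop) (by fun_prop) hSn
    (fun p' hp' x => D.sub _ hK (hSF p' hp' x).1) (fun p' hp' x => D.sub _ hK (hSG p' hp' x).1)
    (fun p' _ x => hasFDerivAt_const _ _) (fun _ _ => hcc) (fun v => by simp; fun_prop)
    (fun _ _ x => hbc x) (fun _ _ x => by simpa using mul_nonneg hC (hpn q x))
    (fun p' hp' x => (hF' p' hp' x).1) (fun p' hp' x => (hF' p' hp' x).2)
    (fun p' hp' x => (hG' p' hp' x).1) (fun p' hp' x => (hG' p' hp' x).2) (by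
      have := (integrable_rpow_phase (n := n) hq).const_mul
        (C * (CF * (1 + |t|) ^ (|m| + 1) * (CG * (1 + ‖matVecL B‖) ^ (|m'| + 1))))
      refine this.congr (Filter.Eventually.of_forall fun x => ?_)
      have hx : (0 : ℝ) < 1 + ‖x‖ := by positivity
      have e : (1 + ‖x‖) ^ (q + (|m| + |m'|) + 2)
          = (1 + ‖x‖) ^ q * ((1 + ‖x‖) ^ (|m| + 1) * (1 + ‖x‖) ^ (|m'| + 1)) := by
        rw [← Real.rpow_add hx, ← Real.rpow_add hx]
        congr 1
        ring
      simp only [e]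
      ring)
  refine ⟨L, hL, fun v => ?_⟩
  rw [hLv v]
  simp only [zero_apply, zero_smul, zero_add, ContinuousLinearMap.id_apply]
  refine integral_add (J_integrable (m := m + 1) (m' := m') hψ (hF.nab_any v) hG ?_ hp t)
    (J_integrable (m := m) (m' := m' + 1) hψ hF (hG.nab_any v) ?_ hp t)
  · linarith
  · linarith

/-- The group parameter enters both shifts additively, so `α_s` factors out of the product and of
the integral. Thus `J` is itself an equivariant extension of its restriction to `s = 0`. -/
lemma J_act (s ξ : Eucl n) (z : ℂ) (t : ℝ) :
    J α B t ψ F G (s, ξ, z) = α.act s (J α B t ψ F G (0, ξ, z)) := by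
  rw [J, J, act_integral]
  congr 1
  funext x
  have e : ∀ (H : Eucl n → ℂ → A) (a : PV n), tw α H ((s, ξ, z) + a)
      = α.act s (tw α H ((0, ξ, z) + a)) := by
    intro H a
    rcases a with ⟨a, b, c⟩
    simp [← tw_add_left]
  simp [amp, e]

/-- Rapidly decreasing weights. -/
def Dec (ψ : Eucl n × Eucl n → ℂ) : Prop := ∀ k : ℕ, W (-(k : ℝ)) fun _ : Unit => ψ

lemma Dec.smooth (h : Dec ψ) : ContDiff ℝ ∞ ψ := (h 0).smooth ()

lemma Dec.dv (h : Dec ψ) (v : Eucl n × Eucl n) : Dec (dv v ψ) := fun k => (h k).dv v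

lemma Dec.mul_left (h : Dec ψ) {σ : Eucl n × Eucl n → ℂ} (hσ : W q fun _ : Unit => σ) :
    Dec fun x => σ x * ψ x := by
  intro k
  refine (hσ.mul (h (k + ⌈q⌉₊))).mono ?_
  push_cast
  linarith [Nat.le_ceil q]

lemma Dec.exists_W (h : Dec ψ) (r : ℝ) : W r fun _ : Unit => ψ := by
  refine (h ⌈-r⌉₊).mono ?_
  linarith [Nat.le_ceil (-r)]

lemma Dec.integrable (h : Dec ψ) (hF : Sym α D m F) (hG : Sym α D m' G) (hp : p ∈ dom n D.U)
    (t : ℝ) : Integrable fun x => (ψ x * phase x) • amp α B F G p t x :=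
  J_integrable (h.exists_W (-(|m| + |m'|) - 2 * n - 1)) hF hG (by linarith) hp t

/-- The variables separate: `η` occurs only in `F`, with the factor `t`, and `y` only in `G`,
through the twisted direction `(-y, By)`. -/
lemma hasLineDerivAt_amp (hF : Sm α D.U F) (hG : Sm α D.U G) (hp : p ∈ dom n D.U) (t : ℝ)
    (x v : Eucl n × Eucl n) : HasFDerivAt (amp α B F G p t) (fderiv ℝ (amp α B F G p t) x) x ∧
      fderiv ℝ (amp α B F G p t) x v = t • amp α B (nab α D.U (0, v.2, 0) F) G p t x
        + amp α B F (nab α D.U (-v.1, matVec B v.1, 0) G) p t x := by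
  have hp1 : p + covShift t x ∈ dom n D.U := by simpa [dom, covShift_apply] using hp
  have hp2 : p + actShift B x ∈ dom n D.U := by simpa [dom, actShift_apply] using hp
  have h1 := (hF.hasFDerivAt D.isOpen hp1).comp x ((covShift t).hasFDerivAt.const_add p)
  have h2 := (hG.hasFDerivAt D.isOpen hp2).comp x ((actShift B).hasFDerivAt.const_add p)
  have h3 : HasFDerivAt (amp α B F G p t) _ x := h1.mul' h2
  refine ⟨h3.differentiableAt.hasFDerivAt, ?_⟩
  have e : fderiv ℝ (tw α F) (p + covShift t x) (covShift t v)
      = t • tw α (nab α D.U (0, v.2, 0) F) (p + covShift t x) := by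
    have : covShift t v = t • ((0, v.2, 0) : PV n) := by simp [covShift_apply]
    rw [this, map_smul, fderiv_tw_eq hp1]
  rw [h3.fderiv]
  simp only [add_apply, smul_apply, ContinuousLinearMap.comp_apply, smul_eq_mul, op_smul_eq_mul, e,
    fderiv_tw_eq hp2, Function.comp_apply, actShift_apply B v, amp, smul_mul_assoc]
  rw [add_comm]

/-- Integration by parts in phase space. -/
theorem J_phaseLin (h : Dec ψ) (hF : Sym α D m F) (hG : Sym α D m' G) (hp : p ∈ dom n D.U)
    (t : ℝ) (v : Eucl n × Eucl n) :
    J α B t (fun x => phaseLin v x * ψ x) F G p = -Complex.I • (J α B t (dv v ψ) F G p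
      + t • J α B t ψ (nab α D.U (0, v.2, 0) F) G p
      + J α B t ψ F (nab α D.U (-v.1, matVec B v.1, 0) G) p) := by
  have hF' := hF.nab_space 0 v.2
  have hG' := hG.nab_space (-v.1) (matVec B v.1)
  have i0 := h.integrable (B := B) hF hG hp t
  have i1 := (h.mul_left (W_linear (I := Unit) (phaseLin v))).integrable (B := B) hF hG hp t
  have i2 := (h.dv v).integrable (B := B) hF hG hp t
  have i3 := (h.integrable (B := B) hF' hG hp t).smul t
  have i4 := h.integrable (B := B) hF hG' hp t
  set f : Eucl n × Eucl n → A := fun x => (ψ x * phase x) • amp α B F G p t x with hf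
  set f' : Eucl n × Eucl n → A := fun x =>
    ((dv v ψ x * phase x) • amp α B F G p t x
      + t • ((ψ x * phase x) • amp α B (nab α D.U (0, v.2, 0) F) G p t x)
      + (ψ x * phase x) • amp α B F (nab α D.U (-v.1, matVec B v.1, 0) G) p t x)
      + (-Complex.I) • ((phaseLin v x * ψ x * phase x) • amp α B F G p t x) with hf'
  have hi' : Integrable f' := ((i2.add i3).add i4).add (i1.smul (-Complex.I))
  have hderiv : ∀ x, HasLineDerivAt ℝ f (f' x) x v := by
    intro x
    obtain ⟨ha, hav⟩ := hasLineDerivAt_amp (B := B) hF.sm hG.sm hp t x v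
    have h1 : HasFDerivAt ψ (fderiv ℝ ψ x) x :=
      (h.smooth.differentiable (by simp) x).hasFDerivAt
    have h2 : HasFDerivAt phase (fderiv ℝ phase x) x :=
      (contDiff_phase.differentiable (by simp) x).hasFDerivAt
    have h3 := ((h1.mul h2).smul ha).hasLineDerivAt v
    have e1 : f' x = ((ψ x * phase x) • fderiv ℝ (amp α B F G p t) x
        + (ψ x • fderiv ℝ phase x + phase x • fderiv ℝ ψ x).smulRight (amp α B F G p t x)) v := by
      simp only [add_apply, smul_apply, ContinuousLinearMap.smulRight_apply, hav, fderiv_phase,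
        smul_eq_mul, hf', dv]
      simp only [smul_add, add_smul, smul_smul, smul_comm t]
      rw [show ψ x * (-Complex.I * (phaseLin v x * phase x))
        = -Complex.I * (phaseLin v x * ψ x * phase x) by ring, mul_comm (phase x)]
      abel
    rw [e1]
    exact h3
  -- Pairing with the constant function `1` says that the line derivative `f'` of `f` has integral
  -- zero. Expanding `f'` by the product rule gives the identity.
  have key := integral_bilinear_hasLineDerivAt_right_eq_neg_left_of_integrable (μ := volume)
    (f := f) (f' := f') (g := fun _ => (1 : ℝ)) (g' := fun _ => 0) (v := v)
    (B := (ContinuousLinearMap.lsmul ℝ ℝ : ℝ →L[ℝ] A →L[ℝ] A).flip) (by simpa using hi')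
    (by simp) (by simpa using i0) (fun x _ => hderiv x)
    (fun x _ => (hasFDerivAt_const (1 : ℝ) x).hasLineDerivAt v)
  simp only [ContinuousLinearMap.flip_apply, ContinuousLinearMap.lsmul_apply, zero_smul, one_smul,
    integral_zero] at key
  have key2 : ∫ x, f' x = 0 := by rw [← neg_eq_zero]; exact key.symm
  have e : ∫ x, f' x = (J α B t (dv v ψ) F G p
      + t • J α B t ψ (nab α D.U (0, v.2, 0) F) G p
      + J α B t ψ F (nab α D.U (-v.1, matVec B v.1, 0) G) p)
      + (-Complex.I) • J α B t (fun x => phaseLin v x * ψ x) F G p := by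
    refine (integral_add ((i2.add i3).add i4) (i1.smul (-Complex.I))).trans ?_
    exact congrArg₂ (· + ·) ((integral_add (i2.add i3) i4).trans (congrArg₂ (· + ·)
      ((integral_add i2 i3).trans (congrArg₂ (· + ·) rfl (integral_smul _ _))) rfl))
      (integral_smul _ _)
  rw [key2] at e
  have e2 : Complex.I • J α B t (fun x => phaseLin v x * ψ x) F G p = (J α B t (dv v ψ) F G p
      + t • J α B t ψ (nab α D.U (0, v.2, 0) F) G p
      + J α B t ψ F (nab α D.U (-v.1, matVec B v.1, 0) G) p) := by
    rw [neg_smul, ← sub_eq_add_neg] at e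
    exact (sub_eq_zero.1 e.symm).symm
  rw [← e2, smul_smul]
  simp

end PhaseIntegral

/-! ### Regularization by partial integration -/

section Osc

variable {n : ℕ} {A : Type*} [CStarAlgebra A]

/-- The coordinate vectors of phase space. -/
def bv : Fin n ⊕ Fin n → Eucl n × Eucl n
  | .inl j => (EuclideanSpace.single j 1, 0)
  | .inr j => (0, EuclideanSpace.single j 1)

/-- The weight `x_b (1 + |x|²)⁻¹`, where `x_b` is the coordinate conjugate to `bv b`. -/
def kap (b : Fin n ⊕ Fin n) (x : Eucl n × Eucl n) : ℂ := phaseLin (bv b) x * rho x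

lemma contDiff_kap (b : Fin n ⊕ Fin n) : ContDiff ℝ ∞ (kap b) :=
  (phaseLin (bv b)).contDiff.mul contDiff_rho

lemma W_kap {I : Type*} (b : Fin n ⊕ Fin n) : W (-1) fun _ : I => kap b :=
  ((W_linear (phaseLin (bv b))).mul W_rho).mono (by norm_num)

lemma quad_eq_sum (x : Eucl n × Eucl n) :
    (quad x : ℂ) = 1 + ∑ b, phaseLin (bv b) x * phaseLin (bv b) x := by
  have h : ∀ y : Eucl n, ‖y‖ ^ 2 = ∑ j, y j * y j := by
    intro y
    rw [EuclideanSpace.norm_eq, Real.sq_sqrt (Finset.sum_nonneg fun i _ => sq_nonneg _)]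
    exact Finset.sum_congr rfl fun i _ => by rw [Real.norm_eq_abs, sq_abs]; ring
  rw [quad, h, h, Fintype.sum_sum_type]
  simp only [phaseLin_apply, bv]
  push_cast
  simp [EuclideanSpace.inner_single_left]
  ring

/-- The weight splits into a part multiplied by `rho`, which already decays better, and parts with a
factor `x_b`, which a partial integration against the phase removes, leaving the decay of `kap b`.
-/
lemma rho_partition (x : Eucl n × Eucl n) :
    rho x + ∑ b, phaseLin (bv b) x * kap b x = 1 := by
  have h0 : (quad x : ℂ) ≠ 0 := by exact_mod_cast (quad_pos x).ne'
  have h : rho x + ∑ b, phaseLin (bv b) x * kap b x = quad x * rho x := by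
    rw [quad_eq_sum, add_mul, one_mul, Finset.sum_mul]
    simp only [kap, mul_assoc]
  rw [h, rho, Complex.ofReal_inv, mul_inv_cancel₀ h0]

/-- One partial integration, which improves the decay of the weight by one order. -/
def oscStep (α : CStarAction n A) (B : Matrix (Fin n) (Fin n) ℝ) (U : Set ℂ) (t : ℝ)
    (Φ : (Eucl n × Eucl n → ℂ) → (Eucl n → ℂ → A) → (Eucl n → ℂ → A) → PV n → A)
    (ψ : Eucl n × Eucl n → ℂ) (F G : Eucl n → ℂ → A) (p : PV n) : A :=
  Φ (fun x => rho x * ψ x) F G p - Complex.I • ∑ b : Fin n ⊕ Fin n,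
    (Φ (dv (bv b) fun x => kap b x * ψ x) F G p
      + t • Φ (fun x => kap b x * ψ x) (nab α U (0, (bv b).2, 0) F) G p
      + Φ (fun x => kap b x * ψ x) F (nab α U (-(bv b).1, matVec B (bv b).1, 0) G) p)

/-- The phase-space integral after `M` partial integrations. -/
def osc (α : CStarAction n A) (B : Matrix (Fin n) (Fin n) ℝ) (U : Set ℂ) (t : ℝ) :
    ℕ → (Eucl n × Eucl n → ℂ) → (Eucl n → ℂ → A) → (Eucl n → ℂ → A) → PV n → A
  | 0 => J α B t
  | M + 1 => oscStep α B U t (osc α B U t M)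

variable {α : CStarAction n A} {B : Matrix (Fin n) (Fin n) ℝ} {D : ParamDomain}
  {F G : Eucl n → ℂ → A} {m m' q : ℝ} {ψ : Eucl n × Eucl n → ℂ} {p : PV n} {t : ℝ} {I : Type*}

/-- Insert `rho_partition` into the weight and apply `J_phaseLin` with the weight `κ_b ψ` to each
term carrying a factor `x_b`. Rapid decay justifies all the splittings. -/
lemma oscStep_J (h : Dec ψ) (hF : Sym α D m F) (hG : Sym α D m' G) (hp : p ∈ dom n D.U) (t : ℝ) :
    oscStep α B D.U t (J α B t) ψ F G p = J α B t ψ F G p := by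
  have hk : ∀ b : Fin n ⊕ Fin n, Dec fun x => kap b x * ψ x := fun b => h.mul_left (W_kap b)
  have e : J α B t ψ F G p = J α B t (fun x => rho x * ψ x) F G p
      + ∑ b, J α B t (fun x => phaseLin (bv b) x * (kap b x * ψ x)) F G p := by
    simp only [J]
    rw [← integral_finsetSum _ fun b _ =>
        ((hk b).mul_left (W_linear (I := Unit) (phaseLin (bv b)))).integrable (B := B) hF hG hp t,
      ← integral_add ((h.mul_left (W_rho (I := Unit))).integrable (B := B) hF hG hp t)
        (integrable_finsetSum _ fun b _ =>
        ((hk b).mul_left (W_linear (I := Unit) (phaseLin (bv b)))).integrable (B := B) hF hG hp t)]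
    congr 1
    funext x
    rw [← Finset.sum_smul, ← add_smul, ← Finset.sum_mul, ← add_mul]
    congr 2
    calc ψ x = 1 * ψ x := (one_mul _).symm
      _ = _ := by
        rw [← rho_partition x, add_mul, Finset.sum_mul]
        simp only [mul_assoc]
  rw [e, oscStep, Finset.smul_sum, sub_eq_add_neg, ← Finset.sum_neg_distrib]
  congr 1
  refine Finset.sum_congr rfl fun b _ => ?_
  rw [J_phaseLin (hk b) hF hG hp t (bv b), neg_smul]

/-- For rapidly decreasing weights the partial integrations change nothing. For weights such as the
constant `1`, `osc` with large `M` serves as the regularized value, and this lemma links it to the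
cutoff integrals. -/
lemma osc_eq_J (M : ℕ) (h : Dec ψ) (hF : Sym α D m F) (hG : Sym α D m' G) (hp : p ∈ dom n D.U)
    (t : ℝ) : osc α B D.U t M ψ F G p = J α B t ψ F G p := by
  induction M generalizing ψ F G with
  | zero => rfl
  | succ M ih =>
    rw [← oscStep_J h hF hG hp t, osc, oscStep, oscStep]
    have hk : ∀ b : Fin n ⊕ Fin n, Dec fun x => kap b x * ψ x := fun b => h.mul_left (W_kap b)
    rw [ih (h.mul_left (W_rho (I := Unit))) hF hG]
    congr 2
    refine Finset.sum_congr rfl fun b _ => ?_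
    rw [ih ((hk b).dv _) hF hG, ih (hk b) (hF.nab_space _ _) hG, ih (hk b) hF (hG.nab_space _ _)]

lemma W.rho_mul {ψ : I → Eucl n × Eucl n → ℂ} (h : W q ψ) :
    W (q - 1) fun i x => rho x * ψ i x := (W_rho.mul h).mono (by linarith)

lemma W.kap_mul {ψ : I → Eucl n × Eucl n → ℂ} (h : W q ψ) (b : Fin n ⊕ Fin n) :
    W (q - 1) fun i x => kap b x * ψ i x := ((W_kap b).mul h).mono (by linarith)

/-- Uniform estimate of the regularized integrals. -/
theorem osc_bound (M : ℕ) {ψ : I → Eucl n × Eucl n → ℂ} (hψ : W q ψ) (hF : Sym α D m F)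
    (hG : Sym α D m' G) (hq : q - M + (|m| + |m'|) < -(2 * n : ℝ)) {K : Set ℂ} (hK : K ∈ D.fam)
    {R : ℝ} (hR : 0 ≤ R) :
    ∃ C : ℝ, 0 ≤ C ∧ ∀ i, ∀ p : PV n, p.2.2 ∈ K → ∀ t : ℝ, |t| ≤ R →
      ‖osc α B D.U t M (ψ i) F G p‖ ≤ C * bracket p.2.1 ^ (m + m') := by
  induction M generalizing ψ F G q with
  | zero => exact J_bound hψ hF hG (by simpa using hq) hK hR
  | succ M ih =>
    -- Each step trades one unit of `M` for one unit of decay. The orders `m` and `m'` are unchanged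
    -- because `oscStep` differentiates the symbols only along the action and the covariable.
    have hq' : q - 1 - M + (|m| + |m'|) < -(2 * n : ℝ) := by push_cast at hq; linarith
    obtain ⟨C₀, hC₀, h₀⟩ := ih hψ.rho_mul hF hG hq'
    choose C₁ hC₁ h₁ using fun b => ih ((hψ.kap_mul b).dv (bv b)) hF hG hq'
    choose C₂ hC₂ h₂ using fun b => ih (hψ.kap_mul b) (hF.nab_space 0 (bv b).2) hG hq'
    choose C₃ hC₃ h₃ using fun b =>
      ih (hψ.kap_mul b) hF (hG.nab_space (-(bv b).1) (matVec B (bv b).1)) hq'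
    have hsum : 0 ≤ ∑ b, (C₁ b + R * C₂ b + C₃ b) := Finset.sum_nonneg fun b _ => by
      have := hC₁ b; have := hC₂ b; have := hC₃ b; positivity
    refine ⟨C₀ + ∑ b, (C₁ b + R * C₂ b + C₃ b), by positivity, fun i p hp t ht => ?_⟩
    have hB := bracket_rpow_pos p.2.1 (m + m')
    rw [osc, oscStep, add_mul, Finset.sum_mul]
    refine (norm_sub_le _ _).trans (add_le_add (h₀ i p hp t ht) ?_)
    rw [norm_smul, Complex.norm_I, one_mul]
    refine norm_sum_le_of_le _ fun b _ => ?_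
    have e2 : ‖t • osc α B D.U t M (fun x => kap b x * ψ i x) (nab α D.U (0, (bv b).2, 0) F) G p‖
        ≤ R * (C₂ b * bracket p.2.1 ^ (m + m')) := by
      rw [norm_smul, Real.norm_eq_abs]
      exact mul_le_mul ht (h₂ b i p hp t ht) (norm_nonneg _) hR
    refine (norm_add_le_of_le (norm_add_le_of_le (h₁ b i p hp t ht) e2)
      (h₃ b i p hp t ht)).trans (le_of_eq (by ring))

/-- Leibniz rule for the regularized integrals. -/
theorem osc_hasFDerivAt (M : ℕ) (hψ : W q fun _ : Unit => ψ) (hF : Sym α D m F)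
    (hG : Sym α D m' G) (hq : q - M + (|m| + |m'|) + 2 < -(2 * n : ℝ)) (hp : p ∈ dom n D.U)
    (t : ℝ) : ∃ L : PV n →L[ℝ] A, HasFDerivAt (osc α B D.U t M ψ F G) L p ∧
      ∀ v, L v = osc α B D.U t M ψ (nab α D.U v F) G p
        + osc α B D.U t M ψ F (nab α D.U v G) p := by
  induction M generalizing ψ F G q with
  | zero => exact J_hasFDerivAt hψ hF hG (by simpa using hq) hp t
  | succ M ih =>
    have hq' : q - 1 - M + (|m| + |m'|) + 2 < -(2 * n : ℝ) := by push_cast at hq; linarith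
    obtain ⟨L₀, hL₀, h₀⟩ := ih hψ.rho_mul hF hG hq'
    choose L₁ hL₁ h₁ using fun b => ih ((hψ.kap_mul b).dv (bv b)) hF hG hq'
    choose L₂ hL₂ h₂ using fun b => ih (hψ.kap_mul b) (hF.nab_space 0 (bv b).2) hG hq'
    choose L₃ hL₃ h₃ using fun b =>
      ih (hψ.kap_mul b) hF (hG.nab_space (-(bv b).1) (matVec B (bv b).1)) hq'
    refine ⟨L₀ - Complex.I • ∑ b, (L₁ b + t • L₂ b + L₃ b), ?_, fun v => ?_⟩
    · exact hL₀.sub ((HasFDerivAt.fun_sum fun b _ =>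
        ((hL₁ b).add ((hL₂ b).const_smul t)).add (hL₃ b)).const_smul Complex.I)
    · have e : (L₀ - Complex.I • ∑ b, (L₁ b + t • L₂ b + L₃ b)) v
          = L₀ v - Complex.I • ∑ b, (L₁ b v + t • L₂ b v + L₃ b v) := by simp
      rw [e, osc, oscStep, oscStep, h₀]
      simp only [h₁, h₂, h₃, nab_comm D.isOpen hF.sm v, nab_comm D.isOpen hG.sm v]
      rw [sub_add_sub_comm, ← smul_add, ← Finset.sum_add_distrib]
      congr 2
      refine Finset.sum_congr rfl fun b _ => ?_
      rw [smul_add]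
      abel

/-- Continuity of the regularized integrals with respect to the weight. -/
theorem osc_tendsto (M : ℕ) {l : Filter I} [l.IsCountablyGenerated]
    {ψ : I → Eucl n × Eucl n → ℂ} {κ : Eucl n × Eucl n → ℂ} (hψ : WConv l q ψ κ)
    (hF : Sym α D m F) (hG : Sym α D m' G) (hq : q - M + (|m| + |m'|) < -(2 * n : ℝ))
    (hp : p ∈ dom n D.U) (t : ℝ) :
    Filter.Tendsto (fun i => osc α B D.U t M (ψ i) F G p) l (𝓝 (osc α B D.U t M κ F G p)) := by
  induction M generalizing ψ κ F G q with
  | zero =>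
    obtain ⟨C, hC, hb⟩ := integrand_bound (B := B) hψ.w hF hG (D.singleton_mem hp) (abs_nonneg t)
    refine tendsto_integral_filter_of_dominated_convergence
      (fun x => C * bracket p.2.1 ^ (m + m') * (1 + ‖x‖) ^ (q + (|m| + |m'|))) ?_ ?_ ?_ ?_
    · exact Filter.Eventually.of_forall fun i =>
        (hF.sm.continuous_integrand hG.sm (hψ.w.smooth i) hp t).aestronglyMeasurable
    · exact Filter.Eventually.of_forall fun i => Filter.Eventually.of_forall (hb i p rfl t le_rfl)
    · exact (integrable_rpow_phase (by simpa using hq)).const_mul _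
    · exact Filter.Eventually.of_forall fun x => ((hψ.lim [] x).mul_const _).smul_const _
  | succ M ih =>
    have hq' : q - 1 - M + (|m| + |m'|) < -(2 * n : ℝ) := by push_cast at hq; linarith
    have hρ := (hψ.mul_left W_rho contDiff_rho).mono (show -2 + q ≤ q - 1 by linarith)
    have hk := fun b : Fin n ⊕ Fin n => (hψ.mul_left (W_kap b) (contDiff_kap b)).mono
      (show -1 + q ≤ q - 1 by linarith)
    refine (ih hρ hF hG hq').sub ((tendsto_finsetSum _ fun b _ => ?_).const_smul _)
    exact ((ih ((hk b).dv (bv b)) hF hG hq').add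
      ((ih (hk b) (hF.nab_space 0 (bv b).2) hG hq').const_smul t)).add
      (ih (hk b) hF (hG.nab_space (-(bv b).1) (matVec B (bv b).1)) hq')

lemma osc_act (M : ℕ) (U : Set ℂ) (s ξ : Eucl n) (z : ℂ) (t : ℝ) :
    osc α B U t M ψ F G (s, ξ, z) = α.act s (osc α B U t M ψ F G (0, ξ, z)) := by
  induction M generalizing ψ F G with
  | zero => exact J_act s ξ z t
  | succ M ih =>
    have h2 : ∀ (c : ℝ) (a : A), α.act s (c • a) = c • α.act s a := fun c a =>
      map_smul (actL α s) c a
    simp only [osc, oscStep]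
    rw [ih]
    simp only [ih (ψ := dv _ _), ih (ψ := fun x => kap _ x * _)]
    simp only [map_sub, map_smul, map_sum, map_add, h2]

lemma amp_smul_left (c : ℂ) (x : Eucl n × Eucl n) :
    amp α B (fun ξ z => c • F ξ z) G p t x = c • amp α B F G p t x := by
  simp [amp, tw_smul]

lemma amp_smul_right (c : ℂ) (x : Eucl n × Eucl n) :
    amp α B F (fun ξ z => c • G ξ z) p t x = c • amp α B F G p t x := by
  simp [amp, tw_smul]

lemma osc_smul_left (M : ℕ) (hF : Sm α D.U F) (c : ℂ) :
    osc α B D.U t M ψ (fun ξ z => c • F ξ z) G p = c • osc α B D.U t M ψ F G p := by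
  induction M generalizing ψ F G with
  | zero =>
    simp only [osc, J, amp_smul_left]
    rw [← integral_smul]
    simp only [smul_comm c]
  | succ M ih =>
    simp only [osc, oscStep]
    simp only [nab_smul D.isOpen hF]
    simp only [ih hF, ih (hF.nab D.isOpen _)]
    simp only [smul_sub, Finset.smul_sum, smul_add, smul_comm c]

lemma osc_smul_right (M : ℕ) (hG : Sm α D.U G) (c : ℂ) :
    osc α B D.U t M ψ F (fun ξ z => c • G ξ z) p = c • osc α B D.U t M ψ F G p := by
  induction M generalizing ψ F G with
  | zero =>
    simp only [osc, J, amp_smul_right]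
    rw [← integral_smul]
    simp only [smul_comm c]
  | succ M ih =>
    simp only [osc, oscStep]
    simp only [nab_smul D.isOpen hG]
    simp only [ih hG, ih (hG.nab D.isOpen _)]
    simp only [smul_sub, Finset.smul_sum, smul_add, smul_comm c]

end Osc

/-! ### Multi-indices and words -/

section FoldIter

variable {n : ℕ} {S T : Type*}

/-- `D_1^{γ_1} ⋯ D_n^{γ_n} a`. -/
def foldIter (D : Fin n → S → S) (γ : Fin n → ℕ) (a : S) : S :=
  (List.finRange n).foldr (fun j G => (D j)^[γ j] G) a

lemma iterate_invariant {P : S → Prop} {D : S → S} (hP : ∀ a, P a → P (D a)) (k : ℕ) {a : S}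
    (ha : P a) : P (D^[k] a) := by
  induction k with
  | zero => exact ha
  | succ k ih => rw [Function.iterate_succ_apply']; exact hP _ ih

lemma foldr_invariant {P : S → Prop} {D : Fin n → S → S} (hP : ∀ j a, P a → P (D j a))
    (γ : Fin n → ℕ) (l : List (Fin n)) {a : S} (ha : P a) :
    P (l.foldr (fun j G => (D j)^[γ j] G) a) := by
  induction l with
  | nil => exact ha
  | cons j l ih => exact iterate_invariant (hP j) _ ih

lemma foldIter_invariant {P : S → Prop} {D : Fin n → S → S} (hP : ∀ j a, P a → P (D j a))
    (γ : Fin n → ℕ) {a : S} (ha : P a) : P (foldIter D γ a) := foldr_invariant hP γ _ ha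

lemma iterate_semiconj {P : S → Prop} {D : S → S} {D' : T → T} {φ : S → T}
    (hP : ∀ a, P a → P (D a)) (hφ : ∀ a, P a → φ (D a) = D' (φ a)) (k : ℕ) {a : S} (ha : P a) :
    φ (D^[k] a) = D'^[k] (φ a) := by
  induction k with
  | zero => rfl
  | succ k ih =>
    rw [Function.iterate_succ_apply', Function.iterate_succ_apply', ← ih,
      hφ _ (iterate_invariant hP k ha)]

lemma foldr_semiconj {P : S → Prop} {D : Fin n → S → S} {D' : Fin n → T → T} {φ : S → T}
    (hP : ∀ j a, P a → P (D j a)) (hφ : ∀ j a, P a → φ (D j a) = D' j (φ a)) (γ : Fin n → ℕ)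
    (l : List (Fin n)) {a : S} (ha : P a) :
    φ (l.foldr (fun j G => (D j)^[γ j] G) a) = l.foldr (fun j G => (D' j)^[γ j] G) (φ a) := by
  induction l with
  | nil => rfl
  | cons j l ih =>
    rw [List.foldr_cons, List.foldr_cons, ← ih]
    exact iterate_semiconj (hP j) (hφ j) _ (foldr_invariant hP γ l ha)

/-- Lifts an intertwining relation for single operators, valid on a stable domain `P` such as the
smooth families, to all multi-indices. -/
lemma foldIter_semiconj {P : S → Prop} {D : Fin n → S → S} {D' : Fin n → T → T} {φ : S → T}
    (hP : ∀ j a, P a → P (D j a)) (hφ : ∀ j a, P a → φ (D j a) = D' j (φ a)) (γ : Fin n → ℕ)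
    {a : S} (ha : P a) : φ (foldIter D γ a) = foldIter D' γ (φ a) :=
  foldr_semiconj hP hφ γ _ ha

lemma foldIter_zero (D : Fin n → S → S) (a : S) : foldIter D 0 a = a := by
  unfold foldIter
  induction List.finRange n with
  | nil => rfl
  | cons j l ih => simp

lemma foldr_congr_multi (D : Fin n → S → S) {γ γ' : Fin n → ℕ} (l : List (Fin n))
    (h : ∀ j ∈ l, γ j = γ' j) (a : S) :
    l.foldr (fun j G => (D j)^[γ j] G) a = l.foldr (fun j G => (D j)^[γ' j] G) a := by
  induction l with
  | nil => rfl
  | cons j l ih =>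
    rw [List.foldr_cons, List.foldr_cons, ih fun j hj => h j (List.mem_cons_of_mem _ hj),
      h j List.mem_cons_self]

/-- The operators are applied in a fixed order, so a new factor `D_j` must be commuted past those in
front until it reaches its own block. -/
lemma foldr_succ_multi {P : S → Prop} {D : Fin n → S → S} (hP : ∀ j a, P a → P (D j a))
    (hcomm : ∀ i j a, P a → D i (D j a) = D j (D i a)) (γ : Fin n → ℕ) (j : Fin n)
    (l : List (Fin n)) (hl : l.Nodup) (hj : j ∈ l) {a : S} (ha : P a) :
    D j (l.foldr (fun j G => (D j)^[γ j] G) a)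
      = l.foldr (fun i G => (D i)^[(γ + Pi.single j 1 : Fin n → ℕ) i] G) a := by
  induction l with
  | nil => simp at hj
  | cons i l ih =>
    rw [List.foldr_cons, List.foldr_cons]
    rw [List.nodup_cons] at hl
    by_cases hij : i = j
    · subst hij
      rw [foldr_congr_multi D l (γ := γ + Pi.single i 1) (γ' := γ) (fun k hk => by
        have : k ≠ i := fun h => hl.1 (h ▸ hk)
        simp [this])]
      simp only [Pi.add_apply, Pi.single_eq_same]
      rw [Function.iterate_succ_apply']
    · have hj' : j ∈ l := by
        rcases List.mem_cons.1 hj with h | h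
        · exact absurd h.symm hij
        · exact h
      have e : (γ + Pi.single j 1 : Fin n → ℕ) i = γ i := by simp [hij]
      rw [e, ← ih hl.2 hj']
      exact iterate_semiconj (hP i) (fun a ha => hcomm j i a ha) _ (foldr_invariant hP γ l ha)

/-- Raising a multi-index by one, for commuting operators. -/
lemma foldIter_apply {P : S → Prop} {D : Fin n → S → S} (hP : ∀ j a, P a → P (D j a))
    (hcomm : ∀ i j a, P a → D i (D j a) = D j (D i a)) (γ : Fin n → ℕ) (j : Fin n) {a : S}
    (ha : P a) : foldIter D γ (D j a) = foldIter D (γ + Pi.single j 1) a := by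
  have h := foldr_succ_multi hP hcomm γ j _ (List.nodup_finRange n) (List.mem_finRange j) ha
  exact (foldr_semiconj (φ := D j) hP (fun i a ha => hcomm j i a ha) γ _ ha).symm.trans h

lemma len_add_single (γ : Fin n → ℕ) (j : Fin n) : len (γ + Pi.single j 1) = len γ + 1 := by
  simp [len, Finset.sum_add_distrib]

@[simp] lemma len_zero : len (0 : Fin n → ℕ) = 0 := by simp [len]

/-- Induction on multi-indices by raising one entry. -/
lemma multi_induction {P : (Fin n → ℕ) → Prop} (h0 : P 0)
    (hs : ∀ γ j, P γ → P (γ + Pi.single j 1)) : ∀ γ, P γ := by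
  have key : ∀ k γ, len γ = k → P γ := by
    intro k
    induction k with
    | zero =>
      intro γ hγ
      have : γ = 0 := by
        funext i
        exact (Finset.sum_eq_zero_iff.1 hγ) i (Finset.mem_univ i)
      exact this ▸ h0
    | succ k ih =>
      intro γ hγ
      obtain ⟨j, hj⟩ : ∃ j, γ j ≠ 0 := by
        by_contra h
        push Not at h
        simp [len, h] at hγ
      have e : γ = (γ - Pi.single j 1) + Pi.single j 1 := by
        funext i
        by_cases hi : i = j
        · subst hi; simp; omega
        · simp [hi]
      rw [e] at hγ ⊢
      exact hs _ _ (ih _ (by rw [len_add_single] at hγ; omega))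
  exact fun γ => key _ γ rfl

end FoldIter

/-! ### Multi-index derivatives of the equivariant extension -/

section MultiNab

variable {n : ℕ} {A : Type*} [CStarAlgebra A]

/-- Iterated derivatives along a tuple of vectors. -/
def mnab (α : CStarAction n A) (U : Set ℂ) (v : Fin n → PV n) (γ : Fin n → ℕ)
    (F : Eucl n → ℂ → A) : Eucl n → ℂ → A := foldIter (fun j => nab α U (v j)) γ F

/-- The vectors `(e_j, 0, 0)`. -/
def actVec (j : Fin n) : PV n := (EuclideanSpace.single j 1, 0, 0)

/-- The vectors `(0, e_j, 0)`. -/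
def covVec (j : Fin n) : PV n := (0, EuclideanSpace.single j 1, 0)

/-- The vectors `(0, B e_j, 0)`. -/
def matCovVec (B : Matrix (Fin n) (Fin n) ℝ) (j : Fin n) : PV n :=
  (0, matVec B (EuclideanSpace.single j 1), 0)

/-- The vectors `(-e_j, B e_j, 0)`. -/
def twistVec (B : Matrix (Fin n) (Fin n) ℝ) (j : Fin n) : PV n :=
  (-EuclideanSpace.single j 1, matVec B (EuclideanSpace.single j 1), 0)

variable {α : CStarAction n A} {U : Set ℂ} {D : ParamDomain} {F G : Eucl n → ℂ → A} {m : ℝ}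
  {B : Matrix (Fin n) (Fin n) ℝ}

lemma Sm.mnab (hU : IsOpen U) (h : Sm α U F) (v : Fin n → PV n) (γ : Fin n → ℕ) :
    Sm α U (mnab α U v γ F) :=
  foldIter_invariant (P := Sm α U) (fun j _ ha => ha.nab hU (v j)) γ h

lemma mnab_zero (v : Fin n → PV n) : mnab α U v 0 F = F := foldIter_zero _ _

lemma mnab_nab (hU : IsOpen U) (h : Sm α U F) (v : Fin n → PV n) (γ : Fin n → ℕ) (j : Fin n) :
    mnab α U v γ (nab α U (v j) F) = mnab α U v (γ + Pi.single j 1) F :=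
  foldIter_apply (P := Sm α U) (D := fun j => nab α U (v j)) (fun j _ ha => ha.nab hU (v j))
    (fun _ _ _ ha => nab_comm hU ha _ _) γ j h

lemma nab_mnab (hU : IsOpen U) (h : Sm α U F) (v : Fin n → PV n) (γ : Fin n → ℕ) (w : PV n) :
    nab α U w (mnab α U v γ F) = mnab α U v γ (nab α U w F) :=
  foldIter_semiconj (P := Sm α U) (φ := nab α U w) (fun j _ ha => ha.nab hU (v j))
    (fun _ _ ha => nab_comm hU ha _ _) γ h

lemma mnab_smul (hU : IsOpen U) (h : Sm α U F) (v : Fin n → PV n) (γ : Fin n → ℕ) (c : ℂ) :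
    mnab α U v γ (fun ξ z => c • F ξ z) = fun ξ z => c • mnab α U v γ F ξ z :=
  (foldIter_semiconj (P := Sm α U) (φ := fun F ξ z => c • F ξ z)
    (fun j _ ha => ha.nab hU (v j)) (fun j _ ha => (nab_smul hU ha c (v j)).symm) γ h).symm

lemma mnab_add (hU : IsOpen U) (h : Sm α U F) (h' : Sm α U G) (v : Fin n → PV n)
    (γ : Fin n → ℕ) : mnab α U v γ (fun ξ z => F ξ z + G ξ z)
      = fun ξ z => mnab α U v γ F ξ z + mnab α U v γ G ξ z := by
  revert F G
  refine multi_induction (P := fun γ => ∀ {F G : Eucl n → ℂ → A}, Sm α U F → Sm α U G →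
    mnab α U v γ (fun ξ z => F ξ z + G ξ z)
      = fun ξ z => mnab α U v γ F ξ z + mnab α U v γ G ξ z) ?_ ?_ γ
  · intro F G _ _; simp [mnab_zero]
  · intro γ j ih F G hF hG
    rw [← mnab_nab hU (hF.add hG), nab_add hU hF hG, ih (hF.nab hU _) (hG.nab hU _),
      mnab_nab hU hF, mnab_nab hU hG]

lemma mnab_zero_fun (v : Fin n → PV n) (γ : Fin n → ℕ) :
    mnab α U v γ (fun _ _ => (0 : A)) = fun _ _ => 0 :=
  foldIter_invariant (P := fun F : Eucl n → ℂ → A => F = fun _ _ => 0)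
    (fun j a ha => by rw [ha]; exact nab_zero_fun _) γ rfl

lemma mnab_sum (hU : IsOpen U) {ι : Type*} (s : Finset ι) {F : ι → Eucl n → ℂ → A}
    (h : ∀ i ∈ s, Sm α U (F i)) (v : Fin n → PV n) (γ : Fin n → ℕ) :
    mnab α U v γ (fun ξ z => ∑ i ∈ s, F i ξ z) = fun ξ z => ∑ i ∈ s, mnab α U v γ (F i) ξ z := by
  classical
  induction s using Finset.induction_on with
  | empty => simpa using mnab_zero_fun v γ
  | insert a s ha ih =>
    simp only [Finset.sum_insert ha]
    rw [mnab_add hU (h a (by simp)) (Sm.sum s fun i hi => h i (by simp [hi])),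
      ih fun i hi => h i (by simp [hi])]

lemma Sym.mnab_of {v : Fin n → PV n} {r : ℝ}
    (hv : ∀ m F, Sym α D m F → ∀ j, Sym α D (m + r) (nab α D.U (v j) F)) (γ : Fin n → ℕ) {m : ℝ}
    {F : Eucl n → ℂ → A} (h : Sym α D m F) : Sym α D (m + len γ * r) (mnab α D.U v γ F) := by
  revert m F
  refine multi_induction (P := fun γ => ∀ {m : ℝ} {F : Eucl n → ℂ → A}, Sym α D m F →
    Sym α D (m + len γ * r) (mnab α D.U v γ F)) ?_ ?_ γ
  · intro m F h; simpa [mnab_zero] using h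
  · intro γ j ih m F h
    rw [← mnab_nab D.isOpen h.sm, len_add_single]
    refine (ih (hv m F h j)).mono (le_of_eq ?_)
    push_cast; ring

lemma Sym.mnab_act (h : Sym α D m F) (γ : Fin n → ℕ) : Sym α D m (mnab α D.U actVec γ F) := by
  simpa using Sym.mnab_of (r := 0) (v := actVec)
    (fun m F h j => by simpa [actVec] using h.nab_space _ _) γ h

lemma Sym.mnab_cov (h : Sym α D m F) (γ : Fin n → ℕ) :
    Sym α D (m - len γ) (mnab α D.U covVec γ F) := by
  have := Sym.mnab_of (r := -1) (v := covVec)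
    (fun m F h j => by simpa [covVec, sub_eq_add_neg] using h.nab_cov (EuclideanSpace.single j 1)) γ h
  simpa [sub_eq_add_neg] using this

lemma Sym.mnab_matCov (h : Sym α D m F) (γ : Fin n → ℕ) :
    Sym α D (m - len γ) (mnab α D.U (matCovVec B) γ F) := by
  have := Sym.mnab_of (r := -1) (v := matCovVec B)
    (fun m F h j => by simpa [matCovVec, sub_eq_add_neg] using h.nab_cov _) γ h
  simpa [sub_eq_add_neg] using this

/-! ### Comparison with partial derivatives -/

/-- Differentiation of the equivariant extension along an affine map. -/
lemma pd_tw_comp (hU : IsOpen U) (h : Sm α U F) (L : Eucl n →L[ℝ] PV n) {p : PV n}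
    (hp : ∀ x, p + L x ∈ dom n U) (j : Fin n) :
    pd j (fun x => tw α F (p + L x))
      = fun x => tw α (nab α U (L (EuclideanSpace.single j 1)) F) (p + L x) := by
  funext x
  have h1 := (h.hasFDerivAt hU (hp x)).comp x (L.hasFDerivAt.const_add p)
  have h2 : HasFDerivAt (fun x => tw α F (p + L x)) _ x := h1
  rw [pd, h2.fderiv, ContinuousLinearMap.comp_apply, fderiv_tw_eq (hp x)]

/-- The multi-index derivatives `∂_t^γ α_t`, `∂_ξ^γ` and `∂_x^κ α_{-x}(f(ξ + Bx))` of the statement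
are instances, for `L` the inclusion of the action, the inclusion of the covariable, and `x ↦ (-x,
Bx, 0)`. -/
lemma mpd_tw_comp (hU : IsOpen U) (h : Sm α U F) (L : Eucl n →L[ℝ] PV n) {p : PV n}
    (hp : ∀ x, p + L x ∈ dom n U) (γ : Fin n → ℕ) :
    mpd γ (fun x => tw α F (p + L x))
      = fun x => tw α (mnab α U (fun j => L (EuclideanSpace.single j 1)) γ F) (p + L x) :=
  (foldIter_semiconj (P := Sm α U) (φ := fun F x => tw α F (p + L x))
    (fun _ _ ha => ha.nab hU _) (fun j _ ha => (pd_tw_comp hU ha L hp j).symm) γ h).symm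

lemma mpd_act_eq (hU : IsOpen U) (h : Sm α U F) (ξ : Eucl n) {z : ℂ} (hz : z ∈ U)
    (γ : Fin n → ℕ) : mpd γ (fun t => α.act t (F ξ z)) 0 = mnab α U actVec γ F ξ z := by
  have := mpd_tw_comp hU h (ContinuousLinearMap.inl ℝ (Eucl n) (Eucl n × ℂ)) (p := (0, ξ, z))
    (fun x => by simpa [dom] using hz) γ
  have e : (fun t => α.act t (F ξ z)) = fun x : Eucl n => tw α F
      ((0, ξ, z) + ContinuousLinearMap.inl ℝ (Eucl n) (Eucl n × ℂ) x) := by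
    funext x; simp [tw]
  rw [e, this]
  simp
  rfl

lemma delta_eq (hU : IsOpen U) (h : Sm α U F) (ξ : Eucl n) {z : ℂ} (hz : z ∈ U)
    (γ : Fin n → ℕ) : delta α γ (F ξ z) = (Complex.I ^ len γ)⁻¹ • mnab α U actVec γ F ξ z := by
  rw [delta, mpd_act_eq hU h ξ hz]

lemma mpd_eq (hU : IsOpen U) (h : Sm α U F) {z : ℂ} (hz : z ∈ U) (γ : Fin n → ℕ) :
    mpd γ (fun ζ => F ζ z) = fun ξ => mnab α U covVec γ F ξ z := by
  let L : Eucl n →L[ℝ] PV n := (ContinuousLinearMap.inr ℝ (Eucl n) (Eucl n × ℂ)).comp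
    (ContinuousLinearMap.inl ℝ (Eucl n) ℂ)
  have := mpd_tw_comp hU h L (p := (0, 0, z)) (fun x => by simpa [dom, L] using hz) γ
  have e : (fun ζ => F ζ z) = fun x : Eucl n => tw α F ((0, 0, z) + L x) := by
    funext x; simp [L]
  rw [e, this]
  funext ξ
  simp [L]
  rfl

/-- The combination `∑_k B_{kj} ∂_k` is the derivative along the `j`-th column `B e_j = ∑_k B_{kj}
e_k`. -/
lemma pdB_eq (hU : IsOpen U) (h : Sm α U F) {z : ℂ} (hz : z ∈ U) (j : Fin n) :
    pdB B j (fun ζ => F ζ z) = fun ξ => nab α U (matCovVec B j) F ξ z := by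
  funext ξ
  let L : Eucl n →L[ℝ] PV n := (ContinuousLinearMap.inr ℝ (Eucl n) (Eucl n × ℂ)).comp
    (ContinuousLinearMap.inl ℝ (Eucl n) ℂ)
  have key : ∀ k, pd k (fun ζ => F ζ z) ξ = nab α U (covVec k) F ξ z := by
    intro k
    have := congrFun (pd_tw_comp hU h L (p := (0, 0, z)) (fun x => by simpa [dom, L] using hz) k) ξ
    have e : (fun ζ => F ζ z) = fun x : Eucl n => tw α F ((0, 0, z) + L x) := by
      funext x; simp [L]
    rw [e, this]
    simp [L]
    rfl
  have e : matCovVec B j = ∑ k, B k j • (covVec k : PV n) := by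
    have h1 : matVec B (EuclideanSpace.single j 1)
        = ∑ k, B k j • (EuclideanSpace.single k (1 : ℝ) : Eucl n) := by
      ext i
      simp [matVec, Finset.sum_apply, Pi.single_apply]
    have h2 : ∀ c : Fin n → Eucl n, (∑ k, ((0, c k, 0) : PV n)) = (0, ∑ k, c k, 0) := by
      intro c
      refine Prod.ext ?_ (Prod.ext ?_ ?_) <;> simp [Prod.fst_sum, Prod.snd_sum]
    simp only [matCovVec, covVec, h1, Prod.smul_mk, smul_zero, h2]
  rw [e, nab_sum_vec]
  simp only [pdB, key, nab_smul_vec]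
  simp

lemma mpdB_eq (hU : IsOpen U) (h : Sm α U F) {z : ℂ} (hz : z ∈ U) (γ : Fin n → ℕ) :
    mpdB B γ (fun ζ => F ζ z) = fun ξ => mnab α U (matCovVec B) γ F ξ z :=
  (foldIter_semiconj (P := Sm α U) (φ := fun F ξ => F ξ z) (fun _ _ ha => ha.nab hU _)
    (fun j _ ha => (pdB_eq hU ha hz j).symm) γ h).symm

lemma twistDeriv_eq (hU : IsOpen U) (h : Sm α U F) {z : ℂ} (hz : z ∈ U) (κ : Fin n → ℕ)
    (ξ : Eucl n) : twistDeriv α B κ (fun ζ => F ζ z) ξ = mnab α U (twistVec B) κ F ξ z := by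
  let L : Eucl n →L[ℝ] PV n := (-ContinuousLinearMap.id ℝ (Eucl n)).prod ((matVecL B).prod 0)
  have := mpd_tw_comp hU h L (p := (0, ξ, z)) (fun x => by simpa [dom, L] using hz) κ
  have e : (fun x => α.act (-x) (F (ξ + matVec B x) z))
      = fun x : Eucl n => tw α F ((0, ξ, z) + L x) := by
    funext x; simp [L, tw]
  rw [twistDeriv, e, this]
  have h0 : L 0 = 0 := map_zero L
  beta_reduce
  rw [h0, add_zero, tw_zero_left]
  rfl

lemma mem_smoothSet (h : Sm α U F) (ξ : Eucl n) {z : ℂ} (hz : z ∈ U) : F ξ z ∈ smoothSet α := by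
  have h1 : ContDiff ℝ ∞ fun t : Eucl n => ((t, ξ, z) : PV n) := by fun_prop
  exact ContDiffOn.comp_contDiff h h1 fun t => hz

lemma contDiffOn_of_Sm (h : Sm α U F) :
    ContDiffOn ℝ ∞ (fun p : Eucl n × ℂ => F p.1 p.2) (Set.univ ×ˢ U) := by
  have h1 : ContDiffOn ℝ ∞ (fun p : Eucl n × ℂ => ((0, p) : PV n)) (Set.univ ×ˢ U) := by fun_prop
  refine (ContDiffOn.comp h h1 fun p hp => hp.2).congr fun p _ => ?_
  simpa using (tw_zero_left (α := α) (F := F) p.1 p.2).symm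

lemma delta_contDiffOn (hU : IsOpen U) (h : Sm α U F) (γ : Fin n → ℕ) :
    ContDiffOn ℝ ∞ (fun p : Eucl n × ℂ => delta α γ (F p.1 p.2)) (Set.univ ×ˢ U) := by
  refine ((contDiffOn_of_Sm (h.mnab hU actVec γ)).const_smul ((Complex.I ^ len γ)⁻¹)).congr ?_
  intro p hp
  exact delta_eq hU h p.1 hp.2 γ

lemma Sym.iterate_par (h : Sym α D m F) (k : ℕ) :
    Sym α D (m + k) ((nab α D.U (0, 0, 1))^[k] F) := by
  induction k with
  | zero => simpa using h
  | succ k ih =>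
    rw [Function.iterate_succ_apply']
    refine (ih.nabDir .par).mono (le_of_eq ?_)
    simp [Dir.wt]; ring

end MultiNab

/-! ### Bilinear operations satisfying the Leibniz rule -/

section LeibnizOp

variable {n : ℕ} {A : Type*} [CStarAlgebra A]

/-- Homogeneous operations on pairs of symbols which satisfy the Leibniz rule and shift the sum of
the orders by `r`. -/
structure LeibnizOp (α : CStarAction n A) (D : ParamDomain) (r : ℝ)
    (T : (Eucl n → ℂ → A) → (Eucl n → ℂ → A) → Eucl n → ℂ → A) : Prop where
  smul_left : ∀ {m m' F G}, Sym α D m F → Sym α D m' G → ∀ c : ℂ,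
    T (fun ξ z => c • F ξ z) G = fun ξ z => c • T F G ξ z
  smul_right : ∀ {m m' F G}, Sym α D m F → Sym α D m' G → ∀ c : ℂ,
    T F (fun ξ z => c • G ξ z) = fun ξ z => c • T F G ξ z
  diff : ∀ {m m' F G}, Sym α D m F → Sym α D m' G →
    DifferentiableOn ℝ (tw α (T F G)) (dom n D.U)
  leibniz : ∀ {m m' F G}, Sym α D m F → Sym α D m' G → ∀ v,
    nab α D.U v (T F G) = fun ξ z => T (nab α D.U v F) G ξ z + T F (nab α D.U v G) ξ z
  bound : ∀ {m m' F G}, Sym α D m F → Sym α D m' G → ∀ K ∈ D.fam, ∃ C : ℝ, ∀ z ∈ K, ∀ ξ,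
    ‖T F G ξ z‖ ≤ C * bracket ξ ^ (m + m' + r)

variable {α : CStarAction n A} {B : Matrix (Fin n) (Fin n) ℝ} {D : ParamDomain}
  {F G : Eucl n → ℂ → A} {m m' q r : ℝ} {ψ : Eucl n × Eucl n → ℂ} {p : PV n} {t : ℝ} {I : Type*}
  {T : (Eucl n → ℂ → A) → (Eucl n → ℂ → A) → Eucl n → ℂ → A}

/-- By the Leibniz rule the set of all values `T F G` is stable under differentiation, with the
right change of order. The single estimate `bound`, being available for all pairs of symbols, thus
yields the estimates of every derivative. -/
theorem LeibnizOp.sym (hT : LeibnizOp α D r T) (hF : Sym α D m F) (hG : Sym α D m' G) :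
    Sym α D (m + m' + r) (T F G) := by
  refine Sym.of_class (fun μ => {h | ∃ m m' F G, m + m' + r = μ ∧ Sym α D m F ∧ Sym α D m' G ∧
    h = T F G}) ?_ ?_ ?_ ?_ _ _ ⟨m, m', F, G, rfl, hF, hG, rfl⟩
  · rintro μ _ ⟨m, m', F, G, rfl, hF, hG, rfl⟩
    exact hT.diff hF hG
  · rintro μ _ ⟨m, m', F, G, rfl, hF, hG, rfl⟩
    rw [hT.leibniz hF hG, hT.leibniz hF hG, hF.holo, hG.holo,
      hT.smul_left (hF.nab_any (0, 0, 1)) hG, hT.smul_right hF (hG.nab_any (0, 0, 1))]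
    simp
  · rintro μ _ ⟨m, m', F, G, rfl, hF, hG, rfl⟩ d
    exact ⟨_, ⟨_, _, _, _, by ring, hF.nabDir d, hG, rfl⟩, _,
      ⟨_, _, _, _, by ring, hF, hG.nabDir d, rfl⟩, hT.leibniz hF hG _⟩
  · rintro μ _ ⟨m, m', F, G, rfl, hF, hG, rfl⟩ K hK
    exact hT.bound hF hG K hK

/-- Pointwise convergence at `(ξ, z)` is assumed for all pairs of symbols. The Leibniz rule moves
every derivative onto the arguments, so the derivatives converge as well. With `actVec` this is
convergence in the topology of `A^∞`. -/
lemma LeibnizOp.tendsto_mnab {T' : I → (Eucl n → ℂ → A) → (Eucl n → ℂ → A) → Eucl n → ℂ → A}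
    {l : Filter I} (hT : LeibnizOp α D r T) (hT' : ∀ i, LeibnizOp α D r (T' i)) (v : Fin n → PV n)
    {ξ : Eucl n} {z : ℂ}
    (hl : ∀ {m m' F G}, Sym α D m F → Sym α D m' G →
      Filter.Tendsto (fun i => T' i F G ξ z) l (𝓝 (T F G ξ z)))
    (γ : Fin n → ℕ) (hF : Sym α D m F) (hG : Sym α D m' G) :
    Filter.Tendsto (fun i => mnab α D.U v γ (T' i F G) ξ z) l
      (𝓝 (mnab α D.U v γ (T F G) ξ z)) := by
  revert m m' F G
  refine multi_induction (P := fun γ => ∀ {F G : Eucl n → ℂ → A} {m m' : ℝ}, Sym α D m F →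
    Sym α D m' G → Filter.Tendsto (fun i => mnab α D.U v γ (T' i F G) ξ z) l
      (𝓝 (mnab α D.U v γ (T F G) ξ z))) ?_ ?_ γ
  · intro F G m m' hF hG
    simpa [mnab_zero] using hl hF hG
  · intro γ j ih F G m m' hF hG
    have e : ∀ {T}, LeibnizOp α D r T → mnab α D.U v (γ + Pi.single j 1) (T F G) = fun ξ z =>
        mnab α D.U v γ (T (nab α D.U (v j) F) G) ξ z
          + mnab α D.U v γ (T F (nab α D.U (v j) G)) ξ z := by
      intro T hT
      rw [← mnab_nab D.isOpen (hT.sym hF hG).sm, hT.leibniz hF hG,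
        mnab_add D.isOpen (hT.sym (hF.nab_any _) hG).sm (hT.sym hF (hG.nab_any _)).sm]
    simp only [e hT, e (hT' _)]
    exact (ih (hF.nab_any _) hG).add (ih hF (hG.nab_any _))

lemma exists_order (n : ℕ) (q r : ℝ) : ∃ M : ℕ, q - M + r < -(2 * n : ℝ) := by
  obtain ⟨M, hM⟩ := exists_nat_gt (q + r + 2 * n)
  exact ⟨M, by linarith⟩

/-- Operations given by regularized integrals. -/
theorem LeibnizOp.of_osc (c : ℝ) (hψ : W q fun _ : Unit => ψ) (t : ℝ)
    (hT : ∀ {m m' F G} {M : ℕ}, Sym α D m F → Sym α D m' G →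
      q - M + (|m| + |m'|) < -(2 * n : ℝ) → ∀ p ∈ dom n D.U,
        tw α (T F G) p = c • osc α B D.U t M ψ F G p)
    (hT0 : ∀ F G ξ, ∀ z ∉ D.U, T F G ξ z = 0) : LeibnizOp α D 0 T where
  smul_left {m m' F G} hF hG b := by
    obtain ⟨M, hM⟩ := exists_order n q (|m| + |m'|)
    funext ξ z
    by_cases hz : z ∈ D.U
    · have h1 := hT (hF.smul b) hG hM (0, ξ, z) hz
      have h2 := hT hF hG hM (0, ξ, z) hz
      rw [tw_zero_left] at h1 h2
      rw [h1, h2, osc_smul_left M hF.sm, smul_comm]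
    · simp [hT0 _ _ _ _ hz]
  smul_right {m m' F G} hF hG b := by
    obtain ⟨M, hM⟩ := exists_order n q (|m| + |m'|)
    funext ξ z
    by_cases hz : z ∈ D.U
    · have h1 := hT hF (hG.smul b) hM (0, ξ, z) hz
      have h2 := hT hF hG hM (0, ξ, z) hz
      rw [tw_zero_left] at h1 h2
      rw [h1, h2, osc_smul_right M hG.sm, smul_comm]
    · simp [hT0 _ _ _ _ hz]
  diff {m m' F G} hF hG := by
    obtain ⟨M, hM⟩ := exists_order n q (|m| + |m'| + 2)
    have h0 : DifferentiableOn ℝ (fun p => c • osc α B D.U t M ψ F G p) (dom n D.U) := by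
      intro p hp
      obtain ⟨L, hL, -⟩ := osc_hasFDerivAt (B := B) M hψ hF hG (by linarith) hp t
      exact (hL.const_smul c).differentiableAt.differentiableWithinAt
    exact h0.congr fun p hp => hT hF hG (by linarith) p hp
  leibniz {m m' F G} hF hG v := by
    -- The number of partial integrations may depend on the orders, since `hT` holds for every
    -- admissible `M`. The margin `2` lets one `M` serve `T F G` and both terms of its derivative.
    obtain ⟨M, hM⟩ := exists_order n q (|m| + |m'| + 2)
    have e1 : |m + 1| ≤ |m| + 1 := by simpa using abs_add_le m 1
    have e2 : |m' + 1| ≤ |m'| + 1 := by simpa using abs_add_le m' 1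
    funext ξ z
    by_cases hz : z ∈ D.U
    · have hp : ((0, ξ, z) : PV n) ∈ dom n D.U := hz
      obtain ⟨L, hL, hLv⟩ := osc_hasFDerivAt (B := B) M hψ hF hG (by linarith) hp t
      have e : tw α (T F G) =ᶠ[𝓝 (0, ξ, z)] fun p => c • osc α B D.U t M ψ F G p := by
        filter_upwards [(isOpen_dom D.isOpen).mem_nhds hp] with p hp
        exact hT hF hG (by linarith) p hp
      have h1 := hT (hF.nab_any v) hG (M := M) (by linarith) (0, ξ, z) hz
      have h2 := hT hF (hG.nab_any v) (M := M) (by linarith) (0, ξ, z) hz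
      rw [tw_zero_left] at h1 h2
      rw [nab_of_mem hz, ((hL.const_smul c).congr_of_eventuallyEq e).fderiv, h1, h2, ← smul_add,
        ← hLv v]
      rfl
    · simp [hT0 _ _ _ _ hz, nab_of_notMem hz]
  bound {m m' F G} hF hG K hK := by
    obtain ⟨M, hM⟩ := exists_order n q (|m| + |m'|)
    obtain ⟨C, hC, hb⟩ := osc_bound (B := B) M hψ hF hG hM hK (abs_nonneg t)
    refine ⟨|c| * C, fun z hz ξ => ?_⟩
    have h := hT hF hG hM (0, ξ, z) (D.sub K hK hz)
    rw [tw_zero_left] at h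
    rw [h, norm_smul, Real.norm_eq_abs, add_zero, mul_assoc]
    exact mul_le_mul_of_nonneg_left (hb () (0, ξ, z) hz t le_rfl) (abs_nonneg c)

end LeibnizOp

/-! ### The twisted product as an oscillatory integral -/

section OscI

variable {n : ℕ} {A : Type*} [CStarAlgebra A]

/-- The bump function on `ℝⁿ` used for cutoffs. -/
def bump (n : ℕ) : ContDiffBump (0 : Eucl n) := ⟨1, 2, one_pos, one_lt_two⟩

/-- The bump function as a Schwartz function. -/
def bumpS (n : ℕ) : 𝓢(Eucl n, ℂ) :=
  HasCompactSupport.toSchwartzMap (f := fun x => ((bump n x : ℝ) : ℂ))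
    ((bump n).hasCompactSupport.comp_left (g := fun r : ℝ => (r : ℂ)) (by simp))
    (Complex.ofRealCLM.contDiff.comp (bump n).contDiff)

lemma bumpS_apply (x : Eucl n) : bumpS n x = ((bump n x : ℝ) : ℂ) := rfl

lemma bumpS_zero : bumpS n 0 = 1 := by
  rw [bumpS_apply, (bump n).one_of_mem_closedBall (by simp [bump])]
  simp

/-- The cutoff `φ(y) φ(η)`. -/
def stdCut (n : ℕ) : 𝓢(Eucl n × Eucl n, ℂ) :=
  HasCompactSupport.toSchwartzMap (f := fun x : Eucl n × Eucl n => bumpS n x.1 * bumpS n x.2)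
    (by
      have h := ((bump n).hasCompactSupport.comp_left (g := fun r : ℝ => (r : ℂ)) (by simp))
      refine HasCompactSupport.of_support_subset_isCompact (h.isCompact.prod h.isCompact) ?_
      intro x hx
      have h1 : bumpS n x.1 ≠ 0 := left_ne_zero_of_mul hx
      have h2 : bumpS n x.2 ≠ 0 := right_ne_zero_of_mul hx
      exact ⟨subset_tsupport _ h1, subset_tsupport _ h2⟩)
    (((bumpS n).smooth ⊤).comp contDiff_fst |>.mul (((bumpS n).smooth ⊤).comp contDiff_snd))

lemma stdCut_apply (x : Eucl n × Eucl n) : stdCut n x = bumpS n x.1 * bumpS n x.2 := rfl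

lemma stdCut_zero : stdCut n 0 = 1 := by simp [stdCut_apply, bumpS_zero]

/-- `(2π)^{-n}`. -/
def cn (n : ℕ) : ℝ := ((2 * Real.pi) ^ n)⁻¹

open Classical in
/-- The normalized phase-space integral, extended by zero. -/
def JI (α : CStarAction n A) (B : Matrix (Fin n) (Fin n) ℝ) (U : Set ℂ) (t : ℝ)
    (ψ : Eucl n × Eucl n → ℂ) (F G : Eucl n → ℂ → A) (ξ : Eucl n) (z : ℂ) : A :=
  if z ∈ U then cn n • J α B t ψ F G (0, ξ, z) else 0

/-- The oscillatory integral `(2π)^{-n} ∬ e^{-i⟨y,η⟩} F(ξ + tη) α_{-y} G(ξ + By)`. -/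
def oscI (α : CStarAction n A) (B : Matrix (Fin n) (Fin n) ℝ) (U : Set ℂ) (t : ℝ)
    (F G : Eucl n → ℂ → A) (ξ : Eucl n) (z : ℂ) : A :=
  Filter.limUnder (𝓝[>] 0) fun ε : ℝ => JI α B U t (cut (stdCut n) (ε, ε, 0)) F G ξ z

variable {α : CStarAction n A} {B : Matrix (Fin n) (Fin n) ℝ} {D : ParamDomain}
  {F G : Eucl n → ℂ → A} {m m' q r : ℝ} {ψ : Eucl n × Eucl n → ℂ} {p : PV n} {t : ℝ} {I : Type*}

lemma cut_zero (χ : 𝓢(Eucl n × Eucl n, ℂ)) : cut χ (0, 0, 0) = fun _ => χ 0 := by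
  funext x; simp only [cut]; congr 1; simp

lemma Dec_cut (χ : 𝓢(Eucl n × Eucl n, ℂ)) {θ : ℝ × ℝ × Eucl n} (h1 : 0 < θ.1)
    (h2 : 0 < θ.2.1) : Dec (cut χ θ) := fun k => W_cut_decay χ h1 h2 k

/-- Truncation of a parameter to `[0, 1]`. -/
def clamp (ε : ℝ) : ℝ := max 0 (min ε 1)

lemma abs_clamp_le (ε : ℝ) : |clamp ε| ≤ 1 := by
  rw [clamp, abs_of_nonneg (le_max_left _ _)]
  simp

lemma tendsto_clamp : Filter.Tendsto clamp (𝓝[>] 0) (𝓝 0) := by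
  have h : Continuous clamp := by unfold clamp; fun_prop
  have h0 : clamp 0 = 0 := by simp [clamp]
  exact (h0 ▸ h.tendsto 0).mono_left nhdsWithin_le_nhds

lemma eventually_clamp : ∀ᶠ ε : ℝ in 𝓝[>] 0, 0 < ε ∧ clamp ε = ε := by
  filter_upwards [Ioo_mem_nhdsGT (zero_lt_one (α := ℝ))] with ε hε
  exact ⟨hε.1, by simp [clamp, hε.1.le, hε.2.le]⟩

/-- The cutoff integrals converge to the regularized integral. -/
theorem J_tendsto (M : ℕ) (χ : 𝓢(Eucl n × Eucl n, ℂ)) (hχ : χ 0 = 1) (hF : Sym α D m F)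
    (hG : Sym α D m' G) (hM : 0 - M + (|m| + |m'|) < -(2 * n : ℝ)) (hp : p ∈ dom n D.U) (t : ℝ) :
    Filter.Tendsto (fun ε : ℝ => J α B t (cut χ (ε, ε, 0)) F G p) (𝓝[>] 0)
      (𝓝 (osc α B D.U t M (fun _ => 1) F G p)) := by
  -- Uniform bounds are required for every index and not only eventually, so `ε` is truncated. Near
  -- `0` from the right nothing changes.
  have h1 : WConv (𝓝[>] (0 : ℝ)) 0 (fun ε => cut χ (clamp ε, clamp ε, 0)) (cut χ (0, 0, 0)) :=
    WConv_cut χ (fun ε => ⟨abs_clamp_le ε, abs_clamp_le ε⟩)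
      (tendsto_clamp.prodMk_nhds (tendsto_clamp.prodMk_nhds tendsto_const_nhds))
  have h2 := osc_tendsto (B := B) M h1 hF hG hM hp t
  rw [cut_zero, hχ] at h2
  refine h2.congr' ?_
  filter_upwards [eventually_clamp] with ε hε
  rw [hε.2]
  exact osc_eq_J M (Dec_cut χ hε.1 hε.1) hF hG hp t

lemma JI_tendsto_osc (M : ℕ) (χ : 𝓢(Eucl n × Eucl n, ℂ)) (hχ : χ 0 = 1) (hF : Sym α D m F)
    (hG : Sym α D m' G) (hM : 0 - M + (|m| + |m'|) < -(2 * n : ℝ)) (t : ℝ) (ξ : Eucl n) {z : ℂ}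
    (hz : z ∈ D.U) : Filter.Tendsto (fun ε : ℝ => JI α B D.U t (cut χ (ε, ε, 0)) F G ξ z) (𝓝[>] 0)
      (𝓝 (cn n • osc α B D.U t M (fun _ => 1) F G (0, ξ, z))) := by
  simp only [JI, hz, if_true]
  exact (J_tendsto M χ hχ hF hG hM hz t).const_smul _

/-- The left side does not involve `M`, so every sufficiently large number of partial integrations
gives the same value. -/
lemma oscI_eq_osc {M : ℕ} (hF : Sym α D m F) (hG : Sym α D m' G)
    (hM : 0 - M + (|m| + |m'|) < -(2 * n : ℝ)) (t : ℝ) (ξ : Eucl n) {z : ℂ} (hz : z ∈ D.U) :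
    oscI α B D.U t F G ξ z = cn n • osc α B D.U t M (fun _ => 1) F G (0, ξ, z) :=
  (JI_tendsto_osc M (stdCut n) stdCut_zero hF hG hM t ξ hz).limUnder_eq

lemma oscI_of_notMem {z : ℂ} (hz : z ∉ D.U) (ξ : Eucl n) : oscI α B D.U t F G ξ z = 0 := by
  simp only [oscI, JI, hz, if_false]
  exact tendsto_const_nhds.limUnder_eq

theorem JI_tendsto (χ : 𝓢(Eucl n × Eucl n, ℂ)) (hχ : χ 0 = 1) (hF : Sym α D m F)
    (hG : Sym α D m' G) (t : ℝ) (ξ : Eucl n) (z : ℂ) :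
    Filter.Tendsto (fun ε : ℝ => JI α B D.U t (cut χ (ε, ε, 0)) F G ξ z) (𝓝[>] 0)
      (𝓝 (oscI α B D.U t F G ξ z)) := by
  by_cases hz : z ∈ D.U
  · obtain ⟨M, hM⟩ := exists_order n 0 (|m| + |m'|)
    rw [oscI_eq_osc hF hG hM t ξ hz]
    exact JI_tendsto_osc M χ hχ hF hG hM t ξ hz
  · rw [oscI_of_notMem hz]
    simp only [JI, hz, if_false]
    exact tendsto_const_nhds

lemma act_real_smul (s : Eucl n) (c : ℝ) (a : A) : α.act s (c • a) = c • α.act s a :=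
  map_smul (actL α s) c a

theorem leibnizOp_JI (hψ : Dec ψ) (t : ℝ) : LeibnizOp α D 0 (JI α B D.U t ψ) := by
  refine LeibnizOp.of_osc (B := B) (cn n) (hψ 0) t ?_ ?_
  · intro m m' F G M hF hG _ p hp
    have hp' : p.2.2 ∈ D.U := hp
    rw [osc_eq_J M hψ hF hG hp t, tw]
    simp only [JI, hp', if_true]
    rw [act_real_smul, ← J_act]
  · intro F G ξ z hz
    simp [JI, hz]

/-- The weight here is the constant `1`, of growth `0`. For `t = 1`, combined with `LeibnizOp.sym`,
this gives the symbol estimates of the twisted product. -/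
theorem leibnizOp_oscI (t : ℝ) : LeibnizOp α D 0 (oscI α B D.U t) := by
  refine LeibnizOp.of_osc (B := B) (cn n) (W_const 1) t ?_ ?_
  · intro m m' F G M hF hG hM p hp
    rw [tw, oscI_eq_osc hF hG hM t _ hp, act_real_smul, ← osc_act]
  · intro F G ξ z hz
    exact oscI_of_notMem hz ξ

lemma regIntegral_eq (χ : 𝓢(Eucl n × Eucl n, ℂ)) {ε : ℝ} (hε : 0 < ε) (hF : Sym α D m F)
    (hG : Sym α D m' G) (ξ : Eucl n) {z : ℂ} (hz : z ∈ D.U) :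
    regIntegral χ (sharpAmplitude α B (fun ζ => F ζ z) (fun ζ => G ζ z) ξ) ε
      = JI α B D.U 1 (cut χ (ε, ε, 0)) F G ξ z := by
  have hi := (Dec_cut χ (θ := (ε, ε, 0)) hε hε).integrable (B := B) hF hG (p := (0, ξ, z)) hz 1
  simp only [JI, hz, if_true, J, regIntegral, cn]
  congr 1
  rw [Measure.volume_eq_prod] at hi ⊢
  rw [integral_prod_symm _ hi]
  congr 1
  funext η
  congr 1
  funext y
  simp [cut, phase, amp, tw, covShift_apply, actShift_apply, sharpAmplitude, mul_comm, add_comm ξ,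
    α.act_zero]

/-- Existence of the oscillatory integral. -/
theorem isOscIntegral_oscI (hF : Sym α D m F) (hG : Sym α D m' G) (ξ : Eucl n) {z : ℂ}
    (hz : z ∈ D.U) :
    IsOscIntegral α (sharpAmplitude α B (fun ζ => F ζ z) (fun ζ => G ζ z) ξ)
      (oscI α B D.U 1 F G ξ z) := by
  have hT := leibnizOp_oscI (α := α) (B := B) (D := D) 1
  refine ⟨mem_smoothSet (hT.sym hF hG).sm ξ hz, fun χ hχ => ⟨fun ε hε => ?_, fun γ => ?_⟩⟩
  · rw [regIntegral_eq χ hε hF hG ξ hz]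
    exact mem_smoothSet ((leibnizOp_JI (Dec_cut χ hε hε) 1).sym hF hG).sm ξ hz
  · rw [delta_eq D.isOpen (hT.sym hF hG).sm ξ hz]
    -- The Leibniz property of the cutoff integrals is available only for `ε > 0`, where the cutoff
    -- decays rapidly. So the index set is restricted to positive numbers and the limit is pulled
    -- back to it.
    have hT' : ∀ ε : Set.Ioi (0 : ℝ),
        LeibnizOp α D 0 (JI α B D.U 1 (cut χ ((ε : ℝ), (ε : ℝ), 0))) := fun ε =>
      leibnizOp_JI (Dec_cut χ (θ := (ε, ε, 0)) ε.2 ε.2) 1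
    have h := hT.tendsto_mnab hT' actVec (ξ := ξ) (z := z)
      (l := Filter.comap Subtype.val (𝓝[>] (0 : ℝ))) (fun hF hG =>
        (JI_tendsto χ hχ hF hG 1 ξ z).comp Filter.tendsto_comap) γ hF hG
    have h' := h.const_smul ((Complex.I ^ len γ)⁻¹)
    have e : ∀ ε : Set.Ioi (0 : ℝ), delta α γ (regIntegral χ
        (sharpAmplitude α B (fun ζ => F ζ z) (fun ζ => G ζ z) ξ) ε)
        = (Complex.I ^ len γ)⁻¹ • mnab α D.U actVec γ
          (JI α B D.U 1 (cut χ ((ε : ℝ), (ε : ℝ), 0)) F G) ξ z := by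
      intro ε
      rw [regIntegral_eq χ ε.2 hF hG ξ hz, delta_eq D.isOpen ((hT' ε).sym hF hG).sm ξ hz]
    simp only [← e] at h'
    refine (Filter.tendsto_comap'_iff (i := Subtype.val) (m := fun ε => delta α γ (regIntegral χ
      (sharpAmplitude α B (fun ζ => F ζ z) (fun ζ => G ζ z) ξ) ε)) ?_).1 h'
    rw [Subtype.range_coe]
    exact self_mem_nhdsWithin

@[simp] lemma delta_zero (a : A) : delta α 0 a = a := by
  have h : mpd 0 (fun t => α.act t a) = fun t => α.act t a :=
    foldIter_zero (n := n) (S := Eucl n → A) pd _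
  simp [delta, h, α.act_zero]

lemma IsOscIntegral.unique {a : Eucl n → Eucl n → A} {v w : A} (hv : IsOscIntegral α a v)
    (hw : IsOscIntegral α a w) : v = w := by
  have h1 := (hv.2 (stdCut n) stdCut_zero).2 0
  have h2 := (hw.2 (stdCut n) stdCut_zero).2 0
  simp only [delta_zero] at h1 h2
  exact tendsto_nhds_unique h1 h2

lemma IsOscIntegral.oscIntegral_eq {a : Eucl n → Eucl n → A} {v : A} (hv : IsOscIntegral α a v) :
    oscIntegral α a = v := by
  have h : ∃ v, IsOscIntegral α a v := ⟨v, hv⟩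
  rw [oscIntegral, dif_pos h]
  exact h.choose_spec.unique hv

end OscI

/-! ### Algebra of operations satisfying the Leibniz rule -/

section LeibnizAlgebra

variable {n : ℕ} {A : Type*} [CStarAlgebra A] {α : CStarAction n A} {B : Matrix (Fin n) (Fin n) ℝ}
  {D : ParamDomain} {F G : Eucl n → ℂ → A} {m m' r s s' : ℝ}
  {T T' : (Eucl n → ℂ → A) → (Eucl n → ℂ → A) → Eucl n → ℂ → A}

lemma LeibnizOp.mono (hT : LeibnizOp α D r T) (h : r ≤ s) : LeibnizOp α D s T :=
  { hT with
    bound := fun hF hG K hK => ((hT.sym hF hG).mono (by linarith)).exists_bound_zero hK |>.imp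
      fun _ h => h.2 }

lemma LeibnizOp.mul : LeibnizOp α D 0 fun F G ξ z => F ξ z * G ξ z where
  smul_left _ _ c := by simp
  smul_right _ _ c := by simp
  diff hF hG := (hF.mul hG).sm.differentiableOn (by simp)
  leibniz hF hG v := nab_mul D.isOpen hF.sm hG.sm v
  bound hF hG K hK := by
    rw [add_zero]
    exact ((hF.mul hG).exists_bound_zero hK).imp fun _ h => h.2

lemma LeibnizOp.zero : LeibnizOp α D r fun _ _ _ _ => 0 where
  smul_left _ _ c := by simp
  smul_right _ _ c := by simp
  diff _ _ := (Sm.zero (α := α) (U := D.U)).differentiableOn (by simp)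
  leibniz _ _ v := by simp [nab_zero_fun]
  bound _ _ K hK := ⟨0, by simp⟩

lemma LeibnizOp.add (hT : LeibnizOp α D r T) (hT' : LeibnizOp α D r T') :
    LeibnizOp α D r fun F G ξ z => T F G ξ z + T' F G ξ z where
  smul_left hF hG c := by simp [hT.smul_left hF hG, hT'.smul_left hF hG]
  smul_right hF hG c := by simp [hT.smul_right hF hG, hT'.smul_right hF hG]
  diff hF hG := ((hT.sym hF hG).add (hT'.sym hF hG)).sm.differentiableOn (by simp)
  leibniz hF hG v := by
    rw [nab_add D.isOpen (hT.sym hF hG).sm (hT'.sym hF hG).sm, hT.leibniz hF hG,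
      hT'.leibniz hF hG]
    funext ξ z
    exact add_add_add_comm _ _ _ _
  bound hF hG K hK := (((hT.sym hF hG).add (hT'.sym hF hG)).exists_bound_zero hK).imp
    fun _ h => h.2

lemma LeibnizOp.smul (c : ℂ) (hT : LeibnizOp α D r T) :
    LeibnizOp α D r fun F G ξ z => c • T F G ξ z where
  smul_left hF hG b := by simp [hT.smul_left hF hG, smul_comm c]
  smul_right hF hG b := by simp [hT.smul_right hF hG, smul_comm c]
  diff hF hG := ((hT.sym hF hG).smul c).sm.differentiableOn (by simp)
  leibniz hF hG v := by
    rw [nab_smul D.isOpen (hT.sym hF hG).sm, hT.leibniz hF hG]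
    simp
  bound hF hG K hK := (((hT.sym hF hG).smul c).exists_bound_zero hK).imp fun _ h => h.2

lemma LeibnizOp.sum {ι : Type*} (S : Finset ι)
    {T : ι → (Eucl n → ℂ → A) → (Eucl n → ℂ → A) → Eucl n → ℂ → A}
    (hT : ∀ i ∈ S, LeibnizOp α D r (T i)) :
    LeibnizOp α D r fun F G ξ z => ∑ i ∈ S, T i F G ξ z := by
  classical
  induction S using Finset.induction_on with
  | empty => simpa using LeibnizOp.zero
  | insert a S ha ih =>
    simp only [Finset.sum_insert ha]
    exact (hT a (by simp)).add (ih fun i hi => hT i (by simp [hi]))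

lemma LeibnizOp.comp_nab (hT : LeibnizOp α D r T) {v w : PV n}
    (hv : ∀ {m F}, Sym α D m F → Sym α D (m + s) (nab α D.U v F))
    (hw : ∀ {m F}, Sym α D m F → Sym α D (m + s') (nab α D.U w F)) :
    LeibnizOp α D (r + s + s') fun F G => T (nab α D.U v F) (nab α D.U w G) where
  smul_left hF hG c := by rw [nab_smul D.isOpen hF.sm, hT.smul_left (hv hF) (hw hG)]
  smul_right hF hG c := by rw [nab_smul D.isOpen hG.sm, hT.smul_right (hv hF) (hw hG)]
  diff hF hG := hT.diff (hv hF) (hw hG)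
  leibniz hF hG u := by
    rw [hT.leibniz (hv hF) (hw hG), nab_comm D.isOpen hF.sm, nab_comm D.isOpen hG.sm]
  bound {m m' F G} hF hG K hK := by
    rw [show m + m' + (r + s + s') = (m + s) + (m' + s') + r by ring]
    exact hT.bound (hv hF) (hw hG) K hK

/-- The iterates of `(F, G) ↦ ∑_j (∂_j F, D_j G)`, followed by multiplication. -/
def expOp (α : CStarAction n A) (B : Matrix (Fin n) (Fin n) ℝ) (U : Set ℂ) :
    ℕ → (Eucl n → ℂ → A) → (Eucl n → ℂ → A) → Eucl n → ℂ → A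
  | 0, F, G => fun ξ z => F ξ z * G ξ z
  | k + 1, F, G => fun ξ z =>
      ∑ j, expOp α B U k (nab α U (covVec j) F) (nab α U (twistVec B j) G) ξ z

lemma Sym.nab_covVec (h : Sym α D m F) (j : Fin n) : Sym α D (m + -1) (nab α D.U (covVec j) F) :=
  h.nab_cov _

lemma Sym.nab_twistVec (h : Sym α D m F) (j : Fin n) :
    Sym α D (m + 0) (nab α D.U (twistVec B j) F) := by
  rw [add_zero]
  exact h.nab_space _ _

/-- Each iteration differentiates the first factor once in the covariable, which lowers the order by
one. The twisted derivative of the second factor keeps its order. -/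
lemma leibnizOp_expOp (k : ℕ) : LeibnizOp α D (-(k : ℝ)) (expOp α B D.U k) := by
  induction k with
  | zero => rw [Nat.cast_zero, neg_zero]; exact LeibnizOp.mul
  | succ k ih =>
    refine LeibnizOp.sum _ fun j _ => ?_
    refine (ih.comp_nab (fun h => h.nab_covVec j) (fun h => h.nab_twistVec j)).mono (le_of_eq ?_)
    push_cast; ring

end LeibnizAlgebra

/-! ### Dependence on the homotopy parameter -/

section Homotopy

variable {n : ℕ} {A : Type*} [CStarAlgebra A] {α : CStarAction n A} {B : Matrix (Fin n) (Fin n) ℝ}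
  {D : ParamDomain} {F G : Eucl n → ℂ → A} {m m' : ℝ} {ψ : Eucl n × Eucl n → ℂ} {p : PV n}

lemma nab_cov_eq_sum (η : Eucl n) :
    nab α D.U (0, η, 0) F = fun ξ z => ∑ j, (η j : ℂ) • nab α D.U (covVec j) F ξ z := by
  have e : ((0, η, 0) : PV n) = ∑ j, η j • (covVec j : PV n) := by
    have := PV_eq_sum ((0, η, 0) : PV n)
    simpa [Dir.vec, covVec] using this
  rw [e, nab_sum_vec]
  simp only [nab_smul_vec]

lemma amp_add_left_sum (η : Eucl n) (t : ℝ) (x : Eucl n × Eucl n) :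
    amp α B (nab α D.U (0, η, 0) F) G p t x
      = ∑ j, (η j : ℂ) • amp α B (nab α D.U (covVec j) F) G p t x := by
  rw [nab_cov_eq_sum]
  simp only [amp, tw_sum, tw_smul, Finset.sum_mul, smul_mul_assoc]

lemma phaseLin_single (j : Fin n) (x : Eucl n × Eucl n) :
    phaseLin (EuclideanSpace.single j 1, 0) x = ((x.2 j : ℝ) : ℂ) := by
  simp [phaseLin_apply, EuclideanSpace.inner_single_left]

lemma hasDerivAt_amp (hF : Sm α D.U F) (hp : p ∈ dom n D.U) (t : ℝ) (x : Eucl n × Eucl n) :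
    HasDerivAt (fun t => amp α B F G p t x) (amp α B (nab α D.U (0, x.2, 0) F) G p t x) t := by
  have hp1 : p + covShift t x ∈ dom n D.U := by simpa [dom, covShift_apply] using hp
  have h1 : HasDerivAt (fun t : ℝ => p + covShift t x) (0, x.2, 0) t := by
    simp only [covShift_apply]
    refine HasDerivAt.const_add p ?_
    refine (hasDerivAt_const t (0 : Eucl n)).prodMk (HasDerivAt.prodMk ?_ (hasDerivAt_const t _))
    simpa using (hasDerivAt_id t).smul_const x.2
  have h2 := (hF.hasFDerivAt D.isOpen hp1).comp_hasDerivAt t h1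
  rw [fderiv_tw_eq hp1] at h2
  exact h2.mul_const _

/-- The derivative in `t` brings down the factors `η_j`. As `η_j` is conjugate to `y_j`, the partial
integration `J_phaseLin` turns it into a derivative in `y_j` of the weight and of the twisted
factor. The weight term is the error that disappears with the cutoff. -/
lemma J_hasDerivAt (hψ : Dec ψ) (hF : Sym α D m F) (hG : Sym α D m' G) (hp : p ∈ dom n D.U)
    (t₀ : ℝ) : HasDerivAt (fun t => J α B t ψ F G p)
      (-Complex.I • ∑ j, (J α B t₀ (dv (EuclideanSpace.single j 1, 0) ψ) (nab α D.U (covVec j) F) G p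
        + J α B t₀ ψ (nab α D.U (covVec j) F) (nab α D.U (twistVec B j) G) p)) t₀ := by
  have hFj : ∀ j, Sym α D m (nab α D.U (covVec j) F) := fun j => hF.nab_space _ _
  have hl : ∀ j : Fin n, Dec fun x => phaseLin (EuclideanSpace.single j 1, 0) x * ψ x := fun j =>
    hψ.mul_left (W_linear (I := Unit) (phaseLin (EuclideanSpace.single j 1, 0)))
  set q : ℝ := -(|m| + |m'|) - 2 * n - 1 with hq
  have hR : 0 ≤ |t₀| + 1 := by positivity
  choose C hC hb using fun j => integrand_bound (B := B) ((hl j).exists_W q) (hFj j) hG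
    (D.singleton_mem hp) hR
  have hInt := integrable_rpow_phase (n := n) (r := q + (|m| + |m'|)) (by linarith)
  have e : ∀ t x, (ψ x * phase x) • amp α B (nab α D.U (0, x.2, 0) F) G p t x
      = ∑ j, ((phaseLin (EuclideanSpace.single j 1, 0) x * ψ x) * phase x)
        • amp α B (nab α D.U (covVec j) F) G p t x := by
    intro t x
    rw [amp_add_left_sum, Finset.smul_sum]
    refine Finset.sum_congr rfl fun j _ => ?_
    rw [phaseLin_single, smul_smul]
    congr 1
    ring
  have h := (hasDerivAt_integral_of_dominated_loc_of_deriv_le (μ := volume)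
    (F := fun t x => (ψ x * phase x) • amp α B F G p t x)
    (F' := fun t x => (ψ x * phase x) • amp α B (nab α D.U (0, x.2, 0) F) G p t x)
    (bound := fun x => ∑ j, C j * bracket p.2.1 ^ (m + m') * (1 + ‖x‖) ^ (q + (|m| + |m'|)))
    (Metric.closedBall_mem_nhds t₀ one_pos)
    (Filter.Eventually.of_forall fun t =>
      (hF.sm.continuous_integrand hG.sm hψ.smooth hp t).aestronglyMeasurable)
    (hψ.integrable hF hG hp t₀) ?_ ?_ (integrable_finsetSum _ fun j _ => hInt.const_mul _) ?_).2
  · refine h.congr_deriv ?_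
    simp only [e]
    rw [integral_finsetSum _ fun j _ => (hl j).integrable (B := B) (hFj j) hG hp t₀,
      Finset.smul_sum]
    refine Finset.sum_congr rfl fun j _ => ?_
    have := J_phaseLin (B := B) hψ (hFj j) hG hp t₀ (EuclideanSpace.single j 1, 0)
    rw [J] at this
    rw [this]
    -- The direction `(e_j, 0)` has no component in `η`, so the partial integration puts no further
    -- derivative on the first factor.
    have e0 : nab α D.U (0, 0, 0) (nab α D.U (covVec j) F) = fun _ _ => 0 := nab_zero_vec
    have e1 : J α B t₀ ψ (fun _ _ => 0) G p = 0 := by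
      have : tw α (fun _ _ => (0 : A)) = fun _ => 0 := funext fun p => map_zero _
      simp [J, amp, this]
    simp [e0, e1, twistVec]
  · simp only [e]
    exact (continuous_finsetSum _ fun j _ => (hFj j).sm.continuous_integrand hG.sm
      (hl j).smooth hp t₀).aestronglyMeasurable
  · refine Filter.Eventually.of_forall fun x t ht => ?_
    rw [e]
    refine norm_sum_le_of_le _ fun j _ => hb j () p rfl t ?_ x
    have : |t - t₀| ≤ 1 := ht
    have := abs_sub_abs_le_abs_sub t t₀
    linarith
  · exact Filter.Eventually.of_forall fun x t _ => (hasDerivAt_amp hF.sm hp t x).fun_const_smul _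

end Homotopy

/-! ### The asymptotic expansion of the twisted product -/

section Expansion

variable {n : ℕ} {A : Type*} [CStarAlgebra A] {α : CStarAction n A} {B : Matrix (Fin n) (Fin n) ℝ}
  {D : ParamDomain} {F G : Eucl n → ℂ → A} {m m' : ℝ} {ψ : Eucl n × Eucl n → ℂ} {p : PV n}

open FourierTransform in
-- Substitute `v = εη`. The factor `2π` in the position variable matches the kernel `e^{-2πi⟨v,u⟩}`
-- of the Fourier transform `𝓕`.
lemma integral_bump_phase {ε : ℝ} (hε : 0 < ε) (u : Eucl n) :
    ∫ η, bumpS n (ε • η) * phase ((2 * Real.pi * ε) • u, η) = ((ε ^ n)⁻¹ : ℝ) • 𝓕 (bumpS n) u := by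
  have h := Measure.integral_comp_smul_of_nonneg volume
    (fun v : Eucl n => bumpS n v * phase ((2 * Real.pi) • u, v)) ε (hR := hε.le)
  rw [SchwartzMap.fourier_coe, Real.fourier_eq']
  rw [finrank_euclideanSpace_fin] at h
  have e1 : ∀ η : Eucl n, phase ((2 * Real.pi * ε) • u, η) = phase ((2 * Real.pi) • u, ε • η) := by
    intro η
    simp only [phase, inner_smul_left, inner_smul_right]
    congr 3
    push_cast
    simp
    ring
  simp only [e1]
  rw [h]
  congr 1
  congr 1
  funext v
  rw [smul_eq_mul, mul_comm, phase]
  congr 2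
  simp only [inner_smul_left]
  rw [real_inner_comm]
  push_cast
  simp
  ring

open FourierTransform in
-- At `t = 0` the amplitude does not depend on `η`, so the inner integral is a Fourier transform of
-- the bump. The substitution `y = 2πεu` leaves an integral over a fixed profile, in which the
-- amplitude concentrates at `y = 0` as `ε → 0`.
lemma J_zero_eq {ε : ℝ} (hε : 0 < ε) (hF : Sym α D m F) (hG : Sym α D m' G) (hp : p ∈ dom n D.U) :
    J α B 0 (cut (stdCut n) (ε, ε, 0)) F G p = (2 * Real.pi) ^ n • ∫ u : Eucl n,
      (bumpS n ((2 * Real.pi * ε ^ 2) • u) * 𝓕 (bumpS n) u)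
        • amp α B F G p 0 ((2 * Real.pi * ε) • u, 0) := by
  have hi := (Dec_cut (stdCut n) (θ := (ε, ε, 0)) hε hε).integrable (B := B) hF hG hp 0
  have hamp : ∀ y η : Eucl n, amp α B F G p 0 (y, η) = amp α B F G p 0 (y, 0) := by
    intro y η; simp [amp, covShift_apply, actShift_apply]
  rw [J]
  rw [Measure.volume_eq_prod] at hi ⊢
  rw [integral_prod _ hi]
  have e1 : ∀ y : Eucl n, ∫ η, (cut (stdCut n) (ε, ε, 0) (y, η) * phase (y, η)) • amp α B F G p 0 (y, η)
      = (bumpS n (ε • y) * ∫ η, bumpS n (ε • η) * phase (y, η)) • amp α B F G p 0 (y, 0) := by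
    intro y
    rw [← integral_const_mul, ← integral_smul_const]
    congr 1
    funext η
    rw [hamp]
    simp [cut, stdCut_apply, mul_assoc]
  simp only [e1]
  have h2 : 0 < 2 * Real.pi * ε := by positivity
  have h := Measure.integral_comp_smul_of_nonneg volume (fun y : Eucl n =>
    (bumpS n (ε • y) * ∫ η, bumpS n (ε • η) * phase (y, η)) • amp α B F G p 0 (y, 0))
    (2 * Real.pi * ε) (hR := h2.le)
  rw [finrank_euclideanSpace_fin] at h
  have h3 := congrArg (fun a => (2 * Real.pi * ε) ^ n • a) h
  simp only [smul_smul] at h3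
  rw [mul_inv_cancel₀ (by positivity), one_smul] at h3
  rw [← h3, mul_pow, mul_smul, ← integral_smul]
  congr 1
  congr 1
  funext u
  rw [integral_bump_phase hε, show (ε * (2 * Real.pi * ε)) = 2 * Real.pi * ε ^ 2 by ring,
    mul_smul_comm, smul_assoc, smul_smul, mul_inv_cancel₀ (by positivity), one_smul]

open FourierTransform in
/-- The oscillatory integral degenerates to a product at `t = 0`. -/
lemma JI_zero_tendsto (hF : Sym α D m F) (hG : Sym α D m' G) (ξ : Eucl n) {z : ℂ} (hz : z ∈ D.U) :
    Filter.Tendsto (fun ε : ℝ => JI α B D.U 0 (cut (stdCut n) (ε, ε, 0)) F G ξ z) (𝓝[>] 0)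
      (𝓝 (F ξ z * G ξ z)) := by
  have hp : ((0, ξ, z) : PV n) ∈ dom n D.U := hz
  obtain ⟨C, hC, hb⟩ := amp_bound (B := B) hF hG (D.singleton_mem hz) le_rfl
  set r : ℝ := |m| + |m'| with hr
  have hr0 : 0 ≤ r := by positivity
  set φ := 𝓕 (bumpS n) with hφ
  have hcont := hF.sm.continuous_amp (B := B) hG.sm hp 0
  obtain ⟨Cφ, hCφ⟩ : ∃ Cφ : ℝ, ∀ x, ‖bumpS n x‖ ≤ Cφ := by
    obtain ⟨C, h⟩ := (bumpS n).decay 0 0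
    exact ⟨C, fun x => by simpa using h.2 x⟩
  have hCφ0 : 0 ≤ Cφ := (norm_nonneg _).trans (hCφ 0)
  have hφi : Integrable fun u : Eucl n => ‖φ u‖ * (1 + ‖u‖) ^ (⌈r⌉₊) := by
    have h1 : ∀ k, Integrable fun u : Eucl n => ‖u‖ ^ k * ‖φ u‖ := fun k =>
      φ.integrable_pow_mul volume k
    have e : (fun u : Eucl n => ‖φ u‖ * (1 + ‖u‖) ^ (⌈r⌉₊)) = fun u =>
        ∑ k ∈ Finset.range (⌈r⌉₊ + 1), ((⌈r⌉₊).choose k : ℝ) * (‖u‖ ^ k * ‖φ u‖) := by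
      funext u
      rw [add_comm 1, add_pow, Finset.mul_sum]
      refine Finset.sum_congr rfl fun k _ => ?_
      simp
      ring
    rw [e]
    exact integrable_finsetSum _ fun k _ => (h1 k).const_mul _
  have hlim : Filter.Tendsto (fun ε : ℝ => ∫ u : Eucl n,
      (bumpS n ((2 * Real.pi * ε ^ 2) • u) * φ u)
        • amp α B F G (0, ξ, z) 0 ((2 * Real.pi * ε) • u, 0)) (𝓝[>] 0)
      (𝓝 (∫ u : Eucl n, φ u • (F ξ z * G ξ z))) := by
    refine tendsto_integral_filter_of_dominated_convergence (fun u => Cφ * (C *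
      bracket ξ ^ (m + m') * (1 + 2 * Real.pi) ^ r) * (‖φ u‖ * (1 + ‖u‖) ^ (⌈r⌉₊))) ?_ ?_ ?_ ?_
    · refine Filter.Eventually.of_forall fun ε => Continuous.aestronglyMeasurable ?_
      refine (((bumpS n).continuous.comp (by fun_prop)).mul φ.continuous).smul ?_
      exact hcont.comp (by fun_prop)
    · filter_upwards [Ioo_mem_nhdsGT (zero_lt_one (α := ℝ))] with ε hε
      refine Filter.Eventually.of_forall fun u => ?_
      have hπ := Real.pi_pos
      have h1 := hb (0, ξ, z) rfl 0 (by simp) ((2 * Real.pi * ε) • u, 0)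
      have h2 : (1 + ‖(((2 * Real.pi * ε) • u, 0) : Eucl n × Eucl n)‖) ^ r
          ≤ (1 + 2 * Real.pi) ^ r * (1 + ‖u‖) ^ (⌈r⌉₊) := by
        have h3 : ‖(((2 * Real.pi * ε) • u, 0) : Eucl n × Eucl n)‖ ≤ 2 * Real.pi * ‖u‖ := by
          rw [Prod.norm_def, norm_zero, max_eq_left (norm_nonneg _), norm_smul,
            Real.norm_of_nonneg (mul_nonneg (by positivity) hε.1.le)]
          refine mul_le_mul_of_nonneg_right ?_ (norm_nonneg _)
          exact mul_le_of_le_one_right (by positivity) hε.2.le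
        refine (one_add_norm_rpow_mul (by positivity : 0 ≤ 2 * Real.pi) hr0 h3).trans ?_
        refine mul_le_mul_of_nonneg_left ?_ (by positivity)
        rw [← Real.rpow_natCast]
        exact Real.rpow_le_rpow_of_exponent_le (one_le_one_add_norm u) (Nat.le_ceil r)
      rw [norm_smul, norm_mul]
      calc _ ≤ (Cφ * ‖φ u‖) * (C * bracket ξ ^ (m + m') *
            ((1 + 2 * Real.pi) ^ r * (1 + ‖u‖) ^ (⌈r⌉₊))) := by
            refine mul_le_mul (mul_le_mul_of_nonneg_right (hCφ _) (norm_nonneg _)) (h1.trans ?_)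
              (norm_nonneg _) (by positivity)
            exact mul_le_mul_of_nonneg_left h2 (mul_nonneg hC (bracket_rpow_pos _ _).le)
        _ = _ := by ring
    · exact hφi.const_mul _
    · refine Filter.Eventually.of_forall fun u => ?_
      have hc : Continuous fun ε : ℝ => (bumpS n ((2 * Real.pi * ε ^ 2) • u) * φ u)
          • amp α B F G (0, ξ, z) 0 ((2 * Real.pi * ε) • u, 0) := by
        refine (((bumpS n).continuous.comp (by fun_prop)).mul_const _).smul ?_
        exact hcont.comp (by fun_prop)
      have := (hc.tendsto 0).mono_left (nhdsWithin_le_nhds (s := Set.Ioi 0))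
      simpa [bumpS_zero, amp, covShift_apply, actShift_apply, matVec, Prod.mk_zero_zero] using this
  -- Fourier inversion at the origin: the integral of the transform is the value of the bump at `0`.
  have hinv : ∫ u : Eucl n, φ u = 1 := by
    have h1 : 𝓕⁻ (𝓕 (bumpS n)) = bumpS n := FourierTransform.fourierInv_fourier_eq _
    have h2 := congrArg (fun f : 𝓢(Eucl n, ℂ) => f 0) h1
    simp only [SchwartzMap.fourierInv_coe, Real.fourierInv_eq', bumpS_zero] at h2
    simpa using h2
  rw [integral_smul_const, hinv, one_smul] at hlim
  refine hlim.congr' ?_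
  filter_upwards [self_mem_nhdsWithin] with ε hε
  simp only [JI, hz, if_true]
  rw [J_zero_eq hε hF hG hp, smul_smul, cn, inv_mul_cancel₀ (by positivity), one_smul]

/-- Rapid decay of each single weight only serves to identify `J` with `osc`. The constant comes
from `osc_bound` and depends on the common bounds of growth `0`, hence is uniform over the family
and over `|t| ≤ 1`. -/
lemma JI_bound {I : Type*} {ψ : I → Eucl n × Eucl n → ℂ} (hψ : W 0 ψ) (hd : ∀ i, Dec (ψ i))
    (hF : Sym α D m F) (hG : Sym α D m' G) {K : Set ℂ} (hK : K ∈ D.fam) :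
    ∃ C : ℝ, 0 ≤ C ∧ ∀ i, ∀ t : ℝ, |t| ≤ 1 → ∀ z ∈ K, ∀ ξ,
      ‖JI α B D.U t (ψ i) F G ξ z‖ ≤ C * bracket ξ ^ (m + m') := by
  obtain ⟨M, hM⟩ := exists_order n 0 (|m| + |m'|)
  obtain ⟨C, hC, hb⟩ := osc_bound (B := B) M hψ hF hG hM hK zero_le_one
  refine ⟨|cn n| * C, by positivity, fun i t ht z hz ξ => ?_⟩
  have hzU := D.sub K hK hz
  simp only [JI, hzU, if_true]
  rw [norm_smul, Real.norm_eq_abs, mul_assoc, ← osc_eq_J M (hd i) hF hG hzU t]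
  exact mul_le_mul_of_nonneg_left (hb i (0, ξ, z) hz t ht) (abs_nonneg _)

/-- The cutoffs with parameter in `(0, 1]`. -/
lemma W_cut_Ioc (χ : 𝓢(Eucl n × Eucl n, ℂ)) :
    W 0 fun ε : Set.Ioc (0 : ℝ) 1 => cut χ ((ε : ℝ), (ε : ℝ), 0) :=
  W_cut χ fun ε => by
    have : |(ε : ℝ)| ≤ 1 := by rw [abs_of_pos ε.2.1]; exact ε.2.2
    exact ⟨this, this⟩

open LineDeriv in
/-- Derivatives of the cutoff contribute arbitrarily little. -/
lemma JI_dv_cut_small (χ : 𝓢(Eucl n × Eucl n, ℂ)) (v : Eucl n) (hF : Sym α D m F)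
    (hG : Sym α D m' G) (ξ : Eucl n) {z : ℂ} (hz : z ∈ D.U) {δ : ℝ} (hδ : 0 < δ) :
    ∀ᶠ ε : ℝ in 𝓝[>] 0, ∀ t ∈ Set.Icc (0 : ℝ) 1,
      ‖JI α B D.U t (dv (v, 0) (cut χ (ε, ε, 0))) F G ξ z‖ ≤ δ := by
  set χ' := ∂_{((v, 0) : Eucl n × Eucl n)} χ with hχ'
  obtain ⟨C, hC, hb⟩ := JI_bound (B := B) (W_cut_Ioc χ') (fun ε => Dec_cut χ' ε.2.1 ε.2.1) hF hG
    (D.singleton_mem hz)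
  set C' := C * bracket ξ ^ (m + m') with hC'
  have hC'0 : 0 ≤ C' := mul_nonneg hC (bracket_rpow_pos _ _).le
  have hδ' : 0 < min 1 (δ / (C' + 1)) := by positivity
  filter_upwards [Ioo_mem_nhdsGT hδ'] with ε hε t ht
  have hε1 : ε < 1 := hε.2.trans_le (min_le_left _ _)
  have hε2 : ε * (C' + 1) < δ := (lt_div_iff₀ (by positivity)).1 (hε.2.trans_le (min_le_right _ _))
  -- Differentiating the cutoff in the position variable extracts one factor `ε`. What remains is a
  -- cutoff integral, which is bounded uniformly in `ε` and `t`.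
  have e : JI α B D.U t (dv (v, 0) (cut χ (ε, ε, 0))) F G ξ z
      = (ε : ℂ) • JI α B D.U t (cut χ' (ε, ε, 0)) F G ξ z := by
    have h0 : ∂_{((0, 0) : Eucl n × Eucl n)} χ = 0 := by
      ext x; rw [SchwartzMap.lineDerivOp_apply_eq_fderiv]; exact map_zero _
    simp only [JI, hz, if_true, J]
    rw [smul_comm (ε : ℂ), ← integral_smul (ε : ℂ), dv_cut]
    congr 2
    funext x
    simp [h0, smul_smul, mul_assoc, cut, hχ']
  rw [e, norm_smul, Complex.norm_real, Real.norm_of_nonneg hε.1.le]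
  have h := hb ⟨ε, hε.1, hε1.le⟩ t (by rw [abs_of_nonneg ht.1]; exact ht.2) z rfl ξ
  have := mul_le_mul_of_nonneg_left h hε.1.le
  nlinarith [hε.1]

/-- The Taylor polynomial of the homotopy. -/
def taylor (α : CStarAction n A) (B : Matrix (Fin n) (Fin n) ℝ) (U : Set ℂ) (N : ℕ) (t : ℝ)
    (F G : Eucl n → ℂ → A) (ξ : Eucl n) (z : ℂ) : A :=
  ∑ k ∈ Finset.range N, ((-Complex.I * t) ^ k / (k.factorial : ℂ)) • expOp α B U k F G ξ z

/-- The Taylor polynomial satisfies the differential equation of the phase-space integral without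
the cutoff error, with the number of terms dropping by one. This makes the comparison inductive. -/
lemma taylor_hasDerivAt (U : Set ℂ) (N : ℕ) (ξ : Eucl n) (z : ℂ) (t : ℝ) :
    HasDerivAt (fun t => taylor α B U (N + 1) t F G ξ z)
      (-Complex.I • ∑ j, taylor α B U N t (nab α U (covVec j) F) (nab α U (twistVec B j) G) ξ z)
      t := by
  have h1 : ∀ k : ℕ, HasDerivAt (fun t : ℝ => (-Complex.I * t) ^ (k + 1) / ((k + 1).factorial : ℂ))
      (-Complex.I * ((-Complex.I * t) ^ k / (k.factorial : ℂ))) t := by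
    intro k
    have h2 : HasDerivAt (fun t : ℝ => -Complex.I * (t : ℂ)) (-Complex.I) t := by
      simpa using (Complex.ofRealCLM.hasDerivAt (x := t)).const_mul (-Complex.I)
    refine ((h2.fun_pow (k + 1)).div_const _).congr_deriv ?_
    have : (k.factorial : ℂ) ≠ 0 := by exact_mod_cast k.factorial_ne_zero
    have : (k : ℂ) + 1 ≠ 0 := by exact_mod_cast k.succ_ne_zero
    rw [Nat.factorial_succ]
    push_cast
    field_simp
  simp only [taylor]
  simp only [Finset.sum_range_succ' _ N]
  simp only [pow_zero]
  refine ((HasDerivAt.fun_sum (u := Finset.range N) fun k _ => (h1 k).smul_const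
    (expOp α B U (k + 1) F G ξ z)).add_const _).congr_deriv ?_
  rw [Finset.sum_comm, Finset.smul_sum]
  refine Finset.sum_congr rfl fun k _ => ?_
  rw [expOp, mul_smul, Finset.smul_sum]

lemma taylor_zero (U : Set ℂ) (N : ℕ) (ξ : Eucl n) (z : ℂ) :
    taylor α B U (N + 1) 0 F G ξ z = F ξ z * G ξ z := by
  simp [taylor, Finset.sum_range_succ', expOp]

/-- Induction on `N`. The `t`-derivative of the difference is a sum of cutoff errors and of the same
differences with one term fewer for the pairs `(∂_j F, D_j G)`, whose total order is lower by one.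
The mean value inequality then bounds the difference on `[0, 1]`. The constant is uniform in `z ∈ K`
and `ξ`; only the range of admissible `ε` depends on `z`, `ξ` and `δ`. -/
lemma JI_sub_taylor_bound (N : ℕ) (hF : Sym α D m F) (hG : Sym α D m' G) {K : Set ℂ}
    (hK : K ∈ D.fam) : ∃ C : ℝ, 0 ≤ C ∧ ∀ z ∈ K, ∀ ξ, ∀ δ > 0, ∀ᶠ ε : ℝ in 𝓝[>] 0,
      ∀ t ∈ Set.Icc (0 : ℝ) 1, ‖JI α B D.U t (cut (stdCut n) (ε, ε, 0)) F G ξ z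
        - taylor α B D.U N t F G ξ z‖ ≤ C * bracket ξ ^ (m + m' - N) + δ := by
  induction N generalizing m m' F G with
  | zero =>
    obtain ⟨C, hC, hb⟩ := JI_bound (B := B) (W_cut_Ioc (stdCut n))
      (fun ε => Dec_cut (stdCut n) ε.2.1 ε.2.1) hF hG hK
    refine ⟨C, hC, fun z hz ξ δ hδ => ?_⟩
    filter_upwards [Ioo_mem_nhdsGT (zero_lt_one (α := ℝ))] with ε hε t ht
    have := hb ⟨ε, hε.1, hε.2.le⟩ t (by rw [abs_of_nonneg ht.1]; exact ht.2) z hz ξ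
    simp only [taylor, Finset.range_zero, Finset.sum_empty, sub_zero, Nat.cast_zero]
    linarith
  | succ N ih =>
    have hFj := fun j => hF.nab_covVec j
    have hGj := fun j => hG.nab_twistVec (B := B) j
    choose C hC hb using fun j => ih (hFj j) (hGj j)
    refine ⟨∑ j, C j, Finset.sum_nonneg fun j _ => hC j, fun z hz ξ δ hδ => ?_⟩
    have hzU := D.sub K hK hz
    -- There are `2n + 1` errors: for each `j` one from the derivative of the cutoff and one from
    -- the induction hypothesis, and one from the initial value at `t = 0`.
    set δ' := δ / (2 * n + 1) with hδ'
    have hδ'0 : 0 < δ' := by positivity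
    have ev1 : ∀ᶠ ε : ℝ in 𝓝[>] 0, ∀ j, ∀ t ∈ Set.Icc (0 : ℝ) 1,
        ‖JI α B D.U t (cut (stdCut n) (ε, ε, 0)) (nab α D.U (covVec j) F)
          (nab α D.U (twistVec B j) G) ξ z - taylor α B D.U N t (nab α D.U (covVec j) F)
          (nab α D.U (twistVec B j) G) ξ z‖ ≤ C j * bracket ξ ^ (m + m' - (N + 1 : ℕ)) + δ' := by
      rw [Filter.eventually_all]
      intro j
      have := hb j z hz ξ δ' hδ'0
      rwa [show m + -1 + (m' + 0) - (N : ℝ) = m + m' - (N + 1 : ℕ) by push_cast; ring] at this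
    have ev2 : ∀ᶠ ε : ℝ in 𝓝[>] 0, ∀ j : Fin n, ∀ t ∈ Set.Icc (0 : ℝ) 1,
        ‖JI α B D.U t (dv (EuclideanSpace.single j 1, 0) (cut (stdCut n) (ε, ε, 0)))
          (nab α D.U (covVec j) F) G ξ z‖ ≤ δ' := by
      rw [Filter.eventually_all]
      exact fun j => JI_dv_cut_small _ _ (hFj j) hG ξ hzU hδ'0
    have ev3 : ∀ᶠ ε : ℝ in 𝓝[>] 0,
        ‖JI α B D.U 0 (cut (stdCut n) (ε, ε, 0)) F G ξ z - F ξ z * G ξ z‖ ≤ δ' := by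
      have h := (JI_zero_tendsto (B := B) hF hG ξ hzU).sub_const (F ξ z * G ξ z)
      rw [sub_self] at h
      have h' := h.norm
      rw [norm_zero] at h'
      exact (h'.eventually_lt_const hδ'0).mono fun _ h => h.le
    filter_upwards [ev1, ev2, ev3, self_mem_nhdsWithin] with ε h1 h2 h3 hε t ht
    set ψ := cut (stdCut n) (ε, ε, 0) with hψ
    have hdec : Dec ψ := Dec_cut _ hε hε
    set b := bracket ξ ^ (m + m' - (N + 1 : ℕ)) with hbdef
    have hderiv : ∀ t, HasDerivAt (fun t => JI α B D.U t ψ F G ξ z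
        - taylor α B D.U (N + 1) t F G ξ z) (-Complex.I • ∑ j,
          (JI α B D.U t (dv (EuclideanSpace.single j 1, 0) ψ) (nab α D.U (covVec j) F) G ξ z
          + (JI α B D.U t ψ (nab α D.U (covVec j) F) (nab α D.U (twistVec B j) G) ξ z
            - taylor α B D.U N t (nab α D.U (covVec j) F) (nab α D.U (twistVec B j) G) ξ z))) t := by
      intro t
      have e1 := (J_hasDerivAt (B := B) hdec hF hG (p := (0, ξ, z)) hzU t).fun_const_smul (cn n)
      have e0 : (fun t => JI α B D.U t ψ F G ξ z) = fun t => cn n • J α B t ψ F G (0, ξ, z) := by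
        funext t; simp only [JI, hzU, if_true]
      rw [← e0] at e1
      refine (e1.fun_sub (taylor_hasDerivAt D.U N ξ z t)).congr_deriv ?_
      rw [smul_comm (cn n), ← smul_sub, Finset.smul_sum, ← Finset.sum_sub_distrib]
      congr 2
      funext j
      simp only [JI, hzU, if_true, smul_add]
      abel
    have key := norm_image_sub_le_of_norm_deriv_le_segment' (a := 0) (b := 1)
      (fun t _ => (hderiv t).hasDerivWithinAt) (C := ∑ j, (δ' + (C j * b + δ'))) (by
        intro t ht
        rw [norm_smul, norm_neg, Complex.norm_I, one_mul]
        refine norm_sum_le_of_le _ fun j _ => ?_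
        exact norm_add_le_of_le (h2 j t ⟨ht.1, ht.2.le⟩) (h1 j t ⟨ht.1, ht.2.le⟩)) t ht
    rw [taylor_zero] at key
    have hS : ∑ j : Fin n, (δ' + (C j * b + δ')) = (∑ j, C j) * b + 2 * n * δ' := by
      simp only [Finset.sum_add_distrib, Finset.sum_mul, Finset.sum_const, Finset.card_univ,
        Fintype.card_fin, nsmul_eq_mul]
      ring
    have hS0 : 0 ≤ (∑ j, C j) * b + 2 * n * δ' := by
      have := Finset.sum_nonneg fun j (_ : j ∈ Finset.univ) => hC j
      have := bracket_rpow_pos ξ (m + m' - (N + 1 : ℕ))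
      positivity
    have hδe : 2 * n * δ' + δ' = δ := by rw [hδ']; field_simp
    rw [hS] at key
    have h4 : ((∑ j, C j) * b + 2 * n * δ') * (t - 0) ≤ (∑ j, C j) * b + 2 * n * δ' :=
      mul_le_of_le_one_right hS0 (by linarith [ht.2])
    have h5 := norm_le_norm_add_norm_sub' (JI α B D.U t ψ F G ξ z
      - taylor α B D.U (N + 1) t F G ξ z) (JI α B D.U 0 ψ F G ξ z - F ξ z * G ξ z)
    linarith

/-- The remainder in the expansion of the twisted product. -/
theorem leibnizOp_remainder (N : ℕ) : LeibnizOp α D (-(N : ℝ)) fun F G ξ z =>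
    oscI α B D.U 1 F G ξ z - taylor α B D.U N 1 F G ξ z := by
  have h0 : LeibnizOp α D 0 fun F G ξ z =>
      oscI α B D.U 1 F G ξ z - taylor α B D.U N 1 F G ξ z := by
    have h1 := (leibnizOp_oscI (α := α) (B := B) (D := D) 1).add ((LeibnizOp.sum
      (Finset.range N) fun k _ => ((leibnizOp_expOp (α := α) (B := B) (D := D) k).mono
        (s := 0) (by simp)).smul ((-Complex.I * (1 : ℝ)) ^ k / (k.factorial : ℂ))).smul (-1))
    simpa only [taylor, neg_smul, one_smul, ← sub_eq_add_neg] using h1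
  refine { h0 with bound := fun {m m' F G} hF hG K hK => ?_ }
  obtain ⟨C, hC, hb⟩ := JI_sub_taylor_bound (B := B) N hF hG hK
  refine ⟨C, fun z hz ξ => ?_⟩
  rw [← sub_eq_add_neg]
  -- The constant `C` does not depend on `δ`. For fixed `δ` the cutoff is removed first; then `δ` is
  -- arbitrary.
  refine le_of_forall_pos_le_add fun δ hδ => ?_
  have h1 := ((JI_tendsto (B := B) (stdCut n) stdCut_zero hF hG 1 ξ z).sub_const
    (taylor α B D.U N 1 F G ξ z)).norm
  refine le_of_tendsto h1 ?_
  filter_upwards [hb z hz ξ δ hδ] with ε hε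
  exact hε 1 (by simp)

end Expansion

/-! ### Multi-index form of the expansion -/

section MultiIndexExpansion

variable {n : ℕ} {A : Type*} [CStarAlgebra A] {α : CStarAction n A} {B : Matrix (Fin n) (Fin n) ℝ}
  {U : Set ℂ} {F G : Eucl n → ℂ → A}

lemma multiFactorial_ne_zero (κ : Fin n → ℕ) : (multiFactorial κ : ℂ) ≠ 0 := by
  simp [multiFactorial, Finset.prod_ne_zero_iff, Nat.factorial_ne_zero]

lemma multiFactorial_add_single (κ : Fin n → ℕ) (j : Fin n) :
    multiFactorial (κ + Pi.single j 1) = (κ j + 1) * multiFactorial κ := by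
  unfold multiFactorial
  rw [← Finset.mul_prod_erase _ _ (Finset.mem_univ j),
    ← Finset.mul_prod_erase _ (fun i => (κ i).factorial) (Finset.mem_univ j)]
  have : ∀ i ∈ Finset.univ.erase j, ((κ + Pi.single j 1 : Fin n → ℕ) i).factorial
      = (κ i).factorial := by
    intro i hi
    simp [Finset.ne_of_mem_erase hi]
  rw [Finset.prod_congr rfl this]
  simp [Nat.factorial_succ, mul_assoc]

lemma mem_piAntidiag_univ {k : ℕ} {κ : Fin n → ℕ} :
    κ ∈ Finset.piAntidiag (Finset.univ : Finset (Fin n)) k ↔ len κ = k := by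
  simp [len]

/-- `∑_j ∑_{|κ| = k} Φ(κ + e_j) / κ! = (k + 1) ∑_{|κ| = k + 1} Φ(κ) / κ!`. -/
lemma sum_piAntidiag_succ {V : Type*} [AddCommGroup V] [Module ℂ V] (Φ : (Fin n → ℕ) → V) (k : ℕ) :
    ∑ j, ∑ κ ∈ Finset.piAntidiag (Finset.univ : Finset (Fin n)) k,
      (multiFactorial κ : ℂ)⁻¹ • Φ (κ + Pi.single j 1)
    = ((k + 1 : ℕ) : ℂ) • ∑ κ ∈ Finset.piAntidiag (Finset.univ : Finset (Fin n)) (k + 1),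
      (multiFactorial κ : ℂ)⁻¹ • Φ κ := by
  -- Reindexing by `κ ↦ κ + e_j` turns `1/κ!` into `κ_j/κ!` for the new index. The indices with `κ_j
  -- = 0`, which the shift misses, have coefficient zero. Summing `κ_j` over `j` afterwards produces
  -- the factor `k + 1`.
  have h : ∀ j, ∑ κ ∈ Finset.piAntidiag (Finset.univ : Finset (Fin n)) k,
      (multiFactorial κ : ℂ)⁻¹ • Φ (κ + Pi.single j 1)
      = ∑ κ ∈ Finset.piAntidiag (Finset.univ : Finset (Fin n)) (k + 1),
        ((κ j : ℂ) * (multiFactorial κ : ℂ)⁻¹) • Φ κ := by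
    intro j
    refine Finset.sum_of_injOn (fun κ => κ + Pi.single j 1) ?_ ?_ ?_ ?_
    · intro κ _ κ' _ h
      exact add_right_cancel h
    · intro κ hκ
      have := mem_piAntidiag_univ.1 hκ
      exact mem_piAntidiag_univ.2 (by rw [len_add_single, this])
    · intro κ hκ hn
      by_cases h0 : κ j = 0
      · simp [h0]
      · refine absurd ⟨κ - Pi.single j 1, ?_, ?_⟩ hn
        · have e : κ - Pi.single j 1 + Pi.single j 1 = κ := by
            funext i
            by_cases hi : i = j
            · subst hi; simp; omega
            · simp [hi]
          refine Finset.mem_coe.2 (mem_piAntidiag_univ.2 ?_)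
          have h1 := mem_piAntidiag_univ.1 hκ
          rw [← e, len_add_single] at h1
          omega
        · funext i
          by_cases hi : i = j
          · subst hi; simp; omega
          · simp [hi]
    · intro κ _
      have h1 := multiFactorial_ne_zero κ
      have h2 : (κ j : ℂ) + 1 ≠ 0 := by exact_mod_cast (κ j).succ_ne_zero
      congr 1
      rw [multiFactorial_add_single]
      simp only [Pi.add_apply, Pi.single_eq_same]
      push_cast
      field_simp
  simp only [h]
  rw [Finset.sum_comm, Finset.smul_sum]
  refine Finset.sum_congr rfl fun κ hκ => ?_
  rw [← Finset.sum_smul, ← Finset.sum_mul, smul_smul, ← mem_piAntidiag_univ.1 hκ, len]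
  push_cast
  rfl

/-- The multinomial formula for the `k`-th power of `∑_j ∂_j ⊗ D_j`, whose summands commute. -/
lemma expOp_eq (hU : IsOpen U) (hF : Sm α U F) (hG : Sm α U G) (k : ℕ) (ξ : Eucl n) (z : ℂ) :
    expOp α B U k F G ξ z = (k.factorial : ℂ) •
      ∑ κ ∈ Finset.piAntidiag (Finset.univ : Finset (Fin n)) k, (multiFactorial κ : ℂ)⁻¹ •
        (mnab α U covVec κ F ξ z * mnab α U (twistVec B) κ G ξ z) := by
  induction k generalizing F G with
  | zero => simp [expOp, mnab_zero, multiFactorial]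
  | succ k ih =>
    rw [expOp]
    simp only [ih (hF.nab hU _) (hG.nab hU _), mnab_nab hU hF, mnab_nab hU hG]
    rw [← Finset.smul_sum, sum_piAntidiag_succ (fun κ => mnab α U covVec κ F ξ z *
      mnab α U (twistVec B) κ G ξ z), smul_smul, Nat.factorial_succ, mul_comm]
    push_cast
    rfl

lemma taylor_eq_sharpTerm (hU : IsOpen U) (hF : Sm α U F) (hG : Sm α U G) (N : ℕ) (ξ : Eucl n)
    {z : ℂ} (hz : z ∈ U) :
    taylor α B U N 1 F G ξ z = ∑ j ∈ Finset.range N, sharpTerm α B F G j ξ z := by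
  refine Finset.sum_congr rfl fun k _ => ?_
  have hk : (k.factorial : ℂ) ≠ 0 := by exact_mod_cast k.factorial_ne_zero
  rw [expOp_eq hU hF hG, smul_smul, sharpTerm, div_mul_cancel₀ _ hk, Finset.smul_sum]
  refine Finset.sum_congr rfl fun κ hκ => ?_
  rw [mpd_eq hU hF hz, twistDeriv_eq hU hG hz, smul_smul, mem_piAntidiag_univ.1 hκ]
  simp [div_eq_mul_inv]

end MultiIndexExpansion

/-! ### Smooth maps into the smooth subalgebra -/

section SmoothMaps

variable {n : ℕ} {A : Type*} [CStarAlgebra A]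

/-- The derivative of `s ↦ α_s(H_γ)` for a family `H` with `H_{γ + e_j}` the `j`-th derivative of
`H_γ`. -/
def actD (α : CStarAction n A) (H : (Fin n → ℕ) → A) (γ : Fin n → ℕ) (s : Eucl n) :
    Eucl n →L[ℝ] A :=
  ∑ j, (EuclideanSpace.proj j : Eucl n →L[ℝ] ℝ).smulRight (α.act s (H (γ + Pi.single j 1)))

/-- Families consisting of all derivatives of an element of the smooth subalgebra. -/
def Compat (α : CStarAction n A) (H : (Fin n → ℕ) → A) : Prop :=
  ∀ γ s, HasFDerivAt (fun s => α.act s (H γ)) (actD α H γ s) s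

variable {α : CStarAction n A}

lemma actD_apply (H : (Fin n → ℕ) → A) (γ : Fin n → ℕ) (s v : Eucl n) :
    actD α H γ s v = ∑ j, v j • α.act s (H (γ + Pi.single j 1)) := by
  simp [actD]

lemma norm_actD_le (H : (Fin n → ℕ) → A) (γ : Fin n → ℕ) (s : Eucl n) :
    ‖actD α H γ s‖ ≤ ∑ j, ‖H (γ + Pi.single j 1)‖ := by
  refine ContinuousLinearMap.opNorm_le_bound _ (Finset.sum_nonneg fun j _ => norm_nonneg _)
    fun v => ?_
  rw [actD_apply, Finset.sum_mul]
  refine norm_sum_le_of_le _ fun j _ => ?_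
  rw [norm_smul, norm_act, mul_comm]
  exact mul_le_mul_of_nonneg_left (PiLp.norm_apply_le v j) (norm_nonneg _)

lemma actD_sub (H H' : (Fin n → ℕ) → A) (γ : Fin n → ℕ) (s : Eucl n) :
    actD α H γ s - actD α H' γ s = actD α (fun γ => H γ - H' γ) γ s := by
  ext v
  simp only [sub_apply, actD_apply, map_sub, smul_sub, Finset.sum_sub_distrib]

lemma sm_const {a : A} (ha : a ∈ smoothSet α) (U : Set ℂ) : Sm α U (fun _ _ => a) := by
  have h : ContDiff ℝ ∞ fun p : PV n => α.act p.1 a :=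
    ContDiff.comp (g := fun t => α.act t a) ha contDiff_fst
  exact h.contDiffOn

lemma nab_act_eq_sum {U : Set ℂ} {F : Eucl n → ℂ → A} (s : Eucl n) :
    nab α U (s, 0, 0) F = fun ξ z => ∑ j, (s j : ℂ) • nab α U (actVec j) F ξ z := by
  have e : ((s, 0, 0) : PV n) = ∑ j, s j • (actVec j : PV n) := by
    have := PV_eq_sum ((s, 0, 0) : PV n)
    simpa [Dir.vec, actVec] using this
  rw [e, nab_sum_vec]
  simp only [nab_smul_vec]

lemma compat_of_mem {a : A} (ha : a ∈ smoothSet α) :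
    Compat α fun γ => mpd γ (fun t => α.act t a) 0 := by
  intro γ s
  have hsm := sm_const ha Set.univ
  have e : ∀ γ, mpd γ (fun t => α.act t a) 0 = mnab α Set.univ actVec γ (fun _ _ => a) 0 0 :=
    fun γ => mpd_act_eq isOpen_univ hsm 0 (Set.mem_univ 0) γ
  have h2 : HasFDerivAt (fun s : Eucl n => ((s, 0, 0) : PV n))
      ((ContinuousLinearMap.id ℝ (Eucl n)).prod 0) s :=
    (hasFDerivAt_id s).prodMk (hasFDerivAt_const (0 : Eucl n × ℂ) s)
  have h1 := ((hsm.mnab isOpen_univ actVec γ).hasFDerivAt isOpen_univ (p := (s, 0, 0))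
    (Set.mem_univ _)).comp s h2
  simp only [e]
  refine HasFDerivAt.congr_fderiv (f' := _) h1 ?_
  ext v
  rw [actD_apply, ContinuousLinearMap.comp_apply, fderiv_tw_eq (U := Set.univ) (Set.mem_univ _)]
  change tw α (nab α Set.univ (v, 0, 0) _) (s, 0, 0) = _
  rw [nab_act_eq_sum, tw_sum]
  refine Finset.sum_congr rfl fun j _ => ?_
  rw [tw_smul, ← mnab_nab isOpen_univ hsm, nab_mnab isOpen_univ hsm]
  simp [tw]

/-- As every `α_s` is isometric, convergence of the components makes the derivatives `actD` converge
uniformly in `s`. A limit of differentiable maps whose derivatives converge uniformly is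
differentiable with the limiting derivative. -/
lemma Compat.of_tendsto {ι : Type*} {l : Filter ι} [l.NeBot] {a : ι → (Fin n → ℕ) → A}
    {b : (Fin n → ℕ) → A} (h : ∀ᶠ i in l, Compat α (a i))
    (hl : ∀ γ, Filter.Tendsto (fun i => a i γ) l (𝓝 (b γ))) : Compat α b := by
  intro γ s
  refine hasFDerivAt_of_tendstoUniformlyOnFilter (l := l) (f := fun i s => α.act s (a i γ))
    (f' := fun i s => actD α (a i) γ s) (g' := fun s => actD α b γ s) ?_ ?_ ?_
  · rw [Metric.tendstoUniformlyOnFilter_iff]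
    intro ε hε
    have h1 : Filter.Tendsto (fun i => ∑ j, ‖b (γ + Pi.single j 1) - a i (γ + Pi.single j 1)‖) l
        (𝓝 0) := by
      have h2 : ∀ j, Filter.Tendsto (fun i => ‖b (γ + Pi.single j 1) - a i (γ + Pi.single j 1)‖) l
          (𝓝 0) := by
        intro j
        have := ((hl (γ + Pi.single j 1)).const_sub (b (γ + Pi.single j 1))).norm
        simpa using this
      simpa using tendsto_finsetSum Finset.univ fun j _ => h2 j
    have h3 := (h1.eventually_lt_const hε).prod_inl (𝓝 s)
    refine h3.mono fun p hp => ?_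
    rw [dist_eq_norm, actD_sub]
    exact (norm_actD_le _ _ _).trans_lt hp
  · exact (h.prod_inl (𝓝 s)).mono fun p hp => hp γ p.2
  · refine Filter.Eventually.of_forall fun y => ?_
    exact ((actL α y).continuous.tendsto _).comp (hl γ)

lemma Compat.const_smul_sub {a b : (Fin n → ℕ) → A} (ha : Compat α a) (hb : Compat α b) (c : ℝ) :
    Compat α fun γ => c • (a γ - b γ) := by
  intro γ s
  have h := ((ha γ s).fun_sub (hb γ s)).fun_const_smul c
  refine (h.congr_fderiv ?_).congr_of_eventuallyEq (Filter.Eventually.of_forall fun s => ?_)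
  · ext v
    simp only [smul_apply, sub_apply, actD_apply, act_real_smul, map_sub, smul_sub,
      Finset.smul_sum, Finset.sum_sub_distrib, smul_comm c]
  · simp [act_real_smul]

variable {E : Type*} [NormedAddCommGroup E] [NormedSpace ℝ E] {Ω : Set E}

/-- Compatibility is preserved by linear combinations and by limits, so it passes from difference
quotients to the derivative. -/
lemma Compat.fderiv_apply (hΩ : IsOpen Ω) {H : (Fin n → ℕ) → E → A}
    (hs : ∀ γ, ContDiffOn ℝ ∞ (H γ) Ω) (hc : ∀ p ∈ Ω, Compat α fun γ => H γ p) (w : E) {p : E}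
    (hp : p ∈ Ω) : Compat α fun γ => fderiv ℝ (H γ) p w := by
  have hev : ∀ᶠ h : ℝ in 𝓝[≠] 0, p + h • w ∈ Ω := by
    have hcont : Continuous fun h : ℝ => p + h • w := by fun_prop
    have h0 : p + (0 : ℝ) • w ∈ Ω := by simpa using hp
    exact (hcont.continuousAt.eventually_mem (hΩ.mem_nhds h0)).filter_mono nhdsWithin_le_nhds
  refine Compat.of_tendsto (l := 𝓝[≠] (0 : ℝ)) (a := fun h γ => h⁻¹ • (H γ (p + h • w) - H γ p))
    ?_ fun γ => ?_
  · exact hev.mono fun h hh => (hc _ hh).const_smul_sub (hc p hp) _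
  · have hd : HasFDerivAt (H γ) (fderiv ℝ (H γ) p) p :=
      (((hs γ).differentiableOn (by simp)).differentiableAt (hΩ.mem_nhds hp)).hasFDerivAt
    have h1 := (hd.hasLineDerivAt w).tendsto_slope_zero
    exact h1

/-- A compatible family of smooth maps defines a smooth map into the smooth subalgebra. -/
theorem contDiffOn_act_of_compat [FiniteDimensional ℝ E] (hΩ : IsOpen Ω) (k : ℕ)
    {H : (Fin n → ℕ) → E → A} (hs : ∀ γ, ContDiffOn ℝ ∞ (H γ) Ω)
    (hc : ∀ p ∈ Ω, Compat α fun γ => H γ p) (γ : Fin n → ℕ) :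
    ContDiffOn ℝ k (fun q : Eucl n × E => α.act q.1 (H γ q.2)) (Set.univ ×ˢ Ω) := by
  have hcont : ∀ {h : E → A}, ContinuousOn h Ω →
      ContinuousOn (fun q : Eucl n × E => α.act q.1 (h q.2)) (Set.univ ×ˢ Ω) := fun hh =>
    (continuous_act_uncurry α).comp_continuousOn
      (continuousOn_fst.prodMk (hh.comp continuousOn_snd fun q hq => hq.2))
  have hopen : IsOpen ((Set.univ : Set (Eucl n)) ×ˢ Ω) := isOpen_univ.prod hΩ
  have hsf : ∀ (w : E) γ, ContDiffOn ℝ ∞ (fun p => fderiv ℝ (H γ) p w) Ω := fun w γ =>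
    ((hs γ).fderiv_of_isOpen hΩ (m := ∞) (by simp)).clm_apply contDiffOn_const
  induction k generalizing H γ with
  | zero => exact contDiffOn_zero.2 (hcont (hs γ).continuousOn)
  | succ k ih =>
    have hfd : ∀ q ∈ (Set.univ : Set (Eucl n)) ×ˢ Ω,
        HasFDerivAt (fun q : Eucl n × E => α.act q.1 (H γ q.2))
          ((actD α (fun γ => H γ q.2) γ q.1).coprod ((actL α q.1).comp (fderiv ℝ (H γ) q.2))) q := by
      intro q hq
      -- The partial derivative in `s` exists by compatibility, the one in the point because `α_s`
      -- is linear and continuous. Both are jointly continuous, so the map is differentiable.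
      refine (hasStrictFDerivAt_uncurry_coprod (𝕜 := ℝ) (f := fun s p => α.act s (H γ p))
        (f₁ := fun s p => actD α (fun γ => H γ p) γ s)
        (f₂ := fun s p => (actL α s).comp (fderiv ℝ (H γ) p)) ?_ ?_ ?_ ?_).hasFDerivAt
      · filter_upwards [hopen.mem_nhds hq] with v hv
        exact hc v.2 hv.2 γ v.1
      · filter_upwards [hopen.mem_nhds hq] with v hv
        exact (actL α v.1).hasFDerivAt.comp v.2 (((hs γ).differentiableOn (by simp)).differentiableAt
          (hΩ.mem_nhds hv.2)).hasFDerivAt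
      · have : ContinuousOn (fun q : Eucl n × E => actD α (fun γ => H γ q.2) γ q.1)
            (Set.univ ×ˢ Ω) := by
          rw [continuousOn_clm_apply]
          intro v
          simp only [actD_apply]
          exact continuousOn_finsetSum _ fun j _ => (hcont (hs _).continuousOn).const_smul _
        exact this.continuousAt (hopen.mem_nhds hq)
      · have : ContinuousOn (fun q : Eucl n × E => (actL α q.1).comp (fderiv ℝ (H γ) q.2))
            (Set.univ ×ˢ Ω) := by
          rw [continuousOn_clm_apply]
          intro w
          exact hcont (hsf w γ).continuousOn
        exact this.continuousAt (hopen.mem_nhds hq)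
    rw [Nat.cast_succ, contDiffOn_succ_iff_fderiv_of_isOpen hopen]
    refine ⟨fun q hq => (hfd q hq).differentiableAt.differentiableWithinAt, by simp,
      contDiffOn_clm_apply.2 fun v => ?_⟩
    -- The components of the derivative are again of the form covered by the induction hypothesis:
    -- `H` with the index raised, or the compatible family of derivatives of `H`.
    have h1 : ContDiffOn ℝ k (fun q : Eucl n × E =>
        (∑ j, v.1 j • α.act q.1 (H (γ + Pi.single j 1) q.2))
          + α.act q.1 (fderiv ℝ (H γ) q.2 v.2)) (Set.univ ×ˢ Ω) := by
      refine (ContDiffOn.sum fun j _ => (ih hs hc _ hsf).const_smul _).add ?_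
      refine ih (H := fun γ p => fderiv ℝ (H γ) p v.2) (hsf v.2)
        (fun p hp => Compat.fderiv_apply hΩ hs hc v.2 hp) γ fun w γ => ?_
      exact ((hsf v.2 γ).fderiv_of_isOpen hΩ (m := ∞) (by simp)).clm_apply contDiffOn_const
    refine h1.congr fun q hq => ?_
    rw [(hfd q hq).fderiv]
    simp [actD_apply]

/-- Smoothness of all `δ^γ F` gives smoothness of the equivariant extension. -/
theorem sm_of_delta {U : Set ℂ} (hU : IsOpen U) {F : Eucl n → ℂ → A}
    (hmem : ∀ ξ, ∀ z ∈ U, F ξ z ∈ smoothSet α)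
    (hs : ∀ γ, ContDiffOn ℝ ∞ (fun p : Eucl n × ℂ => delta α γ (F p.1 p.2)) (Set.univ ×ˢ U)) :
    Sm α U F := by
  have h := fun k : ℕ => contDiffOn_act_of_compat (α := α) (isOpen_univ.prod hU) k
    (H := fun γ (p : Eucl n × ℂ) => mpd γ (fun t => α.act t (F p.1 p.2)) 0) (fun γ => by
      refine ((hs γ).const_smul (Complex.I ^ len γ)).congr fun p _ => ?_
      simp [delta, smul_smul]) (fun p hp => compat_of_mem (hmem p.1 p.2 hp.2)) 0
  have e : dom n U = Set.univ ×ˢ (Set.univ ×ˢ U) := by ext p; simp [dom]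
  rw [Sm, e]
  refine (contDiffOn_infty.2 h).congr fun p _ => ?_
  have h0 : ∀ a : A, mpd 0 (fun t => α.act t a) 0 = a := fun a => by
    simpa [delta] using delta_zero (α := α) a
  simp only [h0]
  rfl

end SmoothMaps

/-! ### Holomorphy in the parameter -/

section Holo

variable {n : ℕ} {A : Type*} [CStarAlgebra A] {α : CStarAction n A} {U V : Set ℂ}
  {F : Eucl n → ℂ → A}

/-- The Cauchy–Riemann equation in the parameter. -/
def Holo (α : CStarAction n A) (U : Set ℂ) (F : Eucl n → ℂ → A) : Prop :=
  nab α U (0, 0, Complex.I) F = fun ξ z => Complex.I • nab α U (0, 0, 1) F ξ z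

lemma Holo.nab (hU : IsOpen U) (hF : Sm α U F) (h : Holo α U F) (v : PV n) :
    Holo α U (nab α U v F) := by
  rw [Holo, nab_comm hU hF, h, nab_smul hU (hF.nab hU _), nab_comm hU hF]

lemma Holo.nab_par (h : Holo α U F) (c : ℂ) :
    TwistedPsiDO.nab α U (0, 0, c) F = fun ξ z => c • TwistedPsiDO.nab α U (0, 0, 1) F ξ z := by
  have e : ((0, 0, c) : PV n) = c.re • (0, 0, 1) + c.im • (0, 0, Complex.I) := by
    simp [Complex.re_add_im]
  rw [e, nab_add_vec, nab_smul_vec, nab_smul_vec, h]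
  funext ξ z
  beta_reduce
  rw [smul_smul, ← add_smul, Complex.re_add_im]

lemma hasFDerivAt_par (hU : IsOpen U) (hF : Sm α U F) (ξ : Eucl n) {z : ℂ} (hz : z ∈ U) :
    HasFDerivAt (fun w => F ξ w) ((fderiv ℝ (tw α F) (0, ξ, z)).comp
      ((0 : ℂ →L[ℝ] Eucl n).prod ((0 : ℂ →L[ℝ] Eucl n).prod (ContinuousLinearMap.id ℝ ℂ)))) z := by
  have hp : ((0, ξ, z) : PV n) ∈ dom n U := hz
  have h1 := (hF.hasFDerivAt hU hp).comp z
    ((hasFDerivAt_const (0 : Eucl n) z).prodMk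
      ((hasFDerivAt_const ξ z).prodMk (hasFDerivAt_id (𝕜 := ℝ) z)))
  have e : (tw α F ∘ fun w : ℂ => ((0, ξ, id w) : PV n)) = fun w => F ξ w := by
    funext w; simp
  rwa [e] at h1

/-- The complex derivative in the parameter. -/
lemma Holo.hasDerivAt (hU : IsOpen U) (hF : Sm α U F) (h : Holo α U F) (ξ : Eucl n) {z : ℂ}
    (hz : z ∈ U) : HasDerivAt (fun w => F ξ w) (TwistedPsiDO.nab α U (0, 0, 1) F ξ z) z := by
  have hp : ((0, ξ, z) : PV n) ∈ dom n U := hz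
  have h2 : HasFDerivAt (fun w => F ξ w) (((1 : ℂ →L[ℂ] ℂ).smulRight
      (TwistedPsiDO.nab α U (0, 0, 1) F ξ z)).restrictScalars ℝ) z := by
    refine (hasFDerivAt_par hU hF ξ hz).congr_fderiv ?_
    ext c
    simp [fderiv_tw_eq hp, h.nab_par c]
  exact (hasFDerivAt_of_restrictScalars ℝ h2 rfl).hasDerivAt.congr_deriv (by simp)

lemma holo_of_differentiableOn (hU : IsOpen U) (hF : Sm α U F)
    (h : ∀ ξ, DifferentiableOn ℂ (fun z => F ξ z) U) : Holo α U F := by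
  funext ξ z
  by_cases hz : z ∈ U
  · have h1 := ((h ξ).differentiableAt (hU.mem_nhds hz)).hasFDerivAt.restrictScalars ℝ
    have h2 := h1.unique (hasFDerivAt_par hU hF ξ hz)
    have e : ∀ c : ℂ, nab α U (0, 0, c) F ξ z = c • fderiv ℂ (fun z => F ξ z) z 1 := by
      intro c
      rw [nab_of_mem hz]
      have h3 := congrArg (fun L : ℂ →L[ℝ] A => L c) h2
      have h4 : fderiv ℂ (fun z => F ξ z) z c = c • fderiv ℂ (fun z => F ξ z) z 1 := by
        rw [← map_smul, smul_eq_mul, mul_one]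
      rw [← h4]
      exact h3.symm
    rw [e, e, one_smul]
  · simp [nab_of_notMem hz]

lemma Holo.iterate (hU : IsOpen U) (hF : Sm α U F) (h : Holo α U F) (k : ℕ) :
    Sm α U ((TwistedPsiDO.nab α U (0, 0, 1))^[k] F)
      ∧ Holo α U ((TwistedPsiDO.nab α U (0, 0, 1))^[k] F) :=
  iterate_invariant (P := fun F => Sm α U F ∧ Holo α U F)
    (fun _ h => ⟨h.1.nab hU _, h.2.nab hU h.1 _⟩) k ⟨hF, h⟩

lemma Holo.mnab (hU : IsOpen U) (hF : Sm α U F) (h : Holo α U F) (v : Fin n → PV n)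
    (γ : Fin n → ℕ) : Holo α U (mnab α U v γ F) :=
  (foldIter_invariant (P := fun F => Sm α U F ∧ Holo α U F)
    (fun _ _ h => ⟨h.1.nab hU _, h.2.nab hU h.1 _⟩) γ ⟨hF, h⟩).2

lemma Holo.iteratedDeriv_eq (hU : IsOpen U) (hF : Sm α U F) (h : Holo α U F) (ξ : Eucl n) (k : ℕ)
    {z : ℂ} (hz : z ∈ U) :
    iteratedDeriv k (fun w => F ξ w) z = (TwistedPsiDO.nab α U (0, 0, 1))^[k] F ξ z := by
  induction k generalizing z with
  | zero => rfl
  | succ k ih =>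
    rw [iteratedDeriv_succ, Function.iterate_succ_apply']
    have e : iteratedDeriv k (fun w => F ξ w)
        =ᶠ[𝓝 z] fun w => (TwistedPsiDO.nab α U (0, 0, 1))^[k] F ξ w := by
      filter_upwards [hU.mem_nhds hz] with w hw
      exact ih hw
    rw [e.deriv_eq]
    exact ((h.iterate hU hF k).2.hasDerivAt hU (h.iterate hU hF k).1 ξ hz).deriv

/-- Change of the parameter and multiplication with a function of the parameter. -/
lemma Sm.transform {c φ : ℂ → ℂ} (hc : ContDiffOn ℝ ∞ c U) (hφ : ContDiffOn ℝ ∞ φ U)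
    (hm : Set.MapsTo φ U V) (h : Sm α V F) : Sm α U fun ξ z => c z • F ξ (φ z) := by
  have h1 : ContDiffOn ℝ ∞ (fun p : PV n => p.2.2) (dom n U) := by fun_prop
  have hm1 : Set.MapsTo (fun p : PV n => p.2.2) (dom n U) U := fun p hp => hp
  have h2 : ContDiffOn ℝ ∞ (fun p : PV n => ((p.1, p.2.1, φ p.2.2) : PV n)) (dom n U) :=
    contDiffOn_fst.prodMk (ContDiffOn.prodMk (by fun_prop) (hφ.comp h1 hm1))
  have h3 : ContDiffOn ℝ ∞ (fun p : PV n => tw α F (p.1, p.2.1, φ p.2.2)) (dom n U) :=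
    ContDiffOn.comp h h2 fun p hp => hm hp
  refine ((hc.comp h1 hm1).smul h3).congr fun p _ => ?_
  simp [tw]

/-! ### Symbol estimates in terms of multi-indices -/

/-- All directional derivatives commute on smooth families, so the letters of a word can be sorted
by type. Only the covariable and the parameter letters contribute to the weight. -/
lemma exists_multi_of_word (w : List (Dir n)) : ∃ (γ β : Fin n → ℕ) (j : ℕ),
    (j : ℝ) - len β = wtSum w ∧ ∀ {U : Set ℂ} {F : Eucl n → ℂ → A}, IsOpen U → Sm α U F →
      nabs α U w F = mnab α U actVec γ (mnab α U covVec β ((nab α U (0, 0, 1))^[j] F)) := by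
  induction w with
  | nil => exact ⟨0, 0, 0, by simp [wtSum], fun _ _ => by simp [nabs, mnab_zero]⟩
  | cons d w ih =>
    obtain ⟨γ, β, j, hw, h⟩ := ih
    have hit : ∀ {U : Set ℂ} {F : Eucl n → ℂ → A}, IsOpen U → Sm α U F → ∀ v,
        (nab α U (0, 0, 1))^[j] (nab α U v F) = nab α U v ((nab α U (0, 0, 1))^[j] F) :=
      fun {U F} hU hF v => (iterate_semiconj (P := Sm α U) (φ := nab α U v)
        (fun _ h => h.nab hU _) (fun _ h => nab_comm hU h _ _) j hF).symm
    have his : ∀ {U : Set ℂ} {F : Eucl n → ℂ → A}, IsOpen U → Sm α U F →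
        Sm α U ((nab α U (0, 0, 1))^[j] F) := fun {U F} hU hF =>
      iterate_invariant (P := Sm α U) (fun _ h => h.nab hU _) j hF
    cases d with
    | act i =>
      refine ⟨γ + Pi.single i 1, β, j, by simp [wtSum, Dir.wt, hw], fun {U F} hU hF => ?_⟩
      rw [nabs, h hU (hF.nab hU _), hit hU hF, ← nab_mnab hU (his hU hF)]
      exact mnab_nab hU ((his hU hF).mnab hU _ _) actVec γ i
    | sp i =>
      refine ⟨γ, β + Pi.single i 1, j, ?_, fun {U F} hU hF => ?_⟩
      · rw [len_add_single, wtSum, Dir.wt, ← hw]; push_cast; ring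
      · rw [nabs, h hU (hF.nab hU _), hit hU hF]
        exact congrArg _ (mnab_nab hU (his hU hF) covVec β i)
    | par =>
      refine ⟨γ, β, j + 1, ?_, fun {U F} hU hF => ?_⟩
      · rw [wtSum, Dir.wt, ← hw]; push_cast; ring
      · rw [nabs, h hU (hF.nab hU _), Function.iterate_succ_apply]
        rfl

variable {D : ParamDomain} {m : ℝ}

theorem Sym.of_multi (hs : Sm α D.U F) (hh : Holo α D.U F)
    (hb : ∀ (γ β : Fin n → ℕ) (j : ℕ), ∀ K ∈ D.fam, ∃ C : ℝ, ∀ z ∈ K, ∀ ξ,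
      ‖mnab α D.U actVec γ (mnab α D.U covVec β ((nab α D.U (0, 0, 1))^[j] F)) ξ z‖
        ≤ C * bracket ξ ^ (m + j - len β)) : Sym α D m F where
  sm := hs
  holo := hh
  bound w K hK := by
    obtain ⟨γ, β, j, hw, h⟩ := exists_multi_of_word (A := A) (α := α) w
    rw [h D.isOpen hs, ← hw, ← add_sub_assoc]
    exact hb γ β j K hK

lemma norm_delta_mpd (hs : Sm α U F) (hU : IsOpen U) (γ β : Fin n → ℕ) (ξ : Eucl n) {z : ℂ}
    (hz : z ∈ U) : ‖delta α γ (mpd β (fun ζ => F ζ z) ξ)‖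
      = ‖mnab α U actVec γ (mnab α U covVec β F) ξ z‖ := by
  rw [mpd_eq hU hs hz, delta_eq hU (hs.mnab hU covVec β) ξ hz, norm_smul]
  simp

lemma Sym.uniformEstimates (h : Sym α D m F) {K : Set ℂ} (hK : K ∈ D.fam) :
    UniformEstimates α m K fun z ξ => F ξ z := by
  intro γ β
  obtain ⟨C, -, hC⟩ := ((h.mnab_cov β).mnab_act γ).exists_bound_zero hK
  refine ⟨C, fun z hz ξ => ?_⟩
  rw [norm_delta_mpd h.sm D.isOpen γ β ξ (D.sub K hK hz)]
  exact hC z hz ξ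

lemma Sym.isSymbol (h : Sym α D m F) {z : ℂ} (hz : z ∈ D.U) : IsSymbol α m fun ξ => F ξ z where
  smooth :=
    { mem := fun ξ => mem_smoothSet h.sm ξ hz
      smooth := fun γ => (delta_contDiffOn D.isOpen h.sm γ).comp_contDiff
        (f := fun ξ : Eucl n => (ξ, z)) (by fun_prop) fun ξ => ⟨Set.mem_univ _, hz⟩ }
  bound γ β := by
    obtain ⟨C, hC⟩ := h.uniformEstimates (D.singleton_mem hz) γ β
    exact ⟨C, hC z rfl⟩

end Holo

/-! ### Sectors and powers -/

section Sector

/-- Rotation by the middle angle centres the sector at the positive axis. As its opening is at most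
`2π`, it then avoids the cut of the principal argument, which makes openness and the holomorphy of
the powers accessible. -/
lemma mem_openSector_iff {a b : ℝ} (hab' : b ≤ a + 2 * Real.pi) (μ : ℂ) :
    μ ∈ openSector a b ↔ μ * Complex.exp (-(((a + b) / 2 : ℝ) * Complex.I)) ∈ Complex.slitPlane ∧
      |(μ * Complex.exp (-(((a + b) / 2 : ℝ) * Complex.I))).arg| < (b - a) / 2 := by
  constructor
  · rintro ⟨r, t, hr, hat, htb, rfl⟩
    have e : (r : ℂ) * Complex.exp (t * Complex.I)
        * Complex.exp (-(((a + b) / 2 : ℝ) * Complex.I))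
        = r * (Complex.cos ((t - (a + b) / 2 : ℝ)) + Complex.sin ((t - (a + b) / 2 : ℝ))
          * Complex.I) := by
      rw [mul_assoc, ← Complex.exp_add, ← Complex.exp_mul_I]
      congr 2
      push_cast
      ring
    have h := Complex.arg_mul_cos_add_sin_mul_I hr (θ := t - (a + b) / 2)
      ⟨by linarith, by linarith⟩
    rw [e, h]
    have h0 : (r : ℂ) * (Complex.cos ((t - (a + b) / 2 : ℝ)) + Complex.sin ((t - (a + b) / 2 : ℝ))
          * Complex.I) ≠ 0 := by
      rw [← Complex.exp_mul_I]
      exact mul_ne_zero (by exact_mod_cast hr.ne') (Complex.exp_ne_zero _)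
    refine ⟨Complex.mem_slitPlane_iff_arg.2 ⟨?_, h0⟩, abs_lt.2 ⟨by linarith, by linarith⟩⟩
    rw [h]
    intro h1
    linarith
  · rintro ⟨h1, h2⟩
    set w := μ * Complex.exp (-(((a + b) / 2 : ℝ) * Complex.I)) with hw
    rw [abs_lt] at h2
    refine ⟨‖w‖, w.arg + (a + b) / 2, norm_pos_iff.2 (Complex.slitPlane_ne_zero h1),
      by linarith, by linarith, ?_⟩
    have h3 : μ = w * Complex.exp (((a + b) / 2 : ℝ) * Complex.I) := by
      rw [hw, mul_assoc, ← Complex.exp_add]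
      simp
    rw [h3]
    nth_rewrite 1 [← Complex.norm_mul_exp_arg_mul_I w]
    rw [mul_assoc, ← Complex.exp_add]
    congr 2
    push_cast
    ring

lemma isOpen_openSector {a b : ℝ} (hab' : b ≤ a + 2 * Real.pi) : IsOpen (openSector a b) := by
  have h1 : IsOpen (Complex.slitPlane ∩ Complex.arg ⁻¹' {x | |x| < (b - a) / 2}) := by
    refine ContinuousOn.isOpen_inter_preimage ?_ Complex.isOpen_slitPlane
      (isOpen_lt continuous_abs continuous_const)
    exact fun x hx => (Complex.continuousAt_arg hx).continuousWithinAt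
  have h2 : openSector a b = (fun μ => μ * Complex.exp (-(((a + b) / 2 : ℝ) * Complex.I))) ⁻¹'
      (Complex.slitPlane ∩ Complex.arg ⁻¹' {x | |x| < (b - a) / 2}) := by
    ext μ
    exact mem_openSector_iff hab' μ
  rw [h2]
  exact h1.preimage (by fun_prop)

lemma ne_zero_of_mem_openSector {a b : ℝ} {μ : ℂ} (h : μ ∈ openSector a b) : μ ≠ 0 := by
  obtain ⟨r, t, hr, -, -, rfl⟩ := h
  exact mul_ne_zero (by exact_mod_cast hr.ne') (Complex.exp_ne_zero _)

/-- The parameters `z` with `1/z` in the sector. -/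
def invSector (a b : ℝ) : Set ℂ := {z | z⁻¹ ∈ openSector a b}

lemma ne_zero_of_mem_invSector {a b : ℝ} {z : ℂ} (h : z ∈ invSector a b) : z ≠ 0 := by
  have h1 := ne_zero_of_mem_openSector (show z⁻¹ ∈ openSector a b from h)
  exact fun h0 => h1 (by simp [h0])

lemma isOpen_invSector {a b : ℝ} (hab' : b ≤ a + 2 * Real.pi) : IsOpen (invSector a b) := by
  have h : invSector a b = {0}ᶜ ∩ (fun z : ℂ => z⁻¹) ⁻¹' openSector a b := by
    ext z
    exact ⟨fun h => ⟨ne_zero_of_mem_invSector h, h⟩, fun h => h.2⟩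
  rw [h]
  exact continuousOn_inv₀.isOpen_inter_preimage isOpen_compl_singleton (isOpen_openSector hab')

lemma closedSector_subset {a b a' b' : ℝ} (ha : a < a') (hb : b' < b) :
    closedSector a' b' ⊆ openSector a b := by
  rintro μ ⟨r, t, hr, h1, h2, rfl⟩
  exact ⟨r, t, hr, by linarith, by linarith, rfl⟩

/-- The parameter domain of weakly parametric symbols. -/
def sectorDom (a b : ℝ) (hab' : b ≤ a + 2 * Real.pi) : ParamDomain where
  U := invSector a b
  isOpen := isOpen_invSector hab'
  fam := {K | (∃ K' : Set ℂ, IsCompact K' ∧ K' ⊆ openSector a b ∧ K = {z | z⁻¹ ∈ K'}) ∨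
    ∃ a' b' : ℝ, a < a' ∧ a' ≤ b' ∧ b' < b ∧ K = {z | z⁻¹ ∈ closedSector a' b' ∧ ‖z‖ ≤ 1}}
  sub := by
    rintro K (⟨K', -, h, rfl⟩ | ⟨a', b', ha, -, hb, rfl⟩) z hz
    · exact h hz
    · exact closedSector_subset ha hb hz.1
  compact_mem := by
    intro K hK hKU
    refine Or.inl ⟨(fun z => z⁻¹) '' K, ?_, ?_, ?_⟩
    · refine hK.image_of_continuousOn (continuousOn_inv₀.mono fun z hz => ?_)
      exact ne_zero_of_mem_invSector (hKU hz)
    · rintro _ ⟨z, hz, rfl⟩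
      exact hKU hz
    · ext z
      refine ⟨fun h => ⟨z, h, rfl⟩, ?_⟩
      rintro ⟨w, hw, h⟩
      rw [← inv_injective h]
      exact hw

variable {a b : ℝ}

lemma mul_exp_mem_slitPlane (hab' : b ≤ a + 2 * Real.pi) {z : ℂ} (hz : z ∈ invSector a b) :
    z * Complex.exp (((a + b) / 2 : ℝ) * Complex.I) ∈ Complex.slitPlane := by
  have h := ((mem_openSector_iff hab' z⁻¹).1 hz).1
  rw [Complex.exp_neg, ← mul_inv] at h
  rw [Complex.mem_slitPlane_iff_arg] at h ⊢
  refine ⟨?_, fun h0 => h.2 (by rw [h0, inv_zero])⟩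
  intro h1
  exact h.1 (by rw [Complex.arg_inv, if_pos h1])

lemma branchPow_differentiableOn (hab' : b ≤ a + 2 * Real.pi) (d : ℝ) :
    DifferentiableOn ℂ (branchPow a b d) (invSector a b) := by
  unfold branchPow
  refine (DifferentiableOn.cpow_const (by fun_prop) fun z hz => ?_).const_mul _
  exact mul_exp_mem_slitPlane hab' hz

lemma branchPow_ne_zero {d : ℝ} {z : ℂ} (hz : z ≠ 0) : branchPow a b d z ≠ 0 := by
  unfold branchPow
  refine mul_ne_zero (Complex.exp_ne_zero _) ?_
  rw [Ne, Complex.cpow_eq_zero_iff]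
  exact fun h => mul_ne_zero hz (Complex.exp_ne_zero _) h.1

lemma branchPow_add (d d' : ℝ) {z : ℂ} (hz : z ≠ 0) :
    branchPow a b (d + d') z = branchPow a b d z * branchPow a b d' z := by
  unfold branchPow
  rw [Complex.ofReal_add, Complex.cpow_add _ _ (mul_ne_zero hz (Complex.exp_ne_zero _)),
    mul_add, Complex.ofReal_add, add_mul, neg_add, Complex.exp_add]
  ring

lemma contDiffOn_of_holo {U : Set ℂ} (hU : IsOpen U) {c : ℂ → ℂ} (h : DifferentiableOn ℂ c U) :
    ContDiffOn ℝ ∞ c U := (h.contDiffOn hU (n := ∞)).restrict_scalars ℝ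

end Sector

/-! ### Weakly parametric symbols -/

section WeaklyParametric

variable {n : ℕ} {A : Type*} [CStarAlgebra A] {α : CStarAction n A} {a b m d : ℝ}
  {f : Eucl n → ℂ → A}

/-- `(ξ, z) ↦ z^d f(ξ, 1/z)`. -/
def paramForm (a b d : ℝ) (f : Eucl n → ℂ → A) : Eucl n → ℂ → A :=
  fun ξ z => branchPow a b d z • f ξ z⁻¹

/-- Inversion and multiplication with the holomorphic branch preserve smoothness and holomorphy. The
complex derivatives `zDeriv` are then iterates of the parameter derivative, and the estimates of the
definition are those required by `Sym.of_multi`. -/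
theorem IsWeaklyParametric.sym (hab' : b ≤ a + 2 * Real.pi) (h : IsWeaklyParametric α a b m d f) :
    Sym α (sectorDom a b hab') m (paramForm a b d f) := by
  have hU := isOpen_invSector hab'
  have hinv : DifferentiableOn ℂ (fun z : ℂ => z⁻¹) (invSector a b) :=
    differentiableOn_inv.mono fun z hz => ne_zero_of_mem_invSector hz
  have hsm : Sm α (invSector a b) (paramForm a b d f) :=
    Sm.transform (contDiffOn_of_holo hU (branchPow_differentiableOn hab' d))
      (contDiffOn_of_holo hU hinv) (fun z hz => hz)
      (sm_of_delta (isOpen_openSector hab') h.mem h.smooth)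
  have hh : Holo α (invSector a b) (paramForm a b d f) := by
    refine holo_of_differentiableOn hU hsm fun ξ => ?_
    refine (branchPow_differentiableOn hab' d).smul ?_
    have := h.holo 0 ξ
    simp only [delta_zero] at this
    exact this.comp hinv fun z hz => hz
  refine Sym.of_multi hsm hh fun γ β j K hK => ?_
  have hsmj := (hh.iterate hU hsm j).1
  have key : UniformEstimates α (m + j) K (zDeriv a b d f j) := by
    rcases hK with ⟨K', hK', hs, rfl⟩ | ⟨a', b', ha, hab, hb, rfl⟩
    · exact h.locally_uniform j K' hK' hs
    · exact h.uniform j a' b' ha hab hb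
  obtain ⟨C, hC⟩ := key γ β
  refine ⟨C, fun z hz ξ => ?_⟩
  have hzU : z ∈ invSector a b := (sectorDom a b hab').sub K hK hz
  have e : zDeriv a b d f j z
      = fun ζ => (nab α (invSector a b) (0, 0, 1))^[j] (paramForm a b d f) ζ z :=
    funext fun ζ => hh.iteratedDeriv_eq hU hsm ζ j hzU
  have h1 := hC z hz ξ
  rw [e, norm_delta_mpd hsmj hU γ β ξ hzU] at h1
  exact h1

/-- The branch of the power is holomorphic without zeros, so `f` is recovered from its parameter
form by division and inversion, and the estimates are read off. -/
theorem isWeaklyParametric_of_sym (hab' : b ≤ a + 2 * Real.pi)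
    (h : Sym α (sectorDom a b hab') m (paramForm a b d f)) : IsWeaklyParametric α a b m d f := by
  have hU := isOpen_invSector hab'
  have hΓ := isOpen_openSector hab'
  have hinv : DifferentiableOn ℂ (fun μ : ℂ => μ⁻¹) (openSector a b) :=
    differentiableOn_inv.mono fun z hz => ne_zero_of_mem_openSector hz
  have hmaps : Set.MapsTo (fun μ : ℂ => μ⁻¹) (openSector a b) (invSector a b) := fun μ hμ => by
    simpa [invSector] using hμ
  have hc : DifferentiableOn ℂ (fun μ => (branchPow a b d μ⁻¹)⁻¹) (openSector a b) :=
    ((branchPow_differentiableOn hab' d).comp hinv hmaps).inv fun μ hμ =>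
      branchPow_ne_zero (inv_ne_zero (ne_zero_of_mem_openSector hμ))
  have hf : ∀ ξ, ∀ μ ∈ openSector a b,
      f ξ μ = (branchPow a b d μ⁻¹)⁻¹ • paramForm a b d f ξ μ⁻¹ := by
    intro ξ μ hμ
    rw [paramForm, inv_inv, smul_smul, inv_mul_cancel₀ (branchPow_ne_zero
      (inv_ne_zero (ne_zero_of_mem_openSector hμ))), one_smul]
  have hsm : Sm α (openSector a b) f :=
    (Sm.transform (contDiffOn_of_holo hΓ hc) (contDiffOn_of_holo hΓ hinv) hmaps h.sm).congr hf
  have hh : Holo α (openSector a b) f := by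
    refine holo_of_differentiableOn hΓ hsm fun ξ => ?_
    refine DifferentiableOn.congr ?_ fun μ hμ => hf ξ μ hμ
    refine hc.smul (DifferentiableOn.comp (g := fun z => paramForm a b d f ξ z) (t := invSector a b)
      (fun z hz => ?_) hinv hmaps)
    exact (Holo.hasDerivAt hU h.sm h.holo ξ hz).differentiableAt.differentiableWithinAt
  have hz : ∀ (j : ℕ) (z : ℂ), z ∈ invSector a b → zDeriv a b d f j z
      = fun ζ => (nab α (invSector a b) (0, 0, 1))^[j] (paramForm a b d f) ζ z :=
    fun j z hzU => funext fun ζ => Holo.iteratedDeriv_eq hU h.sm h.holo ζ j hzU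
  have hunif : ∀ (j : ℕ), ∀ K ∈ (sectorDom a b hab').fam,
      UniformEstimates α (m + j) K (zDeriv a b d f j) := by
    intro j K hK γ β
    obtain ⟨C, hC⟩ := (h.iterate_par j).uniformEstimates hK γ β
    refine ⟨C, fun z hzK ξ => ?_⟩
    rw [hz j z ((sectorDom a b hab').sub K hK hzK)]
    exact hC z hzK ξ
  exact
    { mem := fun ξ μ hμ => mem_smoothSet hsm ξ hμ
      smooth := fun γ => delta_contDiffOn hΓ hsm γ
      holo := fun γ ξ => by
        refine DifferentiableOn.congr (f := fun μ => (Complex.I ^ len γ)⁻¹ •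
          mnab α (openSector a b) actVec γ f ξ μ) (DifferentiableOn.fun_const_smul (fun μ hμ => ?_) _)
          fun μ hμ => delta_eq hΓ hsm ξ hμ γ
        exact ((hh.mnab hΓ hsm actVec γ).hasDerivAt hΓ (hsm.mnab hΓ actVec γ) ξ
          hμ).differentiableAt.differentiableWithinAt
      symbol := fun j z hzΓ => by
        rw [hz j z hzΓ]
        exact (h.iterate_par j).isSymbol (D := sectorDom a b hab') hzΓ
      locally_uniform := fun j K hK hs => hunif j _ (Or.inl ⟨K, hK, hs, rfl⟩)
      uniform := fun j a' b' h1 h2 h3 => hunif j _ (Or.inr ⟨a', b', h1, h2, h3, rfl⟩) }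

end WeaklyParametric

/-! ### Rapidly decreasing families -/

section Schwartz

variable {n : ℕ} {A : Type*} [CStarAlgebra A] {α : CStarAction n A} {D : ParamDomain}
  {F G w : Eucl n → ℂ → A} {m m' : ℝ}

/-- Symbols of order `-∞`. -/
def Sch (α : CStarAction n A) (D : ParamDomain) (w : Eucl n → ℂ → A) : Prop :=
  ∀ μ : ℝ, Sym α D μ w

lemma bracket_rpow_le_one_add_norm (ξ : Eucl n) (r : ℝ) :
    bracket ξ ^ r ≤ 2 ^ |r| * (1 + ‖ξ‖) ^ r := by
  have h0 : (0 : ℝ) < 1 + ‖ξ‖ := by positivity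
  rcases le_total 0 r with hr | hr
  · have h1 : bracket ξ ^ r ≤ (1 + ‖ξ‖) ^ r :=
      Real.rpow_le_rpow (bracket_pos ξ).le (bracket_le_one_add_norm ξ) hr
    exact h1.trans (le_mul_of_one_le_left (by positivity)
      (Real.one_le_rpow one_le_two (abs_nonneg r)))
  · rw [abs_of_nonpos hr, Real.rpow_neg zero_le_two, ← Real.inv_rpow zero_le_two,
      ← Real.mul_rpow (by positivity) h0.le]
    refine Real.rpow_le_rpow_of_nonpos (by positivity) ?_ hr
    linarith [one_add_norm_le_bracket ξ]

lemma integrable_rpow_eucl {r : ℝ} (hr : r < -(n : ℝ)) :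
    Integrable fun x : Eucl n => (1 + ‖x‖) ^ r := by
  have h := integrable_one_add_norm (E := Eucl n) (μ := volume) (r := -r) (by
    simp
    linarith)
  simpa using h

lemma Sch.nab (h : Sch α D w) (v : PV n) : Sch α D (nab α D.U v w) := fun μ => by
  simpa using (h (μ - 1)).nab_any v

lemma Sch.add {w' : Eucl n → ℂ → A} (h : Sch α D w) (h' : Sch α D w') :
    Sch α D fun ξ z => w ξ z + w' ξ z := fun μ => (h μ).add (h' μ)

lemma Sch.smul (c : ℂ) (h : Sch α D w) : Sch α D fun ξ z => c • w ξ z := fun μ => (h μ).smul c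

lemma Sch.tw_bound (h : Sch α D w) {K : Set ℂ} (hK : K ∈ D.fam) (r : ℝ) :
    ∃ C : ℝ, 0 ≤ C ∧ ∀ p : PV n, p.2.2 ∈ K →
      ‖tw α w p‖ ≤ C * (1 + ‖p.2.1‖) ^ r ∧ ‖fderiv ℝ (tw α w) p‖ ≤ C * (1 + ‖p.2.1‖) ^ r := by
  obtain ⟨C, hC, hb⟩ := (h r).tw_bound hK
  obtain ⟨C', hC', hb'⟩ := (h (r - 1)).fderiv_bound hK
  refine ⟨(C + C') * 2 ^ |r|, by positivity, fun p hp => ?_⟩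
  have h1 := bracket_rpow_le_one_add_norm p.2.1 r
  have h2 := hb' p hp
  rw [sub_add_cancel] at h2
  have h3 : 0 ≤ (2 : ℝ) ^ |r| * (1 + ‖p.2.1‖) ^ r := by positivity
  constructor
  · nlinarith [hb p hp, mul_le_mul_of_nonneg_left h1 hC, mul_nonneg hC' h3]
  · nlinarith [mul_le_mul_of_nonneg_left h1 hC', mul_nonneg hC h3]

open Classical in
/-- The scalar function `ξ ↦ ⟨v, ξ⟩ + c`, extended by zero in the parameter. -/
def affineFun (A : Type*) [CStarAlgebra A] (U : Set ℂ) (v : Eucl n) (c : ℝ) (_ξ : Eucl n) (z : ℂ) :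
    A := if z ∈ U then ((inner ℝ v _ξ + c : ℝ) : ℂ) • (1 : A) else 0

lemma hasFDerivAt_affineFun (α : CStarAction n A) {U : Set ℂ} (hU : IsOpen U) (v : Eucl n) (c : ℝ)
    {p : PV n} (hp : p ∈ dom n U) : HasFDerivAt (tw α (affineFun A U v c))
      ((Complex.ofRealCLM.comp ((innerSL ℝ v).comp ((ContinuousLinearMap.fst ℝ _ _).comp
        (ContinuousLinearMap.snd ℝ (Eucl n) (Eucl n × ℂ))))).smulRight (1 : A)) p := by
  set L : PV n →L[ℝ] ℂ := Complex.ofRealCLM.comp ((innerSL ℝ v).comp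
    ((ContinuousLinearMap.fst ℝ _ _).comp (ContinuousLinearMap.snd ℝ (Eucl n) (Eucl n × ℂ))))
    with hLdef
  have hL : ∀ p : PV n, L p = ((inner ℝ v p.2.1 : ℝ) : ℂ) := fun p => rfl
  have h := (L.hasFDerivAt (x := p)).add_const (c : ℂ) |>.smul_const (1 : A)
  refine h.congr_of_eventuallyEq ?_
  filter_upwards [(isOpen_dom hU).mem_nhds hp] with q hq
  have hq' : q.2.2 ∈ U := hq
  simp only [tw, affineFun, hq', if_true, map_smul, map_one, hL]
  push_cast
  rfl

lemma nab_affineFun (α : CStarAction n A) {U : Set ℂ} (hU : IsOpen U) (v : Eucl n) (c : ℝ)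
    (d : PV n) : nab α U d (affineFun A U v c) = affineFun A U 0 (inner ℝ v d.2.1) := by
  funext ξ z
  by_cases hz : z ∈ U
  · rw [nab_of_mem hz, (hasFDerivAt_affineFun α hU v c (p := (0, ξ, z)) hz).fderiv]
    simp [affineFun, hz]
  · simp [nab_of_notMem hz, affineFun, hz]

/-- Makes multiplication by a linear function of `ξ` an instance of the product of symbols. The
disjunctions let a vanishing coefficient have any order; this keeps the class stable, since
derivatives lower the order but annihilate first the linear and then the constant part. -/
lemma Sym.affineFun (v : Eucl n) (c : ℝ) (h1 : v = 0 ∨ 1 ≤ m) (h2 : c = 0 ∨ 0 ≤ m) :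
    Sym α D m (affineFun A D.U v c) := by
  refine Sym.of_class (fun μ => {h | ∃ (v : Eucl n) (c : ℝ), (v = 0 ∨ 1 ≤ μ) ∧ (c = 0 ∨ 0 ≤ μ) ∧
    h = TwistedPsiDO.affineFun A D.U v c}) ?_ ?_ ?_ ?_ _ _ ⟨v, c, h1, h2, rfl⟩
  · rintro μ _ ⟨v, c, -, -, rfl⟩ p hp
    exact (hasFDerivAt_affineFun α D.isOpen v c hp).differentiableAt.differentiableWithinAt
  · rintro μ _ ⟨v, c, -, -, rfl⟩
    rw [nab_affineFun α D.isOpen, nab_affineFun α D.isOpen]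
    funext ξ z
    simp [TwistedPsiDO.affineFun]
  · rintro μ _ ⟨v, c, h1, h2, rfl⟩ d
    refine ⟨_, ⟨0, inner ℝ v d.vec.2.1, Or.inl rfl, ?_, rfl⟩, _, ⟨0, 0, Or.inl rfl, Or.inl rfl,
      rfl⟩, ?_⟩
    · cases d with
      | act j => exact Or.inl (by simp [Dir.vec])
      | sp j =>
        rcases h1 with rfl | h1
        · exact Or.inl (by simp)
        · exact Or.inr (by simp [Dir.wt]; linarith)
      | par => exact Or.inl (by simp [Dir.vec])
    · rw [nab_affineFun α D.isOpen]
      funext ξ z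
      simp [TwistedPsiDO.affineFun]
  · rintro μ _ ⟨v, c, h1, h2, rfl⟩ K hK
    refine ⟨(‖v‖ + |c|) * ‖(1 : A)‖, fun z hz ξ => ?_⟩
    have hzU := D.sub K hK hz
    simp only [TwistedPsiDO.affineFun, hzU, if_true]
    rw [norm_smul, Complex.norm_real, Real.norm_eq_abs, mul_right_comm]
    refine mul_le_mul_of_nonneg_right ?_ (norm_nonneg _)
    refine (abs_add_le _ _).trans ?_
    rw [add_mul]
    refine add_le_add ?_ ?_
    · rcases h1 with rfl | h1
      · simp
      · refine (abs_real_inner_le_norm v ξ).trans (mul_le_mul_of_nonneg_left ?_ (norm_nonneg _))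
        refine (norm_le_bracket ξ).trans ?_
        simpa using bracket_rpow_mono ξ h1
    · rcases h2 with rfl | h2
      · simp
      · refine le_mul_of_one_le_right (abs_nonneg _) ?_
        simpa using bracket_rpow_mono ξ h2

lemma Sym.one : Sym α D 0 fun _ _ => 1 :=
  (Sym.affineFun (0 : Eucl n) 1 (Or.inl rfl) (Or.inr le_rfl)).congr fun ξ z hz => by
    simp [TwistedPsiDO.affineFun, hz]

lemma Sch.inner_smul (h : Sch α D w) (v : Eucl n) :
    Sch α D fun ξ z => ((inner ℝ v ξ : ℝ) : ℂ) • w ξ z := fun μ => by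
  have h1 := (Sym.affineFun (α := α) (D := D) (m := 1) v 0 (Or.inr le_rfl) (Or.inl rfl)).mul
    (h (μ - 1))
  rw [add_sub_cancel] at h1
  exact h1.congr fun ξ z hz => by simp [TwistedPsiDO.affineFun, hz]

lemma nab_const_par {U : Set ℂ} {u : Eucl n → A} (c : ℂ) :
    nab α U (0, 0, c) (fun ξ _ => u ξ) = fun _ _ => 0 := by
  funext ξ z
  by_cases hz : z ∈ U
  · rw [nab_of_mem hz]
    by_cases hd : DifferentiableAt ℝ (tw α fun ξ _ => u ξ) ((0, ξ, z) : PV n)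
    · have h1 : HasDerivAt (fun t : ℝ => ((0, ξ, z) : PV n) + t • ((0, 0, c) : PV n))
          ((0, 0, c) : PV n) 0 := by
        simpa using ((hasDerivAt_id (0 : ℝ)).smul_const ((0, 0, c) : PV n)).const_add
          ((0, ξ, z) : PV n)
      have h2 : HasFDerivAt (tw α fun ξ _ => u ξ)
          (fderiv ℝ (tw α fun ξ _ => u ξ) ((0, ξ, z) : PV n)) (((0, ξ, z) : PV n)
          + (0 : ℝ) • ((0, 0, c) : PV n)) := by
        simpa using hd.hasFDerivAt
      have h3 := h2.comp_hasDerivAt (0 : ℝ) h1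
      have h4 : (tw α fun ξ _ => u ξ) ∘ (fun t : ℝ => ((0, ξ, z) : PV n) + t • ((0, 0, c) : PV n))
          = fun _ => α.act 0 (u ξ) := by
        funext t; simp [tw]
      rw [h4] at h3
      exact HasDerivAt.unique h3 (hasDerivAt_const (𝕜 := ℝ) (0 : ℝ) (α.act 0 (u ξ)))
    · rw [fderiv_zero_of_not_differentiableAt hd]
      simp
  · simp [nab_of_notMem hz]

lemma IsSchwartz.sch {u : Eucl n → A} (h : IsSchwartz α u) (D : ParamDomain) :
    Sch α D fun ξ _ => u ξ := by
  intro μ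
  have hsm : Sm α D.U fun ξ _ => u ξ := by
    refine sm_of_delta D.isOpen (fun ξ z _ => h.smooth.mem ξ) fun γ => ?_
    exact ((h.smooth.smooth γ).comp contDiff_fst).contDiffOn
  have hh : Holo α D.U fun ξ _ => u ξ := by
    rw [Holo, nab_const_par, nab_const_par]
    simp
  refine Sym.of_multi hsm hh fun γ β j K hK => ?_
  cases j with
  | zero =>
    obtain ⟨C, hC⟩ := h.decay ⌈-(μ - len β)⌉₊ γ β
    refine ⟨C, fun z hz ξ => ?_⟩
    rw [Function.iterate_zero, id, ← norm_delta_mpd hsm D.isOpen γ β ξ (D.sub K hK hz)]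
    have hB := bracket_pos ξ
    have h1 : bracket ξ ^ (-(⌈-(μ - len β)⌉₊ : ℝ)) ≤ bracket ξ ^ (μ - len β) :=
      bracket_rpow_mono ξ (by linarith [Nat.le_ceil (-(μ - len β))])
    have h2 := hC ξ
    have hC0 : 0 ≤ C := le_trans (by positivity) h2
    simp only [Nat.cast_zero, add_zero]
    refine le_trans ?_ (mul_le_mul_of_nonneg_left h1 hC0)
    rw [Real.rpow_neg hB.le, Real.rpow_natCast, ← div_eq_mul_inv, le_div_iff₀ (by positivity),
      mul_comm]
    exact h2
  | succ j =>
    refine ⟨0, fun z _ ξ => ?_⟩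
    have e : (nab α D.U (0, 0, 1))^[j] (fun _ _ => (0 : A)) = fun _ _ => 0 := by
      induction j with
      | zero => rfl
      | succ j ih => rw [Function.iterate_succ_apply, nab_zero_fun, ih]
    rw [Function.iterate_succ_apply, nab_const_par, e, mnab_zero_fun, mnab_zero_fun]
    simp

lemma Sch.isSchwartz (h : Sch α D w) {z : ℂ} (hz : z ∈ D.U) : IsSchwartz α fun ξ => w ξ z where
  smooth := ((h 0).isSymbol hz).smooth
  decay N γ β := by
    obtain ⟨C, hC⟩ := ((h (-(N : ℝ) + len β)).isSymbol hz).bound γ β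
    refine ⟨C, fun x => ?_⟩
    have hB := bracket_pos x
    have h1 := hC x
    rw [add_sub_cancel_right, Real.rpow_neg hB.le, Real.rpow_natCast, ← div_eq_mul_inv,
      le_div_iff₀ (by positivity), mul_comm] at h1
    exact h1

end Schwartz

/-! ### Quantization on rapidly decreasing families -/

section Quant

variable {n : ℕ} {A : Type*} [CStarAlgebra A]

/-- `e^{iσ⟨x, ξ⟩}`. -/
def wave (σ : ℝ) (x ξ : Eucl n) : ℂ := Complex.exp (Complex.I * ((σ * inner ℝ x ξ : ℝ) : ℂ))

@[simp] lemma norm_wave (σ : ℝ) (x ξ : Eucl n) : ‖wave σ x ξ‖ = 1 := by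
  rw [wave, Complex.norm_exp]; simp

lemma continuous_wave (σ : ℝ) : Continuous fun p : Eucl n × Eucl n => wave σ p.1 p.2 := by
  unfold wave
  fun_prop

lemma hasFDerivAt_wave_left (σ : ℝ) (x ξ : Eucl n) : HasFDerivAt (fun x => wave σ x ξ)
    ((Complex.I * σ * wave σ x ξ) • (Complex.ofRealCLM.comp (innerSL ℝ ξ))) x := by
  have h0 := ((innerSL ℝ ξ).hasFDerivAt (x := x)).const_mul σ
  have h1 := ((Complex.ofRealCLM.hasFDerivAt.comp x h0).const_mul Complex.I).cexp
  have e : (fun x => Complex.exp (Complex.I * ((Complex.ofRealCLM ∘ fun y => σ * innerSL ℝ ξ y) x)))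
      = fun x => wave σ x ξ := by
    funext y
    simp [wave, real_inner_comm]
  rw [e] at h1
  refine h1.congr_fderiv ?_
  ext v
  simp [wave, real_inner_comm]
  ring

lemma wave_comm (σ : ℝ) (x ξ : Eucl n) : wave σ x ξ = wave σ ξ x := by
  rw [wave, wave, real_inner_comm]

open Classical in
/-- `∫ e^{iσ⟨x,ξ⟩} α_{-x}(g(ξ + Bx)) w(ξ) dξ`, extended by zero in the parameter. -/
def quant (α : CStarAction n A) (B : Matrix (Fin n) (Fin n) ℝ) (U : Set ℂ) (σ : ℝ)
    (g w : Eucl n → ℂ → A) (x : Eucl n) (z : ℂ) : A :=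
  if z ∈ U then ∫ ξ, wave σ x ξ • (tw α g (-x, ξ + matVec B x, z) * w ξ z) else 0

variable {α : CStarAction n A} {B : Matrix (Fin n) (Fin n) ℝ} {D : ParamDomain}
  {g w : Eucl n → ℂ → A} {m σ : ℝ}

/-- The integrand in terms of equivariant extensions. -/
def quantInt (α : CStarAction n A) (B : Matrix (Fin n) (Fin n) ℝ) (σ : ℝ) (g w : Eucl n → ℂ → A)
    (p : PV n) (ξ : Eucl n) : A :=
  wave σ p.2.1 ξ • (tw α g (p.1 - p.2.1, ξ + matVec B p.2.1, p.2.2) * tw α w (p.1, ξ, p.2.2))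

lemma quant_of_notMem {U : Set ℂ} {z : ℂ} (hz : z ∉ U) (x : Eucl n) :
    quant α B U σ g w x z = 0 := by simp [quant, hz]

/-- Under the integral `α_s` merges with `α_{-x}` into `α_{s-x}` and turns `w` into its extension.
So the extension of a quantization is again an integral of extensions. -/
lemma tw_quant {p : PV n} (hp : p ∈ dom n D.U) :
    tw α (quant α B D.U σ g w) p = ∫ ξ, quantInt α B σ g w p ξ := by
  have hp' : p.2.2 ∈ D.U := hp
  simp only [tw, quant, hp', if_true]
  rw [act_integral]
  congr 1
  funext ξ
  simp only [quantInt, tw, map_smul, map_mul, ← α.act_add]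
  rw [sub_eq_add_neg]

lemma quant_of_mem {z : ℂ} (hz : z ∈ D.U) (x : Eucl n) :
    quant α B D.U σ g w x z = ∫ ξ, quantInt α B σ g w (0, x, z) ξ := by
  rw [← tw_quant (D := D) (p := (0, x, z)) hz, tw_zero_left]

lemma quantInt_bound (hg : Sym α D m g) (hw : Sch α D w) {K : Set ℂ} (hK : K ∈ D.fam) (r : ℝ) :
    ∃ C : ℝ, 0 ≤ C ∧ ∀ p : PV n, p.2.2 ∈ K → ∀ ξ,
      ‖quantInt α B σ g w p ξ‖ ≤ C * bracket p.2.1 ^ |m| * (1 + ‖ξ‖) ^ r := by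
  obtain ⟨C, hC, hb⟩ := hg.tw_bound hK
  -- The order `r - m` is chosen so that the product with `⟨ξ⟩^m` decays like `⟨ξ⟩^r`.
  obtain ⟨C', hC', hb'⟩ := (hw (r - m)).tw_bound hK
  refine ⟨C * (1 + ‖matVecL B‖) ^ |m| * 2 ^ |m| * C' * 2 ^ |r|, by positivity, fun p hp ξ => ?_⟩
  have e1 : ‖tw α g (p.1 - p.2.1, ξ + matVec B p.2.1, p.2.2)‖
      ≤ C * (bracket ξ ^ m * ((1 + ‖matVecL B‖) ^ |m| * (2 ^ |m| * bracket p.2.1 ^ |m|))) := by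
    refine (hb (p.1 - p.2.1, ξ + matVec B p.2.1, p.2.2) hp).trans
      (mul_le_mul_of_nonneg_left ?_ hC)
    refine (bracket_add_rpow_le ξ _ m).trans
      (mul_le_mul_of_nonneg_left ?_ (bracket_rpow_pos _ _).le)
    refine (one_add_norm_rpow_mul (norm_nonneg _) (abs_nonneg _)
      ((matVecL B).le_opNorm p.2.1)).trans (mul_le_mul_of_nonneg_left ?_ (by positivity))
    rw [← Real.mul_rpow zero_le_two (bracket_pos _).le]
    exact Real.rpow_le_rpow (by positivity) (one_add_norm_le_bracket _) (abs_nonneg _)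
  have e2 := hb' (p.1, ξ, p.2.2) hp
  have hB := bracket_rpow_pos ξ m
  have hB' := bracket_rpow_pos p.2.1 |m|
  rw [quantInt, norm_smul, norm_wave, one_mul]
  refine (norm_mul_le _ _).trans ((mul_le_mul e1 e2 (norm_nonneg _) (by positivity)).trans ?_)
  have e3 : bracket ξ ^ m * bracket ξ ^ (r - m) ≤ 2 ^ |r| * (1 + ‖ξ‖) ^ r := by
    rw [← Real.rpow_add (bracket_pos ξ), add_sub_cancel]
    exact bracket_rpow_le_one_add_norm ξ r
  calc _ = C * (1 + ‖matVecL B‖) ^ |m| * 2 ^ |m| * C' * bracket p.2.1 ^ |m|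
        * (bracket ξ ^ m * bracket ξ ^ (r - m)) := by ring
    _ ≤ C * (1 + ‖matVecL B‖) ^ |m| * 2 ^ |m| * C' * bracket p.2.1 ^ |m|
        * (2 ^ |r| * (1 + ‖ξ‖) ^ r) := mul_le_mul_of_nonneg_left e3 (by positivity)
    _ = _ := by ring

lemma continuous_quantInt (hg : Sm α D.U g) (hw : Sm α D.U w) {p : PV n} (hp : p ∈ dom n D.U) :
    Continuous (quantInt α B σ g w p) := by
  refine ((continuous_wave σ).comp (by fun_prop : Continuous fun ξ => (p.2.1, ξ))).smul
    ((hg.continuous_comp (l := fun ξ => (p.1 - p.2.1, ξ + matVec B p.2.1, p.2.2)) (by fun_prop)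
      fun _ => hp).mul (hw.continuous_comp (l := fun ξ => (p.1, ξ, p.2.2)) (by fun_prop)
      fun _ => hp))

lemma integrable_quantInt (hg : Sym α D m g) (hw : Sch α D w) {p : PV n} (hp : p ∈ dom n D.U) :
    Integrable (quantInt α B σ g w p) := by
  obtain ⟨C, hC, hb⟩ := quantInt_bound (B := B) (σ := σ) hg hw (D.singleton_mem hp) (-(n + 1))
  exact ((integrable_rpow_eucl (r := -(n + 1)) (by linarith)).const_mul _).mono'
    (continuous_quantInt hg.sm (hw 0).sm hp).aestronglyMeasurable
    (Filter.Eventually.of_forall (hb p rfl))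

/-- The effect of the derivative of the phase. -/
def waveMul (σ : ℝ) (v : Eucl n) (w : Eucl n → ℂ → A) : Eucl n → ℂ → A :=
  fun ξ z => (Complex.I * σ) • (((inner ℝ v ξ : ℝ) : ℂ) • w ξ z)

lemma Sch.waveMul (h : Sch α D w) (σ : ℝ) (v : Eucl n) : Sch α D (waveMul σ v w) :=
  (h.inner_smul v).smul _

/-- The position `x` enters through the group parameter `s - x`, the argument `ξ + Bx` and the wave.
The first two give a derivative of `g`, the third the multiplication by `iσ⟨v, ξ⟩` recorded in
`waveMul`. -/
theorem quant_hasFDerivAt (hg : Sym α D m g) (hw : Sch α D w) {p : PV n} (hp : p ∈ dom n D.U) :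
    ∃ L : PV n →L[ℝ] A, HasFDerivAt (tw α (quant α B D.U σ g w)) L p ∧
      ∀ v, L v = (∫ ξ, quantInt α B σ (nab α D.U (v.1 - v.2.1, matVec B v.2.1, v.2.2) g) w p ξ)
        + ∫ ξ, quantInt α B σ g (fun ξ z => nab α D.U (v.1, 0, v.2.2) w ξ z
          + waveMul σ v.2.1 w ξ z) p ξ := by
  obtain ⟨r, hr, hK⟩ := D.exists_closedBall hp
  obtain ⟨CF, hCF, hbF⟩ := hg.local_bound (matVec B p.2.1) hK
  -- The derivative of the wave grows with exponent `1` and the factor `g` with exponent `|m| + 1`.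
  -- The total exponent is then `-n - 2`, which is integrable.
  obtain ⟨CG, hCG, hbG⟩ := hw.tw_bound hK (-(|m| + n + 4))
  set S : Set (PV n) := {q | matVec B q.2.1 ∈ Metric.closedBall (matVec B p.2.1) 1 ∧
    q.2.2 ∈ Metric.closedBall p.2.2 r} with hS
  have hSn : S ∈ 𝓝 p := by
    refine Filter.inter_mem ?_ ?_
    · exact ((matVecL B).continuous.comp
        (continuous_fst.comp continuous_snd)).continuousAt.preimage_mem_nhds
        (Metric.closedBall_mem_nhds _ one_pos)
    · exact (continuous_snd.comp continuous_snd).continuousAt.preimage_mem_nhds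
        (Metric.closedBall_mem_nhds _ hr)
  let p₁ : PV n →L[ℝ] Eucl n := ContinuousLinearMap.fst ℝ _ _
  let pr : PV n →L[ℝ] Eucl n := (ContinuousLinearMap.fst ℝ _ _).comp (ContinuousLinearMap.snd ℝ _ _)
  let p₃ : PV n →L[ℝ] ℂ := (ContinuousLinearMap.snd ℝ _ _).comp (ContinuousLinearMap.snd ℝ _ _)
  let Λ₁ : PV n →L[ℝ] PV n := (p₁ - pr).prod (((matVecL B).comp pr).prod p₃)
  let Λ₂ : PV n →L[ℝ] PV n := p₁.prod ((0 : PV n →L[ℝ] Eucl n).prod p₃)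
  let l : Eucl n → PV n := fun ξ => (0, ξ, 0)
  have hΛ₁ : ∀ v, Λ₁ v = (v.1 - v.2.1, matVec B v.2.1, v.2.2) := fun v => rfl
  have hΛ₂ : ∀ v, Λ₂ v = (v.1, 0, v.2.2) := fun v => rfl
  have e1 : ∀ q ξ, Λ₁ q + l ξ = (q.1 - q.2.1, ξ + matVec B q.2.1, q.2.2) := fun q ξ => by
    simp [hΛ₁, l, add_comm]
  have e2 : ∀ q ξ, Λ₂ q + l ξ = (q.1, ξ, q.2.2) := fun q ξ => by simp [hΛ₂, l]
  have hl : Continuous l := by fun_prop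
  have hF' : ∀ q ∈ S, ∀ ξ, ‖tw α g (Λ₁ q + l ξ)‖ ≤ CF * (1 + ‖ξ‖) ^ (|m| + 1) ∧
      ‖fderiv ℝ (tw α g) (Λ₁ q + l ξ)‖ ≤ CF * (1 + ‖ξ‖) ^ (|m| + 1) := by
    intro q hq ξ
    rw [e1]
    refine hbF (q.1 - q.2.1, ξ + matVec B q.2.1, q.2.2) hq.2 ξ ?_
    have := hq.1
    rw [mem_closedBall_iff_norm] at this
    simpa [add_comm] using this
  have hG' : ∀ q ∈ S, ∀ ξ, ‖tw α w (Λ₂ q + l ξ)‖ ≤ CG * (1 + ‖ξ‖) ^ (-(|m| + n + 4)) ∧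
      ‖fderiv ℝ (tw α w) (Λ₂ q + l ξ)‖ ≤ CG * (1 + ‖ξ‖) ^ (-(|m| + n + 4)) := by
    intro q hq ξ
    rw [e2]
    exact hbG (q.1, ξ, q.2.2) hq.2
  have hprn : ‖pr‖ ≤ 1 := by
    refine ContinuousLinearMap.opNorm_le_bound _ zero_le_one fun v => ?_
    rw [one_mul]
    exact (norm_fst_le v.2).trans (norm_snd_le v)
  have hcc : ∀ x : Eucl n, Continuous fun ξ => wave σ x ξ := fun x =>
    (continuous_wave σ).comp (by fun_prop : Continuous fun ξ => (x, ξ))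
  obtain ⟨L, hL, hLv⟩ := hasFDerivAt_integral_tw (μ := volume) D.isOpen hg.sm (hw 0).sm
    (c := fun q ξ => wave σ q.2.1 ξ) (c' := fun q ξ => ((Complex.I * σ * wave σ q.2.1 ξ) •
      (Complex.ofRealCLM.comp (innerSL ℝ ξ))).comp pr) (b := fun ξ => (1 + |σ|) * (1 + ‖ξ‖))
    (Λ₁ := Λ₁) (Λ₂ := Λ₂) hl hl hSn
    (fun q hq ξ => by rw [e1]; exact D.sub _ hK hq.2)
    (fun q hq ξ => by rw [e2]; exact D.sub _ hK hq.2)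
    (fun q _ ξ => HasFDerivAt.comp (g := fun x => wave σ x ξ) (f := pr) q
      (hasFDerivAt_wave_left σ q.2.1 ξ) pr.hasFDerivAt)
    (fun q _ => hcc q.2.1) (fun v => by
      have := hcc p.2.1
      simp only [ContinuousLinearMap.comp_apply, smul_apply, innerSL_apply_apply]
      fun_prop)
    (fun q _ ξ => by
      rw [norm_wave]
      nlinarith [abs_nonneg σ, norm_nonneg ξ, mul_nonneg (abs_nonneg σ) (norm_nonneg ξ)])
    (fun q _ ξ => by
      refine (ContinuousLinearMap.opNorm_comp_le _ _).trans ?_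
      have h1 : ‖(Complex.I * σ * wave σ q.2.1 ξ) • (Complex.ofRealCLM.comp (innerSL ℝ ξ))‖
          ≤ |σ| * ‖ξ‖ := by
        rw [norm_smul]
        have : ‖Complex.ofRealCLM.comp (innerSL ℝ ξ)‖ ≤ ‖ξ‖ := by
          refine (ContinuousLinearMap.opNorm_comp_le _ _).trans ?_
          simp
        simpa using mul_le_mul_of_nonneg_left this (abs_nonneg σ)
      nlinarith [abs_nonneg σ, norm_nonneg ξ, mul_nonneg (abs_nonneg σ) (norm_nonneg ξ),
        norm_nonneg pr, norm_nonneg ((Complex.I * σ * wave σ q.2.1 ξ) •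
          (Complex.ofRealCLM.comp (innerSL ℝ ξ)))])
    (fun q hq ξ => (hF' q hq ξ).1) (fun q hq ξ => (hF' q hq ξ).2)
    (fun q hq ξ => (hG' q hq ξ).1) (fun q hq ξ => (hG' q hq ξ).2) (by
      refine ((integrable_rpow_eucl (n := n) (r := 1 + (|m| + 1) + (-(|m| + n + 4)))
        (by linarith)).const_mul ((1 + |σ|) * CF * CG)).congr
        (Filter.Eventually.of_forall fun ξ => ?_)
      have hx : (0 : ℝ) < 1 + ‖ξ‖ := by positivity
      beta_reduce
      rw [Real.rpow_add hx, Real.rpow_add hx, Real.rpow_one]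
      ring)
  refine ⟨L, ?_, fun v => ?_⟩
  · refine hL.congr_of_eventuallyEq ?_
    filter_upwards [(isOpen_dom D.isOpen).mem_nhds hp] with q hq
    rw [tw_quant hq]
    simp only [e1, e2]
    rfl
  · have hg' := hg.nab_any (v.1 - v.2.1, matVec B v.2.1, v.2.2)
    have hw' : Sch α D (fun ξ z => nab α D.U (v.1, 0, v.2.2) w ξ z + waveMul σ v.2.1 w ξ z) :=
      (hw.nab _).add (hw.waveMul σ v.2.1)
    rw [hLv v, ← integral_add (integrable_quantInt hg' hw hp) (integrable_quantInt hg hw' hp)]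
    congr 1
    funext ξ
    simp only [e1, e2, hΛ₁ v, hΛ₂ v, quantInt, tw_add, ContinuousLinearMap.comp_apply, smul_apply,
      innerSL_apply_apply]
    rw [mul_add, smul_add]
    have e3 : tw α (waveMul σ v.2.1 w) (p.1, ξ, p.2.2)
        = (Complex.I * σ * ((inner ℝ v.2.1 ξ : ℝ) : ℂ)) • tw α w (p.1, ξ, p.2.2) := by
      simp only [tw, waveMul, map_smul, smul_smul]
    rw [e3, mul_smul_comm, smul_smul]
    have e4 : (Complex.I * σ * wave σ p.2.1 ξ) • Complex.ofRealCLM (inner ℝ ξ (pr v))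
        = wave σ p.2.1 ξ * (Complex.I * σ * ((inner ℝ v.2.1 ξ : ℝ) : ℂ)) := by
      rw [real_inner_comm]
      simp only [smul_eq_mul, Complex.ofRealCLM_apply]
      have : pr v = v.2.1 := rfl
      rw [this]
      ring
    rw [e4]
    abel

theorem nab_quant (hg : Sym α D m g) (hw : Sch α D w) (v : PV n) :
    nab α D.U v (quant α B D.U σ g w) = fun x z =>
      quant α B D.U σ (nab α D.U (v.1 - v.2.1, matVec B v.2.1, v.2.2) g) w x z
      + quant α B D.U σ g (fun ξ z => nab α D.U (v.1, 0, v.2.2) w ξ z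
          + waveMul σ v.2.1 w ξ z) x z := by
  funext x z
  by_cases hz : z ∈ D.U
  · obtain ⟨L, hL, hLv⟩ := quant_hasFDerivAt (B := B) (σ := σ) hg hw (p := (0, x, z)) hz
    rw [nab_of_mem hz, hL.fderiv, hLv, quant_of_mem hz, quant_of_mem hz]
  · simp [nab_of_notMem hz, quant_of_notMem hz]

lemma quant_smul_left (U : Set ℂ) (c : ℂ) :
    quant α B U σ (fun ξ z => c • g ξ z) w = fun x z => c • quant α B U σ g w x z := by
  funext x z
  by_cases hz : z ∈ U
  · simp only [quant, hz, if_true, tw_smul, smul_mul_assoc]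
    rw [← integral_smul]
    simp only [smul_comm c]
  · simp [quant_of_notMem hz]

lemma quant_smul_right (U : Set ℂ) (c : ℂ) :
    quant α B U σ g (fun ξ z => c • w ξ z) = fun x z => c • quant α B U σ g w x z := by
  funext x z
  by_cases hz : z ∈ U
  · simp only [quant, hz, if_true, mul_smul_comm]
    rw [← integral_smul]
    simp only [smul_comm c]
  · simp [quant_of_notMem hz]

/-- Partial integration against the phase. -/
theorem inner_smul_quant (hg : Sym α D m g) (hw : Sch α D w) (v x : Eucl n) (z : ℂ) :
    (Complex.I * σ * ((inner ℝ x v : ℝ) : ℂ)) • quant α B D.U σ g w x z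
      = -(quant α B D.U σ (nab α D.U (0, v, 0) g) w x z
        + quant α B D.U σ g (nab α D.U (0, v, 0) w) x z) := by
  by_cases hz : z ∈ D.U
  swap
  · simp [quant_of_notMem hz]
  have hp : ∀ s ξ : Eucl n, ((s, ξ, z) : PV n) ∈ dom n D.U := fun _ _ => hz
  set c : ℂ := Complex.I * σ * ((inner ℝ x v : ℝ) : ℂ) with hc
  have i0 := integrable_quantInt (B := B) (σ := σ) hg hw (hp 0 x)
  have i1 := integrable_quantInt (B := B) (σ := σ) (hg.nab_space 0 v) hw (hp 0 x)
  have i2 := integrable_quantInt (B := B) (σ := σ) hg (hw.nab (0, v, 0)) (hp 0 x)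
  set f := quantInt α B σ g w (0, x, z) with hf
  set f' : Eucl n → A := fun ξ => c • f ξ
    + (quantInt α B σ (nab α D.U (0, v, 0) g) w (0, x, z) ξ
      + quantInt α B σ g (nab α D.U (0, v, 0) w) (0, x, z) ξ) with hf'
  have hi' : Integrable f' := (i0.smul c).add (i1.add i2)
  have hderiv : ∀ ξ, HasLineDerivAt ℝ f (f' ξ) ξ v := by
    intro ξ
    let j : Eucl n →L[ℝ] PV n := (0 : Eucl n →L[ℝ] Eucl n).prod
      ((ContinuousLinearMap.id ℝ _).prod 0)
    have hj : ∀ ξ, j ξ = (0, ξ, 0) := fun ξ => rfl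
    have e1 : ∀ ξ, ((0 - x, matVec B x, z) : PV n) + (0, ξ, 0)
        = (0 - x, ξ + matVec B x, z) := fun ξ => by simp [add_comm]
    have e2 : ∀ ξ, ((0, 0, z) : PV n) + (0, ξ, 0) = (0, ξ, z) := fun ξ => by simp
    have h1 := hasFDerivAt_wave_left σ ξ x
    have h2 := HasFDerivAt.comp ξ (hg.sm.hasFDerivAt D.isOpen (p := (0 - x, matVec B x, z) + j ξ)
      (by rw [hj, e1]; exact hz)) (j.hasFDerivAt.const_add (0 - x, matVec B x, z))
    have h3 := HasFDerivAt.comp ξ ((hw 0).sm.hasFDerivAt D.isOpen (p := (0, 0, z) + j ξ)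
      (by rw [hj, e2]; exact hz)) (j.hasFDerivAt.const_add (0, 0, z))
    have h4 := (hasFDerivAt_smul_mul h1 h2 h3).hasLineDerivAt v
    simp only [Function.comp_apply, e1, e2, add_apply, smul_apply, hj,
      ContinuousLinearMap.smulRight_apply, ContinuousLinearMap.comp_apply,
      ContinuousLinearMap.flip_apply, ContinuousLinearMap.mul_apply', fderiv_tw_eq (hp _ _),
      innerSL_apply_apply, Complex.ofRealCLM_apply] at h4
    have e0 : (fun ξ => wave σ ξ x • (tw α g (0 - x, ξ + matVec B x, z) * tw α w (0, ξ, z))) = f := by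
      funext ξ
      simp only [hf, quantInt, wave_comm σ x ξ]
    rw [e0] at h4
    refine (congrArg (fun a => HasLineDerivAt ℝ f a ξ v) ?_).mpr h4
    simp only [hf', hf, quantInt, wave_comm σ x ξ, smul_smul, hc, smul_add]
    congr 2
    simp only [smul_eq_mul]
    ring
  have key := integral_bilinear_hasLineDerivAt_right_eq_neg_left_of_integrable (μ := volume)
    (f := f) (f' := f') (g := fun _ => (1 : ℝ)) (g' := fun _ => 0) (v := v)
    (B := (ContinuousLinearMap.lsmul ℝ ℝ : ℝ →L[ℝ] A →L[ℝ] A).flip) (by simpa using hi')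
    (by simp) (by simpa using i0) (fun x _ => hderiv x)
    (fun x _ => (hasFDerivAt_const (1 : ℝ) x).hasLineDerivAt v)
  simp only [ContinuousLinearMap.flip_apply, ContinuousLinearMap.lsmul_apply, zero_smul, one_smul,
    integral_zero] at key
  have key2 : ∫ ξ, f' ξ = 0 := by rw [← neg_eq_zero]; exact key.symm
  have e : ∫ ξ, f' ξ = c • quant α B D.U σ g w x z
      + (quant α B D.U σ (nab α D.U (0, v, 0) g) w x z
        + quant α B D.U σ g (nab α D.U (0, v, 0) w) x z) := by
    rw [quant_of_mem hz, quant_of_mem hz, quant_of_mem hz]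
    exact (integral_add (i0.smul c) (i1.add i2)).trans
      (congrArg₂ (· + ·) (integral_smul _ _) (integral_add i1 i2))
  rw [key2] at e
  exact eq_neg_of_add_eq_zero_left e.symm

lemma norm_le_sum_abs (x : Eucl n) : ‖x‖ ≤ ∑ j, |inner ℝ x (EuclideanSpace.single j (1 : ℝ))| := by
  have key : x = ∑ j, x j • (EuclideanSpace.single j (1 : ℝ) : Eucl n) := by
    ext i
    simp [Finset.sum_apply, Pi.single_apply]
  conv_lhs => rw [key]
  refine norm_sum_le_of_le _ fun j _ => ?_
  rw [norm_smul]
  simp [EuclideanSpace.inner_single_right]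

/-- Each partial integration in `ξ` gains one power of `x`, by `inner_smul_quant` for the coordinate
directions. The order of `g` does not rise, so the same `m` serves throughout. -/
lemma quant_decay (hσ : σ ≠ 0) (N : ℕ) (hg : Sym α D m g) (hw : Sch α D w) {K : Set ℂ}
    (hK : K ∈ D.fam) : ∃ C : ℝ, 0 ≤ C ∧ ∀ z ∈ K, ∀ x,
      ‖quant α B D.U σ g w x z‖ ≤ C * bracket x ^ (|m| - N) := by
  induction N generalizing g w with
  | zero =>
    obtain ⟨C, hC, hb⟩ := quantInt_bound (B := B) (σ := σ) hg hw hK (-(n + 1))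
    have hInt := integrable_rpow_eucl (n := n) (r := -(n + 1)) (by linarith)
    refine ⟨C * ∫ ξ : Eucl n, (1 + ‖ξ‖) ^ (-((n : ℝ) + 1)),
      mul_nonneg hC (integral_nonneg fun x => by positivity), fun z hz x => ?_⟩
    rw [quant_of_mem (D.sub K hK hz)]
    refine (norm_integral_le_of_norm_le (hInt.const_mul _)
      (Filter.Eventually.of_forall (hb (0, x, z) hz))).trans (le_of_eq ?_)
    rw [integral_const_mul]
    simp only [Nat.cast_zero, sub_zero]
    ring
  | succ N ih =>
    obtain ⟨C, hC, hb⟩ := ih hg hw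
    choose C₁ hC₁ hb₁ using fun j : Fin n =>
      ih (hg.nab_space 0 (EuclideanSpace.single j 1)) hw
    choose C₂ hC₂ hb₂ using fun j : Fin n =>
      ih hg (hw.nab (0, EuclideanSpace.single j 1, 0))
    have hs : 0 ≤ ∑ j, |σ|⁻¹ * (C₁ j + C₂ j) := Finset.sum_nonneg fun j _ => by
      have := hC₁ j; have := hC₂ j; positivity
    refine ⟨C + ∑ j, |σ|⁻¹ * (C₁ j + C₂ j), by positivity, fun z hz x => ?_⟩
    have hB := bracket_pos x
    set P := bracket x ^ (|m| - N) with hP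
    have hP0 : 0 < P := bracket_rpow_pos _ _
    set q := ‖quant α B D.U σ g w x z‖ with hq
    have hj : ∀ j : Fin n, |inner ℝ x (EuclideanSpace.single j (1 : ℝ))| * q
        ≤ |σ|⁻¹ * (C₁ j + C₂ j) * P := by
      intro j
      have h1 := congrArg norm (inner_smul_quant (B := B) (σ := σ) hg hw
        (EuclideanSpace.single j 1) x z)
      rw [norm_smul, norm_neg, norm_mul, norm_mul, Complex.norm_I, one_mul, Complex.norm_real,
        Complex.norm_real, Real.norm_eq_abs, Real.norm_eq_abs] at h1
      have h2 := norm_add_le_of_le (hb₁ j z hz x) (hb₂ j z hz x)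
      rw [← h1, ← add_mul, mul_assoc] at h2
      rw [mul_assoc, ← div_eq_inv_mul, le_div_iff₀ (abs_pos.2 hσ), mul_comm]
      exact h2
    have h3 : bracket x * q ≤ (C + ∑ j, |σ|⁻¹ * (C₁ j + C₂ j)) * P := by
      calc bracket x * q ≤ (1 + ∑ j, |inner ℝ x (EuclideanSpace.single j (1 : ℝ))|) * q :=
            mul_le_mul_of_nonneg_right ((bracket_le_one_add_norm x).trans
              (add_le_add_right (norm_le_sum_abs x) _)) (norm_nonneg _)
        _ = q + ∑ j, |inner ℝ x (EuclideanSpace.single j (1 : ℝ))| * q := by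
            rw [add_mul, one_mul, Finset.sum_mul]
        _ ≤ C * P + ∑ j, |σ|⁻¹ * (C₁ j + C₂ j) * P :=
            add_le_add (hb z hz x) (Finset.sum_le_sum fun j _ => hj j)
        _ = _ := by rw [add_mul, Finset.sum_mul]
    have e : bracket x ^ (|m| - (N + 1 : ℕ)) = P * (bracket x)⁻¹ := by
      rw [hP, ← Real.rpow_neg_one, ← Real.rpow_add hB]
      congr 1
      push_cast
      ring
    rw [e, ← mul_assoc, ← div_eq_mul_inv, le_div_iff₀ hB, mul_comm]
    exact h3

/-- Quantized symbols map rapidly decreasing families to rapidly decreasing families. -/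
theorem Sch.quant (hσ : σ ≠ 0) (hg : Sym α D m g) (hw : Sch α D w) :
    Sch α D (quant α B D.U σ g w) := by
  intro μ
  -- The class ignores the grading: every quantization decays to all orders, so one set serves for
  -- every order.
  refine Sym.of_class (fun _ => {h | ∃ m g w, Sym α D m g ∧ Sch α D w ∧
    h = TwistedPsiDO.quant α B D.U σ g w}) ?_ ?_ ?_ ?_ _ _ ⟨m, g, w, hg, hw, rfl⟩
  · rintro _ _ ⟨m, g, w, hg, hw, rfl⟩ p hp
    obtain ⟨L, hL, -⟩ := quant_hasFDerivAt (B := B) (σ := σ) hg hw hp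
    exact hL.differentiableAt.differentiableWithinAt
  · rintro _ _ ⟨m, g, w, hg, hw, rfl⟩
    have e : ∀ c : ℂ, TwistedPsiDO.nab α D.U (0, 0, c) (TwistedPsiDO.quant α B D.U σ g w)
        = fun x z => c • (TwistedPsiDO.quant α B D.U σ (TwistedPsiDO.nab α D.U (0, 0, 1) g) w x z
          + TwistedPsiDO.quant α B D.U σ g (TwistedPsiDO.nab α D.U (0, 0, 1) w) x z) := by
      intro c
      have h0 : matVec B (0 : Eucl n) = 0 := (matVecL B).map_zero
      rw [nab_quant hg hw]
      simp only [sub_zero, h0, TwistedPsiDO.waveMul, inner_zero_left, Complex.ofReal_zero, zero_smul, smul_zero,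
        add_zero]
      rw [hg.nab_par c, (hw 0).nab_par c, quant_smul_left, quant_smul_right]
      simp only [smul_add]
    rw [e, e]
    simp
  · rintro _ _ ⟨m, g, w, hg, hw, rfl⟩ d
    exact ⟨_, ⟨_, _, _, hg.nab_any _, hw, rfl⟩, _, ⟨_, _, _, hg, (hw.nab _).add (hw.waveMul σ _),
      rfl⟩, nab_quant hg hw d.vec⟩
  · rintro μ _ ⟨m, g, w, hg, hw, rfl⟩ K hK
    obtain ⟨C, hC, hb⟩ := quant_decay (B := B) hσ ⌈|m| - μ⌉₊ hg hw hK
    refine ⟨C, fun z hz x => (hb z hz x).trans (mul_le_mul_of_nonneg_left ?_ hC)⟩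
    exact bracket_rpow_mono x (by linarith [Nat.le_ceil (|m| - μ)])

end Quant

/-! ### Composition of quantized symbols -/

section Composition

variable {n : ℕ} {A : Type*} [CStarAlgebra A] {α : CStarAction n A}
  {B : Matrix (Fin n) (Fin n) ℝ} {D : ParamDomain} {F G w : Eucl n → ℂ → A} {m m' : ℝ}

lemma norm_bumpS_le (x : Eucl n) : ‖bumpS n x‖ ≤ 1 := by
  rw [bumpS_apply, Complex.norm_real, Real.norm_of_nonneg (bump n).nonneg]
  exact (bump n).le_one

lemma wave_add (x y ξ : Eucl n) : wave 1 (x + y) ξ = wave 1 x ξ * wave 1 y ξ := by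
  rw [wave, wave, wave, ← Complex.exp_add, inner_add_left]
  congr 1
  push_cast
  ring

lemma phase_sub_snd (y η ξ : Eucl n) : phase (y, η - ξ) = phase (y, η) * wave 1 y ξ := by
  rw [wave, phase, phase, ← Complex.exp_add, inner_sub_right]
  congr 1
  push_cast
  ring

lemma phase_sub_fst (y x η : Eucl n) : phase (y - x, η) = wave 1 x η * wave (-1) η y := by
  rw [wave, wave, phase, ← Complex.exp_add, inner_sub_left, real_inner_comm η y]
  congr 1
  push_cast
  ring

lemma integral_mul_right_of_integrable {E : Type*} [MeasurableSpace E] {μ : Measure E} {f : E → A}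
    (hf : Integrable f μ) (b : A) : (∫ x, f x ∂μ) * b = ∫ x, f x * b ∂μ :=
  (((ContinuousLinearMap.mul ℝ A).flip b).integral_comp_comm hf).symm

lemma integral_mul_left_of_integrable {E : Type*} [MeasurableSpace E] {μ : Measure E} {f : E → A}
    (hf : Integrable f μ) (b : A) : b * (∫ x, f x ∂μ) = ∫ x, b * f x ∂μ :=
  ((ContinuousLinearMap.mul ℝ A b).integral_comp_comm hf).symm

/-- The integrand of the iterated integral for the composition. -/
def compInt (α : CStarAction n A) (B : Matrix (Fin n) (Fin n) ℝ) (F G w : Eucl n → ℂ → A)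
    (x : Eucl n) (z : ℂ) (θ : ℝ × ℝ) (p : Eucl n × (Eucl n × Eucl n)) : A :=
  (cut (stdCut n) (θ.1, θ.2, 0) p.2 * phase p.2) •
    (tw α F (-x, p.2.2 + matVec B x, z) * quantInt α B 1 G w (0, x + p.2.1, z) p.1)

lemma continuous_compInt (hF : Sm α D.U F) (hG : Sm α D.U G) (hw : Sm α D.U w) (x : Eucl n) {z : ℂ}
    (hz : z ∈ D.U) (θ : ℝ × ℝ) : Continuous (compInt α B F G w x z θ) := by
  have hB : Continuous (matVec B) := (matVecL B).continuous
  unfold compInt quantInt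
  refine ((((contDiff_cut _ _).continuous.comp continuous_snd).mul
    (contDiff_phase.continuous.comp continuous_snd)).smul
    ((hF.continuous_comp (l := fun p : Eucl n × (Eucl n × Eucl n) => (-x, p.2.2 + matVec B x, z))
      (by fun_prop) fun _ => hz).mul ?_))
  refine ((continuous_wave 1).comp (by fun_prop :
    Continuous fun p : Eucl n × (Eucl n × Eucl n) => (x + p.2.1, p.1))).smul
    ((hG.continuous_comp (l := fun p : Eucl n × (Eucl n × Eucl n) =>
      (0 - (x + p.2.1), p.1 + matVec B (x + p.2.1), z)) (by fun_prop) fun _ => hz).mul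
    (hw.continuous_comp (l := fun p : Eucl n × (Eucl n × Eucl n) => (0, p.1, z)) (by fun_prop)
      fun _ => hz))

lemma tw_shift_bound (hF : Sym α D m F) (x : Eucl n) {z : ℂ} (hz : z ∈ D.U) :
    ∃ C : ℝ, 0 ≤ C ∧ ∀ η, ‖tw α F (-x, η + matVec B x, z)‖ ≤ C * (1 + ‖η‖) ^ |m| := by
  obtain ⟨C, hC, hb⟩ := hF.tw_bound (D.singleton_mem hz)
  have hB := bracket_rpow_pos (matVec B x) m
  refine ⟨C * bracket (matVec B x) ^ m, by positivity, fun η => ?_⟩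
  refine (hb (-x, η + matVec B x, z) rfl).trans ?_
  rw [mul_assoc, add_comm]
  exact mul_le_mul_of_nonneg_left (bracket_add_rpow_le _ _ _) hC

lemma integrable_compInt (hF : Sym α D m F) (hG : Sym α D m' G) (hw : Sch α D w) (x : Eucl n)
    {z : ℂ} (hz : z ∈ D.U) {θ : ℝ × ℝ} (h1 : 0 < θ.1) (h2 : 0 < θ.2) :
    Integrable (compInt α B F G w x z θ) := by
  obtain ⟨C, hC, hb⟩ := tw_shift_bound (B := B) hF x hz
  obtain ⟨C', hC', hb'⟩ := quantInt_bound (B := B) (σ := 1) hG hw (D.singleton_mem hz) (-(n + 1))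
  -- This decay absorbs the growth `|m| + |m'|` of the two other factors and leaves the exponent
  -- `-(2n + 1)`, integrable over phase space.
  obtain ⟨C'', hC'', hb''⟩ := ((Dec_cut (stdCut n) (θ := (θ.1, θ.2, 0)) h1 h2).exists_W
    (-(|m| + |m'| + 2 * n + 1))).bound
  have i1 : Integrable fun p : Eucl n × (Eucl n × Eucl n) =>
      ((1 + ‖p.1‖) ^ (-((n : ℝ) + 1))) * ((1 + ‖p.2‖) ^ (-(2 * (n : ℝ) + 1))) :=
    (integrable_rpow_eucl (by linarith)).mul_prod (integrable_rpow_phase (by linarith))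
  have hBx := bracket_rpow_pos x |m'|
  refine (i1.const_mul (C'' * (C * (C' * bracket x ^ |m'|)))).mono'
    (continuous_compInt hF.sm hG.sm (hw 0).sm x hz θ).aestronglyMeasurable
    (Filter.Eventually.of_forall fun p => ?_)
  have hX : (0 : ℝ) < 1 + ‖p.2‖ := by positivity
  have e1 : ‖tw α F (-x, p.2.2 + matVec B x, z)‖ ≤ C * (1 + ‖p.2‖) ^ |m| := by
    refine (hb _).trans (mul_le_mul_of_nonneg_left ?_ hC)
    exact Real.rpow_le_rpow (by positivity) (by linarith [norm_snd_le p.2]) (abs_nonneg _)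
  have e2 : ‖quantInt α B 1 G w (0, x + p.2.1, z) p.1‖
      ≤ C' * (bracket x ^ |m'| * (1 + ‖p.2‖) ^ |m'|) * (1 + ‖p.1‖) ^ (-((n : ℝ) + 1)) := by
    refine (hb' (0, x + p.2.1, z) rfl p.1).trans ?_
    refine mul_le_mul_of_nonneg_right (mul_le_mul_of_nonneg_left ?_ hC') (by positivity)
    refine (bracket_add_rpow_le x p.2.1 |m'|).trans (mul_le_mul_of_nonneg_left ?_ hBx.le)
    rw [abs_abs]
    exact Real.rpow_le_rpow (by positivity) (by linarith [norm_fst_le p.2]) (abs_nonneg _)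
  rw [compInt, norm_smul, norm_mul, norm_phase, mul_one]
  refine (mul_le_mul (hb'' () p.2) ((norm_mul_le _ _).trans (mul_le_mul e1 e2 (norm_nonneg _)
    (by positivity))) (norm_nonneg _) (by positivity)).trans (le_of_eq ?_)
  have e3 : (1 + ‖p.2‖) ^ (-(2 * (n : ℝ) + 1)) = (1 + ‖p.2‖) ^ (-(|m| + |m'| + 2 * n + 1))
      * ((1 + ‖p.2‖) ^ |m| * (1 + ‖p.2‖) ^ |m'|) := by
    rw [← Real.rpow_add hX, ← Real.rpow_add hX]
    congr 1
    ring
  rw [e3]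
  ring

/-- The inner integral over phase space, after translation of the covariable. -/
lemma integral_compInt_phase (hF : Sym α D m F) (hG : Sym α D m' G) (x ξ : Eucl n)
    {z : ℂ} (hz : z ∈ D.U) {θ : ℝ × ℝ} (h1 : 0 < θ.1) (h2 : 0 < θ.2) :
    wave 1 x ξ • (J α B 1 (cut (stdCut n) (θ.1, θ.2, θ.2 • ξ)) F G (-x, ξ + matVec B x, z) * w ξ z)
      = ∫ X, compInt α B F G w x z θ (ξ, X) := by
  have hInt := (Dec_cut (stdCut n) (θ := (θ.1, θ.2, θ.2 • ξ)) h1 h2).integrable (B := B)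
    (p := (-x, ξ + matVec B x, z)) hF hG hz 1
  have hadd : ∀ y, matVec B (x + y) = matVec B x + matVec B y := (matVecL B).map_add x
  rw [J, integral_mul_right_of_integrable hInt, ← integral_smul,
    ← integral_sub_right_eq_self _ ((0, ξ) : Eucl n × Eucl n)]
  congr 1
  funext X
  rcases X with ⟨y, η⟩
  simp only [compInt, quantInt, amp, covShift_apply, actShift_apply, Prod.mk_sub_mk, sub_zero,
    Prod.mk_add_mk, add_zero, one_smul, zero_sub, neg_add, hadd]
  have e1 : cut (stdCut n) (θ.1, θ.2, θ.2 • ξ) (y, η - ξ) = cut (stdCut n) (θ.1, θ.2, 0) (y, η) := by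
    simp [cut, smul_sub]
  have e2 : ξ + matVec B x + (η - ξ) = η + matVec B x := by abel
  have e3 : tw α w (0, ξ, z) = w ξ z := tw_zero_left ..
  rw [e1, e2, phase_sub_snd, wave_add, e3, smul_mul_assoc, smul_smul, mul_smul_comm, smul_smul,
    mul_assoc, ← add_assoc ξ]
  congr 1
  ring

/-- The inner integral over the covariable. -/
lemma integral_compInt_cov (hG : Sym α D m' G) (hw : Sch α D w) (x : Eucl n)
    {z : ℂ} (hz : z ∈ D.U) (θ : ℝ × ℝ) (X : Eucl n × Eucl n) :
    ∫ ξ, compInt α B F G w x z θ (ξ, X) = (cut (stdCut n) (θ.1, θ.2, 0) X * phase X) •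
      (tw α F (-x, X.2 + matVec B x, z) * quant α B D.U 1 G w (x + X.1) z) := by
  simp only [compInt]
  rw [integral_smul, ← integral_mul_left_of_integrable (integrable_quantInt hG hw hz),
    ← quant_of_mem hz]

/-- The composition with cutoffs in phase space. -/
def compCut (α : CStarAction n A) (B : Matrix (Fin n) (Fin n) ℝ) (U : Set ℂ) (M : ℕ)
    (F G w : Eucl n → ℂ → A) (x : Eucl n) (z : ℂ) (θ : ℝ × ℝ) : A :=
  ∫ ξ, wave 1 x ξ • (osc α B U 1 M (cut (stdCut n) (θ.1, θ.2, θ.2 • ξ)) F G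
    (-x, ξ + matVec B x, z) * w ξ z)

lemma compCut_integrand_eq (M : ℕ) (hF : Sym α D m F) (hG : Sym α D m' G) (x ξ : Eucl n)
    {z : ℂ} (hz : z ∈ D.U) {θ : ℝ × ℝ} (h1 : 0 < θ.1) (h2 : 0 < θ.2) :
    wave 1 x ξ • (osc α B D.U 1 M (cut (stdCut n) (θ.1, θ.2, θ.2 • ξ)) F G
      (-x, ξ + matVec B x, z) * w ξ z) = ∫ X, compInt α B F G w x z θ (ξ, X) := by
  rw [osc_eq_J M (Dec_cut (stdCut n) (θ := (θ.1, θ.2, θ.2 • ξ)) h1 h2) hF hG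
    (p := (-x, ξ + matVec B x, z)) hz 1]
  exact integral_compInt_phase hF hG x ξ hz h1 h2

lemma compCut_eq (M : ℕ) (hF : Sym α D m F) (hG : Sym α D m' G) (hw : Sch α D w) (x : Eucl n)
    {z : ℂ} (hz : z ∈ D.U) {θ : ℝ × ℝ} (h1 : 0 < θ.1) (h2 : 0 < θ.2) :
    compCut α B D.U M F G w x z θ = ∫ X, (cut (stdCut n) (θ.1, θ.2, 0) X * phase X) •
      (tw α F (-x, X.2 + matVec B x, z) * quant α B D.U 1 G w (x + X.1) z) := by
  simp only [compCut, compCut_integrand_eq M hF hG x _ hz h1 h2]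
  rw [integral_integral_swap (f := fun ξ X => compInt α B F G w x z θ (ξ, X))
    (integrable_compInt hF hG hw x hz h1 h2)]
  simp only [integral_compInt_cov hG hw x hz]

/-- Measurability in `ξ` is read off from the representation as a partial integral of an integrable
function, instead of from the recursive definition of `osc`. -/
lemma aestronglyMeasurable_compCut (M : ℕ) (hF : Sym α D m F) (hG : Sym α D m' G)
    (hw : Sch α D w) (x : Eucl n) {z : ℂ} (hz : z ∈ D.U) {θ : ℝ × ℝ} (h1 : 0 < θ.1) (h2 : 0 < θ.2) :
    AEStronglyMeasurable fun ξ => wave 1 x ξ • (osc α B D.U 1 M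
      (cut (stdCut n) (θ.1, θ.2, θ.2 • ξ)) F G (-x, ξ + matVec B x, z) * w ξ z) := by
  simp only [compCut_integrand_eq M hF hG x _ hz h1 h2]
  exact (integrable_compInt hF hG hw x hz h1 h2).integral_prod_left.aestronglyMeasurable

lemma compCut_integrand_tendsto {ι : Type*} {l : Filter ι} [l.IsCountablyGenerated] {M : ℕ}
    (hF : Sym α D m F) (hG : Sym α D m' G) (hM : 0 - M + (|m| + |m'|) < -(2 * n : ℝ))
    (x ξ : Eucl n) {z : ℂ} (hz : z ∈ D.U) {θ : ι → ℝ × ℝ} {θ₀ : ℝ × ℝ}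
    (hθ : ∀ i, |(θ i).1| ≤ 1 ∧ |(θ i).2| ≤ 1) (hl : Filter.Tendsto θ l (𝓝 θ₀)) :
    Filter.Tendsto (fun i => wave 1 x ξ • (osc α B D.U 1 M
        (cut (stdCut n) ((θ i).1, (θ i).2, (θ i).2 • ξ)) F G (-x, ξ + matVec B x, z) * w ξ z)) l
      (𝓝 (wave 1 x ξ • (osc α B D.U 1 M (cut (stdCut n) (θ₀.1, θ₀.2, θ₀.2 • ξ)) F G
        (-x, ξ + matVec B x, z) * w ξ z))) := by
  have hc : Continuous fun θ : ℝ × ℝ => ((θ.1, θ.2, θ.2 • ξ) : ℝ × ℝ × Eucl n) := by fun_prop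
  have h := osc_tendsto (B := B) M (WConv_cut (stdCut n)
    (θ := fun i => ((θ i).1, (θ i).2, (θ i).2 • ξ)) hθ ((hc.tendsto θ₀).comp hl)) hF hG hM
    (p := (-x, ξ + matVec B x, z)) hz 1
  exact (h.mul_const _).const_smul _

lemma compCut_tendsto {ι : Type*} {l : Filter ι} [l.IsCountablyGenerated] {M : ℕ}
    (hF : Sym α D m F) (hG : Sym α D m' G) (hM : 0 - M + (|m| + |m'|) < -(2 * n : ℝ))
    (hw : Sch α D w) (x : Eucl n) {z : ℂ} (hz : z ∈ D.U) {θ : ι → ℝ × ℝ} {θ₀ : ℝ × ℝ}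
    (hθ : ∀ i, |(θ i).1| ≤ 1 ∧ |(θ i).2| ≤ 1) (hl : Filter.Tendsto θ l (𝓝 θ₀))
    (hmeas : ∀ᶠ i in l, AEStronglyMeasurable fun ξ => wave 1 x ξ • (osc α B D.U 1 M
      (cut (stdCut n) ((θ i).1, (θ i).2, (θ i).2 • ξ)) F G (-x, ξ + matVec B x, z) * w ξ z)) :
    Filter.Tendsto (fun i => compCut α B D.U M F G w x z (θ i)) l
      (𝓝 (compCut α B D.U M F G w x z θ₀)) := by
  -- The shift of the cutoff depends on `ξ` and is unbounded. As the bounds in `W_cut` are uniform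
  -- in the shift, `ξ` can be included in the index, and the resulting constant does not depend on
  -- it.
  have hW : W 0 fun i : ι × Eucl n => cut (stdCut n) ((θ i.1).1, (θ i.1).2, (θ i.1).2 • i.2) :=
    W_cut (stdCut n) fun i => hθ i.1
  obtain ⟨C, hC, hb⟩ := osc_bound (B := B) M hW hF hG hM (D.singleton_mem hz) (zero_le_one (α := ℝ))
  obtain ⟨C', hC', hb'⟩ := (hw (-(|m + m'| + n + 1))).exists_bound_zero (D.singleton_mem hz)
  have hB := bracket_rpow_pos (matVec B x) (m + m')
  have hInt : Integrable fun ξ : Eucl n => C * (bracket (matVec B x) ^ (m + m')) * C'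
      * 2 ^ |-(|m + m'| + (n : ℝ) + 1)| * (1 + ‖ξ‖) ^ (-((n : ℝ) + 1)) :=
    (integrable_rpow_eucl (by linarith)).const_mul _
  refine tendsto_integral_filter_of_dominated_convergence _ hmeas
    (Filter.Eventually.of_forall fun i => Filter.Eventually.of_forall fun ξ => ?_) hInt
    (Filter.Eventually.of_forall fun ξ => compCut_integrand_tendsto hF hG hM x ξ hz hθ hl)
  have h1 := hb (i, ξ) (-x, ξ + matVec B x, z) rfl 1 (by simp)
  have h2 : bracket (ξ + matVec B x) ^ (m + m')
      ≤ bracket (matVec B x) ^ (m + m') * (1 + ‖ξ‖) ^ |m + m'| := by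
    rw [add_comm]
    exact bracket_add_rpow_le _ _ _
  have h3 := (hb' z rfl ξ).trans (mul_le_mul_of_nonneg_left
    (bracket_rpow_le_one_add_norm ξ (-(|m + m'| + n + 1))) hC')
  have hX : (0 : ℝ) < 1 + ‖ξ‖ := by positivity
  rw [norm_smul, norm_wave, one_mul]
  refine (norm_mul_le _ _).trans ((mul_le_mul (h1.trans (mul_le_mul_of_nonneg_left h2 hC)) h3
    (norm_nonneg _) (by positivity)).trans (le_of_eq ?_))
  have e : (1 + ‖ξ‖) ^ (-((n : ℝ) + 1))
      = (1 + ‖ξ‖) ^ |m + m'| * (1 + ‖ξ‖) ^ (-(|m + m'| + n + 1)) := by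
    rw [← Real.rpow_add hX]
    congr 1
    ring
  rw [e]
  ring

lemma integrable_bumpS_smul {ε : ℝ} (hε : ε ≠ 0) (r : ℝ) :
    Integrable fun η : Eucl n => ‖bumpS n (ε • η)‖ * (1 + ‖η‖) ^ r := by
  have hs : HasCompactSupport fun η : Eucl n => ‖bumpS n (ε • η)‖ := by
    have h : HasCompactSupport (fun x : Eucl n => bumpS n x) :=
      (bump n).hasCompactSupport.comp_left (g := fun r : ℝ => (r : ℂ)) (by simp)
    exact (h.comp_smul hε).norm
  refine Continuous.integrable_of_hasCompactSupport ?_ hs.mul_right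
  refine ((bumpS n).continuous.comp (by fun_prop)).norm.mul ?_
  exact (continuous_const.add continuous_norm).rpow_const fun x =>
    Or.inl (by positivity : (0 : ℝ) < 1 + ‖x‖).ne'

/-- The Fourier transform on families. -/
def fourierFam (α : CStarAction n A) (U : Set ℂ) (w : Eucl n → ℂ → A) : Eucl n → ℂ → A :=
  quant α 0 U (-1) (fun _ _ => 1) w

lemma Sch.fourierFam (h : Sch α D w) : Sch α D (fourierFam α D.U w) :=
  Sch.quant (by norm_num) Sym.one h

lemma fourierFam_of_mem {U : Set ℂ} {z : ℂ} (hz : z ∈ U) (ξ : Eucl n) :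
    fourierFam α U w ξ z = ∫ x, wave (-1) ξ x • w x z := by
  simp [fourierFam, quant, hz, tw]

/-- The decay of `w` controls the position variable and the compact support of the bump the
covariable. So the position cutoff, represented by `c`, can be removed with this bound as majorant.
-/
lemma integrable_comp_limit (hF : Sym α D m F) (hw : Sch α D w) (x : Eucl n) {z : ℂ}
    (hz : z ∈ D.U) {ε : ℝ} (hε : ε ≠ 0) : ∃ b : Eucl n × Eucl n → ℝ, Integrable b ∧
      ∀ X : Eucl n × Eucl n, ∀ c : ℂ, ‖c‖ ≤ 1 → ‖(c * bumpS n (ε • X.2) * phase X) •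
        (tw α F (-x, X.2 + matVec B x, z) * w (x + X.1) z)‖ ≤ b X := by
  obtain ⟨C, hC, hb⟩ := tw_shift_bound (B := B) hF x hz
  obtain ⟨C', hC', hb'⟩ := hw.tw_bound (D.singleton_mem hz) (-(n + 1))
  have i1 : Integrable fun X : Eucl n × Eucl n => (C' * (1 + ‖x + X.1‖) ^ (-((n : ℝ) + 1)))
      * (C * (‖bumpS n (ε • X.2)‖ * (1 + ‖X.2‖) ^ |m|)) :=
    (((integrable_rpow_eucl (by linarith)).comp_add_left x).const_mul C').mul_prod
      ((integrable_bumpS_smul hε _).const_mul C)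
  refine ⟨_, i1, fun X c hc => ?_⟩
  have h1 := (hb' (0, x + X.1, z) rfl).1
  rw [tw_zero_left] at h1
  rw [norm_smul, norm_mul, norm_phase, mul_one, norm_mul]
  have h2 : ‖c‖ * ‖bumpS n (ε • X.2)‖ ≤ ‖bumpS n (ε • X.2)‖ :=
    mul_le_of_le_one_left (norm_nonneg _) hc
  refine (mul_le_mul h2 ((norm_mul_le _ _).trans (mul_le_mul (hb X.2) h1 (norm_nonneg _)
    (by positivity))) (norm_nonneg _) (norm_nonneg _)).trans (le_of_eq ?_)
  ring

lemma continuous_comp_limit (hF : Sm α D.U F) (hw : Sm α D.U w) (x : Eucl n) {z : ℂ}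
    (hz : z ∈ D.U) {c : Eucl n × Eucl n → ℂ} (hc : Continuous c) : Continuous fun X =>
      (c X * phase X) • (tw α F (-x, X.2 + matVec B x, z) * w (x + X.1) z) := by
  refine (hc.mul contDiff_phase.continuous).smul ((hF.continuous_comp (l := fun X : Eucl n × Eucl n =>
    (-x, X.2 + matVec B x, z)) (by fun_prop) fun _ => hz).mul ?_)
  have h := hw.continuous_comp (l := fun X : Eucl n × Eucl n => (0, x + X.1, z)) (by fun_prop)
    fun _ => hz
  simpa only [tw_zero_left] using h

lemma cut_stdCut (ε₁ ε₂ : ℝ) (X : Eucl n × Eucl n) :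
    cut (stdCut n) (ε₁, ε₂, 0) X = bumpS n (ε₁ • X.1) * bumpS n (ε₂ • X.2) := by
  simp [cut, stdCut_apply]

/-- Removing the cutoff in the position variable. -/
lemma comp_tendsto_fst (hF : Sym α D m F) (hw : Sch α D w) (x : Eucl n) {z : ℂ}
    (hz : z ∈ D.U) {ε : ℝ} (hε : ε ≠ 0) :
    Filter.Tendsto (fun ε₁ : ℝ => ∫ X, (cut (stdCut n) (ε₁, ε, 0) X * phase X) •
      (tw α F (-x, X.2 + matVec B x, z) * w (x + X.1) z)) (𝓝[>] 0)
      (𝓝 (∫ X, (bumpS n (ε • X.2) * phase X) •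
        (tw α F (-x, X.2 + matVec B x, z) * w (x + X.1) z))) := by
  obtain ⟨b, hbi, hb⟩ := integrable_comp_limit (B := B) hF hw x hz hε
  refine tendsto_integral_filter_of_dominated_convergence b ?_ ?_ hbi ?_
  · exact Filter.Eventually.of_forall fun ε₁ => (continuous_comp_limit hF.sm (hw 0).sm x hz
      (contDiff_cut _ _).continuous).aestronglyMeasurable
  · refine Filter.Eventually.of_forall fun ε₁ => Filter.Eventually.of_forall fun X => ?_
    rw [cut_stdCut]
    exact hb X _ (norm_bumpS_le _)
  · refine Filter.Eventually.of_forall fun X => ?_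
    have hc : Continuous fun ε₁ : ℝ => bumpS n (ε₁ • X.1) :=
      (bumpS n).continuous.comp (by fun_prop)
    have h1 := hc.tendsto 0
    rw [zero_smul, bumpS_zero] at h1
    have h2 := (((h1.mono_left (nhdsWithin_le_nhds (s := Set.Ioi 0))).mul_const (bumpS n (ε • X.2))).mul_const
      (phase X)).smul_const (tw α F (-x, X.2 + matVec B x, z) * w (x + X.1) z)
    simp only [one_mul] at h2
    simp only [cut_stdCut]
    exact h2

/-- Evaluation of the position integral. -/
lemma comp_limit_eq (hF : Sym α D m F) (hw : Sch α D w) (x : Eucl n) {z : ℂ}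
    (hz : z ∈ D.U) {ε : ℝ} (hε : ε ≠ 0) :
    ∫ X, (bumpS n (ε • X.2) * phase X) • (tw α F (-x, X.2 + matVec B x, z) * w (x + X.1) z)
      = ∫ η, bumpS n (ε • η) • quantInt α B 1 F (fourierFam α D.U w) (0, x, z) η := by
  obtain ⟨b, hbi, hb⟩ := integrable_comp_limit (B := B) hF hw x hz hε
  have hi : Integrable fun X : Eucl n × Eucl n => (bumpS n (ε • X.2) * phase X) •
      (tw α F (-x, X.2 + matVec B x, z) * w (x + X.1) z) := by
    refine hbi.mono' (continuous_comp_limit hF.sm (hw 0).sm x hz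
      ((bumpS n).continuous.comp (by fun_prop))).aestronglyMeasurable
      (Filter.Eventually.of_forall fun X => ?_)
    simpa using hb X 1 (by simp)
  rw [Measure.volume_eq_prod] at hi ⊢
  rw [integral_prod_symm _ hi]
  congr 1
  funext η
  have hwi : Integrable fun y => wave (-1) η y • w y z := by
    have h := integrable_quantInt (B := B) (σ := -1) (Sym.one (α := α)) hw (p := (0, η, z)) hz
    refine h.congr (Filter.Eventually.of_forall fun y => ?_)
    simp [quantInt, tw, α.act_zero]
  have hwi' : Integrable fun y => phase (y, η) • w (x + y) z := by
    have h := (hwi.smul (wave 1 x η)).comp_add_left x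
    refine h.congr (Filter.Eventually.of_forall fun y => ?_)
    have := phase_sub_fst (x + y) x η
    rw [add_sub_cancel_left] at this
    simp [this, smul_smul]
  have e : ∫ y, phase (y, η) • w (x + y) z = wave 1 x η • fourierFam α D.U w η z := by
    rw [fourierFam_of_mem hz, ← integral_smul,
      ← integral_add_left_eq_self (fun y => wave 1 x η • wave (-1) η y • w y z) x]
    congr 1
    funext y
    have := phase_sub_fst (x + y) x η
    rw [add_sub_cancel_left] at this
    rw [this, smul_smul]
  simp only [mul_smul, ← mul_smul_comm (phase _)]
  rw [integral_smul, ← integral_mul_left_of_integrable hwi', e, quantInt, tw_zero_left,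
    mul_smul_comm, zero_sub]

/-- Removing the cutoff in the covariable. -/
lemma comp_tendsto_snd (hF : Sym α D m F) (hw : Sch α D w) (x : Eucl n) {z : ℂ}
    (hz : z ∈ D.U) : Filter.Tendsto (fun ε : ℝ =>
      ∫ η, bumpS n (ε • η) • quantInt α B 1 F w (0, x, z) η) (𝓝[>] 0)
      (𝓝 (quant α B D.U 1 F w x z)) := by
  have hi := integrable_quantInt (B := B) (σ := 1) hF hw (p := (0, x, z)) hz
  rw [quant_of_mem hz]
  refine tendsto_integral_filter_of_dominated_convergence
    (fun η => ‖quantInt α B 1 F w (0, x, z) η‖) ?_ ?_ hi.norm ?_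
  · exact Filter.Eventually.of_forall fun ε => (((bumpS n).continuous.comp
      (by fun_prop)).smul (continuous_quantInt hF.sm (hw 0).sm hz)).aestronglyMeasurable
  · refine Filter.Eventually.of_forall fun ε => Filter.Eventually.of_forall fun η => ?_
    rw [norm_smul]
    exact mul_le_of_le_one_left (norm_nonneg _) (norm_bumpS_le _)
  · refine Filter.Eventually.of_forall fun η => ?_
    have hc : Continuous fun ε : ℝ => bumpS n (ε • η) := (bumpS n).continuous.comp (by fun_prop)
    have h1 := hc.tendsto 0
    rw [zero_smul, bumpS_zero] at h1
    simpa using (h1.mono_left nhdsWithin_le_nhds).smul_const (quantInt α B 1 F w (0, x, z) η)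

/-- The composition formula for quantized symbols. -/
theorem quant_oscI (hF : Sym α D m F) (hG : Sym α D m' G) (hw : Sch α D w) (x : Eucl n) {z : ℂ}
    (hz : z ∈ D.U) : quant α B D.U 1 (oscI α B D.U 1 F G) w x z
      = cn n • quant α B D.U 1 F (fourierFam α D.U (quant α B D.U 1 G w)) x z := by
  obtain ⟨M, hM⟩ := exists_order n 0 (|m| + |m'|)
  have hH : Sch α D (quant α B D.U 1 G w) := Sch.quant one_ne_zero hG hw
  -- The position cutoff is removed first, at a fixed covariable cutoff. The position integral is
  -- then a Fourier transform, which decays rapidly and permits the removal of the second cutoff.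
  have h1 : ∀ ε : ℝ, 0 < ε → ε ≤ 1 → compCut α B D.U M F G w x z (0, ε)
      = ∫ η, bumpS n (ε • η) • quantInt α B 1 F (fourierFam α D.U (quant α B D.U 1 G w))
        (0, x, z) η := by
    intro ε hε hε1
    rw [← comp_limit_eq hF hH x hz hε.ne']
    refine tendsto_nhds_unique ?_ (comp_tendsto_fst (B := B) hF hH x hz hε.ne')
    have h := compCut_tendsto (B := B) (l := 𝓝[>] (0 : ℝ)) (θ := fun ε₁ => (clamp ε₁, ε)) hF hG hM hw
      x hz (fun ε₁ => ⟨abs_clamp_le ε₁, by rw [abs_of_pos hε]; exact hε1⟩)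
      (tendsto_clamp.prodMk_nhds tendsto_const_nhds) (by
        filter_upwards [eventually_clamp] with ε₁ h
        rw [h.2]
        exact aestronglyMeasurable_compCut M hF hG hw x hz (θ := (ε₁, ε)) h.1 hε)
    refine h.congr' ?_
    filter_upwards [eventually_clamp] with ε₁ h
    rw [h.2]
    exact compCut_eq M hF hG hw x hz (θ := (ε₁, ε)) h.1 hε
  have h2 : compCut α B D.U M F G w x z (0, 0)
      = quant α B D.U 1 F (fourierFam α D.U (quant α B D.U 1 G w)) x z := by
    refine tendsto_nhds_unique ?_ (comp_tendsto_snd (B := B) hF hH.fourierFam x hz)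
    have h := compCut_tendsto (B := B) (l := 𝓝[>] (0 : ℝ)) (θ := fun ε => (0, clamp ε)) hF hG hM hw
      x hz (fun ε₁ => ⟨by simp, abs_clamp_le _⟩)
      (tendsto_const_nhds.prodMk_nhds tendsto_clamp) (by
        filter_upwards [eventually_clamp] with ε h
        rw [h.2]
        have hε : |ε| ≤ 1 := by rw [← h.2]; exact abs_clamp_le _
        -- With the position cutoff gone, the Fubini representation no longer applies. Measurability
        -- is inherited from the positive scalings `1/(k+1)` by pointwise convergence.
        refine aestronglyMeasurable_of_tendsto_ae Filter.atTop (f := fun (k : ℕ) ξ => wave 1 x ξ •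
          (osc α B D.U 1 M (cut (stdCut n) (1 / ((k : ℝ) + 1), ε, ε • ξ)) F G
            (-x, ξ + matVec B x, z) * w ξ z))
          (fun k => aestronglyMeasurable_compCut M hF hG hw x hz (θ := (1 / ((k : ℝ) + 1), ε))
            (by positivity) h.1)
          (Filter.Eventually.of_forall fun ξ => compCut_integrand_tendsto hF hG hM x ξ hz
            (θ := fun k : ℕ => (1 / ((k : ℝ) + 1), ε)) (θ₀ := (0, ε)) (fun k => ⟨?_, hε⟩)
            (tendsto_one_div_add_atTop_nhds_zero_nat.prodMk_nhds tendsto_const_nhds))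
        rw [abs_of_nonneg (by positivity), div_le_one (by positivity)]
        linarith [(Nat.cast_nonneg k : (0 : ℝ) ≤ k)])
    refine h.congr' ?_
    filter_upwards [eventually_clamp] with ε h
    rw [h.2]
    exact h1 ε h.1 (by rw [← h.2]; exact (le_abs_self _).trans (abs_clamp_le _))
  rw [← h2, compCut, quant, if_pos hz, ← integral_smul]
  congr 1
  funext ξ
  have e : cut (stdCut n) (0, 0, (0 : ℝ) • ξ) = fun _ => 1 := by
    rw [zero_smul, cut_zero, stdCut_zero]
  have e2 : tw α (oscI α B D.U 1 F G) (-x, ξ + matVec B x, z)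
      = cn n • osc α B D.U 1 M (fun _ => 1) F G (-x, ξ + matVec B x, z) := by
    rw [osc_act, tw, oscI_eq_osc hF hG hM 1 _ hz]
    exact map_smul (actL α (-x)) _ _
  rw [e2, smul_mul_assoc, smul_comm]
  simp only [e]

end Composition

/-! ### Scaling by constants -/

section Scaling

variable {n : ℕ} {A : Type*} [CStarAlgebra A] {α : CStarAction n A}
  {B : Matrix (Fin n) (Fin n) ℝ}

/-- Multiplication by a nonzero scalar is a continuous linear equivalence, so no differentiability
is needed. The same then holds for the iterated derivatives. -/
lemma pd_const_smul (c : ℂ) (j : Fin n) (F : Eucl n → A) :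
    pd j (fun x => c • F x) = fun x => c • pd j F x := by
  funext x
  by_cases hc : c = 0
  · subst hc
    simp [pd]
  · let e : A ≃L[ℝ] A := ContinuousLinearEquiv.smulLeft (Units.mk0 c hc)
    have h := e.comp_fderiv (f := F) (x := x)
    have h1 : e ∘ F = fun x => c • F x := rfl
    rw [h1] at h
    rw [pd, h]
    rfl

lemma mpd_const_smul (c : ℂ) (γ : Fin n → ℕ) (F : Eucl n → A) :
    mpd γ (fun x => c • F x) = fun x => c • mpd γ F x :=
  (foldIter_semiconj (P := fun _ => True) (φ := fun (F : Eucl n → A) x => c • F x)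
    (fun _ _ _ => trivial) (fun j F _ => (pd_const_smul c j F).symm) γ (a := F) trivial).symm

lemma mpdB_const_smul (c : ℂ) (γ : Fin n → ℕ) (F : Eucl n → A) :
    mpdB B γ (fun x => c • F x) = fun x => c • mpdB B γ F x := by
  refine (foldIter_semiconj (P := fun _ => True) (φ := fun (F : Eucl n → A) x => c • F x)
    (fun _ _ _ => trivial) (fun j F _ => ?_) γ (a := F) trivial).symm
  funext x
  simp only [pdB, pd_const_smul, Finset.smul_sum, smul_comm c]

lemma delta_const_smul (c : ℂ) (γ : Fin n → ℕ) (a : A) :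
    delta α γ (c • a) = c • delta α γ a := by
  have e : (fun t => α.act t (c • a)) = fun t => c • α.act t a := by
    funext t
    exact map_smul _ _ _
  rw [delta, delta, e, mpd_const_smul, smul_comm]

lemma twistDeriv_const_smul (c : ℂ) (κ : Fin n → ℕ) (f : Eucl n → A) (ξ : Eucl n) :
    twistDeriv α B κ (fun ζ => c • f ζ) ξ = c • twistDeriv α B κ f ξ := by
  have e : (fun x => α.act (-x) (c • f (ξ + matVec B x)))
      = fun x => c • α.act (-x) (f (ξ + matVec B x)) := by
    funext x
    exact map_smul _ _ _
  rw [twistDeriv, e, mpd_const_smul, twistDeriv]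

lemma smul_mem_smoothSet (c : ℂ) {a : A} (ha : a ∈ smoothSet α) : c • a ∈ smoothSet α := by
  have e : (fun t => α.act t (c • a)) = fun t => c • α.act t a := by
    funext t
    exact map_smul _ _ _
  change ContDiff ℝ ∞ fun t => α.act t (c • a)
  rw [e]
  exact ContDiff.const_smul c ha

lemma IsOscIntegral.const_smul (c : ℂ) {a : Eucl n → Eucl n → A} {v : A}
    (h : IsOscIntegral α a v) : IsOscIntegral α (fun y η => c • a y η) (c • v) := by
  have e : ∀ χ ε, regIntegral χ (fun y η => c • a y η) ε = c • regIntegral χ a ε := by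
    intro χ ε
    simp only [regIntegral, smul_comm _ c]
    simp only [integral_smul]
    rw [smul_comm]
  refine ⟨smul_mem_smoothSet c h.1, fun χ hχ => ⟨fun ε hε => ?_, fun γ => ?_⟩⟩
  · rw [e]
    exact smul_mem_smoothSet c ((h.2 χ hχ).1 ε hε)
  · simp only [e, delta_const_smul]
    exact ((h.2 χ hχ).2 γ).const_smul c

lemma sharpAmplitude_smul (c c' : ℂ) (f g : Eucl n → A) (ξ y η : Eucl n) :
    sharpAmplitude α B (fun ζ => c • f ζ) (fun ζ => c' • g ζ) ξ y η
      = (c * c') • sharpAmplitude α B f g ξ y η := by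
  simp [sharpAmplitude, smul_smul, mul_comm c]

lemma fourierT_const_smul (c : ℂ) (u : Eucl n → A) :
    fourierT (fun x => c • u x) = fun ξ => c • fourierT u ξ := by
  funext ξ
  simp only [fourierT, smul_comm _ c]
  rw [integral_smul]

lemma psiDO_const_smul_left (c : ℂ) (f u : Eucl n → A) :
    psiDO α B (fun ζ => c • f ζ) u = fun x => c • psiDO α B f u x := by
  funext x
  simp only [psiDO, map_smul, smul_mul_assoc, smul_comm _ c]
  rw [integral_smul, smul_comm]

lemma psiDO_const_smul_right (c : ℂ) (f u : Eucl n → A) :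
    psiDO α B f (fun x => c • u x) = fun x => c • psiDO α B f u x := by
  funext x
  simp only [psiDO, fourierT_const_smul, mul_smul_comm, smul_comm _ c]
  rw [integral_smul, smul_comm]

end Scaling

/-! ### Composition of pseudodifferential multipliers -/

section PsiDO

variable {n : ℕ} {A : Type*} [CStarAlgebra A] {α : CStarAction n A}
  {B : Matrix (Fin n) (Fin n) ℝ} {D : ParamDomain} {F G w : Eucl n → ℂ → A} {m m' : ℝ}

lemma fourierT_eq {U : Set ℂ} {z : ℂ} (hz : z ∈ U) :
    fourierT (fun x => w x z) = fun ξ => fourierFam α U w ξ z := by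
  funext ξ
  rw [fourierFam_of_mem hz, fourierT]
  congr 1
  funext x
  rw [wave, real_inner_comm]
  congr 2
  push_cast
  ring

lemma psiDO_eq {U : Set ℂ} {z : ℂ} (hz : z ∈ U) : psiDO α B (fun ζ => F ζ z) (fun x => w x z)
    = fun x => (cn n : ℂ) • quant α B U 1 F (fourierFam α U w) x z := by
  funext x
  rw [psiDO, fourierT_eq (α := α) hz, quant, if_pos hz, cn, Complex.coe_smul]
  simp only [wave, one_mul]
  rfl

lemma Sch.psiDO_fam (hG : Sym α D m' G) (hw : Sch α D w) :
    Sch α D fun x z => (cn n : ℂ) • TwistedPsiDO.quant α B D.U 1 G (TwistedPsiDO.fourierFam α D.U w)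
      x z :=
  (Sch.quant one_ne_zero hG hw.fourierFam).smul _

/-- This is `quant_oscI` applied to the Fourier transform of `u`; the factor `(2π)^{-n}` there is
the normalization of the inner operator. -/
theorem psiDO_comp (hF : Sym α D m F) (hG : Sym α D m' G) {u : Eucl n → A} (hu : IsSchwartz α u)
    {z : ℂ} (hz : z ∈ D.U) : IsSchwartz α (psiDO α B (fun ζ => G ζ z) u) ∧
      psiDO α B (fun ζ => F ζ z) (psiDO α B (fun ζ => G ζ z) u)
        = psiDO α B (fun ζ => oscI α B D.U 1 F G ζ z) u := by
  have hw := hu.sch D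
  have e1 := psiDO_eq (α := α) (B := B) (F := G) (w := fun x _ => u x) hz
  refine ⟨?_, ?_⟩
  · rw [e1]
    exact (Sch.psiDO_fam hG hw).isSchwartz hz
  · rw [e1, psiDO_const_smul_right, psiDO_eq (α := α) (B := B) (F := F)
      (w := quant α B D.U 1 G (fourierFam α D.U fun x _ => u x)) hz,
      psiDO_eq (α := α) (B := B) (w := fun x _ => u x) hz]
    funext x
    rw [quant_oscI hF hG hw.fourierFam x hz]
    simp only [Complex.coe_smul]

end PsiDO

/-! ### The twisted product of weakly parametric symbols -/

section WeaklyParametric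

variable {n : ℕ} {A : Type*} [CStarAlgebra A] {α : CStarAction n A}
  {B : Matrix (Fin n) (Fin n) ℝ} {a b m d m' d' : ℝ} {f g : Eucl n → ℂ → A}

/-- For fixed `z` the powers are scalars. They pass through derivatives and products and combine as
`z^d z^{d'} = z^{d+d'}`. -/
lemma sharpTerm_paramForm (d d' : ℝ) (f g : Eucl n → ℂ → A) (j : ℕ) (ξ : Eucl n) {z : ℂ}
    (hz : z ≠ 0) : sharpTerm α B (paramForm a b d f) (paramForm a b d' g) j ξ z
      = paramForm a b (d + d') (sharpTerm α B f g j) ξ z := by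
  simp only [sharpTerm, paramForm, mpd_const_smul, twistDeriv_const_smul, branchPow_add d d' hz,
    smul_mul_smul_comm, Finset.smul_sum]
  exact Finset.sum_congr rfl fun κ _ => smul_comm _ _ _

lemma isOscIntegral_sharpAmplitude (hab' : b ≤ a + 2 * Real.pi)
    (hf : IsWeaklyParametric α a b m d f) (hg : IsWeaklyParametric α a b m' d' g) (ξ : Eucl n)
    {z : ℂ} (hz : z ∈ invSector a b) :
    IsOscIntegral α (sharpAmplitude α B (fun ζ => f ζ z⁻¹) (fun ζ => g ζ z⁻¹) ξ)
      ((branchPow a b (d + d') z)⁻¹ • oscI α B (invSector a b) 1 (paramForm a b d f)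
        (paramForm a b d' g) ξ z) := by
  have h0 := ne_zero_of_mem_invSector hz
  have h := (isOscIntegral_oscI (B := B) (hf.sym hab') (hg.sym hab') ξ hz).const_smul
    (branchPow a b (d + d') z)⁻¹
  refine (congrArg (fun k => IsOscIntegral α k _) ?_).mp h
  funext y η
  have e := sharpAmplitude_smul (α := α) (B := B) (branchPow a b d z) (branchPow a b d' z)
    (fun ζ => f ζ z⁻¹) (fun ζ => g ζ z⁻¹) ξ y η
  rw [← branchPow_add d d' h0] at e
  exact (congrArg (fun c => (branchPow a b (d + d') z)⁻¹ • c) e).trans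
    (inv_smul_smul₀ (branchPow_ne_zero h0) _)

lemma sharpParam_eq (hab' : b ≤ a + 2 * Real.pi) (hf : IsWeaklyParametric α a b m d f)
    (hg : IsWeaklyParametric α a b m' d' g) (ξ : Eucl n) {z : ℂ} (hz : z ∈ invSector a b) :
    sharpParam α B f g ξ z⁻¹ = (branchPow a b (d + d') z)⁻¹ • oscI α B (invSector a b) 1
      (paramForm a b d f) (paramForm a b d' g) ξ z :=
  (isOscIntegral_sharpAmplitude hab' hf hg ξ hz).oscIntegral_eq

lemma paramForm_sharpParam (hab' : b ≤ a + 2 * Real.pi) (hf : IsWeaklyParametric α a b m d f)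
    (hg : IsWeaklyParametric α a b m' d' g) (ξ : Eucl n) {z : ℂ} (hz : z ∈ invSector a b) :
    paramForm a b (d + d') (sharpParam α B f g) ξ z = oscI α B (invSector a b) 1
      (paramForm a b d f) (paramForm a b d' g) ξ z := by
  rw [paramForm, sharpParam_eq hab' hf hg ξ hz,
    smul_inv_smul₀ (branchPow_ne_zero (ne_zero_of_mem_invSector hz))]

lemma inv_mem_invSector {μ : ℂ} (hμ : μ ∈ openSector a b) : μ⁻¹ ∈ invSector a b := by
  simpa [invSector] using hμ

theorem isOscIntegral_sharpParam (hab' : b ≤ a + 2 * Real.pi)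
    (hf : IsWeaklyParametric α a b m d f) (hg : IsWeaklyParametric α a b m' d' g) (ξ : Eucl n)
    {μ : ℂ} (hμ : μ ∈ openSector a b) :
    IsOscIntegral α (sharpAmplitude α B (fun ζ => f ζ μ) (fun ζ => g ζ μ) ξ)
      (sharpParam α B f g ξ μ) := by
  have h := isOscIntegral_sharpAmplitude (B := B) hab' hf hg ξ (inv_mem_invSector hμ)
  rwa [← sharpParam_eq hab' hf hg ξ (inv_mem_invSector hμ), inv_inv] at h

theorem isWeaklyParametric_sharpParam (hab' : b ≤ a + 2 * Real.pi)
    (hf : IsWeaklyParametric α a b m d f) (hg : IsWeaklyParametric α a b m' d' g) :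
    IsWeaklyParametric α a b (m + m') (d + d') (sharpParam α B f g) := by
  refine isWeaklyParametric_of_sym hab' (Sym.congr (F := oscI α B (invSector a b) 1
    (paramForm a b d f) (paramForm a b d' g)) ?_ fun ξ z hz => paramForm_sharpParam hab' hf hg ξ hz)
  have h := (leibnizOp_oscI (B := B) (D := sectorDom a b hab') 1).sym (hf.sym hab') (hg.sym hab')
  rwa [add_zero] at h

theorem composesTo_sharpParam (hab' : b ≤ a + 2 * Real.pi)
    (hf : IsWeaklyParametric α a b m d f) (hg : IsWeaklyParametric α a b m' d' g) :
    ComposesTo α B a b f g (sharpParam α B f g) := by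
  suffices H : ∀ z ∈ invSector a b, ∀ u, IsSchwartz α u →
      IsSchwartz α (psiDO α B (fun ζ => g ζ z⁻¹) u) ∧
      psiDO α B (fun ζ => f ζ z⁻¹) (psiDO α B (fun ζ => g ζ z⁻¹) u)
        = psiDO α B (fun ζ => sharpParam α B f g ζ z⁻¹) u by
    intro μ hμ u hu
    simpa using H μ⁻¹ (inv_mem_invSector hμ) u hu
  intro z hz u hu
  have h0 := ne_zero_of_mem_invSector hz
  have hc : branchPow a b d z ≠ 0 := branchPow_ne_zero h0
  have hc' : branchPow a b d' z ≠ 0 := branchPow_ne_zero h0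
  set c := branchPow a b d z with hcdef
  set c' := branchPow a b d' z with hcdef'
  have hcc : branchPow a b (d + d') z = c * c' := branchPow_add d d' h0
  obtain ⟨h1, h2⟩ := psiDO_comp (B := B) (hf.sym hab') (hg.sym hab') hu (z := z) hz
  have e1 : (fun ζ => paramForm a b d f ζ z) = fun ζ => c • f ζ z⁻¹ := rfl
  have e2 : (fun ζ => paramForm a b d' g ζ z) = fun ζ => c' • g ζ z⁻¹ := rfl
  have e3 : (fun ζ => oscI α B (sectorDom a b hab').U 1 (paramForm a b d f) (paramForm a b d' g) ζ z)
      = fun ζ => (c * c') • sharpParam α B f g ζ z⁻¹ := by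
    funext ζ
    rw [← hcc]
    exact (paramForm_sharpParam hab' hf hg ζ hz).symm
  rw [e2, psiDO_const_smul_left] at h1
  rw [e1, e2, e3, psiDO_const_smul_left, psiDO_const_smul_left, psiDO_const_smul_left,
    psiDO_const_smul_right] at h2
  refine ⟨?_, ?_⟩
  · have h3 := (((h1.sch (sectorDom a b hab')).smul c'⁻¹).isSchwartz (z := z) hz)
    simpa [smul_smul, hc'] using h3
  · funext x
    have h3 := congrFun h2 x
    simp only [smul_smul] at h3
    exact smul_right_injective A (mul_ne_zero hc hc') h3

lemma Sym.oscI_sub_sum {D : ParamDomain} {F G : Eucl n → ℂ → A} (hF : Sym α D m F)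
    (hG : Sym α D m' G) (N : ℕ) :
    Sym α D (m + m' - N) fun ξ z => oscI α B D.U 1 F G ξ z
      - ∑ j ∈ Finset.range N, TwistedPsiDO.sharpTerm α B F G j ξ z := by
  refine (Sym.congr ((leibnizOp_remainder (B := B) (D := D) N).sym hF hG) fun ξ z hz => ?_).mono
    (by linarith)
  rw [taylor_eq_sharpTerm D.isOpen hF.sm hG.sm N ξ hz]

/-- Asymptotic expansions in terms of symbols. -/
lemma asympExpansion_of_sym (hab' : b ≤ a + 2 * Real.pi) {F : ℕ → Eucl n → ℂ → A}
    (h : ∀ N : ℕ, Sym α (sectorDom a b hab') (m - N) fun ξ z => paramForm a b d f ξ z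
      - ∑ j ∈ Finset.range N, paramForm a b d (F j) ξ z) : AsympExpansion α a b m d f F := by
  have h1 : ∀ N : ℕ, IsWeaklyParametric α a b (m - N) d
      (fun ξ μ => f ξ μ - ∑ j ∈ Finset.range N, F j ξ μ) := fun N => by
    refine isWeaklyParametric_of_sym hab' ((h N).congr fun ξ z _ => ?_)
    simp only [paramForm, smul_sub, Finset.smul_sum]
  refine ⟨by simpa using h1 0, fun j => ?_, h1⟩
  -- The `j`-th term is the difference of two consecutive remainders and inherits the weaker of
  -- their orders.
  refine isWeaklyParametric_of_sym hab' (Sym.congr ((h j).sub ((h (j + 1)).mono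
    (by push_cast; linarith))) fun ξ z _ => ?_)
  rw [Finset.sum_range_succ]
  abel

lemma AsympExpansion.sym (hab' : b ≤ a + 2 * Real.pi) {F : ℕ → Eucl n → ℂ → A}
    (h : AsympExpansion α a b m d f F) (N : ℕ) :
    Sym α (sectorDom a b hab') (m - N) fun ξ z => paramForm a b d f ξ z
      - ∑ j ∈ Finset.range N, paramForm a b d (F j) ξ z := by
  refine ((h.remainder N).sym hab').congr fun ξ z _ => ?_
  simp only [paramForm, smul_sub, Finset.smul_sum]

theorem asympExpansion_sharpParam (hab' : b ≤ a + 2 * Real.pi)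
    (hf : IsWeaklyParametric α a b m d f) (hg : IsWeaklyParametric α a b m' d' g) :
    AsympExpansion α a b (m + m') (d + d') (sharpParam α B f g) (sharpTerm α B f g) := by
  refine asympExpansion_of_sym hab' fun N =>
    ((hf.sym hab').oscI_sub_sum (B := B) (hg.sym hab') N).congr fun ξ z hz => ?_
  rw [paramForm_sharpParam hab' hf hg ξ hz]
  simp only [sharpTerm_paramForm d d' f g _ ξ (ne_zero_of_mem_invSector hz)]
  rfl

end WeaklyParametric

/-! ### Asymptotic expansions -/

section Expansion

variable {n : ℕ} {A : Type*} [CStarAlgebra A] {α : CStarAction n A} {D : ParamDomain}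
  {μ μ' : ℝ} {h h' : Eucl n → ℂ → A} {H H' : ℕ → Eucl n → ℂ → A}

/-- `h ∼ ∑_j H_j` with leading order `μ`. -/
def Expn (α : CStarAction n A) (D : ParamDomain) (μ : ℝ) (h : Eucl n → ℂ → A)
    (H : ℕ → Eucl n → ℂ → A) : Prop :=
  ∀ N : ℕ, Sym α D (μ - N) fun ξ z => h ξ z - ∑ j ∈ Finset.range N, H j ξ z

lemma Expn.sym (e : Expn α D μ h H) : Sym α D μ h := by simpa using e 0

lemma Expn.part (e : Expn α D μ h H) (j : ℕ) : Sym α D (μ - j) (H j) := by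
  refine Sym.congr ((e j).sub ((e (j + 1)).mono (by push_cast; linarith))) fun ξ z _ => ?_
  rw [Finset.sum_range_succ]
  abel

lemma Expn.congr (e : Expn α D μ h H) (he : ∀ ξ, ∀ z ∈ D.U, h' ξ z = h ξ z)
    (hE : ∀ j ξ, ∀ z ∈ D.U, H' j ξ z = H j ξ z) : Expn α D μ h' H' := fun N =>
  (e N).congr fun ξ z hz => by
    rw [he ξ z hz, Finset.sum_congr rfl fun j _ => hE j ξ z hz]

lemma Expn.smul (c : ℂ) (e : Expn α D μ h H) :
    Expn α D μ (fun ξ z => c • h ξ z) fun j ξ z => c • H j ξ z := fun N =>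
  ((e N).smul c).congr fun ξ z _ => by rw [smul_sub, Finset.smul_sum]

lemma Expn.sum {ι : Type*} (s : Finset ι) {h : ι → Eucl n → ℂ → A} {H : ι → ℕ → Eucl n → ℂ → A}
    (e : ∀ i ∈ s, Expn α D μ (h i) (H i)) :
    Expn α D μ (fun ξ z => ∑ i ∈ s, h i ξ z) fun j ξ z => ∑ i ∈ s, H i j ξ z := fun N =>
  (Sym.sum s fun i hi => e i hi N).congr fun ξ z _ => by
    rw [Finset.sum_comm, Finset.sum_sub_distrib]

/-- Padding with `s` zero terms lets expansions of different leading orders be added with a common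
numbering. -/
lemma Expn.shift (s : ℕ) (e : Expn α D (μ - s) h H) :
    Expn α D μ h fun l ξ z => if s ≤ l then H (l - s) ξ z else 0 := by
  intro N
  rcases le_total N s with hN | hN
  · refine (e.sym.mono (sub_le_sub_left (by exact_mod_cast hN) μ)).congr fun ξ z _ => ?_
    rw [Finset.sum_eq_zero fun l hl => if_neg (by have := Finset.mem_range.1 hl; omega), sub_zero]
  · obtain ⟨M, rfl⟩ := Nat.exists_eq_add_of_le hN
    refine ((e M).mono (by push_cast; linarith)).congr fun ξ z _ => ?_
    rw [Finset.sum_range_add, Finset.sum_eq_zero fun l hl =>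
      if_neg (by have := Finset.mem_range.1 hl; omega), zero_add]
    simp

lemma Expn.mul_left {F : Eucl n → ℂ → A} (hF : Sym α D μ F) (e : Expn α D μ' h H) :
    Expn α D (μ + μ') (fun ξ z => F ξ z * h ξ z) fun j ξ z => F ξ z * H j ξ z := fun N =>
  ((hF.mul (e N)).mono (by linarith)).congr fun ξ z _ => by rw [mul_sub, Finset.mul_sum]

/-- Substitution of expansions into an expansion. -/
lemma Expn.of_sum {E : ℕ → Eucl n → ℂ → A} {P : ℕ → ℕ → Eucl n → ℂ → A}
    (hh : ∀ N : ℕ, Sym α D (μ - N) fun ξ z => h ξ z - ∑ k ∈ Finset.range N, E k ξ z)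
    (e : ∀ k : ℕ, Expn α D (μ - k) (E k) (P k)) :
    Expn α D μ h fun j ξ z => ∑ q ∈ Finset.HasAntidiagonal.antidiagonal j, P q.1 q.2 ξ z := by
  intro N
  -- The `k`-th term is expanded only up to `N - k`, since its remainder then has order `μ - k - (N
  -- - k) = μ - N`.
  have h1 : Sym α D (μ - N) fun ξ z => ∑ k ∈ Finset.range N,
      (E k ξ z - ∑ l ∈ Finset.range (N - k), P k l ξ z) := by
    refine Sym.sum _ fun k hk => (e k (N - k)).mono ?_
    rw [Nat.cast_sub (Finset.mem_range.1 hk).le]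
    linarith
  refine ((hh N).add h1).congr fun ξ z _ => ?_
  rw [Finset.sum_sub_distrib, sub_add_sub_cancel,
    ← Finset.sum_range_diag_flip N fun k l => P k l ξ z]
  congr 1
  exact Finset.sum_congr rfl fun j _ =>
    Finset.Nat.sum_antidiagonal_eq_sum_range_succ (fun k l => P k l ξ z) j

lemma Expn.mul (e : Expn α D μ h H) (e' : Expn α D μ' h' H') :
    Expn α D (μ + μ') (fun ξ z => h ξ z * h' ξ z) fun j ξ z =>
      ∑ p ∈ Finset.HasAntidiagonal.antidiagonal j, H p.1 ξ z * H' p.2 ξ z := by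
  refine Expn.of_sum (E := fun k ξ z => H k ξ z * h' ξ z)
    (P := fun k l ξ z => H k ξ z * H' l ξ z) (fun N => ?_) fun k => ?_
  · refine (((e N).mul e'.sym).mono (by linarith)).congr fun ξ z _ => ?_
    rw [sub_mul, Finset.sum_mul]
  · have := e'.mul_left (e.part k)
    rwa [show μ - k + μ' = μ + μ' - k by ring] at this

lemma Expn.mnab {v : Fin n → PV n} {γ : Fin n → ℕ} {s : ℝ}
    (hv : ∀ {m : ℝ} {F : Eucl n → ℂ → A}, Sym α D m F →
      Sym α D (m - s) (TwistedPsiDO.mnab α D.U v γ F)) (e : Expn α D μ h H) :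
    Expn α D (μ - s) (TwistedPsiDO.mnab α D.U v γ h)
      fun j => TwistedPsiDO.mnab α D.U v γ (H j) := by
  intro N
  refine ((hv (e N)).mono (by linarith)).congr fun ξ z _ => ?_
  have hS : Sm α D.U fun ξ z => ∑ j ∈ Finset.range N, H j ξ z :=
    Sm.sum _ fun j _ => (e.part j).sm
  have h1 := mnab_add D.isOpen (e N).sm hS v γ
  have h2 := congrFun (congrFun h1 ξ) z
  simp only [sub_add_cancel] at h2
  rw [h2, mnab_sum D.isOpen _ (fun j _ => (e.part j).sm), add_sub_cancel_right]

end Expansion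

/-! ### The twisted derivatives of an expansion -/

section MultiBinomial

variable {n : ℕ}

lemma multiChoose_eq_zero {κ β : Fin n → ℕ} (h : ¬ β ≤ κ) : multiChoose κ β = 0 := by
  rw [Pi.le_def, not_forall] at h
  obtain ⟨i, hi⟩ := h
  exact Finset.prod_eq_zero (Finset.mem_univ i) (Nat.choose_eq_zero_of_lt (not_le.1 hi))

lemma multiChoose_split (κ β : Fin n → ℕ) (j : Fin n) :
    multiChoose κ β = (κ j).choose (β j) * ∏ i ∈ Finset.univ.erase j, (κ i).choose (β i) :=
  (Finset.mul_prod_erase _ _ (Finset.mem_univ j)).symm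

lemma multiChoose_add_single (κ β : Fin n → ℕ) (j : Fin n) :
    multiChoose (κ + Pi.single j 1) (β + Pi.single j 1)
      = multiChoose κ β + multiChoose κ (β + Pi.single j 1) := by
  have e : ∀ (κ' β' : Fin n → ℕ), (∀ i ≠ j, κ' i = κ i) → (∀ i ≠ j, β' i = β i) →
      ∏ i ∈ Finset.univ.erase j, (κ' i).choose (β' i)
        = ∏ i ∈ Finset.univ.erase j, (κ i).choose (β i) := fun κ' β' h h' =>
    Finset.prod_congr rfl fun i hi => by
      rw [h i (Finset.ne_of_mem_erase hi), h' i (Finset.ne_of_mem_erase hi)]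
  rw [multiChoose_split _ _ j, multiChoose_split κ β j, multiChoose_split κ _ j,
    e _ _ (fun i hi => by simp [hi]) (fun i hi => by simp [hi]),
    e κ (β + Pi.single j 1) (fun i hi => rfl) (fun i hi => by simp [hi])]
  simp [Nat.choose_succ_succ, add_mul]

lemma multiChoose_add_single_of_zero (κ β : Fin n → ℕ) (j : Fin n) (h : β j = 0) :
    multiChoose (κ + Pi.single j 1) β = multiChoose κ β := by
  refine Finset.prod_congr rfl fun i _ => ?_
  by_cases hi : i = j
  · subst hi; simp [h]
  · simp [Pi.single_eq_of_ne hi]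

/-- Pascal's rule for multi-indices, summed. -/
lemma sum_multiChoose_add_single {V : Type*} [AddCommGroup V] [Module ℂ V] (κ : Fin n → ℕ)
    (j : Fin n) (Φ : (Fin n → ℕ) → V) :
    ∑ β ∈ Finset.Iic (κ + Pi.single j 1), (multiChoose (κ + Pi.single j 1) β : ℂ) • Φ β
      = ∑ β ∈ Finset.Iic κ, (multiChoose κ β : ℂ) • (Φ (β + Pi.single j 1) + Φ β) := by
  have hsub : Finset.Iic κ ⊆ Finset.Iic (κ + Pi.single j 1) :=
    Finset.Iic_subset_Iic.2 le_self_add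
  have h1 : ∑ β ∈ Finset.Iic κ, (multiChoose κ β : ℂ) • Φ β
      = ∑ β ∈ Finset.Iic (κ + Pi.single j 1), (multiChoose κ β : ℂ) • Φ β :=
    Finset.sum_subset hsub fun β _ hβ => by
      rw [multiChoose_eq_zero (by simpa using hβ), Nat.cast_zero, zero_smul]
  have h2 : ∑ β ∈ Finset.Iic κ, (multiChoose κ β : ℂ) • Φ (β + Pi.single j 1)
      = ∑ β ∈ Finset.Iic (κ + Pi.single j 1) with β j ≠ 0,
        (multiChoose κ (β - Pi.single j 1) : ℂ) • Φ β := by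
    refine Finset.sum_nbij' (fun β => β + Pi.single j 1) (fun β => β - Pi.single j 1)
      (fun β hβ => ?_) (fun β hβ => ?_) (fun β _ => by simp) (fun β hβ => ?_) fun β _ => by simp
    · simpa using hβ
    · simp only [Finset.mem_filter, Finset.mem_Iic] at hβ ⊢
      exact tsub_le_iff_right.2 hβ.1
    · simp only [Finset.mem_filter] at hβ
      refine tsub_add_cancel_of_le fun i => ?_
      by_cases hi : i = j
      · subst hi; simp; omega
      · simp [hi]
  simp only [smul_add, Finset.sum_add_distrib]
  rw [h1, h2, Finset.sum_filter, ← Finset.sum_add_distrib]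
  refine Finset.sum_congr rfl fun β _ => ?_
  by_cases hβ : β j = 0
  · rw [if_neg (not_not.2 hβ), zero_add, multiChoose_add_single_of_zero κ β j hβ]
  · have e : β = (β - Pi.single j 1) + Pi.single j 1 := by
      refine (tsub_add_cancel_of_le fun i => ?_).symm
      by_cases hi : i = j
      · subst hi; simp; omega
      · simp [hi]
    rw [if_pos hβ, ← add_smul, ← Nat.cast_add]
    congr 2
    conv_lhs => rw [e]
    conv_rhs => rw [e]
    rw [multiChoose_add_single, add_tsub_cancel_right]

variable {A : Type*} [CStarAlgebra A] {α : CStarAction n A} {U : Set ℂ} {G : Eucl n → ℂ → A}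
  {B : Matrix (Fin n) (Fin n) ℝ}

lemma nab_twistVec (j : Fin n) : nab α U (twistVec B j) G
    = fun ξ z => (-1 : ℂ) • nab α U (actVec j) G ξ z + nab α U (matCovVec B j) G ξ z := by
  have e : twistVec B j = (-1 : ℝ) • actVec j + matCovVec B j := by
    simp [twistVec, actVec, matCovVec]
  rw [e, nab_add_vec, nab_smul_vec]
  simp

/-- The binomial theorem for the commuting derivatives along `-e_j` in the group and along `B e_j`
in the covariable, proved by Pascal's rule. -/
lemma mnab_twistVec (hU : IsOpen U) (hG : Sm α U G) (κ : Fin n → ℕ) :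
    mnab α U (twistVec B) κ G = fun ξ z => ∑ β ∈ Finset.Iic κ, (multiChoose κ β : ℂ) •
      (-1 : ℂ) ^ len β • mnab α U actVec β (mnab α U (matCovVec B) (κ - β) G) ξ z := by
  revert G
  refine multi_induction (P := fun κ => ∀ {G : Eucl n → ℂ → A}, Sm α U G →
    mnab α U (twistVec B) κ G = fun ξ z => ∑ β ∈ Finset.Iic κ, (multiChoose κ β : ℂ) •
      (-1 : ℂ) ^ len β • mnab α U actVec β (mnab α U (matCovVec B) (κ - β) G) ξ z) ?_ ?_ κ
  · intro G _
    have e : Finset.Iic (0 : Fin n → ℕ) = {0} := by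
      ext β; simp
    simp [e, mnab_zero, multiChoose]
  · intro κ j ih G hG
    rw [← mnab_nab hU hG, ih (hG.nab hU _)]
    funext ξ z
    refine Eq.trans ?_ (sum_multiChoose_add_single κ j fun β => (-1 : ℂ) ^ len β •
      mnab α U actVec β (mnab α U (matCovVec B) (κ + Pi.single j 1 - β) G) ξ z).symm
    refine Finset.sum_congr rfl fun β hβ => ?_
    have hle : β ≤ κ := Finset.mem_Iic.1 hβ
    have ha := hG.nab hU (actVec j)
    have hm := hG.nab hU (matCovVec B j)
    rw [nab_twistVec, mnab_add hU (ha.smul (-1)) hm, mnab_smul hU ha,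
      mnab_add hU ((ha.mnab hU _ _).smul (-1)) (hm.mnab hU _ _), mnab_smul hU (ha.mnab hU _ _),
      mnab_nab hU hG, ← nab_mnab hU hG, mnab_nab hU (hG.mnab hU _ _), len_add_single,
      add_tsub_add_eq_tsub_right, tsub_add_eq_add_tsub hle, pow_succ, mul_smul, ← smul_add]

end MultiBinomial

/-! ### The expansion of the twisted product -/

section SharpPart

variable {n : ℕ} {A : Type*} [CStarAlgebra A] {α : CStarAction n A} {D : ParamDomain}
  {B : Matrix (Fin n) (Fin n) ℝ} {M M' : ℝ} {f g : Eucl n → ℂ → A} {F G : ℕ → Eucl n → ℂ → A}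

lemma len_sub_le (κ β : Fin n → ℕ) : len (κ - β) ≤ len κ :=
  Finset.sum_le_sum fun _ _ => Nat.sub_le _ _

/-- The summation over `k` only selects `k = |κ - β|`. Of the two bounds on `k`, the one by `|κ|` is
automatic and the one by `l` becomes the condition. -/
lemma twistPart_eq (κ : Fin n → ℕ) (G : ℕ → Eucl n → ℂ → A) (l : ℕ) (ξ : Eucl n) (z : ℂ) :
    twistPart α B κ G l ξ z = ∑ β ∈ Finset.Iic κ, if len (κ - β) ≤ l then
      ((multiChoose κ β : ℂ) * (-Complex.I) ^ len β) •
        delta α β (mpdB B (κ - β) (fun ζ => G (l - len (κ - β)) ζ z) ξ) else 0 := by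
  simp only [twistPart, Finset.sum_filter]
  rw [Finset.sum_comm]
  refine Finset.sum_congr rfl fun β _ => ?_
  rw [Finset.sum_ite_eq]
  have := len_sub_le κ β
  refine if_congr ?_ rfl rfl
  rw [Finset.mem_range]
  omega

lemma neg_I_pow_mul (k : ℕ) : (-Complex.I) ^ k * (Complex.I ^ k)⁻¹ = (-1) ^ k := by
  rw [← inv_pow, ← mul_pow, neg_mul, mul_inv_cancel₀ Complex.I_ne_zero]

/-- In the binomial formula the factor `∂_B^{κ-β}` lowers the order by `|κ - β|` while `δ^β` keeps
it. The summand belonging to `β` is therefore an expansion shifted by `|κ - β|` places. -/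
lemma Expn.twistDeriv (e : Expn α D M' g G) (κ : Fin n → ℕ) :
    Expn α D M' (fun ξ z => TwistedPsiDO.twistDeriv α B κ (fun ζ => g ζ z) ξ)
      (twistPart α B κ G) := by
  have hU := D.isOpen
  have h1 : ∀ β ∈ Finset.Iic κ, Expn α D M'
      (fun ξ z => (multiChoose κ β : ℂ) • (-1 : ℂ) ^ len β •
        TwistedPsiDO.mnab α D.U actVec β (TwistedPsiDO.mnab α D.U (matCovVec B) (κ - β) g) ξ z)
      fun l ξ z => if len (κ - β) ≤ l then (multiChoose κ β : ℂ) • (-1 : ℂ) ^ len β •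
        TwistedPsiDO.mnab α D.U actVec β
          (TwistedPsiDO.mnab α D.U (matCovVec B) (κ - β) (G (l - len (κ - β)))) ξ z else 0 := by
    intro β _
    have h2 := e.mnab (v := matCovVec B) (γ := κ - β) (s := len (κ - β)) fun h => h.mnab_matCov _
    have h3 := h2.mnab (v := actVec) (γ := β) (s := 0) fun h => by
      rw [sub_zero]; exact h.mnab_act _
    rw [sub_zero] at h3
    exact ((h3.smul ((-1 : ℂ) ^ len β)).smul (multiChoose κ β : ℂ)).shift (len (κ - β))
  refine (Expn.sum _ h1).congr (fun ξ z hz => ?_) fun l ξ z hz => ?_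
  · rw [twistDeriv_eq hU e.sym.sm hz, mnab_twistVec hU e.sym.sm]
  · rw [twistPart_eq]
    refine Finset.sum_congr rfl fun β _ => if_congr Iff.rfl ?_ rfl
    have hs := (e.part (l - len (κ - β))).sm
    rw [mpdB_eq hU hs hz, delta_eq hU (hs.mnab hU _ _) ξ hz, smul_smul, mul_assoc, neg_I_pow_mul,
      smul_smul]

lemma Expn.mpd (e : Expn α D M f F) (κ : Fin n → ℕ) :
    Expn α D (M - len κ) (fun ξ z => TwistedPsiDO.mpd κ (fun ζ => f ζ z) ξ)
      fun j ξ z => TwistedPsiDO.mpd κ (fun ζ => F j ζ z) ξ :=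
  (e.mnab (v := covVec) (γ := κ) fun h => h.mnab_cov κ).congr
    (fun ξ z hz => by rw [mpd_eq D.isOpen e.sym.sm hz])
    fun j ξ z hz => by rw [mpd_eq D.isOpen (e.part j).sm hz]

theorem Expn.sharpTerm (e : Expn α D M f F) (e' : Expn α D M' g G) (k : ℕ) :
    Expn α D (M + M' - k) (TwistedPsiDO.sharpTerm α B f g k) fun l ξ z =>
      ∑ p ∈ Finset.HasAntidiagonal.antidiagonal l,
        ∑ κ ∈ Finset.piAntidiag (Finset.univ : Finset (Fin n)) k,
          ((-Complex.I) ^ len κ / (multiFactorial κ : ℂ)) •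
            (TwistedPsiDO.mpd κ (fun ζ => F p.1 ζ z) ξ * twistPart α B κ G p.2 ξ z) := by
  have h1 : ∀ κ ∈ Finset.piAntidiag (Finset.univ : Finset (Fin n)) k, Expn α D (M + M' - k)
      (fun ξ z => ((-Complex.I) ^ len κ / (multiFactorial κ : ℂ)) •
        (TwistedPsiDO.mpd κ (fun ζ => f ζ z) ξ
          * TwistedPsiDO.twistDeriv α B κ (fun ζ => g ζ z) ξ))
      fun l ξ z => ((-Complex.I) ^ len κ / (multiFactorial κ : ℂ)) •
        ∑ p ∈ Finset.HasAntidiagonal.antidiagonal l,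
          (TwistedPsiDO.mpd κ (fun ζ => F p.1 ζ z) ξ * twistPart α B κ G p.2 ξ z) := by
    intro κ hκ
    have h2 := ((e.mpd κ).mul (e'.twistDeriv (B := B) κ)).smul
      ((-Complex.I) ^ len κ / (multiFactorial κ : ℂ))
    have h3 : M - len κ + M' = M + M' - k := by rw [mem_piAntidiag_univ.1 hκ]; ring
    rwa [h3] at h2
  refine (Expn.sum _ h1).congr (fun ξ z hz => rfl) fun l ξ z hz => ?_
  rw [Finset.sum_comm]
  simp only [Finset.smul_sum]

/-- The expansions of the terms are substituted into the expansion of the twisted product. The outer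
pair is swapped at the end because in the defining sum its second entry is `|κ|`. -/
theorem Expn.sharpPart (e : Expn α D M f F) (e' : Expn α D M' g G) :
    Expn α D (M + M') (oscI α B D.U 1 f g) (TwistedPsiDO.sharpPart α B F G) := by
  refine (Expn.of_sum (fun N => e.sym.oscI_sub_sum (B := B) e'.sym N)
    fun k => e.sharpTerm e' k).congr (fun _ _ _ => rfl) fun j ξ z _ => ?_
  exact Finset.Nat.sum_antidiagonal_swap (n := j) (f := fun q : ℕ × ℕ =>
    ∑ p ∈ Finset.HasAntidiagonal.antidiagonal q.2,
      ∑ κ ∈ Finset.piAntidiag (Finset.univ : Finset (Fin n)) q.1,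
        ((-Complex.I) ^ len κ / (multiFactorial κ : ℂ)) •
          (TwistedPsiDO.mpd κ (fun ζ => F p.1 ζ z) ξ * twistPart α B κ G p.2 ξ z))

variable {a b m d m' d' : ℝ}

lemma twistPart_const_smul (c : ℂ) (κ : Fin n → ℕ) (G : ℕ → Eucl n → ℂ → A) (l : ℕ) (ξ : Eucl n)
    (z w : ℂ) (G' : ℕ → Eucl n → ℂ → A) (h : ∀ l ζ, G' l ζ z = c • G l ζ w) :
    twistPart α B κ G' l ξ z = c • twistPart α B κ G l ξ w := by
  simp only [twistPart, h, mpdB_const_smul, delta_const_smul, Finset.smul_sum, smul_comm c]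

lemma sharpPart_paramForm (d d' : ℝ) (F G : ℕ → Eucl n → ℂ → A) (j : ℕ) (ξ : Eucl n) {z : ℂ}
    (hz : z ≠ 0) :
    sharpPart α B (fun j => paramForm a b d (F j)) (fun j => paramForm a b d' (G j)) j ξ z
      = paramForm a b (d + d') (sharpPart α B F G j) ξ z := by
  have h : ∀ κ l, twistPart α B κ (fun j => paramForm a b d' (G j)) l ξ z
      = branchPow a b d' z • twistPart α B κ G l ξ z⁻¹ := fun κ l =>
    twistPart_const_smul _ κ G l ξ z z⁻¹ _ fun l ζ => rfl
  simp only [sharpPart, h]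
  simp only [paramForm, sharpPart, mpd_const_smul, branchPow_add d d' hz, smul_mul_smul_comm, Finset.smul_sum]
  exact Finset.sum_congr rfl fun q _ => Finset.sum_congr rfl fun p _ =>
    Finset.sum_congr rfl fun κ _ => smul_comm _ _ _

theorem asympExpansion_sharpPart (hab' : b ≤ a + 2 * Real.pi)
    (hf : AsympExpansion α a b m d f F) (hg : AsympExpansion α a b m' d' g G) :
    AsympExpansion α a b (m + m') (d + d') (sharpParam α B f g) (sharpPart α B F G) := by
  refine asympExpansion_of_sym hab' ((Expn.sharpPart (B := B) (hf.sym hab') (hg.sym hab')).congr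
    (fun ξ z hz => paramForm_sharpParam hab' hf.mem hg.mem ξ hz) fun j ξ z hz => ?_)
  exact (sharpPart_paramForm d d' F G j ξ (ne_zero_of_mem_invSector hz)).symm

lemma twistPart_zero (G : ℕ → Eucl n → ℂ → A) (l : ℕ) (ξ : Eucl n) (z : ℂ) :
    twistPart α B 0 G l ξ z = G l ξ z := by
  have e : Finset.Iic (0 : Fin n → ℕ) = {0} := by
    ext β; simp
  have h : mpdB B 0 (fun ζ => G l ζ z) = fun ζ => G l ζ z :=
    foldIter_zero (n := n) (S := Eucl n → A) (pdB B) _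
  simp [twistPart_eq, e, multiChoose, h]

lemma sharpPart_zero (F G : ℕ → Eucl n → ℂ → A) (ξ : Eucl n) (z : ℂ) :
    sharpPart α B F G 0 ξ z = F 0 ξ z * G 0 ξ z := by
  have h : mpd 0 (fun ζ => F 0 ζ z) = fun ζ => F 0 ζ z :=
    foldIter_zero (n := n) (S := Eucl n → A) pd _
  simp [sharpPart, twistPart_zero, h, multiFactorial]

end SharpPart

/-! ### Homogeneity -/

section Homogeneity

variable {n : ℕ} {A : Type*} [CStarAlgebra A] {α : CStarAction n A}
  {B : Matrix (Fin n) (Fin n) ℝ} {a b k k' : ℝ} {f g : Eucl n → ℂ → A}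

lemma smul_mem_openSector {t : ℝ} (ht : 1 ≤ t) {μ : ℂ} (hμ : μ ∈ openSector a b) :
    (t : ℂ) * μ ∈ openSector a b := by
  obtain ⟨r, s, hr, h1, h2, rfl⟩ := hμ
  exact ⟨t * r, s, by positivity, h1, h2, by push_cast; ring⟩

lemma IsHomogeneous.congr (h : IsHomogeneous a b k f)
    (e : ∀ ξ, ∀ μ ∈ openSector a b, g ξ μ = f ξ μ) : IsHomogeneous a b k g :=
  fun t ξ μ hμ ht hξ => by
    rw [e _ _ (smul_mem_openSector ht hμ), e _ _ hμ, h t ξ μ hμ ht hξ]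

lemma isHomogeneous_zero : IsHomogeneous a b k (fun (_ : Eucl n) _ => (0 : A)) :=
  fun t ξ μ hμ ht hξ => by simp

lemma IsHomogeneous.smul (c : ℂ) (h : IsHomogeneous a b k f) :
    IsHomogeneous a b k fun ξ μ => c • f ξ μ := fun t ξ μ hμ ht hξ => by
  simp only [h t ξ μ hμ ht hξ, smul_comm c]

lemma IsHomogeneous.sum {ι : Type*} (s : Finset ι) {f : ι → Eucl n → ℂ → A}
    (h : ∀ i ∈ s, IsHomogeneous a b k (f i)) :
    IsHomogeneous a b k fun ξ μ => ∑ i ∈ s, f i ξ μ := fun t ξ μ hμ ht hξ => by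
  rw [Finset.smul_sum]
  exact Finset.sum_congr rfl fun i hi => h i hi t ξ μ hμ ht hξ

lemma IsHomogeneous.mul (h : IsHomogeneous a b k f) (h' : IsHomogeneous a b k' g) :
    IsHomogeneous a b (k + k') fun ξ μ => f ξ μ * g ξ μ := fun t ξ μ hμ ht hξ => by
  simp only [h t ξ μ hμ ht hξ, h' t ξ μ hμ ht hξ, smul_mul_smul_comm]
  rw [Real.rpow_add (by linarith)]

lemma IsHomogeneous.delta (h : IsHomogeneous a b k f) (β : Fin n → ℕ) :
    IsHomogeneous a b k fun ξ μ => TwistedPsiDO.delta α β (f ξ μ) := fun t ξ μ hμ ht hξ => by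
  simp only [h t ξ μ hμ ht hξ, ← Complex.coe_smul, delta_const_smul]

lemma hasFDerivAt_cov {U : Set ℂ} (hU : IsOpen U) (hf : Sm α U f) (ξ : Eucl n) {μ : ℂ}
    (hμ : μ ∈ U) : HasFDerivAt (fun ζ => f ζ μ) ((fderiv ℝ (tw α f) (0, ξ, μ)).comp
      ((0 : Eucl n →L[ℝ] Eucl n).prod ((ContinuousLinearMap.id ℝ (Eucl n)).prod 0))) ξ := by
  have hp : ((0, ξ, μ) : PV n) ∈ dom n U := hμ
  have h1 := (hf.hasFDerivAt hU hp).comp ξ ((hasFDerivAt_const (0 : Eucl n) ξ).prodMk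
    ((hasFDerivAt_id (𝕜 := ℝ) ξ).prodMk (hasFDerivAt_const μ ξ)))
  have e : (tw α f ∘ fun ζ : Eucl n => ((0, id ζ, μ) : PV n)) = fun ζ => f ζ μ := by
    funext ζ; simp
  rwa [e] at h1

lemma fderiv_cov {U : Set ℂ} (hU : IsOpen U) (hf : Sm α U f) (ξ v : Eucl n) {μ : ℂ}
    (hμ : μ ∈ U) : fderiv ℝ (fun ζ => f ζ μ) ξ v = nab α U (0, v, 0) f ξ μ := by
  rw [(hasFDerivAt_cov hU hf ξ hμ).fderiv, nab_of_mem hμ]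
  rfl

lemma Sm.continuous_cov {U : Set ℂ} (hf : Sm α U f) {μ : ℂ} (hμ : μ ∈ U) :
    Continuous fun ξ => f ξ μ := by
  have h := hf.continuous_comp (l := fun ξ : Eucl n => ((0, ξ, μ) : PV n)) (by fun_prop)
    fun ξ => hμ
  simpa using h

/-- Differentiating `f(tξ, tμ) = t^k f(ξ, μ)` in `ξ` gives a factor `t` on the left. This is
legitimate on the open set `|ξ| > 1`, where the identity holds in a neighbourhood. -/
lemma IsHomogeneous.nab_cov (hU : IsOpen (openSector a b)) (hf : Sm α (openSector a b) f)
    (h : IsHomogeneous a b k f) (v : Eucl n) :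
    IsHomogeneous a b (k - 1) (nab α (openSector a b) (0, v, 0) f) := by
  intro t ξ μ hμ ht hξ
  have ht0 : 0 < t := by linarith
  have htμ := smul_mem_openSector ht hμ
  have key : ∀ ζ : Eucl n, 1 < ‖ζ‖ → nab α (openSector a b) (0, v, 0) f (t • ζ) (t * μ)
      = t ^ (k - 1) • nab α (openSector a b) (0, v, 0) f ζ μ := by
    intro ζ hζ
    have hev : (fun ζ : Eucl n => f (t • ζ) (t * μ)) =ᶠ[𝓝 ζ] fun ζ => t ^ k • f ζ μ := by
      filter_upwards [(isOpen_lt continuous_const continuous_norm).mem_nhds hζ] with ζ' hζ'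
      exact h t ζ' μ hμ ht (le_of_lt hζ')
    have h1 : HasFDerivAt (fun ζ : Eucl n => f (t • ζ) (t * μ))
        ((fderiv ℝ (fun ζ => f ζ (t * μ)) (t • ζ)).comp (t • ContinuousLinearMap.id ℝ (Eucl n))) ζ :=
      HasFDerivAt.comp ζ (g := fun ζ => f ζ (t * μ))
        (hasFDerivAt_cov hU hf (t • ζ) htμ).differentiableAt.hasFDerivAt
        ((hasFDerivAt_id (𝕜 := ℝ) ζ).const_smul t)
    have h2 : HasFDerivAt (fun ζ : Eucl n => t ^ k • f ζ μ)
        (t ^ k • fderiv ℝ (fun ζ => f ζ μ) ζ) ζ :=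
      (hasFDerivAt_cov hU hf ζ hμ).differentiableAt.hasFDerivAt.fun_const_smul (t ^ k)
    have h3 := congrArg (fun L : Eucl n →L[ℝ] A => L v)
      (h1.unique (h2.congr_of_eventuallyEq hev))
    have h4 : t • nab α (openSector a b) (0, v, 0) f (t • ζ) (t * μ)
        = t ^ k • nab α (openSector a b) (0, v, 0) f ζ μ := by
      rw [← fderiv_cov hU hf _ v htμ, ← fderiv_cov hU hf _ v hμ, ← map_smul]
      exact h3
    rw [Real.rpow_sub_one ht0.ne', div_eq_inv_mul, mul_smul, ← h4, inv_smul_smul₀ ht0.ne']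
  have hc := hf.nab hU (0, v, 0)
  -- The unit sphere is reached by continuity: for `s > 1` the points `sξ` lie in the open region.
  have hlim : Filter.Tendsto (fun s : ℝ => s • ξ) (𝓝[>] 1) (𝓝 ξ) := by
    have h1 : Continuous fun s : ℝ => s • ξ := by fun_prop
    simpa using (h1.tendsto 1).mono_left nhdsWithin_le_nhds
  have hX := ((hc.continuous_cov htμ).comp (continuous_const_smul t)).continuousAt.tendsto.comp hlim
  have hY := ((hc.continuous_cov hμ).const_smul (t ^ (k - 1))).continuousAt.tendsto.comp hlim
  refine tendsto_nhds_unique hX (hY.congr' ?_)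
  filter_upwards [self_mem_nhdsWithin] with s hs
  have hs1 : (1 : ℝ) < s := hs
  refine (key (s • ξ) ?_).symm
  rw [norm_smul, Real.norm_of_nonneg (by linarith)]
  nlinarith

lemma IsHomogeneous.mnab (hU : IsOpen (openSector a b)) (hf : Sm α (openSector a b) f)
    (h : IsHomogeneous a b k f) (v : Fin n → Eucl n) (γ : Fin n → ℕ) :
    IsHomogeneous a b (k - len γ)
      (TwistedPsiDO.mnab α (openSector a b) (fun j => (0, v j, 0)) γ f) := by
  revert k f
  refine multi_induction (P := fun γ => ∀ {k : ℝ} {f : Eucl n → ℂ → A},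
    Sm α (openSector a b) f → IsHomogeneous a b k f → IsHomogeneous a b (k - len γ)
      (TwistedPsiDO.mnab α (openSector a b) (fun j => (0, v j, 0)) γ f)) ?_ ?_ γ
  · intro k f _ h
    simpa [mnab_zero] using h
  · intro γ j ih k f hf h
    have h1 := ih (hf.nab hU (0, v j, 0)) (h.nab_cov hU hf (v j))
    rw [mnab_nab (v := fun j => (0, v j, 0)) hU hf γ j] at h1
    rwa [len_add_single, Nat.cast_add, Nat.cast_one, add_comm (len γ : ℝ) 1, ← sub_sub]

lemma IsHomogeneous.mpd (hU : IsOpen (openSector a b)) (hf : Sm α (openSector a b) f)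
    (h : IsHomogeneous a b k f) (γ : Fin n → ℕ) :
    IsHomogeneous a b (k - len γ) fun ξ μ => TwistedPsiDO.mpd γ (fun ζ => f ζ μ) ξ :=
  (h.mnab hU hf (fun j => EuclideanSpace.single j 1) γ).congr fun ξ _ hμ =>
    congrFun (mpd_eq hU hf hμ γ) ξ

lemma IsHomogeneous.mpdB (hU : IsOpen (openSector a b)) (hf : Sm α (openSector a b) f)
    (h : IsHomogeneous a b k f) (γ : Fin n → ℕ) :
    IsHomogeneous a b (k - len γ) fun ξ μ => TwistedPsiDO.mpdB B γ (fun ζ => f ζ μ) ξ :=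
  (h.mnab hU hf (fun j => matVec B (EuclideanSpace.single j 1)) γ).congr fun ξ _ hμ =>
    congrFun (mpdB_eq hU hf hμ γ) ξ

variable {m m' : ℝ} {F G : ℕ → Eucl n → ℂ → A}

/-- With `γ = κ - β`, the component of degree `m' - (l - |γ|)` is differentiated `|γ|` times in the
covariable, which gives degree `m' - l` in every summand. -/
lemma isHomogeneous_twistPart (hU : IsOpen (openSector a b))
    (hs : ∀ j, Sm α (openSector a b) (G j)) (hG : ∀ j : ℕ, IsHomogeneous a b (m' - j) (G j))
    (κ : Fin n → ℕ) (l : ℕ) : IsHomogeneous a b (m' - l) (twistPart α B κ G l) := by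
  have e : twistPart α B κ G l = _ := funext fun ξ => funext fun μ => twistPart_eq κ G l ξ μ
  rw [e]
  refine IsHomogeneous.sum _ fun β _ => ?_
  by_cases hl : len (κ - β) ≤ l
  · simp only [if_pos hl]
    have h1 := (((hG (l - len (κ - β))).mpdB (B := B) hU (hs _) (κ - β)).delta (α := α) β).smul
      ((multiChoose κ β : ℂ) * (-Complex.I) ^ len β)
    rwa [Nat.cast_sub hl, show m' - ((l : ℝ) - len (κ - β)) - len (κ - β) = m' - l by ring] at h1
  · simp only [if_neg hl]
    exact isHomogeneous_zero

theorem isHomogeneous_sharpPart (hU : IsOpen (openSector a b))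
    (hs : ∀ j, Sm α (openSector a b) (F j)) (hs' : ∀ j, Sm α (openSector a b) (G j))
    (hF : ∀ j : ℕ, IsHomogeneous a b (m - j) (F j))
    (hG : ∀ j : ℕ, IsHomogeneous a b (m' - j) (G j)) (j : ℕ) :
    IsHomogeneous a b (m + m' - j) (sharpPart α B F G j) := by
  refine IsHomogeneous.sum _ fun q hq => IsHomogeneous.sum _ fun p hp =>
    IsHomogeneous.sum _ fun κ hκ => IsHomogeneous.smul _ ?_
  have h1 := ((hF p.1).mpd hU (hs _) κ).mul (isHomogeneous_twistPart (B := B) hU hs' hG κ p.2)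
  have h2 : (j : ℝ) = p.1 + p.2 + len κ := by
    rw [Finset.HasAntidiagonal.mem_antidiagonal] at hq hp
    rw [mem_piAntidiag_univ] at hκ
    rw [← hq, ← hp, hκ]
    push_cast
    ring
  rwa [show m - (p.1 : ℝ) - len κ + (m' - p.2) = m + m' - j by rw [h2]; ring] at h1

lemma IsWeaklyParametric.sm (hab' : b ≤ a + 2 * Real.pi) {d : ℝ}
    (h : IsWeaklyParametric α a b m d f) : Sm α (openSector a b) f :=
  sm_of_delta (isOpen_openSector hab') h.mem h.smooth

theorem polyhomExpansion_sharpParam (hab' : b ≤ a + 2 * Real.pi) {d d' : ℝ}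
    (hf : PolyhomExpansion α a b m d f F) (hg : PolyhomExpansion α a b m' d' g G) :
    PolyhomExpansion α a b (m + m') (d + d') (sharpParam α B f g) (sharpPart α B F G) where
  homogeneous := isHomogeneous_sharpPart (isOpen_openSector hab')
    (fun j => (hf.expansion.term j).sm hab') (fun j => (hg.expansion.term j).sm hab')
    hf.homogeneous hg.homogeneous
  expansion := by
    have h := asympExpansion_sharpPart (B := B) hab' hf.expansion hg.expansion
    rwa [show m - d + (m' - d') = m + m' - (d + d') by ring] at h

end Homogeneity

end

end TwistedPsiDO

/-! ### The theorem on the twisted product -/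

theorem mainTheorem4 {n : ℕ} {A : Type*} [CStarAlgebra A] (α : CStarAction n A)
    (B : Matrix (Fin n) (Fin n) ℝ) (hB : B.transpose = -B)
    (a b : ℝ) (hab : a < b) (hab' : b ≤ a + 2 * Real.pi) :
    (∀ (m d m' d' : ℝ) (f g : Eucl n → ℂ → A),
      IsWeaklyParametric α a b m d f → IsWeaklyParametric α a b m' d' g →
        (∀ ξ, ∀ μ ∈ openSector a b,
          IsOscIntegral α (sharpAmplitude α B (fun ζ => f ζ μ) (fun ζ => g ζ μ) ξ)
            (sharpParam α B f g ξ μ)) ∧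
        IsWeaklyParametric α a b (m + m') (d + d') (sharpParam α B f g) ∧
        ComposesTo α B a b f g (sharpParam α B f g) ∧
        AsympExpansion α a b (m + m') (d + d') (sharpParam α B f g) (sharpTerm α B f g)) ∧
    (∀ (m d m' d' : ℝ) (f g : Eucl n → ℂ → A) (F G : ℕ → Eucl n → ℂ → A),
      PolyhomExpansion α a b m d f F → PolyhomExpansion α a b m' d' g G →
        IsWeaklyPolyhomogeneous α a b (d + d') (sharpParam α B f g) ∧
        ComposesTo α B a b f g (sharpParam α B f g) ∧
        PolyhomExpansion α a b (m + m') (d + d') (sharpParam α B f g) (sharpPart α B F G) ∧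
        ∀ ξ, ∀ μ ∈ openSector a b, sharpPart α B F G 0 ξ μ = F 0 ξ μ * G 0 ξ μ) := by
  refine ⟨fun m d m' d' f g hf hg => ?_, fun m d m' d' f g F G hf hg => ?_⟩
  · exact ⟨fun ξ μ hμ => isOscIntegral_sharpParam hab' hf hg ξ hμ,
      isWeaklyParametric_sharpParam hab' hf hg, composesTo_sharpParam hab' hf hg,
      asympExpansion_sharpParam hab' hf hg⟩
  · have h := polyhomExpansion_sharpParam (B := B) hab' hf hg
    exact ⟨⟨_, _, h⟩, composesTo_sharpParam hab' hf.expansion.mem hg.expansion.mem, h,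
      fun ξ μ _ => sharpPart_zero F G ξ μ⟩
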